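/- **Setting.** Let $\mathcal G$ be a finite-dimensional semisimple complex Lie algebra with a non-degenerate symmetric invariant form $\langle\,,\rangle$, $\theta$ an automorphism of $\mathcal G$ of order $m$ preserving the form and a Cartan subalgebra $\mathfrak h$, $\omega$ a primitive $m$-th root of unity, and $N\ge 0$. For $i\in\mathbb Z$ let $x_i$ be the component of $x\in\mathcal G$ in $\mathcal G_i=\{y:\theta y=\omega^i y\}$. Identify $\mathfrak h^*$ with $\mathfrak h$ through the form, let $\Phi\subset\mathfrak h$ be the set of roots, $x_\beta$ ($\beta\in\Phi$) chosen root vectors, and $\epsilon,\eta$ scalars with $[x_\beta,x_\gamma]=\epsilon(\beta,\gamma)x_{\beta+\gamma}$ for $\beta,\gamma,\beta+\gamma\in\Phi$ and $\theta^p x_\beta=\eta(p,\beta)x_{\theta^p\beta}$. Let $\mathfrak h_0$ be the space of $\theta$-fixed points of $\mathfrak h$, and $\beta_0$ the component of $\beta\in\mathfrak h$ in $\mathfrak h_0$. Let $A=\mathbb C[t^{\pm1},t_1^{\pm1},\dots,t_N^{\pm1}]$, let $\Omega_A$ be the free $A$-module on $k_0,\dots,k_N$ and $d_A\subset\Omega_A$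 the span of the elements $\frac{r_0}{m}t^{r_0}t^{r}k_0+\sum_{i=1}^N r_i t^{r_0}t^{r}k_i$. On $\tilde\tau=\mathcal G\otimes A\oplus\Omega_A/d_A\oplus\bigoplus_{i=0}^N\mathbb C d_i$ put $$[x\,t^{r_0}t^{r},y\,t^{s_0}t^{s}]=[x,y]t^{r_0+s_0}t^{r+s}+\langle x,y\rangle\Big(\tfrac{r_0}{m}t^{r_0+s_0}t^{r+s}k_0+\sum_{i=1}^N r_i t^{r_0+s_0}t^{r+s}k_i\Big),$$ with $\Omega_A/d_A$ commuting with itself and with $\mathcal G\otimes A$, and the $d_i$ commuting with each other and acting as the degree derivations. Extend $\theta$ to $\tilde\tau$ by $x\,t^{r_0}t^r\mapsto\omega^{-r_0}\theta(x)t^{r_0}t^r$, $t^{r_0}t^rk_i\mapsto\omega^{-r_0}t^{r_0}t^rk_i$, $d_i\mapsto d_i$; the twisted toroidal Lie algebra $\tilde L(\mathcal G,\theta)$ is the algebra of $\theta$-fixed points. For $r\in\mathbb Z^N$ put $x(r,\zeta)=\sum_{i\in\mathbb Z} x_i t^i t^r\zeta^i$ and $k_i(r,\zeta^m)=\sum_{p\in\mathbb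 Z} t^{mp}t^rk_i\zeta^{mp}$; write $\delta(\zeta)=\sum_{i\in\mathbb Z}\zeta^i$ and $D=\zeta\frac{d}{d\zeta}$. Fix $k\in\mathbb C$, $k\neq0$. **$\underline C_k$** is the category of $\tilde L(\mathcal G,\theta)$-modules $V$ (with module homomorphisms) such that $k_0$ acts as $k$; $V$ is the direct sum of the eigenspaces $V_z$ ($z\in\mathbb C$) of $d_0$, and for each $z$ one has $V_{z+\ell}=0$ for all large integers $\ell$; and $\frac1k x(r,\zeta)k_0(s,\zeta^m)=x(r+s,\zeta)$, $\frac1k k_i(r,\zeta^m)k_0(s,\zeta^m)=k_i(r+s,\zeta^m)$ for all $x\in\mathcal G$, $0\le i\le N$, $r,s\in\mathbb Z^N$. **$\underline D_k$** is the category of vector spaces $W$ with operators $d_0,\dots,d_N$, a linear action of $\mathfrak h_0$, and operator series $Z(\beta,r,\zeta)=\sum_{n\in\mathbb Z} Z_n\zeta^n$ ($\beta\in\Phi$), $k_i(r,\zeta^m)=\sum_{p\in\mathbb Z} K_p\zeta^{mp}$ ($0\le i\le N$), such that the constant term $k_0$ of $k_0(0,\zeta^m)$ acts as $k$, $W$ satisfies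 the same condition on $d_0$-eigenspaces, and the following toroidal $Z_k$-algebra relations hold (the morphisms are the linear maps commuting with all these operators): 1. $\frac1kZ(\beta,r,\zeta)k_0(s,\zeta^m)=Z(\beta,r+s,\zeta)$ and $\frac1k k_0(r,\zeta^m)k_i(s,\zeta^m)=k_i(r+s,\zeta^m)$; 2. $\sum_{i=1}^N r_ik_i(r,\zeta^m)+\frac1m Dk_0(r,\zeta^m)=0$; 3. $[d_0,Z(\beta,r,\zeta)]=DZ(\beta,r,\zeta)$, $[d_0,k_j(r,\zeta^m)]=Dk_j(r,\zeta^m)$, and $[d_i,Z(\beta,r,\zeta)]=r_iZ(\beta,r,\zeta)$, $[d_i,k_j(r,\zeta^m)]=r_ik_j(r,\zeta^m)$ for $1\le i\le N$; the $d_i$ commute with each other and with $\mathfrak h_0$; 4. $\mathfrak h_0$ is abelian, $[\alpha,Z(\beta,r,\zeta)]=\langle\alpha,\beta\rangle Z(\beta,r,\zeta)$ for $\alpha\in\mathfrak h_0$, and the $k_i(r,\zeta^m)$ commute with each other, with $\mathfrak h_0$ and with all $Z(\beta,s,\zeta)$; 5. $Z(\beta,r,\omega^p\zeta)=\eta(p,\beta)Z(\theta^p\beta,r,\zeta)$;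 6. for $\beta_1,\beta_2\in\Phi$, with $p$ running over $0\le p<m$ and the powers expanded by the binomial series, $$\prod_{p}(1-\omega^{-p}\zeta_1/\zeta_2)^{\langle\theta^p\beta_1,\beta_2\rangle/k}Z(\beta_1,r,\zeta_1)Z(\beta_2,s,\zeta_2)-\prod_{p}(1-\omega^{-p}\zeta_2/\zeta_1)^{\langle\theta^p\beta_2,\beta_1\rangle/k}Z(\beta_2,s,\zeta_2)Z(\beta_1,r,\zeta_1)$$ $$=\frac1m\sum_{\theta^p\beta_1+\beta_2\in\Phi}\eta(p,\beta_1)\epsilon(\theta^p\beta_1,\beta_2)Z(\theta^p\beta_1+\beta_2,r+s,\zeta_2)\,\delta(\omega^{-p}\zeta_1/\zeta_2)$$ $$-\frac1{mk}\langle x_{\beta_2},x_{-\beta_2}\rangle\sum_{\theta^p\beta_1+\beta_2=0}\eta(p,\beta_1)(\beta_2)_0k_0(r+s,\zeta_2^m)\,\delta(\omega^{-p}\zeta_1/\zeta_2)$$ $$+\frac1m\langle x_{\beta_2},x_{-\beta_2}\rangle\sum_{\theta^p\beta_1+\beta_2=0}\eta(p,\beta_1)\Big(\sum_{i=1}^Nr_ik_i(r+s,\zeta_2^m)\,\delta(\omega^{-p}\zeta_1/\zeta_2)+\frac1m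 k_0(r+s,\zeta_2^m)\,(D\delta)(\omega^{-p}\zeta_1/\zeta_2)\Big).$$ Let $\tilde{\mathfrak h}=\bigoplus_{i\in\mathbb Z}\mathfrak h_i\otimes t^i\oplus\mathbb Ck_0\oplus\mathbb Cd_0$ with $\mathfrak h_i=\mathfrak h\cap\mathcal G_i$, and let $M(k)$ be its Verma module, induced from the one-dimensional module of $\bigoplus_{i\ge0}\mathfrak h_i\otimes t^i\oplus\mathbb Ck_0\oplus\mathbb Cd_0$ on which $k_0$ acts as $k$ and the rest as $0$. For $\beta\in\mathfrak h$ put $E^\pm(\beta,\zeta)=\exp\big(\pm m\sum_{j>0}\beta_{\pm j}\otimes t^{\pm j}\,\zeta^{\pm j}/(jk)\big)$. **Proposition 2.6.** The categories $\underline C_k$ and $\underline D_k$ are equivalent. More precisely, there is an equivalence in which: * the functor $\underline C_k\to\underline D_k$ sends $V$ to $\Omega_V=\{v\in V:(h_i\otimes t^i)v=0\ \text{for all } h\in\mathfrak h,\ i>0\}$ with $Z(\beta,r,\zeta)=E^-(\beta,\zeta)x_\beta(r,\zeta)E^+(\beta,\zeta)$ and with $k_i(r,\zeta^m)$, $\mathfrak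 h_0$, $d_i$ acting by restriction; on morphisms it is restriction; * the inverse functor $\underline D_k\to\underline C_k$ sends $W$ to $M(k)\otimes W$ with $x_\beta(r,\zeta)=E^-(-\beta,\zeta)E^+(-\beta,\zeta)\otimes Z(\beta,r,\zeta)$ for $\beta\in\Phi$; $h(r,\zeta)=\frac1k h(\zeta)k_0(r,\zeta^m)$ for $h\in\mathfrak h$, where $h(\zeta)=\sum_{j\ne0}(h_j\otimes t^j)\zeta^j\otimes1+1\otimes h_0$; $k_i(r,\zeta^m)$ and $d_1,\dots,d_N$ acting on $W$; and $d_0$ acting as $d_0\otimes1+1\otimes d_0$; on morphisms it is $g\mapsto\mathrm{id}\otimes g$. -/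

import Mathlib

open scoped TensorProduct
open CategoryTheory

universe u w

noncomputable section

namespace ToroidalZ

/-! ## The finite dimensional data -/

section RootDef

variable {𝔤 : Type u} [LieRing 𝔤] [LieAlgebra ℂ 𝔤]

/-- `β` is a root of `𝔤` with respect to `𝔥`, where `𝔥*` is identified with `𝔥` through the form:
`β` is a non-zero element of `𝔥` and there is `x ≠ 0` with `[h, x] = ⟨h, β⟩ x` for all `h ∈ 𝔥`. -/
def IsRoot (form : LinearMap.BilinForm ℂ 𝔤) (𝔥 : LieSubalgebra ℂ 𝔤) (β : 𝔤) : Prop :=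
  β ∈ 𝔥 ∧ β ≠ 0 ∧ ∃ x : 𝔤, x ≠ 0 ∧ ∀ h ∈ 𝔥, ⁅h, x⁆ = form h β • x

end RootDef

/-- The data fixed throughout: the number `N` of extra variables, the order `m` of the
automorphism `θ`, a primitive `m`-th root of unity `ω`, the invariant form, the Cartan subalgebra,
the root vectors `x β` and the scalars `ε`, `η` which they define. The functions `x`, `ε`, `η` are
total on `𝔤`; only their values at roots matter. -/
structure Data (𝔤 : Type u) [LieRing 𝔤] [LieAlgebra ℂ 𝔤] where
  N : ℕ
  m : ℕ
  m_pos : 0 < m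
  ω : ℂ
  ω_prim : IsPrimitiveRoot ω m
  form : LinearMap.BilinForm ℂ 𝔤
  form_symm : form.IsSymm
  form_nondeg : form.Nondegenerate
  form_inv : form.lieInvariant 𝔤
  θ : 𝔤 ≃ₗ⁅ℂ⁆ 𝔤
  θ_order : orderOf (((θ : 𝔤 →ₗ⁅ℂ⁆ 𝔤) : 𝔤 →ₗ[ℂ] 𝔤) : Module.End ℂ 𝔤) = m
  form_θ : ∀ x y, form (θ x) (θ y) = form x y
  𝔥 : LieSubalgebra ℂ 𝔤
  𝔥_cartan : 𝔥.IsCartanSubalgebra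
  θ_𝔥 : 𝔥.map (θ : 𝔤 →ₗ⁅ℂ⁆ 𝔤) = 𝔥
  x : 𝔤 → 𝔤
  x_ne_zero : ∀ β, IsRoot form 𝔥 β → x β ≠ 0
  x_root : ∀ β, IsRoot form 𝔥 β → ∀ h ∈ 𝔥, ⁅h, x β⁆ = form h β • x β
  ε : 𝔤 → 𝔤 → ℂ
  ε_spec : ∀ β γ, IsRoot form 𝔥 β → IsRoot form 𝔥 γ → IsRoot form 𝔥 (β + γ) →
    ⁅x β, x γ⁆ = ε β γ • x (β + γ)
  η : ℕ → 𝔤 → ℂ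
  η_spec : ∀ p β, IsRoot form 𝔥 β → θ^[p] (x β) = η p β • x (θ^[p] β)

namespace Data

variable {𝔤 : Type u} [LieRing 𝔤] [LieAlgebra ℂ 𝔤] (S : Data 𝔤)

/-- `θ` as a linear endomorphism. -/
def θl : Module.End ℂ 𝔤 := ((S.θ : 𝔤 →ₗ⁅ℂ⁆ 𝔤) : 𝔤 →ₗ[ℂ] 𝔤)

@[simp] lemma θl_apply (x : 𝔤) : S.θl x = S.θ x := rfl

lemma θl_pow_m : S.θl ^ S.m = 1 := by
  have h := pow_orderOf_eq_one S.θl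
  rwa [show orderOf S.θl = S.m from S.θ_order] at h

lemma ω_ne_zero : S.ω ≠ 0 := S.ω_prim.ne_zero S.m_pos.ne'

/-- The set of roots. -/
abbrev Root : Type u := {β : 𝔤 // IsRoot S.form S.𝔥 β}

/-- The component `x_i` of `x` in the `ω ^ i`-eigenspace `𝔤_i` of `θ`:
`x_i = (1/m) ∑_p ω ^ (-ip) θ^p x`. -/
def proj (i : ℤ) : 𝔤 →ₗ[ℂ] 𝔤 :=
  (S.m : ℂ)⁻¹ • ∑ p ∈ Finset.range S.m, S.ω ^ (-(i * p)) • S.θl ^ p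

lemma θ_proj (i : ℤ) (x : 𝔤) : S.θ (S.proj i x) = S.ω ^ i • S.proj i x := by
  have hω := S.ω_ne_zero
  have hm : S.ω ^ (S.m : ℤ) = 1 := by exact_mod_cast S.ω_prim.pow_eq_one
  let f : ℕ → 𝔤 := fun p => S.ω ^ (-(i * p)) • (S.θl ^ p) x
  have hf : f S.m = f 0 := by
    simp only [f, θl_pow_m]
    rw [mul_comm i, ← mul_neg, zpow_mul, hm]
    simp
  have hs : ∀ p, S.θ (f p) = S.ω ^ i • f (p + 1) := by
    intro p
    simp only [f, map_smul, smul_smul]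
    rw [← zpow_add₀ hω, pow_succ', Module.End.mul_apply, θl_apply]
    congr 2
    push_cast
    ring
  have hp : S.proj i x = (S.m : ℂ)⁻¹ • ∑ p ∈ Finset.range S.m, f p := by
    simp [proj, f, LinearMap.sum_apply]
  rw [hp, map_smul, map_sum, Finset.sum_congr rfl (fun p _ => hs p), ← Finset.smul_sum,
    smul_comm]
  congr 2
  have h1 := Finset.sum_range_succ f S.m
  rw [Finset.sum_range_succ', hf] at h1
  exact add_right_cancel h1

lemma θl_pow_mem (p : ℕ) {x : 𝔤} (hx : x ∈ S.𝔥) : (S.θl ^ p) x ∈ S.𝔥 := by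
  induction p with
  | zero => simpa
  | succ p ih =>
    rw [pow_succ', Module.End.mul_apply]
    have : S.θl ((S.θl ^ p) x) ∈ S.𝔥.map (S.θ : 𝔤 →ₗ⁅ℂ⁆ 𝔤) := ⟨_, ih, rfl⟩
    rwa [S.θ_𝔥] at this

lemma proj_mem (i : ℤ) {x : 𝔤} (hx : x ∈ S.𝔥) : S.proj i x ∈ S.𝔥 := by
  simp only [proj, LinearMap.smul_apply, LinearMap.sum_apply]
  exact S.𝔥.smul_mem _ (sum_mem fun p _ => S.𝔥.smul_mem _ (S.θl_pow_mem p hx))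

/-- `𝔥_0`, the `θ`-fixed points of `𝔥`. -/
def 𝔥₀ : Submodule ℂ 𝔤 := S.𝔥.toSubmodule ⊓ LinearMap.eqLocus S.θl LinearMap.id

/-- The projection of an element of `𝔥` to `𝔥_0`. -/
def proj₀ (x : S.𝔥) : S.𝔥₀ :=
  ⟨S.proj 0 x, S.proj_mem 0 x.2, by simpa using S.θ_proj 0 (x : 𝔤)⟩

/-! ## The toroidal Lie algebra with its degree derivations -/

/-- Exponents `(r₀, r)` of monomials `t^{r₀} t^r`. -/
abbrev Exp : Type := ℤ × (Fin S.N → ℤ)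

/-- The Laurent polynomial ring in `N + 1` variables. -/
abbrev A : Type := AddMonoidAlgebra ℂ S.Exp

/-- The monomial `t^{r₀} t^r`. -/
def mono (γ : S.Exp) : S.A := AddMonoidAlgebra.single γ 1

/-- The degrees of a monomial: index `0` is `r₀`, index `i + 1` is `r i`. -/
def deg (γ : S.Exp) : Fin (S.N + 1) → ℤ := Fin.cons γ.1 γ.2

lemma deg_add (γ δ : S.Exp) (i) : S.deg (γ + δ) i = S.deg γ i + S.deg δ i := by
  refine Fin.cases ?_ (fun j => ?_) i <;> simp [deg]

lemma mono_mul (γ δ : S.Exp) : S.mono γ * S.mono δ = S.mono (γ + δ) := by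
  simp [mono, AddMonoidAlgebra.single_mul_single]

lemma A_ext {M : Type*} [AddCommGroup M] [Module ℂ M] {f g : S.A →ₗ[ℂ] M}
    (h : ∀ γ, f (S.mono γ) = g (S.mono γ)) : f = g :=
  (AddMonoidAlgebra.basis S.Exp ℂ).ext fun γ => by
    simpa [AddMonoidAlgebra.basis_apply, mono] using h γ

/-- The linear endomorphism of `A` multiplying `t^{r₀} t^r` by the scalar `c (r₀, r)`. -/
def diag (c : S.Exp → ℂ) : S.A →ₗ[ℂ] S.A :=
  (AddMonoidAlgebra.basis S.Exp ℂ).constr ℂ fun γ => c γ • S.mono γ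

@[simp] lemma diag_mono (c : S.Exp → ℂ) (γ : S.Exp) : S.diag c (S.mono γ) = c γ • S.mono γ := by
  have := (AddMonoidAlgebra.basis S.Exp ℂ).constr_basis ℂ (fun γ => c γ • S.mono γ) γ
  rwa [AddMonoidAlgebra.basis_apply] at this

/-- The eigenvalue of the derivation `∑ a_i d_i` on the monomial `t^{r₀} t^r`. -/
def wt (a : Fin (S.N + 1) → ℂ) (γ : S.Exp) : ℂ := ∑ i, a i * S.deg γ i

/-- The free `A`-module `Ω_A` with basis `k_0, …, k_N`. -/
abbrev Om : Type := Fin (S.N + 1) → S.A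

/-- `t^{r₀} t^r ↦ (1/m) r₀ t^{r₀} t^r k_0 + r_1 t^{r₀} t^r k_1 + ⋯ + r_N t^{r₀} t^r k_N`. -/
def dOm : S.A →ₗ[ℂ] S.Om :=
  LinearMap.pi fun i => (if i = 0 then (S.m : ℂ)⁻¹ else 1) • S.diag fun γ => (S.deg γ i : ℂ)

/-- The subspace `d_A` of `Ω_A` spanned by the images of the monomials under `dOm`. -/
def dA : Submodule ℂ S.Om := LinearMap.range S.dOm

/-- The centre `Ω_A / d_A` of the toroidal Lie algebra. -/
abbrev Ctr : Type := S.Om ⧸ S.dA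

lemma diag_comm (c e : S.Exp → ℂ) (f : S.A) : S.diag c (S.diag e f) = S.diag e (S.diag c f) := by
  have : S.diag c ∘ₗ S.diag e = S.diag e ∘ₗ S.diag c :=
    S.A_ext fun γ => by simp [smul_smul, mul_comm]
  exact LinearMap.congr_fun this f

/-- A diagonal endomorphism of `A`, acting on the coefficients of `Ω_A / d_A`. -/
def diagC (c : S.Exp → ℂ) : S.Ctr →ₗ[ℂ] S.Ctr :=
  S.dA.mapQ S.dA ((S.diag c).compLeft (Fin (S.N + 1))) <| by
    rintro _ ⟨f, rfl⟩
    refine ⟨S.diag c f, ?_⟩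
    ext1 i
    by_cases hi : i = 0 <;> simp [dOm, hi, S.diag_comm c]

/-- The pairing `(f, g) ↦ g df` with values in `Ω_A / d_A`. -/
def kap : S.A →ₗ[ℂ] S.A →ₗ[ℂ] S.Ctr :=
  LinearMap.mk₂ ℂ (fun f g => S.dA.mkQ (fun i => g * S.dOm f i))
    (fun f f' g => by
      rw [← map_add]; congr 1; ext1 i; simp [mul_add])
    (fun c f g => by
      rw [← map_smul]; congr 1; ext1 i; simp)
    (fun f g g' => by
      rw [← map_add]; congr 1; ext1 i; simp [add_mul])
    (fun c f g => by
      rw [← map_smul]; congr 1; ext1 i; simp)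

lemma kap_apply (f g : S.A) : S.kap f g = S.dA.mkQ (fun i => g * S.dOm f i) := rfl

/-- The multiloop algebra `𝔤 ⊗ A`. -/
abbrev Loop : Type u := S.A ⊗[ℂ] 𝔤

/-- The bracket `(f ⊗ x, g ⊗ y) ↦ fg ⊗ [x, y]` of the multiloop algebra. -/
def br : S.Loop →ₗ[ℂ] S.Loop →ₗ[ℂ] S.Loop :=
  TensorProduct.map₂ (LinearMap.mul ℂ S.A)
    (LinearMap.mk₂ ℂ (fun x y : 𝔤 => ⁅x, y⁆) add_lie smul_lie lie_add fun c x y => lie_smul c x y)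

@[simp] lemma br_tmul (f g : S.A) (x y : 𝔤) :
    S.br (f ⊗ₜ x) (g ⊗ₜ y) = (f * g) ⊗ₜ ⁅x, y⁆ := by
  simp [br]

/-- The bilinear map `(f ⊗ x, g ⊗ y) ↦ ⟨x, y⟩ g df`. On monomials
`(t^{r₀} t^r ⊗ x, t^{s₀} t^s ⊗ y) ↦ ⟨x, y⟩ ((r₀/m) t^{r₀+s₀} t^{r+s} k_0 + ∑ r_i t^{r₀+s₀} t^{r+s} k_i)`. -/
def coc : S.Loop →ₗ[ℂ] S.Loop →ₗ[ℂ] S.Ctr :=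
  (TensorProduct.map₂ S.kap S.form).compr₂ (TensorProduct.rid ℂ S.Ctr).toLinearMap

@[simp] lemma coc_tmul (f g : S.A) (x y : 𝔤) :
    S.coc (f ⊗ₜ x) (g ⊗ₜ y) = S.form x y • S.kap f g := by
  simp [coc]

/-- A diagonal endomorphism of `A` tensored with a linear endomorphism of `𝔤`. -/
def diagL (c : S.Exp → ℂ) (σ : 𝔤 →ₗ[ℂ] 𝔤) : S.Loop →ₗ[ℂ] S.Loop :=
  TensorProduct.map (S.diag c) σ

/-- The Lie algebra `τ ⊕ D = 𝔤 ⊗ A ⊕ Ω_A / d_A ⊕ D`. The component `der` holds the coordinates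
of an element of `D` in the basis `d_0, …, d_N`. -/
@[ext] structure Tor (S : Data 𝔤) : Type u where
  loop : S.Loop
  ctr : S.Ctr
  der : Fin (S.N + 1) → ℂ

/-- The underlying vector space of `τ ⊕ D`. -/
def torEquiv : S.Tor ≃ S.Loop × S.Ctr × (Fin (S.N + 1) → ℂ) where
  toFun X := (X.loop, X.ctr, X.der)
  invFun Y := ⟨Y.1, Y.2.1, Y.2.2⟩
  left_inv _ := rfl
  right_inv _ := rfl

instance : AddCommGroup S.Tor := S.torEquiv.addCommGroup
instance : Module ℂ S.Tor := S.torEquiv.module ℂ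

@[simp] lemma add_loop (X Y : S.Tor) : (X + Y).loop = X.loop + Y.loop := rfl
@[simp] lemma add_ctr (X Y : S.Tor) : (X + Y).ctr = X.ctr + Y.ctr := rfl
@[simp] lemma add_der (X Y : S.Tor) : (X + Y).der = X.der + Y.der := rfl
@[simp] lemma smul_loop (r : ℂ) (X : S.Tor) : (r • X).loop = r • X.loop := rfl
@[simp] lemma smul_ctr (r : ℂ) (X : S.Tor) : (r • X).ctr = r • X.ctr := rfl
@[simp] lemma smul_der (r : ℂ) (X : S.Tor) : (r • X).der = r • X.der := rfl
@[simp] lemma zero_loop : (0 : S.Tor).loop = 0 := rfl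
@[simp] lemma zero_ctr : (0 : S.Tor).ctr = 0 := rfl
@[simp] lemma zero_der : (0 : S.Tor).der = 0 := rfl

/-- On `𝔤 ⊗ A` the bracket is `[f, g] + coc f g`, the space `Ω_A / d_A` is central in `τ`, and an
element of the abelian algebra `D` acts through the degree derivations. -/
instance : Bracket S.Tor S.Tor where
  bracket X Y :=
    { loop := S.br X.loop Y.loop + S.diagL (S.wt X.der) 1 Y.loop - S.diagL (S.wt Y.der) 1 X.loop
      ctr := S.coc X.loop Y.loop + S.diagC (S.wt X.der) Y.ctr - S.diagC (S.wt Y.der) X.ctr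
      der := 0 }

@[simp] lemma bracket_loop (X Y : S.Tor) : ⁅X, Y⁆.loop =
    S.br X.loop Y.loop + S.diagL (S.wt X.der) 1 Y.loop - S.diagL (S.wt Y.der) 1 X.loop := rfl
@[simp] lemma bracket_ctr (X Y : S.Tor) : ⁅X, Y⁆.ctr =
    S.coc X.loop Y.loop + S.diagC (S.wt X.der) Y.ctr - S.diagC (S.wt Y.der) X.ctr := rfl
@[simp] lemma bracket_der (X Y : S.Tor) : ⁅X, Y⁆.der = 0 := rfl

lemma loop_induction {P : S.Loop → Prop} (hadd : ∀ X Y, P X → P Y → P (X + Y))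
    (hmono : ∀ γ x, P (S.mono γ ⊗ₜ x)) (X : S.Loop) : P X := by
  have h0 : P 0 := by simpa using hmono 0 0
  induction X using TensorProduct.induction_on with
  | zero => exact h0
  | add X Y hX hY => exact hadd X Y hX hY
  | tmul f x =>
    induction f using AddMonoidAlgebra.induction_linear with
    | zero => simpa using h0
    | add f g hf hg => rw [TensorProduct.add_tmul]; exact hadd _ _ hf hg
    | single γ r =>
      have : (AddMonoidAlgebra.single γ r : S.A) = r • S.mono γ := by simp [mono]
      rw [this, TensorProduct.smul_tmul]
      exact hmono _ _

@[simp] lemma diagL_tmul (c : S.Exp → ℂ) (σ : 𝔤 →ₗ[ℂ] 𝔤) (γ : S.Exp) (x : 𝔤) :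
    S.diagL c σ (S.mono γ ⊗ₜ x) = c γ • S.mono γ ⊗ₜ[ℂ] σ x := by
  simp [diagL, TensorProduct.smul_tmul']

lemma wt_add (a) (γ δ : S.Exp) : S.wt a (γ + δ) = S.wt a γ + S.wt a δ := by
  simp [wt, deg_add, mul_add, Finset.sum_add_distrib]

lemma wt_add_left (a b) : S.wt (a + b) = S.wt a + S.wt b := by
  ext γ
  simp [wt, add_mul, Finset.sum_add_distrib]

lemma wt_smul_left (r : ℂ) (a) : S.wt (r • a) = r • S.wt a := by
  ext γ
  simp [wt, Finset.mul_sum, mul_assoc]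

lemma wt_zero : S.wt 0 = 0 := by
  ext γ
  simp [wt]

lemma diag_add (c e : S.Exp → ℂ) : S.diag (c + e) = S.diag c + S.diag e :=
  S.A_ext fun γ => by simp [add_smul]

lemma diag_smul (r : ℂ) (c : S.Exp → ℂ) : S.diag (r • c) = r • S.diag c :=
  S.A_ext fun γ => by simp [mul_smul]

lemma diagC_mkQ (c : S.Exp → ℂ) (f : S.Om) :
    S.diagC c (S.dA.mkQ f) = S.dA.mkQ (fun i => S.diag c (f i)) := rfl

lemma diagL_add (c e : S.Exp → ℂ) (σ) : S.diagL (c + e) σ = S.diagL c σ + S.diagL e σ := by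
  simp [diagL, diag_add, TensorProduct.map_add_left]

lemma diagL_smul (r : ℂ) (c : S.Exp → ℂ) (σ) : S.diagL (r • c) σ = r • S.diagL c σ := by
  simp [diagL, diag_smul, TensorProduct.map_smul_left]

lemma diagL_zero (σ) : S.diagL 0 σ = 0 := by
  simpa using S.diagL_smul 0 0 σ

lemma diagC_add (c e : S.Exp → ℂ) : S.diagC (c + e) = S.diagC c + S.diagC e := by
  apply Submodule.linearMap_qext
  apply LinearMap.ext
  intro f
  simp only [LinearMap.comp_apply, LinearMap.add_apply, diagC_mkQ, diag_add]
  rw [← map_add]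
  rfl

lemma diagC_smul (r : ℂ) (c : S.Exp → ℂ) : S.diagC (r • c) = r • S.diagC c := by
  apply Submodule.linearMap_qext
  apply LinearMap.ext
  intro f
  simp only [LinearMap.comp_apply, LinearMap.smul_apply, diagC_mkQ, diag_smul]
  rw [← map_smul]
  rfl

lemma diagC_zero : S.diagC 0 = 0 := by
  simpa using S.diagC_smul 0 0

lemma diagC_comm (c e : S.Exp → ℂ) (z : S.Ctr) :
    S.diagC c (S.diagC e z) = S.diagC e (S.diagC c z) := by
  obtain ⟨f, rfl⟩ := S.dA.mkQ_surjective z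
  simp only [diagC_mkQ, S.diag_comm c e]

lemma diagL_comm (c e : S.Exp → ℂ) (X : S.Loop) :
    S.diagL c 1 (S.diagL e 1 X) = S.diagL e 1 (S.diagL c 1 X) := by
  induction X using S.loop_induction with
  | hadd X Y hX hY => simp only [map_add, hX, hY]
  | hmono γ x => simp [smul_smul, mul_comm]

/-- The class of `t^γ ∑ c_i deg_i(δ) k_i` with `c_0 = 1/m` and `c_i = 1` otherwise. -/
def dvec (γ δ : S.Exp) : S.Ctr :=
  S.dA.mkQ fun i => ((if i = 0 then (S.m : ℂ)⁻¹ else 1) * S.deg δ i) • S.mono γ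

lemma dOm_mono (γ : S.Exp) (i) :
    S.dOm (S.mono γ) i = ((if i = 0 then (S.m : ℂ)⁻¹ else 1) * S.deg γ i) • S.mono γ := by
  simp only [dOm, LinearMap.pi_apply, LinearMap.smul_apply, diag_mono, smul_smul]

lemma kap_mono (γ δ : S.Exp) : S.kap (S.mono γ) (S.mono δ) = S.dvec (γ + δ) γ := by
  rw [kap_apply, dvec]
  congr 1
  ext1 i
  rw [dOm_mono, mul_smul_comm, mono_mul, add_comm δ γ]

lemma dvec_self (γ : S.Exp) : S.dvec γ γ = 0 := by
  rw [dvec, Submodule.mkQ_apply, Submodule.Quotient.mk_eq_zero]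
  exact ⟨S.mono γ, by ext1 i; rw [dOm_mono]⟩

lemma dvec_add (γ δ δ' : S.Exp) : S.dvec γ (δ + δ') = S.dvec γ δ + S.dvec γ δ' := by
  rw [dvec, dvec, dvec, ← map_add]
  congr 1
  ext1 i
  rw [Pi.add_apply, ← add_smul, deg_add]
  push_cast
  rw [mul_add]

lemma diagC_dvec (c) (γ δ : S.Exp) : S.diagC c (S.dvec γ δ) = c γ • S.dvec γ δ := by
  rw [dvec, diagC_mkQ, ← map_smul]
  congr 1
  ext1 i
  rw [map_smul, diag_mono, Pi.smul_apply, smul_comm]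

lemma coc_mono (γ δ : S.Exp) (x y : 𝔤) :
    S.coc (S.mono γ ⊗ₜ x) (S.mono δ ⊗ₜ y) = S.form x y • S.dvec (γ + δ) γ := by
  rw [coc_tmul, kap_mono]

lemma br_mono (γ δ : S.Exp) (x y : 𝔤) :
    S.br (S.mono γ ⊗ₜ x) (S.mono δ ⊗ₜ y) = S.mono (γ + δ) ⊗ₜ ⁅x, y⁆ := by
  rw [br_tmul, mono_mul]

lemma form_comm (x y : 𝔤) : S.form x y = S.form y x := by
  simpa using (S.form_symm.eq x y)

lemma coc_skew (X Y : S.Loop) : S.coc X Y = - S.coc Y X := by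
  induction X using S.loop_induction with
  | hadd X X' hX hX' => simp only [map_add, LinearMap.add_apply, hX, hX', neg_add]
  | hmono γ x =>
    induction Y using S.loop_induction with
    | hadd Y Y' hY hY' => simp only [map_add, LinearMap.add_apply, hY, hY', neg_add]
    | hmono δ y =>
      rw [coc_mono, coc_mono, S.form_comm y x, ← smul_neg, add_comm δ γ]
      congr 1
      rw [eq_neg_iff_add_eq_zero, ← dvec_add, dvec_self]

lemma coc_self (X : S.Loop) : S.coc X X = 0 := by
  have h := S.coc_skew X X
  have h2 : (2 : ℂ) • S.coc X X = 0 := by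
    rw [two_smul]; nth_rewrite 1 [h]; simp
  exact (smul_eq_zero.mp h2).resolve_left two_ne_zero

lemma br_skew (X Y : S.Loop) : S.br X Y = - S.br Y X := by
  induction X using S.loop_induction with
  | hadd X X' hX hX' => simp only [map_add, LinearMap.add_apply, hX, hX', neg_add]
  | hmono γ x =>
    induction Y using S.loop_induction with
    | hadd Y Y' hY hY' => simp only [map_add, LinearMap.add_apply, hY, hY', neg_add]
    | hmono δ y =>
      rw [br_mono, br_mono, add_comm δ γ, ← TensorProduct.tmul_neg, lie_skew]

lemma br_self (X : S.Loop) : S.br X X = 0 := by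
  have h := S.br_skew X X
  have h2 : (2 : ℂ) • S.br X X = 0 := by
    rw [two_smul]; nth_rewrite 1 [h]; simp
  exact (smul_eq_zero.mp h2).resolve_left two_ne_zero

lemma br_leibniz (X Y Z : S.Loop) :
    S.br X (S.br Y Z) = S.br (S.br X Y) Z + S.br Y (S.br X Z) := by
  induction X using S.loop_induction with
  | hadd X X' hX hX' =>
    simp only [map_add, LinearMap.add_apply, hX, hX']; abel
  | hmono γ x =>
    induction Y using S.loop_induction with
    | hadd Y Y' hY hY' =>
      simp only [map_add, LinearMap.add_apply, hY, hY']; abel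
    | hmono δ y =>
      induction Z using S.loop_induction with
      | hadd Z Z' hZ hZ' =>
        simp only [map_add, hZ, hZ']; abel
      | hmono κ z =>
        simp only [br_mono]
        rw [show δ + (γ + κ) = γ + δ + κ by abel, show γ + (δ + κ) = γ + δ + κ by abel,
          ← TensorProduct.tmul_add, leibniz_lie x y z]

lemma coc_leibniz (X Y Z : S.Loop) :
    S.coc X (S.br Y Z) = S.coc (S.br X Y) Z + S.coc Y (S.br X Z) := by
  induction X using S.loop_induction with
  | hadd X X' hX hX' =>
    simp only [map_add, LinearMap.add_apply, hX, hX']; abel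
  | hmono γ x =>
    induction Y using S.loop_induction with
    | hadd Y Y' hY hY' =>
      simp only [map_add, LinearMap.add_apply, hY, hY']; abel
    | hmono δ y =>
      induction Z using S.loop_induction with
      | hadd Z Z' hZ hZ' =>
        simp only [map_add, hZ, hZ']; abel
      | hmono κ z =>
        have h1 : S.form ⁅x, y⁆ z = S.form x ⁅y, z⁆ := by
          rw [← lie_skew, map_neg, LinearMap.neg_apply, S.form_inv y x z, neg_neg]
        have h2 : S.form y ⁅x, z⁆ = - S.form x ⁅y, z⁆ := by
          rw [← h1, S.form_inv x y z, neg_neg]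
        simp only [br_mono, coc_mono]
        rw [h1, h2, dvec_add, show δ + (γ + κ) = γ + δ + κ by abel,
          show γ + (δ + κ) = γ + δ + κ by abel, smul_add, neg_smul, add_neg_cancel_right]

lemma diagL_br {c : S.Exp → ℂ} (hc : ∀ γ δ, c (γ + δ) = c γ + c δ) (X Y : S.Loop) :
    S.diagL c 1 (S.br X Y) = S.br (S.diagL c 1 X) Y + S.br X (S.diagL c 1 Y) := by
  induction X using S.loop_induction with
  | hadd X X' hX hX' => simp only [map_add, LinearMap.add_apply, hX, hX']; abel
  | hmono γ x =>
    induction Y using S.loop_induction with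
    | hadd Y Y' hY hY' => simp only [map_add, hY, hY']; abel
    | hmono δ y =>
      simp only [diagL_tmul, map_smul, LinearMap.smul_apply, Module.End.one_apply, br_mono]
      rw [← add_smul, hc]

lemma diagC_coc {c : S.Exp → ℂ} (hc : ∀ γ δ, c (γ + δ) = c γ + c δ) (X Y : S.Loop) :
    S.diagC c (S.coc X Y) = S.coc (S.diagL c 1 X) Y + S.coc X (S.diagL c 1 Y) := by
  induction X using S.loop_induction with
  | hadd X X' hX hX' => simp only [map_add, LinearMap.add_apply, hX, hX']; abel
  | hmono γ x =>
    induction Y using S.loop_induction with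
    | hadd Y Y' hY hY' => simp only [map_add, hY, hY']; abel
    | hmono δ y =>
      simp only [diagL_tmul, map_smul, LinearMap.smul_apply, Module.End.one_apply, coc_mono,
        diagC_dvec]
      rw [← add_smul, hc, smul_comm]

instance : LieRing S.Tor where
  add_lie X Y Z := by
    ext1
    · simp only [bracket_loop, add_loop, add_der, wt_add_left, diagL_add, map_add,
        LinearMap.add_apply]; abel
    · simp only [bracket_ctr, add_ctr, add_loop, add_der, wt_add_left, diagC_add, map_add,
        LinearMap.add_apply]; abel
    · simp
  lie_add X Y Z := by
    ext1
    · simp only [bracket_loop, add_loop, add_der, wt_add_left, diagL_add, map_add,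
        LinearMap.add_apply]; abel
    · simp only [bracket_ctr, add_ctr, add_loop, add_der, wt_add_left, diagC_add, map_add,
        LinearMap.add_apply]; abel
    · simp
  lie_self X := by
    ext1 <;> simp [coc_self, br_self]
  leibniz_lie X Y Z := by
    ext1
    · simp only [bracket_loop, add_loop, bracket_der, wt_zero, diagL_zero, LinearMap.zero_apply,
        map_add, map_sub, LinearMap.add_apply, LinearMap.sub_apply, S.diagL_br (S.wt_add _),
        S.br_leibniz X.loop Y.loop Z.loop]
      rw [S.br_skew (S.diagL (S.wt Z.der) 1 X.loop) Y.loop, S.diagL_comm (S.wt X.der) (S.wt Y.der),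
        S.diagL_comm (S.wt X.der) (S.wt Z.der), S.diagL_comm (S.wt Y.der) (S.wt Z.der)]
      abel
    · simp only [bracket_loop, bracket_ctr, add_ctr, bracket_der, wt_zero, diagC_zero,
        LinearMap.zero_apply, map_add, map_sub, LinearMap.add_apply, LinearMap.sub_apply,
        S.diagC_coc (S.wt_add _), S.coc_leibniz X.loop Y.loop Z.loop]
      rw [S.coc_skew (S.diagL (S.wt Z.der) 1 X.loop) Y.loop, S.diagC_comm (S.wt X.der) (S.wt Y.der),
        S.diagC_comm (S.wt X.der) (S.wt Z.der), S.diagC_comm (S.wt Y.der) (S.wt Z.der)]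
      abel
    · simp

instance : LieAlgebra ℂ S.Tor where
  lie_smul r X Y := by
    ext1
    · simp only [bracket_loop, smul_loop, smul_der, wt_smul_left, diagL_smul, map_smul,
        LinearMap.smul_apply, smul_add, smul_sub]
    · simp only [bracket_ctr, smul_ctr, smul_loop, smul_der, wt_smul_left,
        diagC_smul, map_smul, LinearMap.smul_apply, smul_add, smul_sub]
    · simp

/-! ## The twisted toroidal Lie algebra -/

/-- The scalar `ω^{-r₀}` by which the twist acts on the monomial `t^{r₀} t^r`. -/
def tw (γ : S.Exp) : ℂ := S.ω ^ (-γ.1)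

lemma tw_add (γ δ : S.Exp) : S.tw (γ + δ) = S.tw γ * S.tw δ := by
  simp only [tw, Prod.fst_add, neg_add, zpow_add₀ S.ω_ne_zero]

/-- The extension of `θ`: `x t^{r₀} t^r ↦ ω^{-r₀} θ(x) t^{r₀} t^r`,
`t^{r₀} t^r k_i ↦ ω^{-r₀} t^{r₀} t^r k_i`, `d_i ↦ d_i`. -/
def θT (X : S.Tor) : S.Tor where
  loop := S.diagL S.tw S.θl X.loop
  ctr := S.diagC S.tw X.ctr
  der := X.der

lemma diagL_tw_br (X Y : S.Loop) :
    S.diagL S.tw S.θl (S.br X Y) = S.br (S.diagL S.tw S.θl X) (S.diagL S.tw S.θl Y) := by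
  induction X using S.loop_induction with
  | hadd X X' hX hX' => simp only [map_add, LinearMap.add_apply, hX, hX']
  | hmono γ x =>
    induction Y using S.loop_induction with
    | hadd Y Y' hY hY' => simp only [map_add, hY, hY']
    | hmono δ y =>
      simp only [diagL_tmul, map_smul, LinearMap.smul_apply, br_mono, smul_smul, tw_add, θl_apply,
        LieEquiv.map_lie, mul_comm]

lemma diagC_tw_coc (X Y : S.Loop) :
    S.diagC S.tw (S.coc X Y) = S.coc (S.diagL S.tw S.θl X) (S.diagL S.tw S.θl Y) := by
  induction X using S.loop_induction with
  | hadd X X' hX hX' => simp only [map_add, LinearMap.add_apply, hX, hX']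
  | hmono γ x =>
    induction Y using S.loop_induction with
    | hadd Y Y' hY hY' => simp only [map_add, hY, hY']
    | hmono δ y =>
      simp only [diagL_tmul, map_smul, LinearMap.smul_apply, coc_mono, diagC_dvec, smul_smul,
        tw_add, θl_apply, form_θ]
      congr 1
      ring

lemma diagL_tw_comm (c : S.Exp → ℂ) (X : S.Loop) :
    S.diagL S.tw S.θl (S.diagL c 1 X) = S.diagL c 1 (S.diagL S.tw S.θl X) := by
  induction X using S.loop_induction with
  | hadd X Y hX hY => simp only [map_add, hX, hY]
  | hmono γ x => simp [smul_smul, mul_comm]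

lemma θT_lie (X Y : S.Tor) : S.θT ⁅X, Y⁆ = ⁅S.θT X, S.θT Y⁆ := by
  ext1
  · simp only [θT, bracket_loop, map_add, map_sub, diagL_tw_br, diagL_tw_comm]
  · simp only [θT, bracket_ctr, map_add, map_sub, diagC_tw_coc, S.diagC_comm S.tw]
  · rfl

/-- The twisted toroidal Lie algebra `L̃(𝔤, θ)`: the fixed points of `θ` in `τ ⊕ D`. -/
def L : LieSubalgebra ℂ S.Tor where
  carrier := {X | S.θT X = X}
  zero_mem' := by
    change S.θT 0 = 0
    ext1 <;> simp [θT]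
  add_mem' := by
    intro X Y (hX : S.θT X = X) (hY : S.θT Y = Y)
    change S.θT (X + Y) = X + Y
    conv_rhs => rw [← hX, ← hY]
    ext1 <;> simp [θT]
  smul_mem' := by
    intro r X (hX : S.θT X = X)
    change S.θT (r • X) = r • X
    conv_rhs => rw [← hX]
    ext1 <;> simp [θT]
  lie_mem' := by
    intro X Y (hX : S.θT X = X) (hY : S.θT Y = Y)
    change S.θT ⁅X, Y⁆ = ⁅X, Y⁆
    rw [θT_lie, hX, hY]

/-- The element `x_i ⊗ t^i t^r` of `L̃(𝔤, θ)`, i.e. the coefficient of `ζ^i` in `x(r, ζ)`. -/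
def gEl (x : 𝔤) (i : ℤ) (r : Fin S.N → ℤ) : S.L :=
  ⟨⟨S.mono (i, r) ⊗ₜ S.proj i x, 0, 0⟩, by
    change S.θT _ = _
    ext1
    · simp only [θT, diagL_tmul, θl_apply, θ_proj, TensorProduct.tmul_smul, smul_smul, tw]
      rw [← zpow_add₀ S.ω_ne_zero]
      simp
    · simp [θT]
    · rfl⟩

/-- The element `t^{mp} t^r k_i` of `L̃(𝔤, θ)`, i.e. the coefficient of `ζ^{mp}` in
`k_i(r, ζ^m)`. -/
def kEl (i : Fin (S.N + 1)) (r : Fin S.N → ℤ) (p : ℤ) : S.L :=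
  ⟨⟨0, S.dA.mkQ (Pi.single i (S.mono (S.m * p, r))), 0⟩, by
    change S.θT _ = _
    ext1
    · simp [θT]
    · simp only [θT, diagC_mkQ]
      congr 1
      ext1 j
      have hm : S.ω ^ (S.m : ℤ) = 1 := by exact_mod_cast S.ω_prim.pow_eq_one
      have h1 : S.tw (S.m * p, r) = 1 := by
        simp only [tw]
        rw [← mul_neg, zpow_mul, hm, one_zpow]
      by_cases hj : j = i
      · subst hj
        simp [h1]
      · simp [hj]
    · rfl⟩

/-- The element `d_i` of `L̃(𝔤, θ)`. -/
def dEl (i : Fin (S.N + 1)) : S.L :=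
  ⟨⟨0, 0, Pi.single i 1⟩, by
    change S.θT _ = _
    ext1 <;> simp [θT]⟩

/-! ## The Heisenberg subalgebra and its Verma module -/

/-- The subalgebra `𝔥~` generated by all `h_i ⊗ t^i` (`h ∈ 𝔥`, `i ∈ ℤ`), `k_0` and `d_0`. -/
def hT : LieSubalgebra ℂ S.L :=
  LieSubalgebra.lieSpan ℂ S.L
    ({y | ∃ (h : S.𝔥) (i : ℤ), y = S.gEl h i 0} ∪ {S.kEl 0 0 0, S.dEl 0})

/-- `h_i ⊗ t^i` as an element of `𝔥~`. -/
def hEl (h : S.𝔥) (i : ℤ) : S.hT :=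
  ⟨S.gEl h i 0, LieSubalgebra.subset_lieSpan (Or.inl ⟨h, i, rfl⟩)⟩

/-- `k_0` as an element of `𝔥~`. -/
def hk : S.hT := ⟨S.kEl 0 0 0, LieSubalgebra.subset_lieSpan (Or.inr (Or.inl rfl))⟩

/-- `d_0` as an element of `𝔥~`. -/
def hd : S.hT := ⟨S.dEl 0, LieSubalgebra.subset_lieSpan (Or.inr (Or.inr rfl))⟩

/-- The enveloping algebra of `𝔥~`. -/
abbrev UH : Type u := UniversalEnvelopingAlgebra ℂ S.hT

/-- The inclusion of `𝔥~` into its enveloping algebra. -/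
def ιH (y : S.hT) : S.UH := UniversalEnvelopingAlgebra.ι ℂ y

/-- The left ideal of `U(𝔥~)` generated by `h_i ⊗ t^i` for `i ≥ 0`, by `k_0 - k` and by `d_0`. -/
def vermaIdeal (k : ℂ) : Submodule S.UH S.UH :=
  Submodule.span S.UH
    ({y | ∃ (h : S.𝔥) (i : ℤ), 0 ≤ i ∧ y = S.ιH (S.hEl h i)} ∪
      {S.ιH S.hk - algebraMap ℂ S.UH k, S.ιH S.hd})

/-- The Verma module `M(k)` of level `k`: it is induced from the one-dimensional module of
`⊕_{i ≥ 0} 𝔥_i ⊗ t^i ⊕ ℂ k_0 ⊕ ℂ d_0` on which `k_0` acts as `k` and everything else as `0`. -/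
abbrev Verma (k : ℂ) : Type u := S.UH ⧸ S.vermaIdeal k

/-- The action of an element of `𝔥~` on `M(k)`. -/
def vermaAct (k : ℂ) (y : S.hT) : Module.End ℂ (S.Verma k) :=
  Algebra.lsmul ℂ ℂ (S.Verma k) (S.ιH y)

/-! ## Formal series -/

/-- The coefficient of `ζ^n` in `exp (∑_{j > 0} a_j ζ^j)`. -/
def expCoeff {R : Type*} [Ring R] [Algebra ℂ R] (a : ℕ → R) (n : ℕ) : R :=
  ∑ l ∈ Finset.range (n + 1), ((l.factorial : ℂ)⁻¹) •
    PowerSeries.coeff n ((PowerSeries.mk fun j => if j = 0 then 0 else a j) ^ l)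

/-- If `ρ j` is the action of `β_j ⊗ t^j`, the coefficient of `ζ^n` in
`E⁺(β, ζ) = exp (m ∑_{j > 0} β_j ⊗ t^j ζ^j / (j k))`. -/
def expPlus {R : Type*} [Ring R] [Algebra ℂ R] (k : ℂ) (ρ : ℤ → R) (n : ℕ) : R :=
  expCoeff (fun j => ((S.m : ℂ) / (j * k)) • ρ j) n

/-- If `ρ j` is the action of `β_j ⊗ t^j`, the coefficient of `ζ^{-n}` in
`E⁻(β, ζ) = exp (-m ∑_{j > 0} β_{-j} ⊗ t^{-j} ζ^{-j} / (j k))`. -/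
def expMinus {R : Type*} [Ring R] [Algebra ℂ R] (k : ℂ) (ρ : ℤ → R) (n : ℕ) : R :=
  expCoeff (fun j => (-((S.m : ℂ) / (j * k))) • ρ (-(j : ℤ))) n

/-- The coefficient of `x^n` in `∏_{p mod m} (1 - ω^{-p} x)^{⟨θ^p β, γ⟩ / k}`, each factor being
expanded by the binomial series. -/
def prodCoeff (k : ℂ) (β γ : 𝔤) (n : ℕ) : ℂ :=
  PowerSeries.coeff n (∏ p ∈ Finset.range S.m,
    PowerSeries.rescale (-(S.ω ^ (-(p : ℤ))))
      (PowerSeries.binomialSeries ℂ (S.form (S.θ^[p] β) γ / k)))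

end Data

/-- The grading condition on a vector space with an operator `d`: it is the direct sum of the
eigenspaces of `d`, and for each `z` the eigenspaces for `z + ℓ` vanish for all large integers
`ℓ`. -/
def GradedBddAbove {V : Type*} [AddCommGroup V] [Module ℂ V] (d : Module.End ℂ V) : Prop :=
  DirectSum.IsInternal (fun z : ℂ => Module.End.eigenspace d z) ∧
    ∀ z : ℂ, ∃ ℓ₀ : ℤ, ∀ ℓ : ℤ, ℓ₀ < ℓ → Module.End.eigenspace d (z + ℓ) = ⊥

/-! ## The category of modules for the twisted toroidal Lie algebra -/

variable {𝔤 : Type u} [LieRing 𝔤] [LieAlgebra ℂ 𝔤]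

/-- The objects of `C_k`: modules of `L̃(𝔤, θ)` on which `k_0` acts as `k`, graded by `d_0` with
degrees bounded above, with the factorisation property
`k⁻¹ x(r, ζ) k_0(s, ζ^m) = x(r + s, ζ)`, `k⁻¹ k_i(r, ζ^m) k_0(s, ζ^m) = k_i(r + s, ζ^m)`.
By the grading condition, each sum below has finitely many non-zero terms. -/
structure ModC (S : Data 𝔤) (k : ℂ) : Type (max u (w + 1)) where
  carrier : Type w
  [addCommGroup : AddCommGroup carrier]
  [module : Module ℂ carrier]
  [lieRingModule : LieRingModule S.L carrier]
  [lieModule : LieModule ℂ S.L carrier]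
  level : ∀ v : carrier, ⁅S.kEl 0 0 0, v⁆ = k • v
  graded : GradedBddAbove (LieModule.toEnd ℂ S.L carrier (S.dEl 0))
  factor_x : ∀ (x : 𝔤) (r s : Fin S.N → ℤ) (n : ℤ) (v : carrier),
    k⁻¹ • ∑ᶠ p : ℤ, ⁅S.gEl x (n - S.m * p) r, ⁅S.kEl 0 s p, v⁆⁆ = ⁅S.gEl x n (r + s), v⁆
  factor_k : ∀ (i : Fin (S.N + 1)) (r s : Fin S.N → ℤ) (n : ℤ) (v : carrier),
    k⁻¹ • ∑ᶠ p : ℤ, ⁅S.kEl i r (n - p), ⁅S.kEl 0 s p, v⁆⁆ = ⁅S.kEl i (r + s) n, v⁆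

namespace ModC

attribute [instance] addCommGroup module lieRingModule lieModule

variable {S : Data 𝔤} {k : ℂ}

/-- Morphisms of `C_k` are the homomorphisms of `L̃(𝔤, θ)`-modules. -/
instance : Category (ModC.{u, w} S k) where
  Hom V V' := V.carrier →ₗ⁅ℂ, S.L⁆ V'.carrier
  id V := LieModuleHom.id
  comp f g := g.comp f

/-- The linear map underlying a morphism of `C_k`. -/
def lin {V V' : ModC.{u, w} S k} (f : V ⟶ V') : V.carrier →ₗ[ℂ] V'.carrier :=
  LieModuleHom.toLinearMap (R := ℂ) (L := S.L) f

variable (V : ModC.{u, w} S k)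

/-- The action of an element of `L̃(𝔤, θ)`. -/
def act (y : S.L) : Module.End ℂ V.carrier := LieModule.toEnd ℂ S.L V.carrier y

/-- The vacuum space `Ω_V = {v | (h_i ⊗ t^i) v = 0 for all h ∈ 𝔥 and i > 0}`. -/
def vacuum : Submodule ℂ V.carrier :=
  ⨅ (h : S.𝔥) (i : ℤ) (_ : 0 < i), LinearMap.ker (V.act (S.gEl h i 0))

/-- The coefficient of `ζ^n` in `Z(β, r, ζ) = E⁻(β, ζ) x_β(r, ζ) E⁺(β, ζ)`, applied to `v`.
By the grading condition, the sum has finitely many non-zero terms. -/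
def zOp (β : S.Root) (r : Fin S.N → ℤ) (n : ℤ) (v : V.carrier) : V.carrier :=
  ∑ᶠ ab : ℕ × ℕ,
    S.expMinus k (fun j => V.act (S.gEl β j 0)) ab.1
      (V.act (S.gEl (S.x β) (n + ab.1 - ab.2) r)
        (S.expPlus k (fun j => V.act (S.gEl β j 0)) ab.2 v))

end ModC

/-! ## The category of modules for the toroidal `Z_k`-algebra -/

/-- The objects of `D_k`: a vector space with operators `Z β r n` (the coefficient of `ζ^n` in
`Z(β, r, ζ)`), `K i r p` (the coefficient of `ζ^{mp}` in `k_i(r, ζ^m)`), `H α` (`α ∈ 𝔥_0`) and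
`d i`, which satisfy the relations of the toroidal `Z_k`-algebra, such that `k_0` acts as `k` and
the `d_0`-degrees are bounded above. The relations are written coefficientwise. By the grading
condition, each infinite sum below has finitely many non-zero terms. -/
structure ModD (S : Data 𝔤) (k : ℂ) : Type (max u (w + 1)) where
  carrier : Type w
  [addCommGroup : AddCommGroup carrier]
  [module : Module ℂ carrier]
  Z : S.Root → (Fin S.N → ℤ) → ℤ → Module.End ℂ carrier
  K : Fin (S.N + 1) → (Fin S.N → ℤ) → ℤ → Module.End ℂ carrier
  H : S.𝔥₀ →ₗ[ℂ] Module.End ℂ carrier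
  d : Fin (S.N + 1) → Module.End ℂ carrier
  /-- `k_0` acts as `k`. -/
  level : K 0 0 0 = k • (1 : Module.End ℂ carrier)
  graded : GradedBddAbove (d 0)
  /-- `k⁻¹ Z(β, r, ζ) k_0(s, ζ^m) = Z(β, r + s, ζ)`. -/
  factor_Z : ∀ (β : S.Root) (r s : Fin S.N → ℤ) (n : ℤ) (v : carrier),
    k⁻¹ • ∑ᶠ p : ℤ, Z β r (n - S.m * p) (K 0 s p v) = Z β (r + s) n v
  /-- `k⁻¹ k_0(r, ζ^m) k_i(s, ζ^m) = k_i(r + s, ζ^m)`. -/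
  factor_K : ∀ (i : Fin (S.N + 1)) (r s : Fin S.N → ℤ) (n : ℤ) (v : carrier),
    k⁻¹ • ∑ᶠ p : ℤ, K 0 r p (K i s (n - p) v) = K i (r + s) n v
  /-- `∑ r_i k_i(r, ζ^m) + m⁻¹ D k_0(r, ζ^m) = 0`. -/
  rel_K : ∀ (r : Fin S.N → ℤ) (p : ℤ),
    ∑ i : Fin S.N, (r i : ℂ) • K i.succ r p + (S.m : ℂ)⁻¹ • ((S.m * p : ℤ) : ℂ) • K 0 r p = 0
  /-- `[d_0, Z(β, r, ζ)] = D Z(β, r, ζ)`. -/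
  d_zero_Z : ∀ (β : S.Root) (r : Fin S.N → ℤ) (n : ℤ),
    d 0 * Z β r n - Z β r n * d 0 = (n : ℂ) • Z β r n
  /-- `[d_i, Z(β, r, ζ)] = r_i Z(β, r, ζ)` for `1 ≤ i ≤ N`. -/
  d_succ_Z : ∀ (i : Fin S.N) (β : S.Root) (r : Fin S.N → ℤ) (n : ℤ),
    d i.succ * Z β r n - Z β r n * d i.succ = (r i : ℂ) • Z β r n
  /-- `[d_0, k_j(r, ζ^m)] = D k_j(r, ζ^m)`. -/
  d_zero_K : ∀ (j : Fin (S.N + 1)) (r : Fin S.N → ℤ) (p : ℤ),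
    d 0 * K j r p - K j r p * d 0 = ((S.m * p : ℤ) : ℂ) • K j r p
  /-- `[d_i, k_j(r, ζ^m)] = r_i k_j(r, ζ^m)` for `1 ≤ i ≤ N`. -/
  d_succ_K : ∀ (i : Fin S.N) (j : Fin (S.N + 1)) (r : Fin S.N → ℤ) (p : ℤ),
    d i.succ * K j r p - K j r p * d i.succ = (r i : ℂ) • K j r p
  /-- `𝔥_0` has degree zero. -/
  d_H : ∀ (i : Fin (S.N + 1)) (α : S.𝔥₀), d i * H α = H α * d i
  d_d : ∀ i j : Fin (S.N + 1), d i * d j = d j * d i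
  /-- `𝔥_0` is abelian. -/
  H_H : ∀ α α' : S.𝔥₀, H α * H α' = H α' * H α
  /-- `[α, Z(β, r, ζ)] = ⟨α, β⟩ Z(β, r, ζ)` for `α ∈ 𝔥_0`. -/
  H_Z : ∀ (α : S.𝔥₀) (β : S.Root) (r : Fin S.N → ℤ) (n : ℤ),
    H α * Z β r n - Z β r n * H α = S.form α β • Z β r n
  /-- `Z(β, r, ω^p ζ) = η(p, β) Z(θ^p β, r, ζ)`. -/
  twist_Z : ∀ (p : ℕ) (β β' : S.Root), (β' : 𝔤) = S.θ^[p] β → ∀ (r : Fin S.N → ℤ) (n : ℤ),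
    S.ω ^ (p * n) • Z β r n = S.η p β • Z β' r n
  /-- The `k_i(r, ζ^m)` commute with each other, with the `Z(β, r, ζ)` and with `𝔥_0`. -/
  K_K : ∀ (i : Fin (S.N + 1)) (r : Fin S.N → ℤ) (p : ℤ) (j : Fin (S.N + 1)) (s : Fin S.N → ℤ)
    (q : ℤ), K i r p * K j s q = K j s q * K i r p
  K_Z : ∀ (i : Fin (S.N + 1)) (r : Fin S.N → ℤ) (p : ℤ) (β : S.Root) (s : Fin S.N → ℤ)
    (n : ℤ), K i r p * Z β s n = Z β s n * K i r p
  K_H : ∀ (i : Fin (S.N + 1)) (r : Fin S.N → ℤ) (p : ℤ) (α : S.𝔥₀), K i r p * H α = H α * K i r p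
  /-- The coefficient of `ζ₁^a ζ₂^b` in the generalised commutation relation
  `∏_p (1 - ω^{-p} ζ₁/ζ₂)^{⟨θ^p β₁, β₂⟩/k} Z(β₁, r, ζ₁) Z(β₂, s, ζ₂)
    - ∏_p (1 - ω^{-p} ζ₂/ζ₁)^{⟨θ^p β₂, β₁⟩/k} Z(β₂, s, ζ₂) Z(β₁, r, ζ₁)
  = (1/m) ∑_{θ^p β₁ + β₂ ∈ Φ} η(p, β₁) ε(θ^p β₁, β₂) Z(θ^p β₁ + β₂, r + s, ζ₂) δ(ω^{-p} ζ₁/ζ₂)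
  - (1/(mk)) ⟨x_{β₂}, x_{-β₂}⟩ ∑_{θ^p β₁ + β₂ = 0} η(p, β₁) (β₂)_0 k_0(r + s, ζ₂^m) δ(ω^{-p} ζ₁/ζ₂)
  + (1/m) ⟨x_{β₂}, x_{-β₂}⟩ ∑_{θ^p β₁ + β₂ = 0} η(p, β₁)
      (∑_i r_i k_i(r + s, ζ₂^m) δ(ω^{-p} ζ₁/ζ₂) + (1/m) k_0(r + s, ζ₂^m) (Dδ)(ω^{-p} ζ₁/ζ₂))`.
  Here `κ i` is the coefficient of `ζ₂^{a+b}` in `k_i(r + s, ζ₂^m)`. -/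
  comm : ∀ (β₁ β₂ : S.Root) (r s : Fin S.N → ℤ) (a b : ℤ) (v : carrier),
    let κ : Fin (S.N + 1) → Module.End ℂ carrier := fun i =>
      if (S.m : ℤ) ∣ a + b then K i (r + s) ((a + b) / S.m) else 0
    (∑ᶠ n : ℕ, S.prodCoeff k β₁ β₂ n • Z β₁ r (a - n) (Z β₂ s (b + n) v)) -
      (∑ᶠ n : ℕ, S.prodCoeff k β₂ β₁ n • Z β₂ s (b - n) (Z β₁ r (a + n) v)) =
    (S.m : ℂ)⁻¹ • ∑ p ∈ Finset.range S.m, S.ω ^ (-(p * a)) • S.η p β₁ •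
      open scoped Classical in
      if h : IsRoot S.form S.𝔥 (S.θ^[p] β₁ + β₂) then
        S.ε (S.θ^[p] β₁) β₂ • Z ⟨S.θ^[p] β₁ + β₂, h⟩ (r + s) (a + b) v
      else if S.θ^[p] β₁ + (β₂ : 𝔤) = 0 then
        S.form (S.x β₂) (S.x (-β₂)) •
          (-(k⁻¹ • H (S.proj₀ ⟨β₂, β₂.2.1⟩) (κ 0 v)) + ∑ i : Fin S.N, (r i : ℂ) • κ i.succ v +
            ((S.m : ℂ)⁻¹ * a) • κ 0 v)
      else 0

namespace ModD

attribute [instance] addCommGroup module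

variable {S : Data 𝔤} {k : ℂ}

/-- Morphisms of `D_k`: linear maps commuting with all the operators. -/
@[ext] structure Hom (W W' : ModD.{u, w} S k) : Type w where
  lin : W.carrier →ₗ[ℂ] W'.carrier
  map_Z : ∀ β r n v, lin (W.Z β r n v) = W'.Z β r n (lin v)
  map_K : ∀ i r p v, lin (W.K i r p v) = W'.K i r p (lin v)
  map_H : ∀ α v, lin (W.H α v) = W'.H α (lin v)
  map_d : ∀ i v, lin (W.d i v) = W'.d i (lin v)

instance : Category (ModD.{u, w} S k) where
  Hom W W' := Hom W W'
  id W := ⟨LinearMap.id, by simp, by simp, by simp, by simp⟩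
  comp f g := ⟨g.lin ∘ₗ f.lin, by simp [f.map_Z, g.map_Z], by simp [f.map_K, g.map_K],
    by simp [f.map_H, g.map_H], by simp [f.map_d, g.map_d]⟩

/-- The linear map underlying a morphism of `D_k`. -/
def lin {W W' : ModD.{u, w} S k} (f : W ⟶ W') : W.carrier →ₗ[ℂ] W'.carrier := Hom.lin f

end ModD

/-! ## The two functors -/

variable {S : Data 𝔤} {k : ℂ}

/-- `F` is (naturally isomorphic to) the functor `V ↦ Ω_V`, where on `Ω_V` the operators
`Z(β, r, ζ)` are `E⁻(β, ζ) x_β(r, ζ) E⁺(β, ζ)`, and `k_i(r, ζ^m)`, `𝔥_0`, `d_i` act by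
restriction. -/
def IsVacuumFunctor (F : ModC.{u, w} S k ⥤ ModD.{u, w} S k) : Prop :=
  ∃ φ : ∀ V : ModC.{u, w} S k, (F.obj V).carrier ≃ₗ[ℂ] V.vacuum,
    (∀ V β r n u, (φ V ((F.obj V).Z β r n u) : V.carrier) = V.zOp β r n (φ V u)) ∧
    (∀ V i r p u, (φ V ((F.obj V).K i r p u) : V.carrier) = V.act (S.kEl i r p) (φ V u)) ∧
    (∀ V (α : S.𝔥₀) u, (φ V ((F.obj V).H α u) : V.carrier) = V.act (S.gEl α 0 0) (φ V u)) ∧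
    (∀ V i u, (φ V ((F.obj V).d i u) : V.carrier) = V.act (S.dEl i) (φ V u)) ∧
    (∀ (V V' : ModC.{u, w} S k) (f : V ⟶ V') (u : (F.obj V).carrier),
      (φ V' (ModD.lin (F.map f) u) : V'.carrier) = ModC.lin f (φ V u))

/-- `G` is (naturally isomorphic to) the functor `W ↦ M(k) ⊗ W`, where
`x_β(r, ζ) = E⁻(-β, ζ) E⁺(-β, ζ) ⊗ Z(β, r, ζ)` for roots `β`,
`h(r, ζ) = k⁻¹ h(ζ) k_0(r, ζ^m)` for `h ∈ 𝔥`, with `h(ζ) = ∑_{j ≠ 0} h_j ⊗ t^j ζ^j` on `M(k)` plus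
`h_0` on `W`; `k_i(r, ζ^m)` acts on `W`, `d_0` acts on both factors and `d_1, …, d_N` on `W`. -/
def IsInductionFunctor (G : ModD.{u, w} S k ⥤ ModC.{u, w} S k) : Prop :=
  ∃ ψ : ∀ W : ModD.{u, w} S k, S.Verma k ⊗[ℂ] W.carrier ≃ₗ[ℂ] (G.obj W).carrier,
    (∀ W (β : S.Root) r n u v, (G.obj W).act (S.gEl (S.x β) n r) (ψ W (u ⊗ₜ v)) =
      ψ W (∑ᶠ ab : ℕ × ℕ,
        (S.expMinus k (fun j => S.vermaAct k (S.hEl (-⟨β, β.2.1⟩) j)) ab.1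
          (S.expPlus k (fun j => S.vermaAct k (S.hEl (-⟨β, β.2.1⟩) j)) ab.2 u)) ⊗ₜ
          W.Z β r (n + ab.1 - ab.2) v)) ∧
    (∀ W (h : S.𝔥) r n u v, (G.obj W).act (S.gEl h n r) (ψ W (u ⊗ₜ v)) =
      k⁻¹ • ψ W (∑ᶠ p : ℤ,
        if n - S.m * p = 0 then u ⊗ₜ W.H (S.proj₀ h) (W.K 0 r p v)
        else S.vermaAct k (S.hEl h (n - S.m * p)) u ⊗ₜ W.K 0 r p v)) ∧
    (∀ W i r p u v, (G.obj W).act (S.kEl i r p) (ψ W (u ⊗ₜ v)) = ψ W (u ⊗ₜ W.K i r p v)) ∧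
    (∀ W u v, (G.obj W).act (S.dEl 0) (ψ W (u ⊗ₜ v)) =
      ψ W (S.vermaAct k S.hd u ⊗ₜ v + u ⊗ₜ W.d 0 v)) ∧
    (∀ W (i : Fin S.N) u v, (G.obj W).act (S.dEl i.succ) (ψ W (u ⊗ₜ v)) =
      ψ W (u ⊗ₜ W.d i.succ v)) ∧
    (∀ (W W' : ModD.{u, w} S k) (g : W ⟶ W') u v,
      ModC.lin (G.map g) (ψ W (u ⊗ₜ v)) = ψ W' (u ⊗ₜ ModD.lin g v))

end ToroidalZ

end

open scoped TensorProduct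
open CategoryTheory

noncomputable section

namespace ToroidalZ

section

namespace Data

/-! ### Root vectors -/

section RootVectors

variable {𝔤 : Type u} [LieRing 𝔤] [LieAlgebra ℂ 𝔤] (S : Data 𝔤)

/-! The oscillators `h_i ⊗ t^i` with `i ≠ 0` satisfy Heisenberg relations at level `k ≠ 0`, and a
module whose degrees are bounded above is, over them, induced from its vacuum space: `V ≅ M(k) ⊗
Ω_V` (`HeisGr.exists_equiv`). The theorem says that the remaining part of the action of `L̃(𝔤, θ)`
is then equivalent to the `Z_k`-operators on `Ω_V`.

The principle behind most steps is uniqueness by vacuum expectation value. Let `ι` be the inclusion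
of the vacuum, `ε` the projection to it that kills the images of the creation operators, and `vev Y
= ε Y ι`. A graded family of operators that is stable (up to linear span) under commutators with the
oscillators, is bounded above in degree and has `vev` zero must vanish (`HeisVac.operator_eq_zero`):
descending induction on the degree kills all `Y ι w`, and the creation operators carry this from the
vacuum to the whole space. So two operator series with the same commutators with the oscillators are
equal as soon as their expectation values agree.

The coefficients of `x_β(r, ζ)` obey `[h_i, X_n] = ⟨h_i, β⟩ X_{n+i}`. On the vacuum, multiplication
by `E⁻(β, ζ)` cancels these commutators, so `E⁻ X E⁺` acts there as `vev X = Z`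
(`IsVertex.finsum_Em_X`), and conversely `X ι = E⁻(-β) Z` (`IsVertex.X_ι_eq_finsum`). Moving `E⁻(-γ,
ζ₂)` to the left through `X(ζ₁)`, until `ε` kills it, produces a scalar series. Its coefficients
satisfy the recursion obtained from the logarithmic derivative of the product of binomial series
(`mul_prodCoeff`), which explains the powers in the generalised commutation relation
(`HeisVac.ε_X_X`). The right-hand side of that relation is the expectation value of the bracket of
two root vectors, computed once in `HeisVac.vev_lie_x` for an arbitrary linear map on `L̃(𝔤, θ)` and
used for both functors.

From `C_k` to `D_k` the relations are therefore expectation values of brackets. From `D_k` to `C_k`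
one defines the operators on `M(k) ⊗ W` and checks brackets. Those involving `h(r, ζ)` reduce to the
oscillators by the factorisation `h(r, ζ) = k⁻¹ h(ζ) k_0(r, ζ^m)`. For two root vectors, the failure
of the bracket relation has expectation value zero by the commutation relation in `W`, hence
vanishes by the uniqueness principle (`ModD.isRep_x_x`).

The statement `V ≅ M(k) ⊗ Ω_V` rests on the Sugawara operator, which acts on `M(k) ⊗ W` as `-d_0 ⊗
1`. It kills vacuum vectors, and `d_0` is invertible on the kernel of the vacuum functional of
`M(k)`, so the vacuum of `M(k) ⊗ W` is exactly `1 ⊗ W`. No PBW basis is needed: the vacuum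
functional comes from a polynomial representation. Finally `M(k) ⊗ Ω_V ≅ V` respects the whole of
`L̃(𝔤, θ)` by the uniqueness principle again (`ModC.equiv_rep`). -/

lemma form_lie_left (x y z : 𝔤) : S.form ⁅x, y⁆ z = - S.form y ⁅x, z⁆ := S.form_inv x y z

lemma form_lie_right (x y z : 𝔤) : S.form ⁅x, y⁆ z = S.form x ⁅y, z⁆ := by
  rw [← lie_skew, map_neg, LinearMap.neg_apply, form_lie_left, neg_neg]

variable [FiniteDimensional ℂ 𝔤] [LieAlgebra.IsSemisimple ℂ 𝔤]

lemma lie_cartan {h h' : 𝔤} (hh : h ∈ S.𝔥) (hh' : h' ∈ S.𝔥) : ⁅h, h'⁆ = 0 := by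
  have := S.𝔥_cartan
  have h0 : ⁅(⟨h, hh⟩ : S.𝔥), (⟨h', hh'⟩ : S.𝔥)⁆ = 0 := trivial_lie_zero _ _ _ _
  simpa using congrArg Subtype.val h0

/-- An induction principle for `𝔤` from its decomposition into `𝔥` and common eigenspaces of `𝔥`
for non-zero eigenvalues. -/
lemma cartan_weight_induction {P : 𝔤 → Prop} (hadd : ∀ x y, P x → P y → P (x + y))
    (hcartan : ∀ h ∈ S.𝔥, P h)
    (hweight : ∀ (α : Module.Dual ℂ S.𝔥), α ≠ 0 → ∀ x : 𝔤, x ≠ 0 → (∀ h : S.𝔥, ⁅(h : 𝔤), x⁆ = α h • x) →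
      (∀ y : 𝔤, (∀ h : S.𝔥, ⁅(h : 𝔤), y⁆ = α h • y) → ∃ c : ℂ, y = c • x) → P x) (x : 𝔤) : P x := by
  classical
  have := S.𝔥_cartan
  have hx : x ∈ (⨆ χ : LieModule.Weight ℂ S.𝔥 𝔤, LieModule.genWeightSpace 𝔤 χ).toSubmodule := by
    rw [LieModule.iSup_genWeightSpace_eq_top']; trivial
  rw [LieSubmodule.iSup_toSubmodule] at hx
  have P0 : P 0 := hcartan 0 S.𝔥.zero_mem
  induction hx using Submodule.iSup_induction' with
  | zero => exact P0
  | add x y _ _ hx hy => exact hadd _ _ hx hy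
  | mem χ x hx =>
    by_cases h0 : χ.IsZero
    · have hz : (χ : S.𝔥 → ℂ) = 0 := h0
      apply hcartan
      have h1 : x ∈ LieAlgebra.rootSpace S.𝔥 (0 : S.𝔥 → ℂ) := by rw [← hz]; exact hx
      rw [LieAlgebra.rootSpace_zero_eq] at h1
      simpa using h1
    · by_cases hx0 : x = 0
      · rw [hx0]; exact P0
      have hx' : x ∈ LieAlgebra.rootSpace S.𝔥 χ := hx
      -- Semisimplicity enters twice: elements of a generalised root space are true eigenvectors,
      -- and root spaces are lines.
      have hx2 := LieAlgebra.IsKilling.lie_eq_smul_of_mem_rootSpace hx'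
      refine hweight χ.toLinear (by simpa using h0) x hx0 hx2 ?_
      intro y hy
      have hy' : y ∈ LieAlgebra.rootSpace S.𝔥 χ := by
        refine (LieModule.mem_genWeightSpace 𝔤 (χ : S.𝔥 → ℂ) y).mpr fun h => ⟨1, ?_⟩
        have := hy h
        simp only [LieModule.Weight.toLinear_apply] at this
        simp [← this]
      have h1 := LieAlgebra.IsKilling.finrank_rootSpace_eq_one χ h0
      rw [finrank_eq_one_iff_of_nonzero' (⟨x, hx'⟩ : LieAlgebra.rootSpace S.𝔥 χ) (by
        simpa [Subtype.ext_iff] using hx0)] at h1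
      obtain ⟨c, hc⟩ := h1 ⟨y, hy'⟩
      exact ⟨c, by simpa using (congrArg Subtype.val hc).symm⟩

/-- Invariance moves an `h'` with `α h' ≠ 0` from `x` onto `h`, where it gives zero because `𝔥` is
abelian, while on `x` it acts by the non-zero scalar `α h'`. -/
lemma form_cartan_weight {h x : 𝔤} (hh : h ∈ S.𝔥) {α : Module.Dual ℂ S.𝔥} (hα : α ≠ 0)
    (hx : ∀ h : S.𝔥, ⁅(h : 𝔤), x⁆ = α h • x) : S.form h x = 0 := by
  obtain ⟨h', hh'⟩ : ∃ h', α h' ≠ 0 := by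
    by_contra! hc; exact hα (LinearMap.ext hc)
  have h1 : S.form h ⁅(h' : 𝔤), x⁆ = 0 := by
    rw [← form_lie_right, S.lie_cartan hh h'.2]; simp
  rw [hx, map_smul, smul_eq_mul] at h1
  exact (mul_eq_zero.mp h1).resolve_left hh'

lemma eq_zero_of_form_cartan {h : 𝔤} (hh : h ∈ S.𝔥) (hf : ∀ h' ∈ S.𝔥, S.form h h' = 0) : h = 0 := by
  apply S.form_nondeg.1 h
  intro x
  induction x using S.cartan_weight_induction with
  | hadd x y hx hy => rw [map_add, hx, hy, add_zero]
  | hcartan h' hh' => exact hf h' hh'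
  | hweight α hα x _ hx _ => exact S.form_cartan_weight hh hα hx

/-- The restriction of the form to `𝔥`. -/
def formH : LinearMap.BilinForm ℂ S.𝔥 := S.form.restrict S.𝔥.toSubmodule

omit [FiniteDimensional ℂ 𝔤] [LieAlgebra.IsSemisimple ℂ 𝔤] in
@[simp] lemma formH_apply (h h' : S.𝔥) : S.formH h h' = S.form h h' := rfl

lemma formH_nondeg : S.formH.Nondegenerate := by
  have hs : S.formH.IsSymm := ⟨fun x y => by simp [S.form_comm]⟩
  refine (LinearMap.BilinForm.IsSymm.isRefl hs).nondegenerate_iff_separatingLeft.mpr ?_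
  intro h hf
  exact Subtype.ext (S.eq_zero_of_form_cartan h.2 fun h' hh' => hf ⟨h', hh'⟩)

/-- Weights are functionals on `𝔥`, whereas `IsRoot` speaks of elements of `𝔥`. Nondegeneracy of the
restricted form translates one into the other; the form need not be the Killing form. -/
lemma exists_isRoot_of_weight {α : Module.Dual ℂ S.𝔥} (hα : α ≠ 0) {x : 𝔤} (hx0 : x ≠ 0)
    (hx : ∀ h : S.𝔥, ⁅(h : 𝔤), x⁆ = α h • x) :
    ∃ β, IsRoot S.form S.𝔥 β ∧ ∀ h : S.𝔥, α h = S.form h β := by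
  let β : S.𝔥 := (S.formH.toDual S.formH_nondeg).symm α
  have hβ : ∀ h : S.𝔥, α h = S.form h β := by
    intro h
    rw [S.form_comm]
    exact (LinearMap.BilinForm.apply_toDual_symm_apply (hB := S.formH_nondeg) (f := α) h).symm
  refine ⟨β, ⟨β.2, ?_, x, hx0, fun h hh => ?_⟩, hβ⟩
  · intro h0
    exact hα (LinearMap.ext fun h => by rw [hβ, h0]; simp)
  · rw [← hβ ⟨h, hh⟩]; exact hx ⟨h, hh⟩

lemma cartan_root_induction {P : 𝔤 → Prop} (hadd : ∀ x y, P x → P y → P (x + y))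
    (hcartan : ∀ h ∈ S.𝔥, P h) (hroot : ∀ (c : ℂ) (β : S.Root), P (c • S.x β)) (x : 𝔤) : P x := by
  induction x using S.cartan_weight_induction with
  | hadd x y hx hy => exact hadd x y hx hy
  | hcartan h hh => exact hcartan h hh
  | hweight α hα x hx0 hx h1 =>
    obtain ⟨β, hβ, hαβ⟩ := S.exists_isRoot_of_weight hα hx0 hx
    obtain ⟨c, hc⟩ := h1 (S.x β) fun h => by rw [hαβ]; exact S.x_root β hβ h h.2
    have hc0 : c ≠ 0 := by rintro rfl; exact S.x_ne_zero β hβ (by simpa using hc)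
    have : x = c⁻¹ • S.x β := by rw [hc, smul_smul, inv_mul_cancel₀ hc0, one_smul]
    rw [this]
    exact hroot _ ⟨β, hβ⟩

end RootVectors

end Data

end

/-! ### Orthogonality of root vectors and the splitting of `𝔤` along them. -/

section

namespace Data

section RootSystem

variable {𝔤 : Type u} [LieRing 𝔤] [LieAlgebra ℂ 𝔤] (S : Data 𝔤)

lemma lie_x (β : S.Root) {h : 𝔤} (hh : h ∈ S.𝔥) : ⁅h, S.x β⁆ = S.form h β • S.x β :=
  S.x_root β β.2 h hh

variable [FiniteDimensional ℂ 𝔤] [LieAlgebra.IsSemisimple ℂ 𝔤]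

/-- Invariance under `h` gives `⟨h, β + γ⟩ ⟨x, y⟩ = 0` for all `h ∈ 𝔥`; if `⟨x, y⟩ ≠ 0`,
nondegeneracy on `𝔥` forces `β + γ = 0`. -/
lemma form_weight {β γ x y : 𝔤} (hβ : β ∈ S.𝔥) (hγ : γ ∈ S.𝔥) (hβγ : β + γ ≠ 0)
    (hx : ∀ h ∈ S.𝔥, ⁅h, x⁆ = S.form h β • x) (hy : ∀ h ∈ S.𝔥, ⁅h, y⁆ = S.form h γ • y) :
    S.form x y = 0 := by
  by_contra hne
  apply hβγ
  apply S.eq_zero_of_form_cartan (S.𝔥.add_mem hβ hγ)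
  intro h hh
  have h1 := S.form_lie_left h x y
  rw [hx h hh, hy h hh] at h1
  simp only [map_smul, LinearMap.smul_apply, smul_eq_mul] at h1
  rw [S.form_comm, map_add]
  have : (S.form h β + S.form h γ) * S.form x y = 0 := by linear_combination h1
  exact (mul_eq_zero.mp this).resolve_right hne

lemma form_cartan_x {h : 𝔤} (hh : h ∈ S.𝔥) (β : S.Root) : S.form h (S.x β) = 0 :=
  S.form_weight S.𝔥.zero_mem β.2.1 (by simpa using β.2.2.1)
    (fun h' hh' => by simp [S.lie_cartan hh' hh]) (fun _ => S.lie_x β)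

lemma form_x_cartan {h : 𝔤} (hh : h ∈ S.𝔥) (β : S.Root) : S.form (S.x β) h = 0 := by
  rw [S.form_comm, S.form_cartan_x hh]

lemma form_x_x {β γ : S.Root} (h : (β : 𝔤) + γ ≠ 0) : S.form (S.x β) (S.x γ) = 0 :=
  S.form_weight β.2.1 γ.2.1 h (fun _ => S.lie_x β) (fun _ => S.lie_x γ)

/-- By nondegeneracy `x_β` must pair non-trivially with something, and orthogonality of weights
leaves only a root vector for `-β`. -/
lemma exists_neg (β : S.Root) : IsRoot S.form S.𝔥 (-(β : 𝔤)) ∧ S.form (S.x β) (S.x (-β)) ≠ 0 := by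
  by_contra hcon
  apply S.x_ne_zero β β.2
  apply S.form_nondeg.1
  intro z
  induction z using S.cartan_root_induction with
  | hadd x y hx hy => rw [map_add, hx, hy, add_zero]
  | hcartan h hh => exact S.form_x_cartan hh β
  | hroot c γ =>
    rw [map_smul]
    by_cases h : (β : 𝔤) + γ = 0
    · have hγ : -(β : 𝔤) = γ := neg_eq_of_add_eq_zero_right h
      rw [hγ] at hcon
      by_contra hne
      exact hcon ⟨γ.2, fun h0 => hne (by rw [h0, smul_zero])⟩
    · rw [S.form_x_x h, smul_zero]

/-- The negative of a root. -/
def negRoot (β : S.Root) : S.Root := ⟨-β, (S.exists_neg β).1⟩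

/-- The difference of the two sides is orthogonal to `𝔥` by invariance and to every root vector
because it has weight zero. -/
lemma lie_x_x_of_add_eq_zero {β γ : S.Root} (h : (β : 𝔤) + γ = 0) :
    ⁅S.x β, S.x γ⁆ = S.form (S.x β) (S.x γ) • (β : 𝔤) := by
  rw [← sub_eq_zero]
  apply S.form_nondeg.1
  have hγ : (γ : 𝔤) = -β := (neg_eq_of_add_eq_zero_right h).symm
  intro z
  induction z using S.cartan_root_induction with
  | hadd x y hx hy => rw [map_add, hx, hy, add_zero]
  | hcartan h hh =>
    rw [map_sub, LinearMap.sub_apply, form_lie_right, ← lie_skew, S.lie_x γ hh, hγ, map_smul,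
      LinearMap.smul_apply, S.form_comm β h]
    simp only [map_neg, map_smul, smul_eq_mul]
    ring
  | hroot c δ =>
    rw [map_smul, map_sub, LinearMap.sub_apply, map_smul, LinearMap.smul_apply,
      S.form_cartan_x β.2.1 δ, S.form_weight S.𝔥.zero_mem δ.2.1 (by simpa using δ.2.2.1) _
        (fun _ => S.lie_x δ)]
    · simp
    · intro h hh
      rw [leibniz_lie, S.lie_x β hh, S.lie_x γ hh, hγ]
      simp

omit [FiniteDimensional ℂ 𝔤] [LieAlgebra.IsSemisimple ℂ 𝔤] in
lemma lie_x_x_of_not_isRoot {β γ : S.Root} (h : (β : 𝔤) + γ ≠ 0)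
    (hr : ¬ IsRoot S.form S.𝔥 ((β : 𝔤) + γ)) : ⁅S.x β, S.x γ⁆ = 0 := by
  by_contra hne
  refine hr ⟨S.𝔥.add_mem β.2.1 γ.2.1, h, _, hne, fun h hh => ?_⟩
  rw [leibniz_lie, S.lie_x β hh, S.lie_x γ hh, map_add, add_smul]
  simp

/-- Roots inject into the finite set of weights of `𝔥` on `𝔤`; injectivity is nondegeneracy of the
form on `𝔥`. -/
instance : Finite S.Root := by
  have := S.𝔥_cartan
  have key : ∀ β : S.Root, LieModule.genWeightSpace 𝔤 (fun h : S.𝔥 => S.form h β) ≠ ⊥ := by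
    intro β hb
    apply S.x_ne_zero β β.2
    have : S.x β ∈ LieModule.genWeightSpace 𝔤 (fun h : S.𝔥 => S.form h β) := by
      refine (LieModule.mem_genWeightSpace 𝔤 _ _).mpr fun h => ⟨1, ?_⟩
      simp [S.lie_x β h.2]
    rw [hb] at this
    simpa using this
  let f : S.Root → LieModule.Weight ℂ S.𝔥 𝔤 := fun β => ⟨fun h => S.form h β, key β⟩
  refine Finite.of_injective f fun β γ h => ?_
  have h1 : ∀ h : S.𝔥, S.form h β = S.form h γ :=
    fun x => congrFun (congrArg (fun χ : LieModule.Weight ℂ S.𝔥 𝔤 => (χ : S.𝔥 → ℂ)) h) x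
  refine Subtype.ext (sub_eq_zero.mp (S.eq_zero_of_form_cartan (S.𝔥.sub_mem β.2.1 γ.2.1) ?_))
  intro h hh
  rw [S.form_comm, map_sub, h1 ⟨h, hh⟩, sub_self]

instance : Fintype S.Root := Fintype.ofFinite _

/-- The coordinate of `x_β` in the decomposition of `𝔤` into `𝔥` and the lines `ℂ x_β`. -/
def coord (β : S.Root) : 𝔤 →ₗ[ℂ] ℂ :=
  (S.form (S.x β) (S.x (-β)))⁻¹ • (S.form (S.x (-β)))

lemma coord_cartan (β : S.Root) {h : 𝔤} (hh : h ∈ S.𝔥) : S.coord β h = 0 := by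
  simp [coord, S.form_x_cartan hh (S.negRoot β), show S.x (-β) = S.x (S.negRoot β) from rfl,
    -Subtype.forall]

lemma coord_x_self (β : S.Root) : S.coord β (S.x β) = 1 := by
  simp only [coord, LinearMap.smul_apply, smul_eq_mul, S.form_comm (S.x (-β)) (S.x β)]
  exact inv_mul_cancel₀ (S.exists_neg β).2

lemma coord_x_of_ne {β γ : S.Root} (h : β ≠ γ) : S.coord β (S.x γ) = 0 := by
  have : S.form (S.x (-β)) (S.x γ) = 0 := by
    refine S.form_x_x (β := S.negRoot β) (γ := γ) fun h0 => h (Subtype.ext ?_)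
    exact (neg_add_eq_zero.mp h0)
  simp [coord, this]

lemma sub_sum_coord_mem (x : 𝔤) : x - ∑ β : S.Root, S.coord β x • S.x β ∈ S.𝔥 := by
  induction x using S.cartan_root_induction with
  | hadd x y hx hy =>
    have := S.𝔥.add_mem hx hy
    convert! this using 1
    simp only [map_add, add_smul, Finset.sum_add_distrib]
    abel
  | hcartan h hh => simpa [S.coord_cartan _ hh] using hh
  | hroot c γ =>
    rw [Finset.sum_eq_single γ]
    · simp [S.coord_x_self]
    · intro β _ hβ; simp [S.coord_x_of_ne hβ]
    · simp

/-- The projection of `𝔤` to `𝔥` along the root vectors. -/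
def cartanProj : 𝔤 →ₗ[ℂ] S.𝔥 :=
  LinearMap.codRestrict S.𝔥.toSubmodule
    (LinearMap.id - ∑ β : S.Root, (S.coord β).smulRight (S.x β))
    fun x => by simpa [LinearMap.sum_apply] using S.sub_sum_coord_mem x

lemma cartanProj_add_sum (x : 𝔤) :
    (S.cartanProj x : 𝔤) + ∑ β : S.Root, S.coord β x • S.x β = x := by
  have : (S.cartanProj x : 𝔤) = x - ∑ β : S.Root, S.coord β x • S.x β := by
    change (LinearMap.id - ∑ β : S.Root, (S.coord β).smulRight (S.x β) : 𝔤 →ₗ[ℂ] 𝔤) x = _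
    simp [LinearMap.sum_apply]
  rw [this, sub_add_cancel]

lemma cartanProj_cartan (h : S.𝔥) : S.cartanProj h = h := by
  have := S.cartanProj_add_sum h
  exact Subtype.ext (by simpa [S.coord_cartan _ h.2] using this)

lemma cartanProj_x (β : S.Root) : S.cartanProj (S.x β) = 0 := by
  have := S.cartanProj_add_sum (S.x β)
  rw [Finset.sum_eq_single β (fun γ _ hγ => by simp [S.coord_x_of_ne hγ]) (by simp),
    S.coord_x_self] at this
  exact Subtype.ext (by simpa using this)

/-! ### The action of `θ` on roots -/

omit [FiniteDimensional ℂ 𝔤] [LieAlgebra.IsSemisimple ℂ 𝔤]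

lemma θl_pow_apply (p : ℕ) (x : 𝔤) : (S.θl ^ p) x = S.θ^[p] x := by
  rw [Module.End.pow_apply]; rfl

lemma θ_iterate_mem (p : ℕ) {x : 𝔤} (hx : x ∈ S.𝔥) : S.θ^[p] x ∈ S.𝔥 := by
  rw [← θl_pow_apply]; exact S.θl_pow_mem p hx

lemma form_θ_iterate (p : ℕ) (x y : 𝔤) : S.form (S.θ^[p] x) (S.θ^[p] y) = S.form x y := by
  induction p with
  | zero => rfl
  | succ p ih => rw [Function.iterate_succ_apply', Function.iterate_succ_apply', S.form_θ, ih]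

lemma θ_iterate_lie (p : ℕ) (x y : 𝔤) : S.θ^[p] ⁅x, y⁆ = ⁅S.θ^[p] x, S.θ^[p] y⁆ := by
  induction p with
  | zero => rfl
  | succ p ih => simp only [Function.iterate_succ_apply', ih, LieEquiv.map_lie]

lemma θ_iterate_surj (p : ℕ) {h : 𝔤} (hh : h ∈ S.𝔥) : ∃ h' ∈ S.𝔥, S.θ^[p] h' = h := by
  induction p generalizing h with
  | zero => exact ⟨h, hh, rfl⟩
  | succ p ih =>
    rw [← S.θ_𝔥] at hh
    obtain ⟨h1, hh1, rfl⟩ := hh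
    obtain ⟨h2, hh2, rfl⟩ := ih hh1
    exact ⟨h2, hh2, Function.iterate_succ_apply' _ _ _⟩

lemma isRoot_θ_iterate (p : ℕ) {β : 𝔤} (hβ : IsRoot S.form S.𝔥 β) :
    IsRoot S.form S.𝔥 (S.θ^[p] β) := by
  have hinj : Function.Injective S.θ^[p] := Function.Injective.iterate S.θ.injective p
  have h0 : S.θ^[p] (0 : 𝔤) = 0 := by rw [← θl_pow_apply, map_zero]
  obtain ⟨hβ1, hβ2, x, hx, hxh⟩ := hβ
  refine ⟨S.θ_iterate_mem p hβ1, fun h => hβ2 (hinj (by rw [h, h0])), S.θ^[p] x,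
    fun h => hx (hinj (by rw [h, h0])), fun h hh => ?_⟩
  obtain ⟨h', hh', rfl⟩ := S.θ_iterate_surj p hh
  rw [← θ_iterate_lie, hxh h' hh', form_θ_iterate, ← θl_pow_apply, ← θl_pow_apply, map_smul]

/-- The root `θ^p β`. -/
def θRoot (p : ℕ) (β : S.Root) : S.Root := ⟨S.θ^[p] β, S.isRoot_θ_iterate p β.2⟩

lemma θ_iterate_x (p : ℕ) (β : S.Root) : S.θ^[p] (S.x β) = S.η p β • S.x (S.θRoot p β) :=
  S.η_spec p β β.2

end RootSystem

end Data

end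

section

namespace Data

section Brackets

variable {𝔤 : Type u} [LieRing 𝔤] [LieAlgebra ℂ 𝔤] (S : Data 𝔤)

/-! ### The projections to the eigenspaces of `θ` -/

lemma m_ne_zero : (S.m : ℂ) ≠ 0 := by exact_mod_cast S.m_pos.ne'

lemma ω_zpow_m : S.ω ^ (S.m : ℤ) = 1 := by exact_mod_cast S.ω_prim.pow_eq_one

lemma ω_zpow_eq_one_iff (i : ℤ) : S.ω ^ i = 1 ↔ (S.m : ℤ) ∣ i :=
  S.ω_prim.zpow_eq_one_iff_dvd i

lemma proj_eq_sum (i : ℤ) (x : 𝔤) :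
    S.proj i x = (S.m : ℂ)⁻¹ • ∑ p ∈ Finset.range S.m, S.ω ^ (-(i * p)) • S.θ^[p] x := by
  simp [proj, LinearMap.sum_apply, θl_pow_apply]

lemma θ_iterate_of_θ_eq {i : ℤ} {x : 𝔤} (hx : S.θ x = S.ω ^ i • x) (p : ℕ) :
    S.θ^[p] x = S.ω ^ (i * p) • x := by
  induction p with
  | zero => simp
  | succ p ih =>
    rw [Function.iterate_succ_apply', ih, map_smul, hx, smul_smul, ← zpow_add₀ S.ω_ne_zero]
    push_cast
    ring_nf

lemma θ_iterate_proj (i : ℤ) (x : 𝔤) (p : ℕ) :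
    S.θ^[p] (S.proj i x) = S.ω ^ (i * p) • S.proj i x :=
  S.θ_iterate_of_θ_eq (S.θ_proj i x) p

lemma proj_of_θ_eq {i : ℤ} {x : 𝔤} (hx : S.θ x = S.ω ^ i • x) : S.proj i x = x := by
  rw [proj_eq_sum]
  simp only [S.θ_iterate_of_θ_eq hx, smul_smul, ← zpow_add₀ S.ω_ne_zero, neg_add_cancel, zpow_zero, one_smul]
  simp [← Nat.cast_smul_eq_nsmul ℂ, smul_smul, S.m_ne_zero]

@[simp] lemma proj_proj (i : ℤ) (x : 𝔤) : S.proj i (S.proj i x) = S.proj i x :=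
  S.proj_of_θ_eq (S.θ_proj i x)

lemma proj_congr {i j : ℤ} (h : (S.m : ℤ) ∣ i - j) : S.proj i = S.proj j := by
  have : S.ω ^ i = S.ω ^ j := by
    have := (S.ω_zpow_eq_one_iff _).mpr h
    rwa [zpow_sub₀ S.ω_ne_zero, div_eq_one_iff_eq (zpow_ne_zero _ S.ω_ne_zero)] at this
  ext x
  rw [proj_eq_sum, proj_eq_sum]
  congr 1
  refine Finset.sum_congr rfl fun p _ => ?_
  rw [← neg_mul, ← neg_mul, zpow_mul, zpow_mul, zpow_neg, zpow_neg, this]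

lemma proj_sub_m_mul (i q : ℤ) : S.proj (i - S.m * q) = S.proj i :=
  S.proj_congr ⟨-q, by ring⟩

lemma form_proj_left (i : ℤ) (x y : 𝔤) : S.form (S.proj i x) y = S.form x (S.proj (-i) y) := by
  -- both sides agree with the pairing of the projections
  have key : ∀ (i : ℤ) (x y : 𝔤), S.form (S.proj i x) y = S.form (S.proj i x) (S.proj (-i) y) := by
    intro i x y
    have h : ∀ p : ℕ, S.form (S.proj i x) (S.ω ^ (-(-i * p)) • S.θ^[p] y) =
        S.form (S.proj i x) y := by
      intro p
      rw [map_smul, show -(-i * (p : ℤ)) = i * p by ring, ← LinearMap.smul_apply, ← map_smul, ← θ_iterate_proj,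
        form_θ_iterate]
    rw [S.proj_eq_sum (-i) y, map_smul, map_sum, Finset.sum_congr rfl fun p _ => h p]
    simp [S.m_ne_zero]
  rw [key, S.form_comm x, key (-i) y x, S.form_comm (S.proj (-i) y), neg_neg]

lemma form_proj_proj (i : ℤ) (x y : 𝔤) :
    S.form (S.proj i x) (S.proj (-i) y) = S.form (S.proj i x) y := by
  rw [← form_proj_left, proj_proj]

lemma form_proj_proj_of_dvd {i j : ℤ} (h : (S.m : ℤ) ∣ i + j) (x y : 𝔤) :
    S.form (S.proj i x) (S.proj j y) = S.form (S.proj i x) y := by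
  rw [S.proj_congr (i := j) (j := -i) (by simpa [add_comm] using h), form_proj_proj]

lemma form_proj_proj_of_not_dvd {i j : ℤ} (h : ¬ (S.m : ℤ) ∣ i + j) (x y : 𝔤) :
    S.form (S.proj i x) (S.proj j y) = 0 := by
  have h1 := S.form_θ (S.proj i x) (S.proj j y)
  rw [θ_proj, θ_proj, map_smul, map_smul, LinearMap.smul_apply, smul_smul,
    ← zpow_add₀ S.ω_ne_zero, smul_eq_mul] at h1
  have h2 : S.ω ^ (i + j) ≠ 1 := fun h0 => h ((S.ω_zpow_eq_one_iff _).mp h0)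
  rw [add_comm] at h2
  have h3 : (S.ω ^ (j + i) - 1) * S.form (S.proj i x) (S.proj j y) = 0 := by
    rw [sub_mul, h1]; ring
  exact (mul_eq_zero.mp h3).resolve_left (sub_ne_zero.mpr h2)

/-- Since `θ` is an automorphism with eigenvalue `ω^i` on the first argument, averaging the second
argument with the character of `j` amounts to averaging the bracket with that of `i + j`. Only one
inner projection survives, the form in which brackets are used below. -/
lemma lie_proj_proj (i j : ℤ) (x y : 𝔤) :
    ⁅S.proj i x, S.proj j y⁆ = S.proj (i + j) ⁅S.proj i x, y⁆ := by
  rw [S.proj_eq_sum j, S.proj_eq_sum (i + j), lie_smul, lie_sum]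
  congr 1
  refine Finset.sum_congr rfl fun p _ => ?_
  rw [θ_iterate_lie, θ_iterate_proj, smul_lie, smul_smul, ← zpow_add₀ S.ω_ne_zero, lie_smul]
  congr 2
  ring

lemma proj_θ_iterate (i : ℤ) (p : ℕ) (x : 𝔤) :
    S.proj i (S.θ^[p] x) = S.ω ^ (p * i) • S.proj i x := by
  have h1 : S.proj i (S.θ^[p] x) = S.θ^[p] (S.proj i x) := by
    rw [proj_eq_sum, proj_eq_sum, ← S.θl_pow_apply p (_ • _), map_smul, map_sum]
    congr 1
    refine Finset.sum_congr rfl fun q _ => ?_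
    rw [map_smul, θl_pow_apply, ← Function.iterate_add_apply, ← Function.iterate_add_apply,
      add_comm]
  rw [h1, θ_iterate_proj, mul_comm]

/-! ### Brackets of the generators of `L̃(𝔤, θ)` -/

lemma L_ext {X Y : S.L} (h1 : (X : S.Tor).loop = (Y : S.Tor).loop)
    (h2 : (X : S.Tor).ctr = (Y : S.Tor).ctr) (h3 : (X : S.Tor).der = (Y : S.Tor).der) : X = Y :=
  Subtype.ext (Tor.ext h1 h2 h3)

/-- `x ↦ x_i ⊗ t^i t^r` as a linear map. -/
def gElₗ (i : ℤ) (r : Fin S.N → ℤ) : 𝔤 →ₗ[ℂ] S.L where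
  toFun x := S.gEl x i r
  map_add' x y := S.L_ext (by simp [gEl, TensorProduct.tmul_add]) (by simp [gEl]) (by simp [gEl])
  map_smul' c x := S.L_ext (by simp [gEl]) (by simp [gEl]) (by simp [gEl])

lemma gEl_add (x y : 𝔤) (i : ℤ) (r : Fin S.N → ℤ) :
    S.gEl (x + y) i r = S.gEl x i r + S.gEl y i r := (S.gElₗ i r).map_add x y

lemma gEl_smul (c : ℂ) (x : 𝔤) (i : ℤ) (r : Fin S.N → ℤ) :
    S.gEl (c • x) i r = c • S.gEl x i r := (S.gElₗ i r).map_smul c x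

lemma gEl_proj (x : 𝔤) (i : ℤ) (r : Fin S.N → ℤ) : S.gEl (S.proj i x) i r = S.gEl x i r :=
  S.L_ext (by simp [gEl]) rfl rfl

lemma gEl_θ_iterate (p : ℕ) (x : 𝔤) (i : ℤ) (r : Fin S.N → ℤ) :
    S.gEl (S.θ^[p] x) i r = S.ω ^ (p * i) • S.gEl x i r := by
  rw [← gEl_proj, proj_θ_iterate, gEl_smul, gEl_proj]

/-- The central term in the bracket of `x_a ⊗ t^a t^r` and `y_b ⊗ t^b t^s`, divided by `⟨x_a, y⟩`. -/
def cEl (a b : ℤ) (r s : Fin S.N → ℤ) : S.L :=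
  if (S.m : ℤ) ∣ a + b then
    (a / S.m : ℂ) • S.kEl 0 (r + s) ((a + b) / S.m) +
      ∑ i : Fin S.N, (r i : ℂ) • S.kEl i.succ (r + s) ((a + b) / S.m)
  else 0

lemma kEl_loop (i r p) : (S.kEl i r p : S.Tor).loop = 0 := rfl
lemma kEl_der (i r p) : (S.kEl i r p : S.Tor).der = 0 := rfl

lemma dvec_eq_sum (r : Fin S.N → ℤ) (p : ℤ) (δ : S.Exp) :
    S.dvec (S.m * p, r) δ = (δ.1 / S.m : ℂ) • (S.kEl 0 r p : S.Tor).ctr +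
      ∑ i : Fin S.N, (δ.2 i : ℂ) • (S.kEl i.succ r p : S.Tor).ctr := by
  simp only [kEl, ← map_smul, ← map_sum, ← map_add, dvec]
  congr 1
  ext1 j
  refine Fin.cases ?_ (fun j => ?_) j
  · simp [deg, Finset.sum_apply, div_eq_inv_mul]
  · simp [deg, Finset.sum_apply, Pi.single_apply, Fin.succ_ne_zero]

@[simp] lemma sum_loop {ι : Type*} (s : Finset ι) (f : ι → S.Tor) :
    (∑ i ∈ s, f i).loop = ∑ i ∈ s, (f i).loop := by
  classical
  induction s using Finset.induction_on with
  | empty => simp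
  | insert a s ha ih => rw [Finset.sum_insert ha, Finset.sum_insert ha, ← ih]; rfl

@[simp] lemma sum_ctr {ι : Type*} (s : Finset ι) (f : ι → S.Tor) :
    (∑ i ∈ s, f i).ctr = ∑ i ∈ s, (f i).ctr := by
  classical
  induction s using Finset.induction_on with
  | empty => simp
  | insert a s ha ih => rw [Finset.sum_insert ha, Finset.sum_insert ha, ← ih]; rfl

@[simp] lemma sum_der {ι : Type*} (s : Finset ι) (f : ι → S.Tor) :
    (∑ i ∈ s, f i).der = ∑ i ∈ s, (f i).der := by
  classical
  induction s using Finset.induction_on with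
  | empty => simp
  | insert a s ha ih => rw [Finset.sum_insert ha, Finset.sum_insert ha, ← ih]; rfl

lemma cEl_loop (a b r s) : (S.cEl a b r s : S.Tor).loop = 0 := by
  unfold cEl
  split_ifs
  · simp [kEl_loop]
  · rfl

lemma cEl_der (a b r s) : (S.cEl a b r s : S.Tor).der = 0 := by
  unfold cEl
  split_ifs
  · simp [kEl_der]
  · rfl

lemma cEl_ctr {a b : ℤ} (h : (S.m : ℤ) ∣ a + b) (r s) :
    (S.cEl a b r s : S.Tor).ctr = S.dvec ((a, r) + (b, s)) (a, r) := by
  have h1 : ((a, r) + (b, s) : S.Exp) = (S.m * ((a + b) / S.m), r + s) := by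
    rw [Int.mul_ediv_cancel' h]; rfl
  rw [h1, dvec_eq_sum, cEl, if_pos h]
  simp

/-- If `m ∤ a + b`, the eigenspaces `𝔤_a` and `𝔤_b` are orthogonal, which matches the value `0` of
`cEl` there. If `m ∣ a + b`, projecting the second argument does not change the pairing. -/
lemma gEl_lie_gEl (x y : 𝔤) (a b : ℤ) (r s : Fin S.N → ℤ) :
    ⁅S.gEl x a r, S.gEl y b s⁆ = S.gEl ⁅S.proj a x, y⁆ (a + b) (r + s) +
      S.form (S.proj a x) y • S.cEl a b r s := by
  refine S.L_ext ?_ ?_ ?_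
  · simp [gEl, cEl_loop, wt_zero, diagL_zero, mono_mul, lie_proj_proj]
  · by_cases h : (S.m : ℤ) ∣ a + b
    · simp [gEl, cEl_ctr, h, kap_mono, diagC_zero, wt_zero, S.form_proj_proj_of_dvd h]
    · simp [gEl, cEl, h, kap_mono, diagC_zero, wt_zero, S.form_proj_proj_of_not_dvd h]
  · simp [gEl, cEl_der]

lemma kEl_lie_gEl (i r p) (x : 𝔤) (n s) : ⁅S.kEl i r p, S.gEl x n s⁆ = 0 := by
  refine S.L_ext ?_ ?_ ?_ <;> simp [kEl, gEl, diagC_zero, diagL_zero, wt_zero]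

lemma gEl_lie_kEl (i r p) (x : 𝔤) (n s) : ⁅S.gEl x n s, S.kEl i r p⁆ = 0 := by
  rw [← lie_skew, kEl_lie_gEl, neg_zero]

lemma kEl_lie_kEl (i r p j s q) : ⁅S.kEl i r p, S.kEl j s q⁆ = 0 := by
  refine S.L_ext ?_ ?_ ?_ <;> simp [kEl, diagC_zero, diagL_zero, wt_zero]

lemma wt_single (i : Fin (S.N + 1)) (γ : S.Exp) : S.wt (Pi.single i 1) γ = S.deg γ i := by
  simp [wt, Pi.single_apply]

lemma dEl_lie_gEl (i : Fin (S.N + 1)) (x : 𝔤) (n : ℤ) (r : Fin S.N → ℤ) :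
    ⁅S.dEl i, S.gEl x n r⁆ = (S.deg (n, r) i : ℂ) • S.gEl x n r := by
  refine S.L_ext ?_ ?_ ?_ <;> simp [dEl, gEl, diagC_zero, diagL_zero, wt_zero, wt_single]

lemma dEl_lie_kEl (i j : Fin (S.N + 1)) (r : Fin S.N → ℤ) (p : ℤ) :
    ⁅S.dEl i, S.kEl j r p⁆ = (S.deg (S.m * p, r) i : ℂ) • S.kEl j r p := by
  refine S.L_ext ?_ ?_ ?_
  · simp [dEl, kEl, diagL_zero, wt_zero]
  · have : (⁅S.dEl i, S.kEl j r p⁆ : S.L).1.ctr =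
        S.diagC (S.wt (Pi.single i 1)) (S.kEl j r p : S.Tor).ctr := by
      simp [dEl, kEl, diagC_zero, wt_zero]
    rw [this]
    change S.diagC _ (S.dA.mkQ _) = (_ : ℂ) • S.dA.mkQ _
    rw [diagC_mkQ, ← map_smul]
    congr 1
    ext1 l
    by_cases hl : l = j
    · subst hl; simp [wt_single]
    · simp [hl]
  · simp [dEl, kEl]

lemma dEl_lie_dEl (i j : Fin (S.N + 1)) : ⁅S.dEl i, S.dEl j⁆ = 0 := by
  refine S.L_ext ?_ ?_ ?_ <;> simp [dEl]

/-- This is the vanishing of the class of `d(t^{mp} t^r)` in `Ω_A / d_A` (`dvec_self`); the factor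
`1/m` at `k_0` turns the exponent `mp` into `p`. -/
lemma sum_kEl (r : Fin S.N → ℤ) (p : ℤ) :
    ∑ i : Fin S.N, (r i : ℂ) • S.kEl i.succ r p + (p : ℂ) • S.kEl 0 r p = 0 := by
  refine S.L_ext ?_ ?_ ?_
  · simp [kEl_loop]
  · have h := S.dvec_eq_sum r p (S.m * p, r)
    rw [dvec_self] at h
    have h2 : (((S.m : ℤ) * p : ℤ) / S.m : ℂ) = p := by
      push_cast; field_simp [S.m_ne_zero]
    rw [add_comm]
    simp only [h2] at h
    simpa using h.symm
  · simp [kEl_der]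

end Brackets

end Data

end

section

namespace Data

section Generators

variable {𝔤 : Type u} [LieRing 𝔤] [LieAlgebra ℂ 𝔤] (S : Data 𝔤)

/-! ### Generators of `L̃(𝔤, θ)` and linear maps on it -/

/-- The average of the first `m` powers of an endomorphism. -/
def average {M : Type*} [AddCommGroup M] [Module ℂ M] (T : Module.End ℂ M) : Module.End ℂ M :=
  (S.m : ℂ)⁻¹ • ∑ p ∈ Finset.range S.m, T ^ p

lemma average_of_fixed {M : Type*} [AddCommGroup M] [Module ℂ M] {T : Module.End ℂ M} {x : M}
    (hx : T x = x) : S.average T x = x := by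
  have h : ∀ p : ℕ, (T ^ p) x = x := fun p => by
    rw [Module.End.pow_apply]; exact Function.iterate_fixed hx p
  simp [average, LinearMap.sum_apply, h, ← Nat.cast_smul_eq_nsmul ℂ, smul_smul, S.m_ne_zero]

lemma average_of_smul {M : Type*} [AddCommGroup M] [Module ℂ M] {T : Module.End ℂ M} {x : M}
    {c : ℂ} (hx : T x = c • x) (hc : c ^ S.m = 1) :
    S.average T x = if c = 1 then x else 0 := by
  split_ifs with h1
  · exact S.average_of_fixed (by rw [hx, h1, one_smul])
  · have h : ∀ p : ℕ, (T ^ p) x = c ^ p • x := fun p => by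
      induction p with
      | zero => simp
      | succ p ih => rw [pow_succ', Module.End.mul_apply, ih, map_smul, hx, smul_smul, pow_succ]
    have h2 : ∑ p ∈ Finset.range S.m, c ^ p = 0 := by
      rw [geom_sum_eq h1, hc, sub_self, zero_div]
    simp [average, LinearMap.sum_apply, h, ← Finset.sum_smul, h2]

lemma average_loop (γ : S.Exp) (x : 𝔤) :
    S.average (S.diagL S.tw S.θl) (S.mono γ ⊗ₜ x) = S.mono γ ⊗ₜ S.proj γ.1 x := by
  have h : ∀ p : ℕ, ((S.diagL S.tw S.θl) ^ p) (S.mono γ ⊗ₜ x) =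
      S.ω ^ (-(γ.1 * p)) • S.mono γ ⊗ₜ[ℂ] S.θ^[p] x := fun p => by
    induction p with
    | zero => simp
    | succ p ih =>
      rw [pow_succ', Module.End.mul_apply, ih, map_smul, diagL_tmul, smul_smul, tw,
        ← zpow_add₀ S.ω_ne_zero, θl_apply, Function.iterate_succ_apply']
      push_cast
      ring_nf
  simp only [average, LinearMap.smul_apply, LinearMap.sum_apply, h, proj_eq_sum]
  rw [TensorProduct.tmul_smul, TensorProduct.tmul_sum]
  simp only [TensorProduct.tmul_smul]

lemma average_ctr (i : Fin (S.N + 1)) (γ : S.Exp) :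
    S.average (S.diagC S.tw) (S.dA.mkQ (Pi.single i (S.mono γ))) =
      if (S.m : ℤ) ∣ γ.1 then S.dA.mkQ (Pi.single i (S.mono γ)) else 0 := by
  have h1 : S.diagC S.tw (S.dA.mkQ (Pi.single i (S.mono γ))) =
      S.tw γ • S.dA.mkQ (Pi.single i (S.mono γ)) := by
    rw [diagC_mkQ, ← map_smul]
    congr 1
    ext1 j
    by_cases hj : j = i
    · subst hj; simp
    · simp [hj]
  rw [S.average_of_smul h1]
  · have : S.tw γ = 1 ↔ (S.m : ℤ) ∣ γ.1 := by rw [tw, ω_zpow_eq_one_iff, dvd_neg]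
    simp only [this]
  · rw [tw, ← zpow_natCast, ← zpow_mul, mul_comm, zpow_mul, ω_zpow_m, one_zpow]

/-- The linear span of `Ω_A / d_A` by monomials. -/
lemma ctr_induction {P : S.Ctr → Prop} (hadd : ∀ X Y, P X → P Y → P (X + Y))
    (hmono : ∀ (c : ℂ) γ i, P (c • S.dA.mkQ (Pi.single i (S.mono γ)))) (X : S.Ctr) : P X := by
  obtain ⟨f, rfl⟩ := S.dA.mkQ_surjective X
  have h0 : P 0 := by simpa using hmono 0 0 0
  have hf : f = ∑ i, LinearMap.single ℂ (fun _ : Fin (S.N + 1) => S.A) i (f i) := by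
    ext1 j
    simp [Finset.sum_apply, Pi.single_apply]
  rw [hf, map_sum]
  refine Finset.sum_induction _ P hadd h0 fun i _ => ?_
  generalize f i = g
  induction g using AddMonoidAlgebra.induction_linear with
  | zero => simpa using h0
  | add f g hf hg => rw [map_add, map_add]; exact hadd _ _ hf hg
  | single γ r =>
    have : (AddMonoidAlgebra.single γ r : S.A) = r • S.mono γ := by simp [mono]
    rw [this, map_smul, map_smul]
    exact hmono r γ i

/-- `L̃(𝔤, θ)` is spanned by the elements `x_n ⊗ t^n t^r`, `t^{mp} t^r k_i` and `d_i`. -/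
lemma L_induction {P : S.L → Prop} (hadd : ∀ X Y, P X → P Y → P (X + Y))
    (hsmul : ∀ (c : ℂ) X, P X → P (c • X)) (hg : ∀ x n r, P (S.gEl x n r))
    (hk : ∀ i r p, P (S.kEl i r p)) (hd : ∀ i, P (S.dEl i)) (Y : S.L) : P Y := by
  have h0 : P 0 := by simpa using hsmul 0 _ (hd 0)
  -- Averaging over the powers of `θ` projects to the fixed points and sends monomials to the listed
  -- generators or to zero; an element of `S.L` is its own average.
  have hloop : ∀ X : S.Loop, ∃ Y : S.L, P Y ∧
      (Y : S.Tor) = ⟨S.average (S.diagL S.tw S.θl) X, 0, 0⟩ := by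
    intro X
    induction X using S.loop_induction with
    | hadd X X' hX hX' =>
      obtain ⟨Y, hY, h1⟩ := hX
      obtain ⟨Y', hY', h1'⟩ := hX'
      exact ⟨Y + Y', hadd _ _ hY hY', by
        change (Y : S.Tor) + (Y' : S.Tor) = _
        rw [h1, h1']; ext1 <;> simp⟩
    | hmono γ x => exact ⟨S.gEl x γ.1 γ.2, hg _ _ _, by rw [average_loop]; rfl⟩
  have hctr : ∀ X : S.Ctr, ∃ Y : S.L, P Y ∧
      (Y : S.Tor) = ⟨0, S.average (S.diagC S.tw) X, 0⟩ := by
    intro X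
    induction X using S.ctr_induction with
    | hadd X X' hX hX' =>
      obtain ⟨Y, hY, h1⟩ := hX
      obtain ⟨Y', hY', h1'⟩ := hX'
      exact ⟨Y + Y', hadd _ _ hY hY', by
        change (Y : S.Tor) + (Y' : S.Tor) = _
        rw [h1, h1']; ext1 <;> simp⟩
    | hmono c γ i =>
      rw [map_smul, average_ctr]
      by_cases h : (S.m : ℤ) ∣ γ.1
      · refine ⟨c • S.kEl i γ.2 (γ.1 / S.m), hsmul _ _ (hk _ _ _), ?_⟩
        rw [if_pos h, kEl]
        simp only [Int.mul_ediv_cancel' h]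
        change c • (⟨_, _, _⟩ : S.Tor) = _
        ext1 <;> simp
      · exact ⟨0, h0, by rw [if_neg h]; ext1 <;> simp⟩
  have hder : ∀ a : Fin (S.N + 1) → ℂ, P (∑ i, a i • S.dEl i) := fun a =>
    Finset.sum_induction _ P hadd h0 fun i _ => hsmul _ _ (hd i)
  have hY : S.θT Y = Y := Y.2
  obtain ⟨Y1, hY1, e1⟩ := hloop (Y : S.Tor).loop
  obtain ⟨Y2, hY2, e2⟩ := hctr (Y : S.Tor).ctr
  rw [S.average_of_fixed (congrArg Tor.loop hY)] at e1
  rw [S.average_of_fixed (congrArg Tor.ctr hY)] at e2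
  have : Y = Y1 + Y2 + ∑ i, (Y : S.Tor).der i • S.dEl i := by
    refine S.L_ext ?_ ?_ ?_
    · simp [e1, e2, dEl]
    · simp [e1, e2, dEl]
    · ext j
      simp [e1, e2, dEl, Finset.sum_apply, Pi.single_apply]
  rw [this]
  exact hadd _ _ (hadd _ _ hY1 hY2) (hder _)

/-- The linear map on `τ ⊕ D` with prescribed values on `x t^γ`, `t^γ k_i` and `d_i`. -/
def torLift {E : Type*} [AddCommGroup E] [Module ℂ E] (f : S.Exp → 𝔤 →ₗ[ℂ] E)
    (g : Fin (S.N + 1) → S.Exp → E)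
    (hg : ∀ γ, ∑ i, ((if i = 0 then (S.m : ℂ)⁻¹ else 1) * S.deg γ i) • g i γ = 0)
    (d : Fin (S.N + 1) → E) : S.Tor →ₗ[ℂ] E where
  toFun X := TensorProduct.lift ((AddMonoidAlgebra.basis S.Exp ℂ).constr ℂ f) X.loop +
    S.dA.liftQ (∑ i, ((AddMonoidAlgebra.basis S.Exp ℂ).constr ℂ (g i)) ∘ₗ LinearMap.proj i) (by
      rintro _ ⟨f, rfl⟩
      rw [LinearMap.mem_ker, ← LinearMap.comp_apply]
      refine LinearMap.congr_fun (S.A_ext fun γ => ?_ : _ = (0 : S.A →ₗ[ℂ] E)) f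
      have hb : ∀ i, ((AddMonoidAlgebra.basis S.Exp ℂ).constr ℂ (g i)) (S.mono γ) = g i γ := by
        intro i
        have := (AddMonoidAlgebra.basis S.Exp ℂ).constr_basis ℂ (g i) γ
        rwa [AddMonoidAlgebra.basis_apply] at this
      simp only [LinearMap.comp_apply, LinearMap.sum_apply, LinearMap.proj_apply, dOm_mono,
        map_smul, hb, LinearMap.zero_apply]
      exact hg γ) X.ctr +
    ∑ i, X.der i • d i
  map_add' X Y := by
    simp only [add_loop, add_ctr, add_der, map_add, Pi.add_apply, add_smul,
      Finset.sum_add_distrib]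
    abel
  map_smul' c X := by
    simp only [smul_loop, smul_ctr, smul_der, map_smul, Pi.smul_apply, smul_add, Finset.smul_sum,
      smul_smul, smul_eq_mul, RingHom.id_apply]

section

variable {E : Type*} [AddCommGroup E] [Module ℂ E] (f : S.Exp → 𝔤 →ₗ[ℂ] E)
    (g : Fin (S.N + 1) → S.Exp → E)
    (hg : ∀ γ, ∑ i, ((if i = 0 then (S.m : ℂ)⁻¹ else 1) * S.deg γ i) • g i γ = 0)
    (d : Fin (S.N + 1) → E)

lemma torLift_gEl (x : 𝔤) (n : ℤ) (r : Fin S.N → ℤ) :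
    S.torLift f g hg d (S.gEl x n r) = f (n, r) (S.proj n x) := by
  have hb := (AddMonoidAlgebra.basis S.Exp ℂ).constr_basis ℂ f (n, r)
  rw [AddMonoidAlgebra.basis_apply] at hb
  simp [torLift, gEl, mono, hb]

lemma torLift_kEl (i : Fin (S.N + 1)) (r : Fin S.N → ℤ) (p : ℤ) :
    S.torLift f g hg d (S.kEl i r p) = g i (S.m * p, r) := by
  have hb : ∀ i, ((AddMonoidAlgebra.basis S.Exp ℂ).constr ℂ (g i)) (S.mono (S.m * p, r)) =
      g i (S.m * p, r) := by
    intro i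
    have := (AddMonoidAlgebra.basis S.Exp ℂ).constr_basis ℂ (g i) (S.m * p, r)
    rwa [AddMonoidAlgebra.basis_apply] at this
  simp only [torLift, kEl, LinearMap.coe_mk, AddHom.coe_mk, Submodule.mkQ_apply, Submodule.liftQ_apply,
    LinearMap.sum_apply, LinearMap.comp_apply, LinearMap.proj_apply]
  rw [Finset.sum_eq_single i]
  · simp [hb]
  · intro j _ hj; simp [hj]
  · simp

lemma torLift_dEl (i : Fin (S.N + 1)) : S.torLift f g hg d (S.dEl i) = d i := by
  simp [torLift, dEl, Pi.single_apply]

end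

end Generators

end Data

end

section

/-! ### The Euler operator on power series -/

section EulerOp

variable {R : Type*} [Ring R] [Algebra ℂ R]

open PowerSeries in
/-- The operator `X d/dX` on power series. -/
def eulerOp (f : PowerSeries R) : PowerSeries R := PowerSeries.mk fun n => (n : ℂ) • coeff n f

open PowerSeries

@[simp] lemma coeff_eulerOp (f : PowerSeries R) (n : ℕ) :
    coeff n (eulerOp f) = (n : ℂ) • coeff n f := coeff_mk _ _

lemma coeff_complex_smul (c : ℂ) (f : PowerSeries R) (n : ℕ) :
    coeff n (c • f) = c • coeff n f := rfl

lemma eulerOp_one : eulerOp (1 : PowerSeries R) = 0 := by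
  ext n
  by_cases h : n = 0 <;> simp [coeff_one, h]

lemma eulerOp_mul (f g : PowerSeries R) : eulerOp (f * g) = eulerOp f * g + f * eulerOp g := by
  ext n
  simp only [coeff_eulerOp, coeff_mul, map_add, Finset.smul_sum, ← Finset.sum_add_distrib]
  refine Finset.sum_congr rfl fun p hp => ?_
  rw [← Finset.HasAntidiagonal.mem_antidiagonal.mp hp]
  push_cast
  rw [add_smul, smul_mul_assoc, mul_smul_comm]

lemma eulerOp_pow {f : PowerSeries R} (hf : Commute (eulerOp f) f) (l : ℕ) :
    eulerOp (f ^ (l + 1)) = ((l + 1 : ℕ) : ℂ) • (eulerOp f * f ^ l) := by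
  induction l with
  | zero => simp
  | succ l ih =>
    rw [pow_succ' f (l + 1), eulerOp_mul, ih, mul_smul_comm, ← mul_assoc f, ← hf.eq, mul_assoc,
      ← pow_succ' f l, Nat.cast_succ (l + 1), add_smul, one_smul, add_comm]

omit [Algebra ℂ R] in
lemma coeff_pow_eq_zero_of_lt {f : PowerSeries R} (h0 : coeff 0 f = 0) {n l : ℕ} (h : n < l) :
    coeff n (f ^ l) = 0 := by
  induction l generalizing n with
  | zero => omega
  | succ l ih =>
    rw [pow_succ', coeff_mul]
    refine Finset.sum_eq_zero fun p hp => ?_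
    have hp := Finset.HasAntidiagonal.mem_antidiagonal.mp hp
    rcases Nat.eq_zero_or_pos p.1 with h1 | h1
    · rw [h1, h0, zero_mul]
    · rw [ih (by omega), mul_zero]

lemma Data.expCoeff_zero (a : ℕ → R) : Data.expCoeff a 0 = 1 := by
  simp [Data.expCoeff]

/-- Coefficient form of the differential equation `D exp(A) = (D A) exp(A)` for the Euler operator
`D`, valid because the coefficients commute. All later statements about `E^±` are drawn from this
recursion. -/
lemma Data.smul_expCoeff {a : ℕ → R} (ha : ∀ i j, Commute (a i) (a j)) (n : ℕ) :
    (n : ℂ) • Data.expCoeff a n =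
      ∑ p ∈ Finset.HasAntidiagonal.antidiagonal n, (p.1 : ℂ) • (a p.1 * Data.expCoeff a p.2) := by
  set A : PowerSeries R := PowerSeries.mk fun j => if j = 0 then 0 else a j with hA
  have h0 : coeff 0 A = 0 := by simp [hA]
  have hcomm : Commute (eulerOp A) A := by
    ext n
    rw [coeff_mul, coeff_mul, ← Finset.Nat.sum_antidiagonal_swap]
    refine Finset.sum_congr rfl fun p _ => ?_
    simp only [hA, coeff_eulerOp, coeff_mk, Prod.fst_swap, Prod.snd_swap]
    split_ifs
    · simp
    · simp
    · simp
    · rw [smul_mul_assoc, mul_smul_comm, (ha _ _).eq]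
  -- As `A` has no constant term, `A^l` starts in degree `l`, so the truncated sum in `expCoeff` may
  -- be extended to any larger range.
  have hE : ∀ {n M : ℕ}, n < M → Data.expCoeff a n =
      ∑ l ∈ Finset.range M, ((l.factorial : ℂ)⁻¹) • coeff n (A ^ l) := by
    intro n M hM
    refine Finset.sum_subset (Finset.range_subset_range.mpr hM) fun l _ hl => ?_
    rw [coeff_pow_eq_zero_of_lt h0 (by simpa using hl), smul_zero]
  rcases n with _ | n
  · simp
  rw [hE (Nat.lt_succ_self (n + 1)), Finset.sum_range_succ']
  simp only [pow_zero, coeff_one, Nat.succ_ne_zero, if_false, smul_zero, add_zero]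
  have h1 : ∀ l, ((n + 1 : ℕ) : ℂ) • (((l + 1).factorial : ℂ)⁻¹ • coeff (n + 1) (A ^ (l + 1))) =
      ((l.factorial : ℂ)⁻¹) • coeff (n + 1) (eulerOp A * A ^ l) := by
    intro l
    rw [smul_comm, ← coeff_eulerOp, eulerOp_pow hcomm, coeff_complex_smul, smul_smul]
    congr 1
    rw [Nat.factorial_succ]
    have : ((l + 1 : ℕ) : ℂ) ≠ 0 := by exact_mod_cast l.succ_ne_zero
    have : (l.factorial : ℂ) ≠ 0 := by exact_mod_cast l.factorial_ne_zero
    push_cast at *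
    field_simp
  rw [Finset.smul_sum, Finset.sum_congr rfl fun l _ => h1 l]
  simp only [coeff_mul, Finset.smul_sum]
  rw [Finset.sum_comm]
  refine Finset.sum_congr rfl fun p hp => ?_
  rcases Nat.eq_zero_or_pos p.1 with h2 | h2
  · simp [h2]
  have hp := Finset.HasAntidiagonal.mem_antidiagonal.mp hp
  rw [hE (show p.2 < n + 1 by omega), Finset.mul_sum, Finset.smul_sum]
  refine Finset.sum_congr rfl fun l _ => ?_
  simp only [hA, coeff_eulerOp, coeff_mk, h2.ne', if_false, smul_mul_assoc, mul_smul_comm]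
  rw [smul_comm]

/-- The logarithmic Euler derivative of `(1 + X)^c` is `c X / (1 + X)`. Multiplying by `1 + X`
reduces the claim to the recursion for binomial coefficients. -/
lemma eulerOp_binomialSeries (c : ℂ) : eulerOp (PowerSeries.binomialSeries ℂ c) =
    (PowerSeries.mk fun j => if j = 0 then 0 else -(c * (-1) ^ j)) * PowerSeries.binomialSeries ℂ c := by
  have h1 : (1 + X : PowerSeries ℂ) ≠ 0 := by
    intro h
    simpa using congrArg (coeff 0) h
  apply mul_left_cancel₀ h1
  have h2 : (1 + X : PowerSeries ℂ) * (PowerSeries.mk fun j => if j = 0 then 0 else -(c * (-1) ^ j)) =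
      c • X := by
    ext n
    rcases n with _ | n
    · simp [add_mul]
    · rcases n with _ | n
      · simp [add_mul, coeff_succ_X_mul]
      · simp [add_mul, coeff_succ_X_mul, coeff_X, pow_succ]
  rw [← mul_assoc, h2]
  ext n
  rcases n with _ | n
  · rw [add_mul, one_mul, map_add, coeff_eulerOp, coeff_zero_X_mul, smul_mul_assoc, map_smul,
      coeff_zero_X_mul]
    simp
  · have h3 := Ring.choose_smul_choose c (Nat.le_succ n)
    simp only [Nat.succ_eq_add_one, Nat.choose_succ_self_right, Nat.add_sub_cancel_left,
      Ring.choose_one_right, nsmul_eq_mul] at h3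
    simp only [add_mul, one_mul, map_add, coeff_eulerOp, binomialSeries_coeff, coeff_succ_X_mul,
      smul_mul_assoc, map_smul, smul_eq_mul, mul_one]
    rw [h3]
    ring

lemma eulerOp_rescale (c : ℂ) (f : PowerSeries ℂ) :
    eulerOp (rescale c f) = rescale c (eulerOp f) := by
  ext n
  simp only [coeff_eulerOp, coeff_rescale, smul_eq_mul]
  ring

lemma eulerOp_prod {ι : Type*} (s : Finset ι) (f g : ι → PowerSeries ℂ)
    (h : ∀ i ∈ s, eulerOp (f i) = g i * f i) :
    eulerOp (∏ i ∈ s, f i) = (∑ i ∈ s, g i) * ∏ i ∈ s, f i := by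
  classical
  induction s using Finset.induction_on with
  | empty => simp [eulerOp_one]
  | insert a s ha ih =>
    rw [Finset.prod_insert ha, Finset.sum_insert ha, eulerOp_mul, h a (Finset.mem_insert_self _ _),
      ih fun i hi => h i (Finset.mem_insert_of_mem hi)]
    ring

end EulerOp

namespace Data

variable {𝔤 : Type u} [LieRing 𝔤] [LieAlgebra ℂ 𝔤] (S : Data 𝔤)

open PowerSeries

lemma prodCoeff_zero (k : ℂ) (β γ : 𝔤) : S.prodCoeff k β γ 0 = 1 := by
  rw [prodCoeff, coeff_zero_eq_constantCoeff_apply, map_prod]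
  refine Finset.prod_eq_one fun p _ => ?_
  rw [← coeff_zero_eq_constantCoeff_apply, coeff_rescale]
  simp

/-- The logarithmic derivative of the product is a sum over `p`, and the powers of `ω` in it
assemble `θ^p β` into `m` times the component of `β` in an eigenspace of `θ`. The result is the
recursion that expectation values with `E⁻` obey in `ε_X_Em`. -/
lemma mul_prodCoeff (k : ℂ) (β γ : 𝔤) (n : ℕ) : (n : ℂ) * S.prodCoeff k β γ n =
    ∑ p ∈ Finset.HasAntidiagonal.antidiagonal n, (if p.1 = 0 then 0 else
      -((S.m / k) * S.form (S.proj p.1 β) γ)) * S.prodCoeff k β γ p.2 := by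
  rw [prodCoeff, ← smul_eq_mul, ← coeff_eulerOp, eulerOp_prod _ _ (fun p : ℕ =>
    rescale (-(S.ω ^ (-(p : ℤ)))) (PowerSeries.mk fun j => if j = 0 then 0 else
      -(S.form (S.θ^[p] β) γ / k * (-1) ^ j))), coeff_mul]
  · refine Finset.sum_congr rfl fun p _ => ?_
    rw [prodCoeff]
    congr 1
    simp only [map_sum, coeff_rescale, coeff_mk]
    by_cases h : p.1 = 0
    · simp [h]
    · simp only [h, if_false, proj_eq_sum, map_smul, map_sum, LinearMap.smul_apply,
        LinearMap.sum_apply, smul_eq_mul, Finset.mul_sum, ← Finset.sum_neg_distrib]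
      refine Finset.sum_congr rfl fun q _ => ?_
      have h3 : (-(S.ω ^ (-(q : ℤ)))) ^ p.1 * (-1) ^ p.1 = S.ω ^ (-((p.1 : ℤ) * q)) := by
        rw [← mul_pow, neg_mul_neg, mul_one, ← zpow_natCast, ← zpow_mul]
        congr 1; ring
      have h4 : (S.m : ℂ) / k * ((S.m : ℂ)⁻¹ * (S.ω ^ (-((p.1 : ℤ) * q)) * S.form (S.θ^[q] β) γ)) =
          S.ω ^ (-((p.1 : ℤ) * q)) * (S.form (S.θ^[q] β) γ / k) := by
        have := S.m_ne_zero
        field_simp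
      rw [h4, ← h3]
      ring
  · intro p _
    rw [eulerOp_rescale, eulerOp_binomialSeries, map_mul]

end Data

end

section

/-! ### Sums with finite support -/

section Finsum

lemma hasFiniteSupport_of_le {M : Type*} [Zero M] {f : ℕ → M} (K : ℕ) (h : ∀ n, K ≤ n → f n = 0) :
    f.HasFiniteSupport :=
  (Set.finite_lt_nat K).subset fun n hn => by
    by_contra hc
    exact hn (h n (not_lt.mp hc))

lemma hasFiniteSupport_int {M : Type*} [Zero M] {f : ℤ → M} (a b : ℤ)
    (ha : ∀ n, n < a → f n = 0) (hb : ∀ n, b < n → f n = 0) : f.HasFiniteSupport :=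
  (Set.finite_Icc a b).subset fun n hn => by
    by_contra hc
    rw [Set.mem_Icc, not_and_or, not_le, not_le] at hc
    exact hn (hc.elim (ha n) (hb n))

lemma finsum_comp_injective {α β M : Type*} [AddCommMonoid M] {e : α → β}
    (he : Function.Injective e) {g : β → M} (hg : ∀ y, y ∉ Set.range e → g y = 0) :
    ∑ᶠ x, g (e x) = ∑ᶠ y, g y := by
  rw [← finsum_mem_range he, ← finsum_mem_univ (f := g)]
  refine finsum_mem_inter_support_eq' _ _ _ fun y hy => ?_
  simp only [Set.mem_univ, iff_true]
  by_contra h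
  exact hy (hg y h)

lemma finsum_nat_shift {M : Type*} [AddCommMonoid M] (i : ℕ) {g : ℕ → M}
    (hg : ∀ n, n < i → g n = 0) : ∑ᶠ n, g (n + i) = ∑ᶠ n, g n :=
  finsum_comp_injective (add_left_injective i) fun y hy => hg y <| by
    by_contra h
    exact hy ⟨y - i, Nat.sub_add_cancel (not_lt.mp h)⟩

variable {ι E F G : Type*} [AddCommGroup E] [Module ℂ E] [AddCommGroup F] [Module ℂ F]
  [AddCommGroup G] [Module ℂ G]

lemma linear_finsum (g : E →ₗ[ℂ] F) {f : ι → E} (hf : f.HasFiniteSupport) :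
    g (∑ᶠ i, f i) = ∑ᶠ i, g (f i) := map_finsum g hf

/-- A family of linear maps such that each vector is killed by almost all of them. -/
def LocFin (f : ι → E →ₗ[ℂ] F) : Prop := ∀ v, (fun i => f i v).HasFiniteSupport

/-- The sum of a locally finite family of linear maps. -/
def locSum (f : ι → E →ₗ[ℂ] F) (hf : LocFin f) : E →ₗ[ℂ] F where
  toFun v := ∑ᶠ i, f i v
  map_add' v w := by
    simp only [map_add]
    exact finsum_add_distrib (hf v) (hf w)
  map_smul' c v := by
    simp only [map_smul]
    exact (smul_finsum' c (hf v)).symm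

@[simp] lemma locSum_apply (f : ι → E →ₗ[ℂ] F) (hf : LocFin f) (v : E) :
    locSum f hf v = ∑ᶠ i, f i v := rfl

omit [Module ℂ E] in
lemma hasFiniteSupport_add {f g : ι → E} (hf : f.HasFiniteSupport) (hg : g.HasFiniteSupport) :
    (fun i => f i + g i).HasFiniteSupport :=
  (Set.Finite.union hf hg).subset (Function.support_add f g)

lemma hasFiniteSupport_linear (g : E →ₗ[ℂ] F) {f : ι → E} (hf : f.HasFiniteSupport) :
    (fun i => g (f i)).HasFiniteSupport :=
  Set.Finite.subset hf fun i hi hfi => hi (by simp only [hfi, map_zero])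

end Finsum

/-! ### Derivations and exponentials -/

section Derivations

variable {R : Type*} [Ring R] [Algebra ℂ R]

open PowerSeries

/-- Uniqueness for a linear differential equation: in degree `n > 0` the equation determines the
coefficient from lower ones. It is used to identify two series solving the same equation. -/
lemma eq_zero_of_eulerOp_eq {B H : PowerSeries R} (hB : coeff 0 B = 0) (hH0 : coeff 0 H = 0)
    (hH : eulerOp H = B * H) : H = 0 := by
  ext n
  rw [map_zero]
  induction n using Nat.strong_induction_on with
  | _ n ih =>
    rcases Nat.eq_zero_or_pos n with rfl | hn
    · exact hH0
    have h1 : (n : ℂ) • coeff n H = 0 := by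
      rw [← coeff_eulerOp, hH, coeff_mul]
      refine Finset.sum_eq_zero fun p hp => ?_
      have hp := Finset.HasAntidiagonal.mem_antidiagonal.mp hp
      rcases Nat.eq_zero_or_pos p.1 with h1 | h1
      · rw [h1, hB, zero_mul]
      · rw [ih p.2 (by omega), mul_zero]
    exact (smul_eq_zero_iff_right (by exact_mod_cast hn.ne')).mp h1

/-- The coefficientwise extension of an operator on the coefficients to power series. -/
def mapCoeff (δ : R →ₗ[ℂ] R) (f : PowerSeries R) : PowerSeries R :=
  PowerSeries.mk fun n => δ (coeff n f)

lemma coeff_mapCoeff (δ : R →ₗ[ℂ] R) (f : PowerSeries R) (n : ℕ) :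
    coeff n (mapCoeff δ f) = δ (coeff n f) := coeff_mk _ _

lemma eulerOp_mapCoeff (δ : R →ₗ[ℂ] R) (f : PowerSeries R) :
    eulerOp (mapCoeff δ f) = mapCoeff δ (eulerOp f) := by
  ext n; simp [coeff_mapCoeff]

lemma mapCoeff_mul {δ : R →ₗ[ℂ] R} (hδ : ∀ x y, δ (x * y) = δ x * y + x * δ y)
    (f g : PowerSeries R) : mapCoeff δ (f * g) = mapCoeff δ f * g + f * mapCoeff δ g := by
  ext n
  simp only [coeff_mapCoeff, coeff_mul, map_add, map_sum, hδ, ← Finset.sum_add_distrib]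

/-- The exponential series of `∑_{j > 0} a_j ζ^j`. -/
def expSeries (a : ℕ → R) : PowerSeries R := PowerSeries.mk (Data.expCoeff a)

/-- The series `∑_{j > 0} a_j ζ^j`. -/
def posSeries (a : ℕ → R) : PowerSeries R := PowerSeries.mk fun j => if j = 0 then 0 else a j

lemma coeff_zero_eulerOp (f : PowerSeries R) : coeff 0 (eulerOp f) = 0 := by
  rw [coeff_eulerOp]; simp

lemma eulerOp_expSeries {a : ℕ → R} (ha : ∀ i j, Commute (a i) (a j)) :
    eulerOp (expSeries a) = eulerOp (posSeries a) * expSeries a := by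
  ext n
  rw [coeff_eulerOp, expSeries, coeff_mk, Data.smul_expCoeff ha, coeff_mul]
  refine Finset.sum_congr rfl fun p _ => ?_
  rw [coeff_eulerOp, posSeries, coeff_mk, coeff_mk]
  split_ifs with h
  · simp [h]
  · rw [smul_mul_assoc]

lemma derivation_one {δ : R →ₗ[ℂ] R} (hδ : ∀ x y, δ (x * y) = δ x * y + x * δ y) : δ 1 = 0 := by
  have := hδ 1 1
  simpa using this

/-- For `A` the exponent, `δ(exp A) - (δ A) exp A` has zero constant term and satisfies the same
Euler equation as `exp A`, because `δ A` is central; hence it vanishes. -/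
lemma mapCoeff_expSeries_of_central {a : ℕ → R} (ha : ∀ i j, Commute (a i) (a j))
    {δ : R →ₗ[ℂ] R} (hδ : ∀ x y, δ (x * y) = δ x * y + x * δ y) {c : ℕ → ℂ}
    (hc : ∀ j, j ≠ 0 → δ (a j) = algebraMap ℂ R (c j)) :
    mapCoeff δ (expSeries a) = posSeries (fun j => algebraMap ℂ R (c j)) * expSeries a := by
  rw [← sub_eq_zero]
  have hA : mapCoeff δ (posSeries a) = posSeries (fun j => algebraMap ℂ R (c j)) := by
    ext n
    rw [coeff_mapCoeff, posSeries, posSeries, coeff_mk, coeff_mk]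
    split_ifs with h
    · rw [map_zero]
    · exact hc n h
  have hcomm : ∀ f : PowerSeries R,
      posSeries (fun j => algebraMap ℂ R (c j)) * f = f * posSeries fun j => algebraMap ℂ R (c j) := by
    intro f
    ext n
    rw [coeff_mul, coeff_mul, ← Finset.Nat.sum_antidiagonal_swap]
    refine Finset.sum_congr rfl fun p _ => ?_
    simp only [posSeries, coeff_mk, Prod.fst_swap, Prod.snd_swap]
    split_ifs
    · simp
    · exact Algebra.commutes _ _
  refine eq_zero_of_eulerOp_eq (B := eulerOp (posSeries a)) (coeff_zero_eulerOp _) ?_ ?_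
  · rw [map_sub, coeff_mapCoeff, coeff_mul]
    simp [expSeries, posSeries, Data.expCoeff_zero, derivation_one hδ]
  · have hsub : ∀ f g : PowerSeries R, eulerOp (f - g) = eulerOp f - eulerOp g := fun f g => by
      ext n; simp [smul_sub]
    rw [hsub, eulerOp_mapCoeff, eulerOp_expSeries ha, mapCoeff_mul hδ, ← eulerOp_mapCoeff, hA,
      eulerOp_mul, eulerOp_expSeries ha, mul_sub, ← mul_assoc, ← mul_assoc, hcomm]
    abel

lemma derivation_expCoeff_of_central {a : ℕ → R} (ha : ∀ i j, Commute (a i) (a j))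
    {δ : R →ₗ[ℂ] R} (hδ : ∀ x y, δ (x * y) = δ x * y + x * δ y) {i : ℕ} (hi : i ≠ 0) {c : ℂ}
    (hc : ∀ j, δ (a j) = if j = i then c • (1 : R) else 0) (n : ℕ) :
    δ (Data.expCoeff a n) = if i ≤ n then c • Data.expCoeff a (n - i) else 0 := by
  have h := congrArg (coeff n) (mapCoeff_expSeries_of_central ha hδ
    (c := fun j => if j = i then c else 0) fun j _ => by
      rw [hc]; split_ifs <;> simp [Algebra.algebraMap_eq_smul_one])
  rw [coeff_mapCoeff, expSeries, coeff_mk, coeff_mul] at h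
  rw [h]
  split_ifs with hin
  · rw [Finset.sum_eq_single (i, n - i)]
    · simp [posSeries, hi, Algebra.algebraMap_eq_smul_one]
    · rintro ⟨p, q⟩ hpq hne
      have hpq := Finset.HasAntidiagonal.mem_antidiagonal.mp hpq
      have : p ≠ i := by
        rintro rfl
        apply hne
        simp only at hpq
        ext <;> simp
        omega
      simp [posSeries, this]
    · intro hc
      exact absurd (Finset.HasAntidiagonal.mem_antidiagonal.mpr (by simp; omega)) hc
  · refine Finset.sum_eq_zero fun p hp => ?_
    have hp := Finset.HasAntidiagonal.mem_antidiagonal.mp hp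
    have : p.1 ≠ i := by omega
    simp [posSeries, this]

/-- Here `δ` acts on the exponent as `s` times the Euler operator, so both agree on the exponential
by uniqueness. The case `s = 0` serves below to show that an operator commuting with the exponent
commutes with the exponential. -/
lemma derivation_expCoeff_of_weight {a : ℕ → R} (ha : ∀ i j, Commute (a i) (a j))
    {δ : R →ₗ[ℂ] R} (hδ : ∀ x y, δ (x * y) = δ x * y + x * δ y) {s : ℂ}
    (hs : ∀ j, δ (a j) = (s * j) • a j) (n : ℕ) :
    δ (Data.expCoeff a n) = (s * n) • Data.expCoeff a n := by
  have hsub : ∀ f g : PowerSeries R, eulerOp (f - g) = eulerOp f - eulerOp g := fun f g => by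
    ext n; simp [smul_sub]
  have hsmul : ∀ (c : ℂ) (f : PowerSeries R), eulerOp (c • f) = c • eulerOp f := fun c f => by
    ext n
    rw [coeff_complex_smul, coeff_eulerOp, coeff_eulerOp, coeff_complex_smul, smul_comm]
  have hA : mapCoeff δ (posSeries a) = s • eulerOp (posSeries a) := by
    ext n
    rw [coeff_mapCoeff, coeff_complex_smul, coeff_eulerOp, posSeries, coeff_mk]
    split_ifs with h
    · simp
    · rw [hs, smul_smul]
  have key : mapCoeff δ (expSeries a) - s • eulerOp (expSeries a) = 0 := by
    refine eq_zero_of_eulerOp_eq (B := eulerOp (posSeries a)) (coeff_zero_eulerOp _) ?_ ?_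
    · rw [map_sub, coeff_mapCoeff, coeff_complex_smul, coeff_zero_eulerOp]
      simp [expSeries, Data.expCoeff_zero, derivation_one hδ]
    · have h2 : eulerOp (eulerOp (expSeries a)) = eulerOp (eulerOp (posSeries a)) * expSeries a +
          eulerOp (posSeries a) * eulerOp (expSeries a) := by
        conv_lhs => rw [eulerOp_expSeries ha, eulerOp_mul]
      have h3 : mapCoeff δ (eulerOp (expSeries a)) = mapCoeff δ (eulerOp (posSeries a)) *
          expSeries a + eulerOp (posSeries a) * mapCoeff δ (expSeries a) := by
        rw [eulerOp_expSeries ha, mapCoeff_mul hδ]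
      rw [hsub, eulerOp_mapCoeff, hsmul, h2, h3, ← eulerOp_mapCoeff, hA, hsmul, smul_mul_assoc,
        smul_add, mul_sub, mul_smul_comm]
      abel
  have h := congrArg (coeff n) (sub_eq_zero.mp key)
  rw [coeff_mapCoeff, coeff_complex_smul, coeff_eulerOp, expSeries, coeff_mk, smul_smul] at h
  exact h

/-- The commutator with `y` as a linear operator. -/
def adOp (y : R) : R →ₗ[ℂ] R := LinearMap.mulLeft ℂ y - LinearMap.mulRight ℂ y

lemma adOp_apply (y x : R) : adOp y x = y * x - x * y := rfl

lemma adOp_mul (y x z : R) : adOp y (x * z) = adOp y x * z + x * adOp y z := by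
  simp only [adOp_apply]; noncomm_ring

end Derivations

end

section

variable {𝔤 : Type u} [LieRing 𝔤] [LieAlgebra ℂ 𝔤]

/-! ### Representations of the Heisenberg relations -/

/-- The operators `a i h` satisfy the commutation relations of the `h_i ⊗ t^i` at level `k`. -/
def HeisRel (S : Data 𝔤) (k : ℂ) {R : Type*} [Ring R] [Algebra ℂ R] (a : ℤ → S.𝔥 →ₗ[ℂ] R) : Prop :=
  ∀ i j h h', a i h * a j h' - a j h' * a i h =
    if i + j = 0 then ((i : ℂ) / S.m * k * S.form (S.proj i h) h') • (1 : R) else 0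

namespace HeisRel

variable {S : Data 𝔤} {k : ℂ} {R : Type*} [Ring R] [Algebra ℂ R] {a : ℤ → S.𝔥 →ₗ[ℂ] R}
  (H : HeisRel S k a)

include H

lemma commute {i j : ℤ} (hij : i + j ≠ 0) (h h' : S.𝔥) : Commute (a i h) (a j h') := by
  have := H i j h h'
  rw [if_neg hij] at this
  exact sub_eq_zero.mp this

lemma commute_minus (β : S.𝔥) (i j : ℕ) :
    Commute ((-((S.m : ℂ) / (i * k))) • a (-(i : ℤ)) β)
      ((-((S.m : ℂ) / (j * k))) • a (-(j : ℤ)) β) := by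
  by_cases hi : i = 0
  · simp [hi]
  · exact ((H.commute (by omega) β β).smul_left _).smul_right _

lemma commute_plus (β : S.𝔥) (i j : ℕ) :
    Commute (((S.m : ℂ) / (i * k)) • a (i : ℤ) β) (((S.m : ℂ) / (j * k)) • a (j : ℤ) β) := by
  by_cases hi : i = 0
  · simp [hi]
  · exact ((H.commute (by omega) β β).smul_left _).smul_right _

lemma smul_expMinus (β : S.𝔥) (n : ℕ) :
    (n : ℂ) • S.expMinus k (fun j => a j β) n = ∑ p ∈ Finset.HasAntidiagonal.antidiagonal n,
      (if p.1 = 0 then 0 else -((S.m : ℂ) / k)) •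
        (a (-(p.1 : ℤ)) β * S.expMinus k (fun j => a j β) p.2) := by
  rw [Data.expMinus, Data.smul_expCoeff (H.commute_minus β)]
  refine Finset.sum_congr rfl fun p _ => ?_
  by_cases h : p.1 = 0
  · simp [h]
  · rw [if_neg h, smul_mul_assoc, smul_smul]
    have : (p.1 : ℂ) ≠ 0 := by exact_mod_cast h
    congr 1
    field_simp

lemma smul_expPlus (β : S.𝔥) (n : ℕ) :
    (n : ℂ) • S.expPlus k (fun j => a j β) n = ∑ p ∈ Finset.HasAntidiagonal.antidiagonal n,
      (if p.1 = 0 then 0 else ((S.m : ℂ) / k)) •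
        (a (p.1 : ℤ) β * S.expPlus k (fun j => a j β) p.2) := by
  rw [Data.expPlus, Data.smul_expCoeff (H.commute_plus β)]
  refine Finset.sum_congr rfl fun p _ => ?_
  by_cases h : p.1 = 0
  · simp [h]
  · rw [if_neg h, smul_mul_assoc, smul_smul]
    have : (p.1 : ℂ) ≠ 0 := by exact_mod_cast h
    congr 1
    field_simp

/-- The normalisation `m / (jk)` in the exponent cancels the factor `(i/m) k` of the Heisenberg
relation at `j = i`, so the scalar is just a value of the form. -/
lemma lie_expMinus (hk : k ≠ 0) (β h : S.𝔥) {i : ℕ} (hi : i ≠ 0) (n : ℕ) :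
    a i h * S.expMinus k (fun j => a j β) n - S.expMinus k (fun j => a j β) n * a i h =
      if i ≤ n then (-S.form (S.proj i h) β) • S.expMinus k (fun j => a j β) (n - i) else 0 := by
  have := derivation_expCoeff_of_central (H.commute_minus β) (adOp_mul (a i h)) hi
    (c := -S.form (S.proj i h) β) (fun j => ?_) n
  · exact this
  · rw [adOp_apply, mul_smul_comm, smul_mul_assoc, ← smul_sub, H]
    by_cases hj : j = i
    · subst hj
      have h1 : (j : ℂ) ≠ 0 := by exact_mod_cast hi
      have h2 := S.m_ne_zero
      rw [if_pos rfl, if_pos (by omega), smul_smul]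
      congr 1
      push_cast
      field_simp
    · rw [if_neg hj, if_neg (by omega), smul_zero]

lemma lie_expMinus_of_neg (β h : S.𝔥) {i : ℤ} (hi : i < 0) (n : ℕ) :
    a i h * S.expMinus k (fun j => a j β) n - S.expMinus k (fun j => a j β) n * a i h = 0 := by
  have := derivation_expCoeff_of_weight (H.commute_minus β) (adOp_mul (a i h)) (s := 0)
    (fun j => ?_) n
  · rw [zero_mul, zero_smul] at this; exact this
  · rw [zero_mul, zero_smul, adOp_apply]
    by_cases hj : j = 0
    · simp [hj]
    rw [mul_smul_comm, smul_mul_assoc, ← smul_sub, H, if_neg (by omega), smul_zero]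

lemma lie_expPlus (hk : k ≠ 0) (β h : S.𝔥) {i : ℕ} (hi : i ≠ 0) (n : ℕ) :
    a (-i) h * S.expPlus k (fun j => a j β) n - S.expPlus k (fun j => a j β) n * a (-i) h =
      if i ≤ n then (-S.form (S.proj (-i) h) β) • S.expPlus k (fun j => a j β) (n - i) else 0 := by
  have := derivation_expCoeff_of_central (H.commute_plus β) (adOp_mul (a (-i) h)) hi
    (c := -S.form (S.proj (-i) h) β) (fun j => ?_) n
  · exact this
  · rw [adOp_apply, mul_smul_comm, smul_mul_assoc, ← smul_sub, H]
    by_cases hj : j = i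
    · subst hj
      have h1 : (j : ℂ) ≠ 0 := by exact_mod_cast hi
      have h2 := S.m_ne_zero
      rw [if_pos rfl, if_pos (by omega), smul_smul]
      congr 1
      push_cast
      field_simp
    · rw [if_neg hj, if_neg (by omega), smul_zero]

lemma lie_expPlus_of_pos (β h : S.𝔥) {i : ℤ} (hi : 0 < i) (n : ℕ) :
    a i h * S.expPlus k (fun j => a j β) n - S.expPlus k (fun j => a j β) n * a i h = 0 := by
  have := derivation_expCoeff_of_weight (H.commute_plus β) (adOp_mul (a i h)) (s := 0)
    (fun j => ?_) n
  · rw [zero_mul, zero_smul] at this; exact this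
  · rw [zero_mul, zero_smul, adOp_apply]
    by_cases hj : j = 0
    · simp [hj]
    rw [mul_smul_comm, smul_mul_assoc, ← smul_sub, H, if_neg (by omega), smul_zero]

lemma lie_degree_expMinus {d : R} (hd : ∀ i h, d * a i h - a i h * d = (i : ℂ) • a i h) (β : S.𝔥)
    (n : ℕ) : d * S.expMinus k (fun j => a j β) n - S.expMinus k (fun j => a j β) n * d =
      (-(n : ℂ)) • S.expMinus k (fun j => a j β) n := by
  have := derivation_expCoeff_of_weight (H.commute_minus β) (adOp_mul d) (s := -1)
    (fun j => ?_) n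
  · rw [neg_one_mul] at this; exact this
  · rw [adOp_apply, mul_smul_comm, smul_mul_assoc, ← smul_sub, hd, smul_comm]
    push_cast
    simp

lemma lie_degree_expPlus {d : R} (hd : ∀ i h, d * a i h - a i h * d = (i : ℂ) • a i h) (β : S.𝔥)
    (n : ℕ) : d * S.expPlus k (fun j => a j β) n - S.expPlus k (fun j => a j β) n * d =
      (n : ℂ) • S.expPlus k (fun j => a j β) n := by
  have := derivation_expCoeff_of_weight (H.commute_plus β) (adOp_mul d) (s := 1)
    (fun j => ?_) n
  · rw [one_mul] at this; exact this
  · rw [adOp_apply, mul_smul_comm, smul_mul_assoc, ← smul_sub, hd, smul_comm]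
    push_cast
    simp

end HeisRel

lemma expMinus_zero (S : Data 𝔤) (k : ℂ) {R : Type*} [Ring R] [Algebra ℂ R] (ρ : ℤ → R) :
    S.expMinus k ρ 0 = 1 := Data.expCoeff_zero _

lemma expPlus_zero (S : Data 𝔤) (k : ℂ) {R : Type*} [Ring R] [Algebra ℂ R] (ρ : ℤ → R) :
    S.expPlus k ρ 0 = 1 := Data.expCoeff_zero _

/-! ### Heisenberg modules generated by their vacuum -/

/-- A vector space `E` with operators `a i h` satisfying the Heisenberg relations at level `k`,
which is generated by its vacuum space `W` and decomposes into `W` and the images of the creation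
operators. -/
structure HeisVac (S : Data 𝔤) (k : ℂ) (E W : Type*) [AddCommGroup E] [Module ℂ E]
    [AddCommGroup W] [Module ℂ W] where
  a : ℤ → S.𝔥 →ₗ[ℂ] Module.End ℂ E
  rel : HeisRel S k a
  ι : W →ₗ[ℂ] E
  ε : E →ₗ[ℂ] W
  ε_ι : ∀ w, ε (ι w) = w
  a_ι : ∀ i, 0 < i → ∀ h w, a i h (ι w) = 0
  ε_a : ∀ i, i < 0 → ∀ h v, ε (a i h v) = 0
  vac : ∀ v, (∀ i, 0 < i → ∀ h, a i h v = 0) → ι (ε v) = v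
  gen : ∀ Q : Submodule ℂ E, (∀ w, ι w ∈ Q) → (∀ i, i < 0 → ∀ h, ∀ v ∈ Q, a i h v ∈ Q) → ∀ v, v ∈ Q

namespace HeisVac

variable {S : Data 𝔤} {k : ℂ} {E W : Type*} [AddCommGroup E] [Module ℂ E]
  [AddCommGroup W] [Module ℂ W] (H : HeisVac S k E W)

/-- A graded family of vectors which is stable under the annihilation operators, bounded above and
has no vacuum component is zero. -/
lemma vector_eq_zero (P : ℤ → Set E)
    (hP : ∀ n, ∀ y ∈ P n, ∀ i, 0 < i → ∀ h, H.a i h y ∈ Submodule.span ℂ (P (n + i)))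
    (hbd : ∃ M, ∀ n, M < n → ∀ y ∈ P n, y = 0) (hε : ∀ n, ∀ y ∈ P n, H.ε y = 0) (n : ℤ) (y : E)
    (hy : y ∈ P n) : y = 0 := by
  obtain ⟨M, hM⟩ := hbd
  -- Descending induction on the degree: once all higher degrees vanish, `y` is killed by the
  -- annihilation operators, hence is a vacuum vector and equals `ι (ε y) = 0`.
  have key : ∀ t : ℕ, ∀ n, M - t < n → ∀ y ∈ P n, y = 0 := by
    intro t
    induction t with
    | zero => intro n hn; exact hM n (by simpa using hn)
    | succ t ih =>
      intro n hn y hy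
      rw [← H.vac y, hε n y hy, map_zero]
      intro i hi h
      have h1 := hP n y hy i hi h
      have h2 : Submodule.span ℂ (P (n + i)) = ⊥ :=
        Submodule.span_eq_bot.mpr (ih (n + i) (by push_cast at hn; omega))
      rw [h2] at h1
      simpa using h1
  exact key (M - n + 1).toNat n (by omega) y hy

/-- A graded family of operators which is stable under commutators with the Heisenberg operators,
bounded above and has vacuum expectation values zero is zero. -/
lemma operator_eq_zero (P : ℤ → Set (Module.End ℂ E))
    (hP : ∀ n, ∀ Y ∈ P n, ∀ i, i ≠ 0 → ∀ h,
      H.a i h * Y - Y * H.a i h ∈ Submodule.span ℂ (P (n + i)))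
    (hbd : ∀ w, ∃ M : ℤ, ∀ n, M < n → ∀ Y ∈ P n, Y (H.ι w) = 0)
    (hε : ∀ n, ∀ Y ∈ P n, ∀ w, H.ε (Y (H.ι w)) = 0) (n : ℤ) (Y : Module.End ℂ E)
    (hY : Y ∈ P n) : Y = 0 := by
  -- Applied to `Y (ι w)`, an annihilation operator acts through its commutator with `Y`, so these
  -- vectors form a family to which `vector_eq_zero` applies.
  have h1 : ∀ w, ∀ n, ∀ Y ∈ P n, Y (H.ι w) = 0 := by
    intro w n Y hY
    refine H.vector_eq_zero (fun n => (fun Y : Module.End ℂ E => Y (H.ι w)) '' P n) ?_ ?_ ?_ n _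
      ⟨Y, hY, rfl⟩
    · rintro n _ ⟨Y, hY, rfl⟩ i hi h
      have h2 := Submodule.mem_map_of_mem (f := LinearMap.applyₗ (R := ℂ) (H.ι w))
        (hP n Y hY i hi.ne' h)
      rw [Submodule.map_span] at h2
      have h3 : (LinearMap.applyₗ (R := ℂ) (H.ι w)) (H.a i h * Y - Y * H.a i h) =
          H.a i h (Y (H.ι w)) := by
        simp [H.a_ι i hi]
      rwa [h3] at h2
    · obtain ⟨M, hM⟩ := hbd w
      exact ⟨M, by rintro n hn _ ⟨Y, hY, rfl⟩; exact hM n hn Y hY⟩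
    · rintro n _ ⟨Y, hY, rfl⟩
      exact hε n Y hY w
  -- The common kernel contains the vacuum and is stable under creation operators, since `Y a v = a
  -- Y v - [a, Y] v` and `[a, Y]` lies in the span of the family; `gen` then makes it everything.
  let Q : Submodule ℂ E := ⨅ (n : ℤ) (Y : P n), LinearMap.ker (Y : Module.End ℂ E)
  have hQ : ∀ v, v ∈ Q ↔ ∀ n, ∀ Y ∈ P n, Y v = 0 := by
    intro v; simp [Q, Submodule.mem_iInf]
  ext v
  refine (hQ v).mp (H.gen Q (fun w => (hQ _).mpr (h1 w)) ?_ v) n Y hY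
  intro i hi h v hv
  rw [hQ] at hv ⊢
  intro n Y hY
  have h4 : ∀ Z ∈ Submodule.span ℂ (P (n + i)), Z v = 0 := by
    intro Z hZ
    induction hZ using Submodule.span_induction with
    | mem Z hZ => exact hv _ Z hZ
    | zero => rfl
    | add Z Z' _ _ h h' => rw [LinearMap.add_apply, h, h', add_zero]
    | smul c Z _ h => rw [LinearMap.smul_apply, h, smul_zero]
  have h5 := h4 _ (hP n Y hY i hi.ne h)
  simpa [hv n Y hY] using h5

/-- The coefficients of `E⁻(β, ζ)` on `E`. -/
abbrev Em (β : S.𝔥) (n : ℕ) : Module.End ℂ E := S.expMinus k (fun j => H.a j β) n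

/-- The coefficients of `E⁺(β, ζ)` on `E`. -/
abbrev Ep (β : S.𝔥) (n : ℕ) : Module.End ℂ E := S.expPlus k (fun j => H.a j β) n

/-- By the recursion, `n` times the `n`-th coefficient is a sum of terms with a creation operator on
the left, and `ε` kills their images. -/
lemma ε_Em (β : S.𝔥) {n : ℕ} (hn : n ≠ 0) (v : E) : H.ε (H.Em β n v) = 0 := by
  have h := congrArg H.ε (LinearMap.congr_fun (H.rel.smul_expMinus β n) v)
  rw [LinearMap.smul_apply, map_smul, LinearMap.sum_apply, map_sum, Finset.sum_eq_zero] at h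
  · exact (smul_eq_zero_iff_right (by exact_mod_cast hn)).mp h
  · intro p _
    by_cases hp : p.1 = 0
    · simp [hp]
    · rw [LinearMap.smul_apply, Module.End.mul_apply, map_smul, H.ε_a _ (by omega), smul_zero]

lemma Ep_ι (β : S.𝔥) {n : ℕ} (hn : n ≠ 0) (w : W) : H.Ep β n (H.ι w) = 0 := by
  induction n using Nat.strong_induction_on with
  | _ n ih =>
    have h := LinearMap.congr_fun (H.rel.smul_expPlus β n) (H.ι w)
    rw [LinearMap.smul_apply, LinearMap.sum_apply, Finset.sum_eq_zero] at h
    · exact (smul_eq_zero_iff_right (by exact_mod_cast hn)).mp h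
    · intro p hp
      have hp := Finset.HasAntidiagonal.mem_antidiagonal.mp hp
      by_cases hp1 : p.1 = 0
      · simp [hp1]
      rw [LinearMap.smul_apply, Module.End.mul_apply]
      by_cases hp2 : p.2 = 0
      · rw [hp2, expPlus_zero, Module.End.one_apply, H.a_ι _ (by omega), smul_zero]
      · rw [ih p.2 (by omega) hp2, map_zero, smul_zero]

/-- The operators `X n` have the commutation relations with the Heisenberg operators of the
coefficients of `x_β(r, ζ)`, and annihilate each vacuum vector for large `n`. -/
structure IsVertex (β : S.𝔥) (X : ℤ → Module.End ℂ E) : Prop where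
  lie : ∀ i, i ≠ 0 → ∀ h n, H.a i h * X n - X n * H.a i h = S.form (S.proj i h) β • X (n + i)
  bdd : ∀ w, ∃ M : ℤ, ∀ n, M < n → X n (H.ι w) = 0

variable {H}

/-! ### Vertex operators and their vacuum expectation values. -/

namespace IsVertex

variable {β : S.𝔥} {X : ℤ → Module.End ℂ E} (hX : H.IsVertex β X)

include hX

lemma a_X_ι {i : ℤ} (hi : 0 < i) (h : S.𝔥) (n : ℤ) (w : W) :
    H.a i h (X n (H.ι w)) = S.form (S.proj i h) β • X (n + i) (H.ι w) := by
  have := LinearMap.congr_fun (hX.lie i hi.ne' h n) (H.ι w)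
  simpa [H.a_ι i hi] using this

lemma finite_Em_X (γ : S.𝔥) (n : ℤ) (w : W) :
    (fun a : ℕ => H.Em γ a (X (n + a) (H.ι w))).HasFiniteSupport := by
  obtain ⟨M, hM⟩ := hX.bdd w
  refine hasFiniteSupport_of_le (M - n + 1).toNat fun a ha => ?_
  rw [hM _ (by omega), map_zero]

lemma finite_Em_Z (γ : S.𝔥) (n : ℤ) (w : W) :
    (fun a : ℕ => H.Em γ a (H.ι (H.ε (X (n + a) (H.ι w))))).HasFiniteSupport := by
  obtain ⟨M, hM⟩ := hX.bdd w
  refine hasFiniteSupport_of_le (M - n + 1).toNat fun a ha => ?_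
  rw [hM _ (by omega), map_zero, map_zero, map_zero]

/-- On the vacuum `E⁻(β, ζ) X(ζ)` takes values in the vacuum. -/
lemma finsum_Em_X (hk : k ≠ 0) (n : ℤ) (w : W) :
    ∑ᶠ a : ℕ, H.Em β a (X (n + a) (H.ι w)) = H.ι (H.ε (X n (H.ι w))) := by
  have hfin := hX.finite_Em_X β
  have h1 : H.ε (∑ᶠ a : ℕ, H.Em β a (X (n + a) (H.ι w))) = H.ε (X n (H.ι w)) := by
    rw [linear_finsum _ (hfin n w), finsum_eq_single _ 0 fun a ha => H.ε_Em β ha _]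
    simp [expMinus_zero]
  rw [← h1, H.vac]
  intro i hi h
  rw [linear_finsum _ (hfin n w)]
  lift i to ℕ using hi.le
  have hi' : i ≠ 0 := by omega
  set c := S.form (S.proj i h) β
  -- The commutator with `X` shifts its index by `i` with coefficient `c`; the commutator with `E⁻`
  -- lowers `a` by `i` with coefficient `-c`. After the shift `a ↦ a + i` the two sums cancel, so
  -- the total is a vacuum vector.
  have h2 : ∀ a : ℕ, H.a i h (H.Em β a (X (n + a) (H.ι w))) =
      c • H.Em β a (X (n + i + a) (H.ι w)) -
        (if i ≤ a then c • H.Em β (a - i) (X (n + a) (H.ι w)) else 0) := by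
    intro a
    have h3 := LinearMap.congr_fun (H.rel.lie_expMinus hk β h hi' a) (X (n + a) (H.ι w))
    rw [LinearMap.sub_apply, Module.End.mul_apply, Module.End.mul_apply, sub_eq_iff_eq_add,
      hX.a_X_ι hi, map_smul, show n + (a : ℤ) + i = n + i + a by ring] at h3
    rw [h3]
    split_ifs <;> simp [c, add_comm, sub_eq_add_neg]
  rw [finsum_congr h2, finsum_sub_distrib, sub_eq_zero]
  · refine Eq.trans (finsum_congr fun a => ?_) (finsum_nat_shift i fun a ha => if_neg (by omega))
    rw [if_pos (Nat.le_add_left i a), Nat.add_sub_cancel]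
    congr 4
    push_cast; ring
  · exact hasFiniteSupport_linear (c • LinearMap.id) (hfin (n + i) w)
  · obtain ⟨M, hM⟩ := hX.bdd w
    refine hasFiniteSupport_of_le (M - n + 1).toNat fun a ha => ?_
    rw [hM _ (by omega), map_zero, smul_zero, ite_self]

/-- On the vacuum `X(ζ) = E⁻(-β, ζ) Z(ζ)`, where `Z(ζ)` is the vacuum expectation value. -/
lemma X_ι_eq_finsum (hk : k ≠ 0) (n : ℤ) (w : W) :
    X n (H.ι w) = ∑ᶠ a : ℕ, H.Em (-β) a (H.ι (H.ε (X (n + a) (H.ι w)))) := by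
  have hfin := hX.finite_Em_Z (-β)
  rw [← sub_eq_zero]
  -- No inversion of `E⁻(β, ζ)` is needed: the difference is a graded family on which annihilation
  -- operators act with the same scalar, and its vacuum component is zero.
  refine H.vector_eq_zero (fun n => {X n (H.ι w) -
    ∑ᶠ a : ℕ, H.Em (-β) a (H.ι (H.ε (X (n + a) (H.ι w))))}) ?_ ?_ ?_ n _ rfl
  · rintro n _ rfl i hi h
    refine Submodule.mem_span_singleton.mpr ⟨S.form (S.proj i h) β, ?_⟩
    rw [map_sub, hX.a_X_ι hi, smul_sub]
    congr 1
    rw [linear_finsum _ (hfin n w)]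
    lift i to ℕ using hi.le
    have hi' : i ≠ 0 := by omega
    set c := S.form (S.proj i h) β with hc
    have h2 : ∀ a : ℕ, H.a i h (H.Em (-β) a (H.ι (H.ε (X (n + a) (H.ι w))))) =
        if i ≤ a then c • H.Em (-β) (a - i) (H.ι (H.ε (X (n + a) (H.ι w)))) else 0 := by
      intro a
      have h3 := LinearMap.congr_fun (H.rel.lie_expMinus hk (-β) h hi' a)
        (H.ι (H.ε (X (n + a) (H.ι w))))
      rw [LinearMap.sub_apply, Module.End.mul_apply, Module.End.mul_apply, H.a_ι _ hi, map_zero,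
        sub_zero] at h3
      rw [h3]
      split_ifs
      · rw [LinearMap.smul_apply, NegMemClass.coe_neg, map_neg, neg_neg]
      · rfl
    rw [finsum_congr h2, smul_finsum' _ (hfin _ w)]
    refine Eq.trans (finsum_congr fun a => ?_) (finsum_nat_shift i fun a ha => if_neg (by omega))
    rw [if_pos (Nat.le_add_left i a), Nat.add_sub_cancel]
    congr 6
    push_cast; ring
  · obtain ⟨M, hM⟩ := hX.bdd w
    refine ⟨M, ?_⟩
    rintro n hn _ rfl
    rw [hM n hn, finsum_eq_zero_of_forall_eq_zero, sub_zero]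
    intro a
    rw [hM _ (by omega), map_zero, map_zero, map_zero]
  · rintro n _ rfl
    rw [map_sub, linear_finsum _ (hfin n w), finsum_eq_single _ 0 fun a ha => H.ε_Em _ ha _]
    simp [expMinus_zero, H.ε_ι]

/-- The vacuum expectation value of `X(ζ₁) E⁻(-γ, ζ₂)`. -/
lemma ε_X_Em (γ : S.𝔥) (n : ℕ) (b : ℤ) (w : W) :
    H.ε (X b (H.Em (-γ) n (H.ι w))) = S.prodCoeff k β γ n • H.ε (X (b - n) (H.ι w)) := by
  induction n using Nat.strong_induction_on generalizing b with
  | _ n ih =>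
    rcases Nat.eq_zero_or_pos n with rfl | hn
    · simp [expMinus_zero, Data.prodCoeff_zero]
    have hn' : (n : ℂ) ≠ 0 := by exact_mod_cast hn.ne'
    apply smul_right_injective _ hn'
    -- The recursion for `E⁻(-γ)` exposes a creation operator next to `X b`. Moved to the left it is
    -- killed by `ε`, and what remains, its commutator with `X`, reproduces the recursion of
    -- `mul_prodCoeff`.
    have h := congrArg (fun v => H.ε (X b v))
      (LinearMap.congr_fun (H.rel.smul_expMinus (-γ) n) (H.ι w))
    simp only [LinearMap.smul_apply, map_smul, LinearMap.sum_apply, map_sum,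
      Module.End.mul_apply] at h
    simp only
    rw [h, smul_smul, Data.mul_prodCoeff, Finset.sum_smul]
    refine Finset.sum_congr rfl fun p hp => ?_
    have hp := Finset.HasAntidiagonal.mem_antidiagonal.mp hp
    by_cases hp1 : p.1 = 0
    · simp [hp1]
    set u := S.expMinus k (fun j => H.a j (-γ)) p.2 (H.ι w) with hu
    have h1 := congrArg H.ε (LinearMap.congr_fun (hX.lie (-(p.1 : ℤ)) (by omega) (-γ) b) u)
    rw [LinearMap.sub_apply, Module.End.mul_apply, Module.End.mul_apply, map_sub,
      H.ε_a _ (by omega), zero_sub, neg_eq_iff_eq_neg] at h1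
    rw [if_neg hp1, if_neg hp1, h1, LinearMap.smul_apply, map_smul, ih p.2 (by omega)]
    have h2 : S.form (S.proj (-(p.1 : ℤ)) ((-γ : S.𝔥) : 𝔤)) β = - S.form (S.proj p.1 β) γ := by
      rw [S.form_proj_left, neg_neg, S.form_comm, NegMemClass.coe_neg, map_neg]
    rw [h2, show b + -(p.1 : ℤ) - p.2 = b - n by omega]
    module

end IsVertex

/-- The vacuum expectation value of a product of two vertex operators. -/
lemma ε_X_X {β γ : S.𝔥} {X Y : ℤ → Module.End ℂ E} (hX : H.IsVertex β X) (hY : H.IsVertex γ Y)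
    (hk : k ≠ 0) (a b : ℤ) (w : W) : H.ε (X a (Y b (H.ι w))) =
      ∑ᶠ n : ℕ, S.prodCoeff k β γ n •
        H.ε (X (a - n) (H.ι (H.ε (Y (b + n) (H.ι w))))) := by
  rw [hY.X_ι_eq_finsum hk, ← LinearMap.comp_apply, linear_finsum _ (hY.finite_Em_Z (-γ) b w)]
  exact finsum_congr fun n => hX.ε_X_Em γ n a _

/-- The formula for the vacuum expectation value of a vertex operator as a product of series. -/
lemma IsVertex.finsum_Em_X_Ep {β : S.𝔥} {X : ℤ → Module.End ℂ E} (hX : H.IsVertex β X)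
    (hk : k ≠ 0) (n : ℤ) (w : W) :
    ∑ᶠ ab : ℕ × ℕ, H.Em β ab.1 (X (n + ab.1 - ab.2) (H.Ep β ab.2 (H.ι w))) =
      H.ι (H.ε (X n (H.ι w))) := by
  rw [← hX.finsum_Em_X hk, ← finsum_comp_injective (e := fun a : ℕ => (a, 0))]
  · simp [expPlus_zero]
  · intro a b h; simpa using h
  · rintro ⟨a, b⟩ hab
    have hb : b ≠ 0 := by
      rintro rfl; exact hab ⟨a, rfl⟩
    rw [H.Ep_ι β hb, map_zero, map_zero]

end HeisVac

end

section

namespace Data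

section Verma

variable {𝔤 : Type u} [LieRing 𝔤] [LieAlgebra ℂ 𝔤] (S : Data 𝔤)

/-! ### The Heisenberg subalgebra -/

/-- The projection of `𝔥` to `𝔥_i`. -/
def projH (i : ℤ) : S.𝔥 →ₗ[ℂ] S.𝔥 :=
  (S.proj i).restrict (p := S.𝔥.toSubmodule) (q := S.𝔥.toSubmodule) fun _ hx => S.proj_mem i hx

@[simp] lemma coe_projH (i : ℤ) (h : S.𝔥) : (S.projH i h : 𝔤) = S.proj i h := rfl

/-- `h ↦ h_i ⊗ t^i` as a linear map to `𝔥~`. -/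
def hElₗ (i : ℤ) : S.𝔥 →ₗ[ℂ] S.hT where
  toFun h := S.hEl h i
  map_add' x y := Subtype.ext (S.gEl_add x y i 0)
  map_smul' c x := Subtype.ext (S.gEl_smul c x i 0)

/-- For `r = 0` the relation of `d_A` reads `q t^{mq} k_0 = 0`. Consequently the only central term
arising between Heisenberg generators is `k_0` itself. -/
lemma kEl_zero_zero_of_ne {q : ℤ} (hq : q ≠ 0) : S.kEl 0 0 q = 0 := by
  have h := S.sum_kEl 0 q
  simp only [Pi.zero_apply, Int.cast_zero, zero_smul, Finset.sum_const_zero, zero_add] at h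
  exact (smul_eq_zero_iff_right (by exact_mod_cast hq)).mp h

lemma cEl_zero_zero (i j : ℤ) :
    S.cEl i j 0 0 = if i + j = 0 then (i / S.m : ℂ) • S.kEl 0 0 0 else 0 := by
  unfold cEl
  by_cases h : i + j = 0
  · simp [h]
  · rw [if_neg h]
    split_ifs with h1
    · obtain ⟨q, hq⟩ := h1
      have hq0 : q ≠ 0 := by rintro rfl; simp at hq; exact h hq
      have hm : (S.m : ℤ) ≠ 0 := by exact_mod_cast S.m_pos.ne'
      rw [hq, Int.mul_ediv_cancel_left _ hm, add_zero, S.kEl_zero_zero_of_ne hq0]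
      simp
    · rfl

variable [FiniteDimensional ℂ 𝔤] [LieAlgebra.IsSemisimple ℂ 𝔤]

lemma gEl_lie_gEl_cartan (h h' : S.𝔥) (i j : ℤ) : ⁅S.gEl h i 0, S.gEl h' j 0⁆ =
    if i + j = 0 then (i / S.m * S.form (S.proj i h) h' : ℂ) • S.kEl 0 0 0 else 0 := by
  rw [gEl_lie_gEl, S.lie_cartan (S.proj_mem i h.2) h'.2, cEl_zero_zero]
  have : S.gEl (0 : 𝔤) (i + j) (0 + 0) = 0 := (S.gElₗ _ _).map_zero
  rw [this, zero_add]
  split_ifs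
  · rw [smul_smul, mul_comm]
  · rw [smul_zero]

/-- Brackets of generators are multiples of generators, so their linear span is already a Lie
subalgebra. -/
lemma hT_eq_span : S.hT.toSubmodule = Submodule.span ℂ
    ({y | ∃ (h : S.𝔥) (i : ℤ), y = S.gEl h i 0} ∪ {S.kEl 0 0 0, S.dEl 0}) := by
  set G : Set S.L := {y | ∃ (h : S.𝔥) (i : ℤ), y = S.gEl h i 0} ∪ {S.kEl 0 0 0, S.dEl 0} with hG
  have hg : ∀ (h : S.𝔥) i, S.gEl h i 0 ∈ Submodule.span ℂ G := fun h i =>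
    Submodule.subset_span (Or.inl ⟨h, i, rfl⟩)
  have hkk : S.kEl 0 0 0 ∈ Submodule.span ℂ G := Submodule.subset_span (Or.inr (Or.inl rfl))
  have gen : ∀ x ∈ G, ∀ y ∈ G, ⁅x, y⁆ ∈ Submodule.span ℂ G := by
    rintro x (⟨h, i, rfl⟩ | rfl | rfl) y (⟨h', j, rfl⟩ | rfl | rfl)
    · rw [gEl_lie_gEl_cartan]
      split_ifs
      · exact Submodule.smul_mem _ _ hkk
      · exact zero_mem _
    · rw [gEl_lie_kEl]; exact zero_mem _
    · rw [← lie_skew, dEl_lie_gEl]; exact neg_mem (Submodule.smul_mem _ _ (hg h i))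
    · rw [kEl_lie_gEl]; exact zero_mem _
    · rw [lie_self]; exact zero_mem _
    · rw [← lie_skew, dEl_lie_kEl]; exact neg_mem (Submodule.smul_mem _ _ hkk)
    · rw [dEl_lie_gEl]; exact Submodule.smul_mem _ _ (hg h' j)
    · rw [dEl_lie_kEl]; exact Submodule.smul_mem _ _ hkk
    · rw [lie_self]; exact zero_mem _
  have key : ∀ x ∈ Submodule.span ℂ G, ∀ y ∈ Submodule.span ℂ G, ⁅x, y⁆ ∈ Submodule.span ℂ G := by
    intro x hx y hy
    induction hx using Submodule.span_induction with
    | mem x hx =>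
      induction hy using Submodule.span_induction with
      | mem y hy => exact gen x hx y hy
      | zero => rw [lie_zero]; exact zero_mem _
      | add y y' _ _ h h' => rw [lie_add]; exact add_mem h h'
      | smul c y _ h => rw [lie_smul]; exact Submodule.smul_mem _ _ h
    | zero => rw [zero_lie]; exact zero_mem _
    | add x x' _ _ h h' => rw [add_lie]; exact add_mem h h'
    | smul c x _ h => rw [smul_lie]; exact Submodule.smul_mem _ _ h
  let T : LieSubalgebra ℂ S.L :=
    { Submodule.span ℂ G with lie_mem' := fun {x y} hx hy => key x hx y hy }
  apply le_antisymm
  · have : S.hT ≤ T := LieSubalgebra.lieSpan_le.mpr Submodule.subset_span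
    exact this
  · exact Submodule.span_le.mpr LieSubalgebra.subset_lieSpan

lemma hT_induction {P : S.hT → Prop} (hadd : ∀ x y, P x → P y → P (x + y))
    (hsmul : ∀ (c : ℂ) x, P x → P (c • x)) (hg : ∀ h i, P (S.hEl h i)) (hk : P S.hk)
    (hd : P S.hd) (y : S.hT) : P y := by
  obtain ⟨y, hy⟩ := y
  have hy' : y ∈ S.hT.toSubmodule := hy
  rw [hT_eq_span] at hy'
  suffices ∀ y ∈ Submodule.span ℂ ({y | ∃ (h : S.𝔥) (i : ℤ), y = S.gEl h i 0} ∪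
      {S.kEl 0 0 0, S.dEl 0}), ∃ hy : y ∈ S.hT, P ⟨y, hy⟩ from (this y hy').2
  intro y hy
  induction hy using Submodule.span_induction with
  | mem y hy =>
    rcases hy with ⟨h, i, rfl⟩ | rfl | rfl
    · exact ⟨_, hg h i⟩
    · exact ⟨_, hk⟩
    · exact ⟨_, hd⟩
  | zero => exact ⟨S.hT.zero_mem, by have := hsmul 0 _ hk; rwa [zero_smul] at this⟩
  | add x y _ _ hx hy =>
    obtain ⟨h1, h1'⟩ := hx
    obtain ⟨h2, h2'⟩ := hy
    exact ⟨S.hT.add_mem h1 h2, hadd _ _ h1' h2'⟩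
  | smul c x _ hx =>
    obtain ⟨h1, h1'⟩ := hx
    exact ⟨S.hT.smul_mem c h1, hsmul c _ h1'⟩

/-! ### The universal property of the Verma module -/

section Lift

variable {E : Type*} [AddCommGroup E] [Module ℂ E] (k : ℂ) (a : ℤ → S.𝔥 →ₗ[ℂ] Module.End ℂ E)
  (D : Module.End ℂ E)

omit [FiniteDimensional ℂ 𝔤] [LieAlgebra.IsSemisimple ℂ 𝔤] in
-- The family is supported at `i = 0`, `γ = 0`, where the degree in the coefficient is zero; thus
-- the value chosen for `k_0` is compatible with `d_A`.
lemma heisMap_rel (e : E) (γ : S.Exp) :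
    ∑ i, ((if i = 0 then (S.m : ℂ)⁻¹ else 1) * S.deg γ i) • (if i = 0 ∧ γ = 0 then e else 0) =
      0 := by
  refine Finset.sum_eq_zero fun i _ => ?_
  split_ifs with h1 h2 h2
  · rw [h2.2]; simp [h1, deg]
  · simp
  · exact absurd h2.1 h1
  · simp

/-- The linear map `𝔥~ → End E` given by operators `a i h` for `h_i ⊗ t^i` and `D` for `d_0`. -/
def heisMap : S.hT →ₗ[ℂ] Module.End ℂ E :=
  S.torLift (fun γ => if γ.2 = 0 then a γ.1 ∘ₗ S.cartanProj else 0)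
    (fun i γ => if i = 0 ∧ γ = 0 then k • (1 : Module.End ℂ E) else 0) (S.heisMap_rel _)
    (fun i => if i = 0 then D else 0) ∘ₗ S.L.toSubmodule.subtype ∘ₗ S.hT.toSubmodule.subtype

variable {k a D}

lemma heisMap_hEl (ha : ∀ i h, a i (S.projH i h) = a i h) (h : S.𝔥) (i : ℤ) :
    S.heisMap k a D (S.hEl h i) = a i h := by
  have := S.torLift_gEl (fun γ => if γ.2 = 0 then a γ.1 ∘ₗ S.cartanProj else 0)
    (fun i γ => if i = 0 ∧ γ = 0 then k • (1 : Module.End ℂ E) else 0) (S.heisMap_rel _)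
    (fun i => if i = 0 then D else 0) (h : 𝔤) i 0
  rw [if_pos rfl, LinearMap.comp_apply, ← coe_projH, cartanProj_cartan, ha] at this
  exact this

lemma heisMap_hk : S.heisMap k a D S.hk = k • 1 := by
  refine (S.torLift_kEl (fun γ => if γ.2 = 0 then a γ.1 ∘ₗ S.cartanProj else 0) _
    (S.heisMap_rel _) (fun i => if i = 0 then D else 0) _ _ _).trans ?_
  rw [if_pos]
  simp

lemma heisMap_hd : S.heisMap k a D S.hd = D :=
  (S.torLift_dEl (fun γ => if γ.2 = 0 then a γ.1 ∘ₗ S.cartanProj else 0) _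
    (S.heisMap_rel (k • 1)) _ _).trans (if_pos rfl)

lemma heisMap_lie (ha : ∀ i h, a i (S.projH i h) = a i h) (H : HeisRel S k a)
    (hD : ∀ i h, D * a i h - a i h * D = (i : ℂ) • a i h) (x y : S.hT) :
    S.heisMap k a D ⁅x, y⁆ =
      S.heisMap k a D x * S.heisMap k a D y - S.heisMap k a D y * S.heisMap k a D x := by
  have e1 : ∀ h h' i j, ⁅S.hEl h i, S.hEl h' j⁆ =
    if i + j = 0 then (i / S.m * S.form (S.proj i h) h' : ℂ) • S.hk else 0 := by
    intro h h' i j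
    apply Subtype.ext
    refine (S.gEl_lie_gEl_cartan h h' i j).trans ?_
    split_ifs <;> rfl
  have e2 : ∀ h i, ⁅S.hEl h i, S.hk⁆ = 0 := fun h i => Subtype.ext (S.gEl_lie_kEl _ _ _ _ _ _)
  have e3 : ∀ h i, ⁅S.hd, S.hEl h i⁆ = (i : ℂ) • S.hEl h i := fun h i =>
    Subtype.ext (S.dEl_lie_gEl _ _ _ _)
  have e4 : ⁅S.hd, S.hk⁆ = 0 := Subtype.ext <| (S.dEl_lie_kEl _ _ _ _).trans (by simp [deg])
  induction x using S.hT_induction with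
  | hadd x x' hx hx' => rw [add_lie, map_add, hx, hx', map_add]; noncomm_ring
  | hsmul c x hx => rw [smul_lie, map_smul, hx, map_smul, smul_mul_assoc, mul_smul_comm, smul_sub]
  | hg h i =>
    induction y using S.hT_induction with
    | hadd x x' hx hx' => rw [lie_add, map_add, hx, hx', map_add]; noncomm_ring
    | hsmul c x hx => rw [lie_smul, map_smul, hx, map_smul, smul_mul_assoc, mul_smul_comm, smul_sub]
    | hg h' j =>
      rw [e1, S.heisMap_hEl ha, S.heisMap_hEl ha, H]
      split_ifs
      · rw [map_smul, heisMap_hk, smul_smul]; congr 1; ring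
      · rw [map_zero]
    | hk => rw [e2, map_zero, heisMap_hk]; simp
    | hd =>
      rw [← lie_skew, e3, map_neg, map_smul, S.heisMap_hEl ha, heisMap_hd, ← hD]; abel
  | hk =>
    induction y using S.hT_induction with
    | hadd x x' hx hx' => rw [lie_add, map_add, hx, hx', map_add]; noncomm_ring
    | hsmul c x hx => rw [lie_smul, map_smul, hx, map_smul, smul_mul_assoc, mul_smul_comm, smul_sub]
    | hg h' j => rw [← lie_skew, e2, neg_zero, map_zero, heisMap_hk]; simp
    | hk => rw [lie_self, map_zero, sub_self]
    | hd => rw [← lie_skew, e4, neg_zero, map_zero, heisMap_hk]; simp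
  | hd =>
    rw [heisMap_hd]
    induction y using S.hT_induction with
    | hadd x x' hx hx' => rw [lie_add, map_add, hx, hx', map_add]; noncomm_ring
    | hsmul c x hx => rw [lie_smul, map_smul, hx, map_smul, smul_mul_assoc, mul_smul_comm, smul_sub]
    | hg h' j => rw [e3, map_smul, S.heisMap_hEl ha, hD]
    | hk => rw [e4, map_zero, heisMap_hk]; simp
    | hd => rw [lie_self, map_zero, heisMap_hd, sub_self]

omit [FiniteDimensional ℂ 𝔤] [LieAlgebra.IsSemisimple ℂ 𝔤] in
/-- The extension of a representation of `𝔥~` to its enveloping algebra. -/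
lemma exists_algHom (T : S.hT →ₗ[ℂ] Module.End ℂ E)
    (hT : ∀ x y, T ⁅x, y⁆ = T x * T y - T y * T x) :
    ∃ F : S.UH →ₐ[ℂ] Module.End ℂ E, ∀ y, F (S.ιH y) = T y := by
  let _ : LieRing (Module.End ℂ E) := LieRing.ofAssociativeRing
  let T' : S.hT →ₗ⁅ℂ⁆ Module.End ℂ E := { T with map_lie' := fun {x y} => hT x y }
  exact ⟨UniversalEnvelopingAlgebra.lift ℂ T', fun y => UniversalEnvelopingAlgebra.lift_ι_apply ℂ T' y⟩

end Lift

/-- The highest weight vector of the Verma module. -/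
def vermaOne (k : ℂ) : S.Verma k := Submodule.Quotient.mk 1

/-- The operators extend to a representation `F` of the enveloping algebra, and `P ↦ F P e` kills
the generators of `vermaIdeal` because `e` satisfies the conditions of a highest weight vector.
Prescribing `D` as well makes the lift compatible with degrees. -/
lemma exists_vermaLift {E : Type*} [AddCommGroup E] [Module ℂ E] {k : ℂ}
    {a : ℤ → S.𝔥 →ₗ[ℂ] Module.End ℂ E} {D : Module.End ℂ E}
    (ha : ∀ i h, a i (S.projH i h) = a i h) (H : HeisRel S k a)
    (hD : ∀ i h, D * a i h - a i h * D = (i : ℂ) • a i h) (e : E)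
    (he : ∀ i h, 0 ≤ i → a i h e = 0) (hDe : D e = 0) :
    ∃ φ : S.Verma k →ₗ[ℂ] E, φ (S.vermaOne k) = e ∧
      (∀ h i u, φ (S.vermaAct k (S.hEl h i) u) = a i h (φ u)) ∧
      ∀ u, φ (S.vermaAct k S.hd u) = D (φ u) := by
  obtain ⟨F, hF⟩ := S.exists_algHom (S.heisMap k a D) (S.heisMap_lie ha H hD)
  let f : S.UH →ₛₗ[(F : S.UH →+* Module.End ℂ E)] E :=
    { toFun := fun P => F P e
      map_add' := fun P Q => by simp
      map_smul' := fun P Q => by simp }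
  have hf : S.vermaIdeal k ≤ LinearMap.ker f := by
    refine Submodule.span_le.mpr ?_
    rintro _ (⟨h, i, hi, rfl⟩ | rfl | rfl)
    · change F _ e = 0
      rw [hF, S.heisMap_hEl ha, he i h hi]
    · change F _ e = 0
      rw [map_sub, hF, heisMap_hk, AlgHom.commutes, Algebra.algebraMap_eq_smul_one, sub_self]
      rfl
    · change F _ e = 0
      rw [hF, heisMap_hd, hDe]
  let g := (S.vermaIdeal k).liftQ f hf
  have hg : ∀ (P : S.UH) u, g (P • u) = F P (g u) := fun P u => map_smulₛₗ g P u
  refine ⟨{ toFun := g, map_add' := map_add g, map_smul' := fun c u => ?_ }, ?_, ?_, ?_⟩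
  · rw [← algebraMap_smul S.UH c u, hg, AlgHom.commutes]
    simp [Algebra.algebraMap_eq_smul_one]
  · change F 1 e = e
    rw [map_one]; rfl
  · intro h i u
    refine (hg _ u).trans ?_
    rw [hF, S.heisMap_hEl ha]; rfl
  · intro u
    refine (hg _ u).trans ?_
    rw [hF, heisMap_hd]; rfl

end Verma

end Data

end

section

namespace Data

section VermaStructure

variable {𝔤 : Type u} [LieRing 𝔤] [LieAlgebra ℂ 𝔤] (S : Data 𝔤)

/-! ### The structure of the Verma module -/

lemma UH_induction {P : S.UH → Prop} (halg : ∀ c, P (algebraMap ℂ S.UH c)) (hι : ∀ y, P (S.ιH y))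
    (hmul : ∀ x y, P x → P y → P (x * y)) (hadd : ∀ x y, P x → P y → P (x + y)) (x : S.UH) :
    P x := by
  obtain ⟨x, rfl⟩ : ∃ z, UniversalEnvelopingAlgebra.mkAlgHom ℂ S.hT z = x :=
    Quotient.exists_rep x
  induction x using TensorAlgebra.induction with
  | algebraMap c => rw [AlgHom.commutes]; exact halg c
  | ι y => exact hι y
  | mul x y hx hy => rw [map_mul]; exact hmul _ _ hx hy
  | add x y hx hy => rw [map_add]; exact hadd _ _ hx hy

lemma ιH_lie (x y : S.hT) : S.ιH ⁅x, y⁆ = S.ιH x * S.ιH y - S.ιH y * S.ιH x :=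
  let _ : LieRing (UniversalEnvelopingAlgebra ℂ S.hT) := LieRing.ofAssociativeRing
  LieHom.map_lie (UniversalEnvelopingAlgebra.ι ℂ) x y

lemma ιH_add (x y : S.hT) : S.ιH (x + y) = S.ιH x + S.ιH y :=
  let _ : LieRing (UniversalEnvelopingAlgebra ℂ S.hT) := LieRing.ofAssociativeRing
  map_add (UniversalEnvelopingAlgebra.ι ℂ) x y

lemma ιH_smul (c : ℂ) (x : S.hT) : S.ιH (c • x) = c • S.ιH x :=
  let _ : LieRing (UniversalEnvelopingAlgebra ℂ S.hT) := LieRing.ofAssociativeRing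
  map_smul (UniversalEnvelopingAlgebra.ι ℂ) c x

variable (k : ℂ)

lemma vermaAct_apply (y : S.hT) (u : S.Verma k) : S.vermaAct k y u = S.ιH y • u := rfl

/-- The action of `𝔥~` on the Verma module as a linear map. -/
def vermaActₗ : S.hT →ₗ[ℂ] Module.End ℂ (S.Verma k) where
  toFun := S.vermaAct k
  map_add' x y := by rw [vermaAct, ιH_add, map_add]; rfl
  map_smul' c x := by rw [vermaAct, ιH_smul, map_smul]; rfl

lemma vermaActₗ_apply (y : S.hT) : S.vermaActₗ k y = S.vermaAct k y := rfl

lemma vermaAct_lie (x y : S.hT) : S.vermaAct k ⁅x, y⁆ =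
    S.vermaAct k x * S.vermaAct k y - S.vermaAct k y * S.vermaAct k x := by
  simp only [vermaAct, ιH_lie, map_sub, map_mul]

lemma verma_induction_act (Q : Submodule ℂ (S.Verma k)) (h1 : S.vermaOne k ∈ Q)
    (hQ : ∀ y, ∀ u ∈ Q, S.vermaAct k y u ∈ Q) (u : S.Verma k) : u ∈ Q := by
  have key : ∀ P : S.UH, ∀ u ∈ Q, P • u ∈ Q := by
    intro P
    induction P using S.UH_induction with
    | halg c => intro u hu; rw [algebraMap_smul]; exact Q.smul_mem c hu
    | hι y => exact hQ y
    | hmul x y hx hy => intro u hu; rw [mul_smul]; exact hx _ (hy u hu)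
    | hadd x y hx hy => intro u hu; rw [add_smul]; exact add_mem (hx u hu) (hy u hu)
  obtain ⟨P, rfl⟩ := Submodule.Quotient.mk_surjective _ u
  have := key P _ h1
  rwa [vermaOne, ← Submodule.Quotient.mk_smul, smul_eq_mul, mul_one] at this

lemma vermaAct_hEl_one (h : S.𝔥) {i : ℤ} (hi : 0 ≤ i) :
    S.vermaAct k (S.hEl h i) (S.vermaOne k) = 0 := by
  rw [vermaAct_apply, vermaOne, ← Submodule.Quotient.mk_smul, smul_eq_mul, mul_one,
    Submodule.Quotient.mk_eq_zero]
  exact Submodule.subset_span (Or.inl ⟨h, i, hi, rfl⟩)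

lemma vermaAct_hd_one : S.vermaAct k S.hd (S.vermaOne k) = 0 := by
  rw [vermaAct_apply, vermaOne, ← Submodule.Quotient.mk_smul, smul_eq_mul, mul_one,
    Submodule.Quotient.mk_eq_zero]
  exact Submodule.subset_span (Or.inr (Or.inr rfl))

lemma vermaAct_hk_one : S.vermaAct k S.hk (S.vermaOne k) = k • S.vermaOne k := by
  rw [← sub_eq_zero, ← algebraMap_smul S.UH k, vermaAct_apply, ← sub_smul, vermaOne,
    ← Submodule.Quotient.mk_smul, smul_eq_mul, mul_one, Submodule.Quotient.mk_eq_zero]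
  exact Submodule.subset_span (Or.inr (Or.inl rfl))

/-- The action of `h_i ⊗ t^i` on the Verma module. -/
def vA (i : ℤ) : S.𝔥 →ₗ[ℂ] Module.End ℂ (S.Verma k) := S.vermaActₗ k ∘ₗ S.hElₗ i

lemma vA_apply (i : ℤ) (h : S.𝔥) : S.vA k i h = S.vermaAct k (S.hEl h i) := rfl

lemma vA_projH (i : ℤ) (h : S.𝔥) : S.vA k i (S.projH i h) = S.vA k i h := by
  rw [vA_apply, vA_apply]
  congr 1
  exact Subtype.ext (S.gEl_proj h i 0)

/-- The action of `d_0` on the Verma module. -/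
def vD : Module.End ℂ (S.Verma k) := S.vermaAct k S.hd

lemma lie_vD_vA (i : ℤ) (h : S.𝔥) :
    S.vD k * S.vA k i h - S.vA k i h * S.vD k = (i : ℂ) • S.vA k i h := by
  rw [vD, vA_apply, ← vermaAct_lie]
  have : ⁅S.hd, S.hEl h i⁆ = (i : ℂ) • S.hEl h i := Subtype.ext (S.dEl_lie_gEl _ _ _ _)
  rw [this, ← vermaActₗ_apply, map_smul, vermaActₗ_apply]

variable [FiniteDimensional ℂ 𝔤] [LieAlgebra.IsSemisimple ℂ 𝔤]

/-- `k_0` is central in `𝔥~` and acts as `k` on the generating vector. -/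
lemma vermaAct_hk : S.vermaAct k S.hk = k • 1 := by
  have hc : ∀ y : S.hT, ⁅S.hk, y⁆ = 0 := by
    intro y
    induction y using S.hT_induction with
    | hadd x y hx hy => rw [lie_add, hx, hy, add_zero]
    | hsmul c x hx => rw [lie_smul, hx, smul_zero]
    | hg h i => exact Subtype.ext (S.kEl_lie_gEl _ _ _ _ _ _)
    | hk => rw [lie_self]
    | hd =>
      rw [← lie_skew, neg_eq_zero]
      exact Subtype.ext <| (S.dEl_lie_kEl _ _ _ _).trans (by simp [deg])
  refine LinearMap.ext fun u => ?_
  refine S.verma_induction_act k (LinearMap.eqLocus (S.vermaAct k S.hk) (k • 1))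
    (S.vermaAct_hk_one k) ?_ u
  intro y u hu
  rw [LinearMap.mem_eqLocus] at hu ⊢
  have h1 := S.vermaAct_lie k S.hk y
  rw [hc, ← vermaActₗ_apply, map_zero] at h1
  have h2 := LinearMap.congr_fun h1 u
  simp only [LinearMap.zero_apply, LinearMap.sub_apply, Module.End.mul_apply, hu] at h2
  rw [eq_comm, sub_eq_zero] at h2
  rw [h2]; simp

lemma vA_rel : HeisRel S k (S.vA k) := by
  intro i j h h'
  rw [vA_apply, vA_apply, ← vermaAct_lie]
  have : ⁅S.hEl h i, S.hEl h' j⁆ =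
      if i + j = 0 then (i / S.m * S.form (S.proj i h) h' : ℂ) • S.hk else 0 := by
    apply Subtype.ext
    refine (S.gEl_lie_gEl_cartan h h' i j).trans ?_
    split_ifs <;> rfl
  rw [this, ← vermaActₗ_apply]
  split_ifs
  · rw [map_smul, vermaActₗ_apply, vermaAct_hk, smul_smul]; congr 1; ring
  · rw [map_zero]

/-- The Verma module is generated from its highest weight vector by the `h_i ⊗ t^i`, `i < 0`. -/
lemma verma_induction (Q : Submodule ℂ (S.Verma k)) (h1 : S.vermaOne k ∈ Q)
    (hQ : ∀ i < 0, ∀ h, ∀ u ∈ Q, S.vA k i h u ∈ Q) (u : S.Verma k) : u ∈ Q := by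
  let Good : Submodule ℂ (S.Verma k) → Prop := fun N =>
    S.vermaOne k ∈ N ∧ ∀ i < 0, ∀ h, ∀ u ∈ N, S.vA k i h u ∈ N
  let N : Submodule ℂ (S.Verma k) := sInf {N | Good N}
  have hN : Good N := by
    refine ⟨Submodule.mem_sInf.mpr fun N' h => h.1, fun i hi h u hu => ?_⟩
    rw [Submodule.mem_sInf] at hu ⊢
    exact fun N' h' => h'.2 i hi h u (hu N' h')
  have hmin : ∀ N', Good N' → N ≤ N' := fun N' h => sInf_le h
  -- `N` is the smallest subspace containing the highest weight vector and stable under creation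
  -- operators; `N'` collects those of its vectors that `d_0` and all `h_i`, `i ≥ 0`, keep in `N`.
  -- The commutation relations give `N'` the same two properties, so minimality yields `N ≤ N'`.
  -- This takes the place of a PBW argument.
  let N' : Submodule ℂ (S.Verma k) := N ⊓ (N.comap (S.vD k) ⊓
    ⨅ (i : ℤ) (_ : 0 ≤ i) (h : S.𝔥), N.comap (S.vA k i h))
  have hmem : ∀ u, u ∈ N' ↔ u ∈ N ∧ S.vD k u ∈ N ∧ ∀ i, 0 ≤ i → ∀ h, S.vA k i h u ∈ N := by
    intro u; simp [N', Submodule.mem_inf, Submodule.mem_iInf]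
  have hN' : Good N' := by
    constructor
    · rw [hmem]
      refine ⟨hN.1, ?_, fun i hi h => ?_⟩
      · rw [vD, vermaAct_hd_one]; exact zero_mem _
      · rw [vA_apply, S.vermaAct_hEl_one k h hi]; exact zero_mem _
    · intro i hi h u hu
      rw [hmem] at hu ⊢
      obtain ⟨h0, h1, h2⟩ := hu
      refine ⟨hN.2 i hi h u h0, ?_, fun j hj h' => ?_⟩
      · have := LinearMap.congr_fun (S.lie_vD_vA k i h) u
        rw [LinearMap.sub_apply, Module.End.mul_apply, Module.End.mul_apply,
          sub_eq_iff_eq_add] at this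
        rw [this]
        exact add_mem (N.smul_mem _ (hN.2 i hi h u h0)) (hN.2 i hi h _ h1)
      · have := LinearMap.congr_fun (S.vA_rel k j i h' h) u
        rw [LinearMap.sub_apply, Module.End.mul_apply, Module.End.mul_apply,
          sub_eq_iff_eq_add] at this
        rw [this]
        refine add_mem ?_ (hN.2 i hi h _ (h2 j hj h'))
        split_ifs
        · exact N.smul_mem _ h0
        · exact zero_mem _
  have hle := hmin _ hN'
  refine hmin Q ⟨h1, hQ⟩ (S.verma_induction_act k N hN.1 ?_ u)
  intro y u hu
  have hu' := (hmem u).mp (hle hu)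
  rw [← vermaActₗ_apply]
  induction y using S.hT_induction with
  | hadd x y hx hy => rw [map_add]; exact add_mem hx hy
  | hsmul c x hx => rw [map_smul]; exact N.smul_mem c hx
  | hg h i =>
    rcases lt_or_ge i 0 with hi | hi
    · exact hN.2 i hi h u hu
    · exact hu'.2.2 i hi h
  | hk => rw [vermaActₗ_apply, vermaAct_hk]; exact N.smul_mem k hu
  | hd => exact hu'.2.1

lemma verma_iSup_eigenspace : ⨆ n : ℕ, Module.End.eigenspace (S.vD k) (-(n : ℂ)) = ⊤ := by
  refine eq_top_iff.mpr fun u _ => S.verma_induction k _ ?_ ?_ u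
  · refine Submodule.mem_iSup_of_mem 0 (Module.End.mem_eigenspace_iff.mpr ?_)
    rw [vD, vermaAct_hd_one]; simp
  · intro i hi h u hu
    induction hu using Submodule.iSup_induction' with
    | mem n u hu =>
      refine Submodule.mem_iSup_of_mem (n + (-i).toNat) (Module.End.mem_eigenspace_iff.mpr ?_)
      have := LinearMap.congr_fun (S.lie_vD_vA k i h) u
      rw [LinearMap.sub_apply, Module.End.mul_apply, Module.End.mul_apply,
        Module.End.mem_eigenspace_iff.mp hu, sub_eq_iff_eq_add, map_smul, LinearMap.smul_apply,
        ← add_smul] at this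
      rw [this]
      congr 1
      have h2 : ((-i).toNat : ℂ) = -i := by
        have h3 : (((-i).toNat : ℤ) : ℂ) = ((-i : ℤ) : ℂ) := by congr 1; omega
        rw [Int.cast_natCast] at h3
        rw [h3]; push_cast; rfl
      push_cast; rw [h2]; ring
    | zero => rw [map_zero]; exact zero_mem _
    | add x y _ _ hx hy => rw [map_add]; exact add_mem hx hy

/-! ### The vacuum functional -/

/-- The polynomial ring on which the Heisenberg operators act. -/
abbrev Fock : Type := MvPolynomial (ℕ × Fin (Module.finrank ℂ S.𝔥)) ℂ

/-- The linear polynomial representing `h_{-j} ⊗ t^{-j}`. -/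
def fockCre (j : ℕ) : S.𝔥 →ₗ[ℂ] S.Fock :=
  (∑ l, ((Module.finBasis ℂ S.𝔥).coord l).smulRight (MvPolynomial.X (j, l))) ∘ₗ S.projH (-j)

/-- The derivation representing `h_j ⊗ t^j`. -/
def fockAnn (j : ℕ) (h : S.𝔥) : Derivation ℂ S.Fock S.Fock :=
  MvPolynomial.mkDerivation ℂ fun p =>
    if p.1 = j then MvPolynomial.C (j / S.m * k * S.form (S.proj j h) (Module.finBasis ℂ S.𝔥 p.2))
    else 0

lemma fockAnn_cre (i j : ℕ) (h h' : S.𝔥) : S.fockAnn k i h (S.fockCre j h') =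
    if i = j then MvPolynomial.C (i / S.m * k * S.form (S.proj i h) h') else 0 := by
  simp only [fockCre, LinearMap.comp_apply, LinearMap.sum_apply, LinearMap.smulRight_apply,
    map_sum, Derivation.map_smul, fockAnn, MvPolynomial.mkDerivation_X]
  by_cases hij : i = j
  · subst hij
    simp only [if_true]
    rw [← S.form_proj_proj, ← coe_projH _ _ h']
    conv_rhs => rw [← (Module.finBasis ℂ S.𝔥).sum_repr (S.projH (-i) h')]
    rw [AddSubmonoidClass.coe_finsetSum, map_sum, Finset.mul_sum, map_sum]
    refine Finset.sum_congr rfl fun l _ => ?_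
    rw [Module.Basis.coord_apply, SetLike.val_smul, map_smul, MvPolynomial.smul_eq_C_mul,
      ← MvPolynomial.C_mul, smul_eq_mul]
    congr 1; ring
  · rw [if_neg hij]
    refine Finset.sum_eq_zero fun l _ => ?_
    rw [if_neg (Ne.symm hij), smul_zero]

lemma fockAnn_add (j : ℕ) (h h' : S.𝔥) :
    S.fockAnn k j (h + h') = S.fockAnn k j h + S.fockAnn k j h' :=
  MvPolynomial.derivation_ext fun p => by
    simp only [fockAnn, MvPolynomial.mkDerivation_X, Derivation.add_apply]
    split_ifs
    · rw [← map_add]; congr 1; simp; ring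
    · simp

lemma fockAnn_smul (j : ℕ) (c : ℂ) (h : S.𝔥) : S.fockAnn k j (c • h) = c • S.fockAnn k j h :=
  MvPolynomial.derivation_ext fun p => by
    simp only [fockAnn, MvPolynomial.mkDerivation_X, Derivation.smul_apply]
    split_ifs
    · rw [MvPolynomial.smul_eq_C_mul, ← map_mul]; congr 1; simp; ring
    · simp

/-- The Heisenberg operators on the polynomial ring. -/
def fockA (i : ℤ) : S.𝔥 →ₗ[ℂ] Module.End ℂ S.Fock :=
  if 0 < i then
    { toFun := fun h => (S.fockAnn k i.toNat h : S.Fock →ₗ[ℂ] S.Fock)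
      map_add' := fun h h' => by rw [fockAnn_add]; rfl
      map_smul' := fun c h => by rw [fockAnn_smul]; rfl }
  else if i < 0 then LinearMap.mul ℂ S.Fock ∘ₗ S.fockCre (-i).toNat
  else 0

lemma fockA_pos {j : ℕ} (hj : 0 < j) (h : S.𝔥) (f : S.Fock) :
    S.fockA k j h f = S.fockAnn k j h f := by
  have : (0 : ℤ) < j := by exact_mod_cast hj
  rw [fockA, if_pos this]
  rfl

lemma fockA_neg {j : ℕ} (hj : 0 < j) (h : S.𝔥) (f : S.Fock) :
    S.fockA k (-j) h f = S.fockCre j h * f := by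
  have h1 : -(j : ℤ) < 0 := by omega
  rw [fockA, if_neg (by omega), if_pos h1]
  simp

lemma fockA_zero : S.fockA k 0 = 0 := by
  rw [fockA, if_neg (by omega), if_neg (by omega)]

lemma int_trichotomy (i : ℤ) :
    (∃ j : ℕ, 0 < j ∧ i = j) ∨ i = 0 ∨ ∃ j : ℕ, 0 < j ∧ i = -j := by
  rcases lt_trichotomy 0 i with h | h | h
  · exact Or.inl ⟨i.toNat, by omega, by omega⟩
  · exact Or.inr (Or.inl h.symm)
  · exact Or.inr (Or.inr ⟨(-i).toNat, by omega, by omega⟩)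

lemma fockA_rel : HeisRel S k (S.fockA k) := by
  intro i j h h'
  refine LinearMap.ext fun f => ?_
  rw [LinearMap.sub_apply, Module.End.mul_apply, Module.End.mul_apply]
  rcases int_trichotomy i with ⟨i, hi, rfl⟩ | rfl | ⟨i, hi, rfl⟩
  · rcases int_trichotomy j with ⟨j, hj, rfl⟩ | rfl | ⟨j, hj, rfl⟩
    · rw [if_neg (by omega)]
      simp only [S.fockA_pos k hi, S.fockA_pos k hj]
      have : ⁅S.fockAnn k i h, S.fockAnn k j h'⁆ = 0 := MvPolynomial.derivation_ext fun p => by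
        simp only [Derivation.commutator_apply, fockAnn, MvPolynomial.mkDerivation_X]
        split_ifs <;> simp
      rw [← Derivation.commutator_apply, this]; rfl
    · rw [if_neg (by omega), fockA_zero]; simp
    · simp only [S.fockA_pos k hi, S.fockA_neg k hj]
      rw [Derivation.leibniz, fockAnn_cre]
      by_cases hij : i = j
      · subst hij
        simp [MvPolynomial.smul_eq_C_mul, mul_comm]
      · rw [if_neg hij, if_neg (by omega)]; simp
  · rw [fockA_zero]; simp
  · rcases int_trichotomy j with ⟨j, hj, rfl⟩ | rfl | ⟨j, hj, rfl⟩
    · simp only [S.fockA_pos k hj, S.fockA_neg k hi]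
      rw [Derivation.leibniz, fockAnn_cre]
      by_cases hij : i = j
      · subst hij
        have : S.form (S.proj (-(i : ℤ)) h) h' = S.form (S.proj i h') h := by
          rw [form_proj_left, neg_neg, form_comm]
        simp [MvPolynomial.smul_eq_C_mul, mul_comm, this, neg_div]
      · rw [if_neg (Ne.symm hij), if_neg (by omega)]; simp
    · rw [if_neg (by omega), fockA_zero]; simp
    · rw [if_neg (by omega)]
      simp only [S.fockA_neg k hi, S.fockA_neg k hj, LinearMap.zero_apply]
      ring

lemma fockA_projH (i : ℤ) (h : S.𝔥) : S.fockA k i (S.projH i h) = S.fockA k i h := by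
  refine LinearMap.ext fun f => ?_
  rcases int_trichotomy i with ⟨i, hi, rfl⟩ | rfl | ⟨i, hi, rfl⟩
  · rw [S.fockA_pos k hi, S.fockA_pos k hi]
    simp [fockAnn]
  · rw [fockA_zero]; rfl
  · rw [S.fockA_neg k hi, S.fockA_neg k hi]
    have : S.projH (-(i : ℤ)) (S.projH (-(i : ℤ)) h) = S.projH (-(i : ℤ)) h :=
      Subtype.ext (S.proj_proj _ _)
    rw [fockCre, LinearMap.comp_apply, this, ← LinearMap.comp_apply]

/-- The degree derivation of the polynomial ring. -/
def fockD : Derivation ℂ S.Fock S.Fock :=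
  MvPolynomial.mkDerivation ℂ fun p => (-(p.1 : ℂ)) • MvPolynomial.X p

lemma fockD_cre (j : ℕ) (h : S.𝔥) : S.fockD (S.fockCre j h) = (-(j : ℂ)) • S.fockCre j h := by
  simp only [fockCre, LinearMap.comp_apply, LinearMap.sum_apply, LinearMap.smulRight_apply,
    map_sum, Derivation.map_smul, fockD, MvPolynomial.mkDerivation_X, Finset.smul_sum]
  refine Finset.sum_congr rfl fun l _ => smul_comm _ _ _

lemma lie_fockD_fockA (i : ℤ) (h : S.𝔥) :
    (S.fockD : Module.End ℂ S.Fock) * S.fockA k i h - S.fockA k i h * S.fockD =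
      (i : ℂ) • S.fockA k i h := by
  refine LinearMap.ext fun f => ?_
  rw [LinearMap.sub_apply, Module.End.mul_apply, Module.End.mul_apply, LinearMap.smul_apply]
  rcases int_trichotomy i with ⟨i, hi, rfl⟩ | rfl | ⟨i, hi, rfl⟩
  · simp only [S.fockA_pos k hi, Derivation.coeFn_coe]
    have : ⁅S.fockD, S.fockAnn k i h⁆ = (i : ℂ) • S.fockAnn k i h :=
      MvPolynomial.derivation_ext fun p => by
        simp only [Derivation.commutator_apply, fockAnn, fockD, MvPolynomial.mkDerivation_X,
          Derivation.smul_apply, Derivation.map_smul]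
        split_ifs with hp
        · simp [hp]
        · simp
    rw [← Derivation.commutator_apply, this]; simp
  · rw [fockA_zero]; simp
  · simp only [S.fockA_neg k hi, Derivation.coeFn_coe]
    rw [Derivation.leibniz, fockD_cre]
    simp [mul_comm]

/-- There is a functional on the Verma module which is `1` on the highest weight vector and kills
the images of the `h_i ⊗ t^i`, `i < 0`. -/
lemma exists_vermaFunctional : ∃ ε : S.Verma k →ₗ[ℂ] ℂ, ε (S.vermaOne k) = 1 ∧
    ∀ i < 0, ∀ h u, ε (S.vA k i h u) = 0 := by
  -- In the polynomial representation creation operators multiply by linear forms, so evaluation at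
  -- the origin kills their images, and the highest weight vector maps to `1`. The variables range
  -- over a basis of all of `𝔥` in every degree; the surplus is harmless, since no isomorphism with
  -- the Verma module is claimed.
  obtain ⟨φ, h1, h2, -⟩ := S.exists_vermaLift (S.fockA_projH k) (S.fockA_rel k)
    (S.lie_fockD_fockA k) (1 : S.Fock) (fun i h hi0 => by
      rcases int_trichotomy i with ⟨i, hi, rfl⟩ | rfl | ⟨i, hi, rfl⟩
      · rw [S.fockA_pos k hi]; simp
      · rw [fockA_zero]; rfl
      · omega) (by simp)
  refine ⟨(MvPolynomial.aeval fun _ => (0 : ℂ)).toLinearMap ∘ₗ φ, by simp [h1], ?_⟩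
  intro i hi0 h u
  rcases int_trichotomy i with ⟨i, hi, rfl⟩ | rfl | ⟨i, hi, rfl⟩
  · omega
  · omega
  · rw [LinearMap.comp_apply, vA_apply, h2, S.fockA_neg k hi]
    simp [fockCre]

/-- The vacuum functional of the Verma module. -/
def vermaε : S.Verma k →ₗ[ℂ] ℂ := (S.exists_vermaFunctional k).choose

lemma vermaε_one : S.vermaε k (S.vermaOne k) = 1 := (S.exists_vermaFunctional k).choose_spec.1

lemma vermaε_vA {i : ℤ} (hi : i < 0) (h : S.𝔥) (u : S.Verma k) :
    S.vermaε k (S.vA k i h u) = 0 := (S.exists_vermaFunctional k).choose_spec.2 i hi h u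

end VermaStructure

end Data

end

section

/-! ### Graded spaces with degrees bounded above -/

section Graded

variable {E : Type*} [AddCommGroup E] [Module ℂ E]

/-- If `v ∈ p i` is written as an element of `F i` plus a sum from the other `F j`, that sum lies
both in `p i` and in the span of the other `p j`, so independence kills it. -/
lemma eq_of_iSupIndep {ι : Type*} {p F : ι → Submodule ℂ E} (hp : iSupIndep p)
    (hF : ∀ i, F i ≤ p i) (htop : ⨆ i, F i = ⊤) (i : ι) : F i = p i := by
  refine le_antisymm (hF i) fun v hv => ?_
  have h1 : v ∈ F i ⊔ ⨆ (j : ι) (_ : j ≠ i), F j := by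
    have : ⨆ j, F j ≤ F i ⊔ ⨆ (j : ι) (_ : j ≠ i), F j := by
      refine iSup_le fun j => ?_
      by_cases h : j = i
      · rw [h]; exact le_sup_left
      · exact (le_iSup₂ (f := fun j (_ : j ≠ i) => F j) j h).trans le_sup_right
    exact this (htop ▸ Submodule.mem_top)
  obtain ⟨f, hf, g, hg, rfl⟩ := Submodule.mem_sup.mp h1
  have hg' : g ∈ ⨆ (j : ι) (_ : j ≠ i), p j :=
    (iSup₂_mono fun j _ => hF j : (⨆ (j : ι) (_ : j ≠ i), F j) ≤ _) hg
  have hg2 : g ∈ p i := by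
    have := sub_mem hv (hF i hf)
    rwa [add_sub_cancel_left] at this
  have := (Submodule.disjoint_def.mp (hp i)) g hg2 hg'
  rw [this, add_zero]
  exact hf

lemma gradedBddAbove_iff {D : Module.End ℂ E} : GradedBddAbove D ↔
    (⨆ z, Module.End.eigenspace D z = ⊤) ∧
      ∀ z : ℂ, ∃ ℓ₀ : ℤ, ∀ ℓ : ℤ, ℓ₀ < ℓ → Module.End.eigenspace D (z + ℓ) = ⊥ := by
  rw [GradedBddAbove, DirectSum.isInternal_submodule_iff_iSupIndep_and_iSup_eq_top]
  simp only [D.eigenspaces_iSupIndep, true_and]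

lemma GradedBddAbove.restrict {D : Module.End ℂ E} (hD : GradedBddAbove D) (p : Submodule ℂ E)
    (hp : ∀ v ∈ p, D v ∈ p) : GradedBddAbove (D.restrict hp) := by
  rw [gradedBddAbove_iff] at hD ⊢
  have hmem : ∀ z v, v ∈ Module.End.eigenspace (D.restrict hp) z ↔
      (v : E) ∈ Module.End.eigenspace D z := by
    intro z v
    rw [Module.End.mem_eigenspace_iff, Module.End.mem_eigenspace_iff, Subtype.ext_iff]
    rfl
  refine ⟨eq_top_iff.mpr fun v _ => ?_, fun z => ?_⟩
  · -- the components of a vector of `p` lie in `p`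
    have key : ∀ (s : Finset ℂ) (f : ℂ → E), (∀ z ∈ s, f z ∈ Module.End.eigenspace D z) →
        ∑ z ∈ s, f z ∈ p → ∀ z ∈ s, f z ∈ p := by
      intro s
      induction s using Finset.induction_on with
      | empty => simp
      | insert a s ha ih =>
        intro f hf hs
        have hf' : ∀ z ∈ insert a s, D (f z) = z • f z := fun z hz =>
          Module.End.mem_eigenspace_iff.mp (hf z hz)
        -- Applying `D - a` removes the component of eigenvalue `a` and rescales the others by the
        -- non-zero numbers `z - a`.
        have h1 : ∑ z ∈ s, (z - a) • f z ∈ p := by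
          have h2 := sub_mem (hp _ hs) (p.smul_mem a hs)
          rw [map_sum, Finset.smul_sum, ← Finset.sum_sub_distrib, Finset.sum_insert ha,
            hf' a (Finset.mem_insert_self a s), sub_self, zero_add] at h2
          convert h2 using 1
          refine Finset.sum_congr rfl fun z hz => ?_
          rw [hf' z (Finset.mem_insert_of_mem hz), sub_smul]
        have h3 : ∀ z ∈ s, f z ∈ p := by
          intro z hz
          have h4 := ih (fun z => (z - a) • f z)
            (fun z hz => Submodule.smul_mem _ _ (hf z (Finset.mem_insert_of_mem hz))) h1 z hz
          have h5 : z - a ≠ 0 := sub_ne_zero.mpr fun h => ha (h ▸ hz)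
          have := p.smul_mem (z - a)⁻¹ h4
          rwa [inv_smul_smul₀ h5] at this
        intro z hz
        rcases Finset.mem_insert.mp hz with rfl | hz
        · rw [Finset.sum_insert ha] at hs
          have := sub_mem hs (sum_mem h3)
          rwa [add_sub_cancel_right] at this
        · exact h3 z hz
    have hv : (v : E) ∈ ⨆ z, Module.End.eigenspace D z := hD.1 ▸ Submodule.mem_top
    obtain ⟨f, hf, hs⟩ := (Submodule.mem_iSup_iff_exists_finsupp _ _).mp hv
    have hfp : ∀ z ∈ f.support, f z ∈ p := key f.support f (fun z _ => hf z) (by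
      have : (∑ z ∈ f.support, f z) = v := hs
      rw [this]; exact v.2)
    have : v = ∑ z ∈ f.support.attach, (⟨f z, hfp z z.2⟩ : p) := by
      apply Subtype.ext
      rw [← hs, AddSubmonoidClass.coe_finsetSum, Finset.sum_attach f.support fun z => f z]
      rfl
    rw [this]
    refine sum_mem fun z _ => Submodule.mem_iSup_of_mem (z : ℂ) ?_
    rw [hmem]
    exact hf z
  · obtain ⟨ℓ₀, h⟩ := hD.2 z
    refine ⟨ℓ₀, fun ℓ hℓ => eq_bot_iff.mpr fun v hv => ?_⟩
    rw [hmem, h ℓ hℓ] at hv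
    exact Subtype.ext hv

/-- `v` is killed by all operators of degree greater than `N`. -/
def DegBdd (D : Module.End ℂ E) (N : ℤ) (v : E) : Prop :=
  ∀ (Y : Module.End ℂ E) (n : ℤ), D * Y - Y * D = (n : ℂ) • Y → N < n → Y v = 0

namespace DegBdd

variable {D : Module.End ℂ E} {N N' : ℤ} {v v' : E}

lemma mono (h : DegBdd D N v) (hN : N ≤ N') : DegBdd D N' v :=
  fun Y n hY hn => h Y n hY (hN.trans_lt hn)

/-- The identity is an operator of degree `0`, so a negative bound applies to it. -/
lemma eq_zero (h : DegBdd D N v) (hN : N < 0) : v = 0 := by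
  simpa using h 1 0 (by simp) hN

lemma apply (h : DegBdd D N v) {X : Module.End ℂ E} {i : ℤ}
    (hX : D * X - X * D = (i : ℂ) • X) : DegBdd D (N - i) (X v) := by
  intro Y n hY hn
  refine h (Y * X) (n + i) ?_ (by omega)
  have : D * (Y * X) - Y * X * D = (D * Y - Y * D) * X + Y * (D * X - X * D) := by noncomm_ring
  rw [this, hY, hX, smul_mul_assoc, mul_smul_comm, ← add_smul]
  push_cast; rfl

end DegBdd

/-- A vector has finitely many homogeneous components, and an operator of large degree sends each
into a zero eigenspace. This bound replaces homogeneous decompositions below: it gives local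
finiteness of sums and serves as induction parameter. -/
lemma GradedBddAbove.exists_degBdd {D : Module.End ℂ E} (hD : GradedBddAbove D) (v : E) :
    ∃ N : ℕ, DegBdd D N v := by
  rw [gradedBddAbove_iff] at hD
  have hv : v ∈ ⨆ z, Module.End.eigenspace D z := hD.1 ▸ Submodule.mem_top
  induction hv using Submodule.iSup_induction' with
  | mem z v hv =>
    obtain ⟨ℓ₀, h⟩ := hD.2 z
    refine ⟨ℓ₀.toNat, fun Y n hY hn => ?_⟩
    have h1 : Y v ∈ Module.End.eigenspace D (z + n) := by
      have := LinearMap.congr_fun hY v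
      rw [LinearMap.sub_apply, Module.End.mul_apply, Module.End.mul_apply,
        Module.End.mem_eigenspace_iff.mp hv, map_smul, sub_eq_iff_eq_add] at this
      rw [Module.End.mem_eigenspace_iff, this, LinearMap.smul_apply, ← add_smul, add_comm]
    rw [h n (by omega)] at h1
    exact h1
  | zero => exact ⟨0, fun Y n _ _ => map_zero Y⟩
  | add v w _ _ hv hw =>
    obtain ⟨N, hN⟩ := hv
    obtain ⟨N', hN'⟩ := hw
    refine ⟨max N N', fun Y n hY hn => ?_⟩
    rw [map_add, hN Y n hY (by omega), hN' Y n hY (by omega), add_zero]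

lemma DirectSum.IsInternal.exists_linearMap {ι F : Type*} [DecidableEq ι] [AddCommGroup F]
    [Module ℂ F] {p : ι → Submodule ℂ E} (h : DirectSum.IsInternal p) (f : ι → E →ₗ[ℂ] F) :
    ∃ g : E →ₗ[ℂ] F, ∀ i, ∀ v ∈ p i, g v = f i v := by
  let e := LinearEquiv.ofBijective (DirectSum.coeLinearMap p) h
  refine ⟨DirectSum.toModule ℂ ι F (fun i => (f i).domRestrict (p i)) ∘ₗ e.symm.toLinearMap,
    fun i v hv => ?_⟩
  have : e.symm v = DirectSum.lof ℂ ι (fun i => p i) i ⟨v, hv⟩ := by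
    rw [LinearEquiv.symm_apply_eq]
    exact (DirectSum.coeLinearMap_lof p i ⟨v, hv⟩).symm
  rw [LinearMap.comp_apply, LinearEquiv.coe_coe, this, DirectSum.toModule_lof]
  rfl

end Graded

end

section

/-! ### The degree operator in terms of the Heisenberg operators -/

section Sugawara

variable {𝔤 : Type u} [LieRing 𝔤] [LieAlgebra ℂ 𝔤] (S : Data 𝔤)
  [FiniteDimensional ℂ 𝔤] [LieAlgebra.IsSemisimple ℂ 𝔤]

namespace Data

/-- A basis of `𝔥`. -/
def bH : Module.Basis (Fin (Module.finrank ℂ S.𝔥)) ℂ S.𝔥 := Module.finBasis ℂ S.𝔥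

/-- The dual basis of `bH` with respect to the form. -/
def bH' : Module.Basis (Fin (Module.finrank ℂ S.𝔥)) ℂ S.𝔥 :=
  S.formH.dualBasis S.formH_nondeg S.bH

lemma sum_form_bH (h : S.𝔥) : ∑ l, S.form h (S.bH l) • S.bH' l = h := by
  conv_rhs => rw [← S.bH'.sum_repr h]
  refine Finset.sum_congr rfl fun l _ => ?_
  rw [bH', LinearMap.BilinForm.dualBasis_repr_apply]
  rfl

lemma sum_form_bH' (h : S.𝔥) : ∑ l, S.form (S.bH' l) h • S.bH l = h := by
  conv_rhs => rw [← S.bH.sum_repr h]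
  refine Finset.sum_congr rfl fun l _ => ?_
  congr 1
  conv_lhs => rw [← S.bH.sum_repr h]
  rw [← formH_apply, map_sum, Finset.sum_eq_single l]
  · rw [map_smul, bH', LinearMap.BilinForm.apply_dualBasis_left]; simp
  · intro j _ hj
    rw [map_smul, bH', LinearMap.BilinForm.apply_dualBasis_left]; simp [hj]
  · simp

end Data

variable {S} {k : ℂ} {E : Type*} [AddCommGroup E] [Module ℂ E]
  {a : ℤ → S.𝔥 →ₗ[ℂ] Module.End ℂ E}

/-- Each vector is killed by the `a j h` for large `j`. -/
def AnnFin (a : ℤ → S.𝔥 →ₗ[ℂ] Module.End ℂ E) : Prop :=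
  ∀ v, ∃ J : ℕ, ∀ j : ℕ, J ≤ j → ∀ h, a j h v = 0

/-- A homogeneous part of the Sugawara operator. -/
def sugTerm (a : ℤ → S.𝔥 →ₗ[ℂ] Module.End ℂ E) (j : ℕ) : Module.End ℂ E :=
  ∑ l, a (-((j + 1 : ℕ) : ℤ)) (S.bH l) * a ((j + 1 : ℕ) : ℤ) (S.bH' l)

lemma sugTerm_apply (j : ℕ) (v : E) : sugTerm a j v =
    ∑ l, a (-((j + 1 : ℕ) : ℤ)) (S.bH l) (a ((j + 1 : ℕ) : ℤ) (S.bH' l) v) := by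
  simp [sugTerm, LinearMap.sum_apply]

lemma AnnFin.locFin (ha : AnnFin a) : LocFin (sugTerm a) := by
  intro v
  obtain ⟨J, hJ⟩ := ha v
  refine hasFiniteSupport_of_le J fun j hj => ?_
  rw [sugTerm_apply]
  exact Finset.sum_eq_zero fun l _ => by rw [hJ _ (by omega), map_zero]

/-- The Sugawara operator. -/
def sugawara (k : ℂ) (a : ℤ → S.𝔥 →ₗ[ℂ] Module.End ℂ E) (ha : AnnFin a) : Module.End ℂ E :=
  ((S.m : ℂ) / k) • locSum (sugTerm a) ha.locFin

/-- Only one of the two factors can fail to commute with `a i h`, and only if `j + 1 = |i|`; summing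
over dual bases then reassembles `h`. -/
lemma lie_sugTerm (H : HeisRel S k a) (hp : ∀ i, i ≠ 0 → ∀ h, a i (S.projH i h) = a i h) {i : ℤ}
    (hi : i ≠ 0) (h : S.𝔥) (j : ℕ) : sugTerm a j * a i h - a i h * sugTerm a j =
      if j + 1 = i.natAbs then (-(i * k / S.m : ℂ)) • a i h else 0 := by
  have h1 : sugTerm a j * a i h - a i h * sugTerm a j =
      ∑ l, (a (-((j + 1 : ℕ) : ℤ)) (S.bH l) *
          (a ((j + 1 : ℕ) : ℤ) (S.bH' l) * a i h - a i h * a ((j + 1 : ℕ) : ℤ) (S.bH' l)) +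
        (a (-((j + 1 : ℕ) : ℤ)) (S.bH l) * a i h - a i h * a (-((j + 1 : ℕ) : ℤ)) (S.bH l)) *
          a ((j + 1 : ℕ) : ℤ) (S.bH' l)) := by
    rw [sugTerm, Finset.sum_mul, Finset.mul_sum, ← Finset.sum_sub_distrib]
    refine Finset.sum_congr rfl fun l _ => ?_
    noncomm_ring
  rw [h1]
  simp only [H ((j + 1 : ℕ) : ℤ) i, H (-((j + 1 : ℕ) : ℤ)) i]
  rcases Data.int_trichotomy i with ⟨i, hi, rfl⟩ | rfl | ⟨i, hi, rfl⟩
  · rw [Int.natAbs_natCast]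
    simp only [if_neg (show ¬ ((j + 1 : ℕ) : ℤ) + i = 0 by omega)]
    by_cases h3 : j + 1 = i
    · subst h3
      have h4 : ∀ l, S.form (S.proj (-((j + 1 : ℕ) : ℤ)) (S.bH l)) h =
          S.form (S.projH ((j + 1 : ℕ) : ℤ) h) (S.bH l) := fun l => by
        rw [S.form_proj_left, neg_neg, S.form_comm, S.coe_projH]
      simp only [if_pos (show -((j + 1 : ℕ) : ℤ) + ((j + 1 : ℕ) : ℤ) = 0 by omega), if_true]
      conv_rhs => rw [← hp _ (by omega), ← S.sum_form_bH (S.projH ((j + 1 : ℕ) : ℤ) h)]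
      rw [map_sum, Finset.smul_sum]
      refine Finset.sum_congr rfl fun l _ => ?_
      rw [mul_zero, zero_add, smul_mul_assoc, one_mul, map_smul, smul_smul, h4]
      congr 1
      push_cast
      ring
    · simp only [if_neg h3, if_neg (show ¬ -((j + 1 : ℕ) : ℤ) + i = 0 by omega)]
      simp
  · exact absurd rfl hi
  · rw [Int.natAbs_neg, Int.natAbs_natCast]
    simp only [if_neg (show ¬ -((j + 1 : ℕ) : ℤ) + -(i : ℤ) = 0 by omega)]
    by_cases h3 : j + 1 = i
    · subst h3
      simp only [if_pos (show ((j + 1 : ℕ) : ℤ) + -((j + 1 : ℕ) : ℤ) = 0 by omega), if_true]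
      conv_rhs => rw [← hp _ (by omega), ← S.sum_form_bH' (S.projH (-((j + 1 : ℕ) : ℤ)) h)]
      rw [map_sum, Finset.smul_sum]
      refine Finset.sum_congr rfl fun l _ => ?_
      rw [zero_mul, add_zero, mul_smul_comm, mul_one, map_smul, smul_smul,
        S.form_proj_left, S.coe_projH]
      congr 1
      push_cast
      ring
    · simp only [if_neg h3, if_neg (show ¬ ((j + 1 : ℕ) : ℤ) + -(i : ℤ) = 0 by omega)]
      simp

/-- Thus the negative of the Sugawara operator has the same commutators with the oscillators as
`d_0`. Unlike `d_0` it kills every vacuum vector, since each of its terms ends in an annihilation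
operator. -/
lemma lie_sugawara (H : HeisRel S k a) (hp : ∀ i, i ≠ 0 → ∀ h, a i (S.projH i h) = a i h)
    (ha : AnnFin a) (hk : k ≠ 0) {i : ℤ} (hi : i ≠ 0) (h : S.𝔥) (v : E) :
    sugawara k a ha (a i h v) = a i h (sugawara k a ha v) - (i : ℂ) • a i h v := by
  rw [sub_eq_add_neg, ← sub_eq_iff_eq_add']
  have h1 : ∀ j, sugTerm a j (a i h v) - a i h (sugTerm a j v) =
      if j + 1 = i.natAbs then (-(i * k / S.m : ℂ)) • a i h v else 0 := by
    intro j
    have := LinearMap.congr_fun (lie_sugTerm H hp hi h j) v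
    rw [LinearMap.sub_apply, Module.End.mul_apply, Module.End.mul_apply] at this
    rw [this]
    split_ifs <;> rfl
  have hm := S.m_ne_zero
  rw [sugawara, LinearMap.smul_apply, LinearMap.smul_apply, map_smul, ← smul_sub, locSum_apply,
    locSum_apply, linear_finsum _ (ha.locFin v), ← finsum_sub_distrib (ha.locFin _)
      (hasFiniteSupport_linear (a i h) (ha.locFin v)), finsum_congr h1,
    finsum_eq_single _ (i.natAbs - 1) (fun j hj => if_neg (by omega)), if_pos (by omega), smul_smul,
    ← neg_smul]
  congr 1
  field_simp

lemma sugawara_eq_zero (ha : AnnFin a) {v : E} (hv : ∀ i, 0 < i → ∀ h, a i h v = 0) :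
    sugawara k a ha v = 0 := by
  rw [sugawara, LinearMap.smul_apply, locSum_apply, finsum_eq_zero_of_forall_eq_zero, smul_zero]
  intro j
  rw [sugTerm_apply]
  exact Finset.sum_eq_zero fun l _ => by rw [hv _ (by omega), map_zero]

end Sugawara

end

section

/-! ### The tensor product of the Verma module with a vector space -/

section VermaTensor

variable {𝔤 : Type u} [LieRing 𝔤] [LieAlgebra ℂ 𝔤]

/-- The structure of the Verma module: the Heisenberg operators, the degree operator, the highest
weight vector and the vacuum functional. -/
structure VermaLike (S : Data 𝔤) (k : ℂ) (M : Type*) [AddCommGroup M] [Module ℂ M] where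
  A : ℤ → S.𝔥 →ₗ[ℂ] Module.End ℂ M
  D : Module.End ℂ M
  one : M
  ε : M →ₗ[ℂ] ℂ
  rel : HeisRel S k A
  A_projH : ∀ i h, A i (S.projH i h) = A i h
  lie_D : ∀ i h, D * A i h - A i h * D = (i : ℂ) • A i h
  A_one : ∀ i h, 0 ≤ i → A i h one = 0
  D_one : D one = 0
  ε_one : ε one = 1
  ε_A : ∀ i, i < 0 → ∀ h u, ε (A i h u) = 0
  induction : ∀ Q : Submodule ℂ M, one ∈ Q → (∀ i < 0, ∀ h, ∀ u ∈ Q, A i h u ∈ Q) → ∀ u, u ∈ Q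
  iSup_eigenspace : ⨆ n : ℕ, Module.End.eigenspace D (-(n : ℂ)) = ⊤

/-- The Verma module has the structure of a Verma module. -/
def Data.vermaLike (S : Data 𝔤) [FiniteDimensional ℂ 𝔤] [LieAlgebra.IsSemisimple ℂ 𝔤] (k : ℂ) :
    VermaLike S k (S.Verma k) where
  A := S.vA k
  D := S.vD k
  one := S.vermaOne k
  ε := S.vermaε k
  rel := S.vA_rel k
  A_projH := S.vA_projH k
  lie_D := S.lie_vD_vA k
  A_one _ h hi := S.vermaAct_hEl_one k h hi
  D_one := S.vermaAct_hd_one k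
  ε_one := S.vermaε_one k
  ε_A _ hi := S.vermaε_vA k hi
  induction := S.verma_induction k
  iSup_eigenspace := S.verma_iSup_eigenspace k

variable {S : Data 𝔤} {k : ℂ} {M : Type*} [AddCommGroup M] [Module ℂ M] (Φ : VermaLike S k M)

namespace VermaLike

lemma isInternal :
    DirectSum.IsInternal fun n : ℕ => Module.End.eigenspace (Φ.D) (-(n : ℂ)) := by
  rw [DirectSum.isInternal_submodule_iff_iSupIndep_and_iSup_eq_top]
  refine ⟨(Φ.D).eigenspaces_iSupIndep.comp (f := fun n : ℕ => -(n : ℂ)) fun a b h => ?_,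
    Φ.iSup_eigenspace⟩
  simpa using h

/-- `d_0` is invertible on the complement of the highest weight vector. -/
lemma exists_D_inverse : ∃ g : Module.End ℂ (M),
    (∀ u, g (Φ.D u) = u - Φ.ε u • Φ.one) ∧
      ∀ u, Φ.D (g u) = u - Φ.ε u • Φ.one := by
  -- `g` divides by the eigenvalue `-n`; at `n = 0` the convention `0⁻¹ = 0` makes it zero on the
  -- kernel of `D`.
  obtain ⟨g, hg⟩ := DirectSum.IsInternal.exists_linearMap (Φ.isInternal)
    fun n => ((-(n : ℂ))⁻¹ • LinearMap.id : Module.End ℂ (M))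
  have hcomm : ∀ u, Φ.D (g u) = g (Φ.D u) := by
    intro u
    have hu : u ∈ ⨆ n : ℕ, Module.End.eigenspace (Φ.D) (-(n : ℂ)) :=
      Φ.iSup_eigenspace ▸ Submodule.mem_top
    induction hu using Submodule.iSup_induction' with
    | mem n u hu =>
      rw [hg n u hu, Module.End.mem_eigenspace_iff.mp hu, map_smul, hg n u hu,
        LinearMap.smul_apply, LinearMap.id_apply, map_smul, Module.End.mem_eigenspace_iff.mp hu,
        smul_comm]
    | zero => simp
    | add u v _ _ hu hv => simp only [map_add, hu, hv]
  have key : ∀ u, g (Φ.D u) = u - Φ.ε u • Φ.one := by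
    intro u
    refine Φ.induction (LinearMap.eqLocus (g ∘ₗ Φ.D)
      (LinearMap.id - (Φ.ε).smulRight (Φ.one))) ?_ ?_ u
    · rw [LinearMap.mem_eqLocus, LinearMap.comp_apply, D_one]
      simp [ε_one]
    · rintro i hi h u -
      have hu : u ∈ ⨆ n : ℕ, Module.End.eigenspace (Φ.D) (-(n : ℂ)) :=
        Φ.iSup_eigenspace ▸ Submodule.mem_top
      rw [LinearMap.mem_eqLocus]
      simp only [LinearMap.comp_apply, LinearMap.sub_apply, LinearMap.id_apply,
        LinearMap.smulRight_apply, Φ.ε_A _ hi, zero_smul, sub_zero]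
      induction hu using Submodule.iSup_induction' with
      | mem n u hu =>
        have h2 : -((n + (-i).toNat : ℕ) : ℂ) = i - n := by
          have h3 : (((-i).toNat : ℤ) : ℂ) = ((-i : ℤ) : ℂ) := by congr 1; omega
          rw [Int.cast_natCast] at h3
          push_cast
          rw [h3]; push_cast; ring
        have h1 : Φ.D (Φ.A i h u) = (-((n + (-i).toNat : ℕ) : ℂ)) • Φ.A i h u := by
          have := LinearMap.congr_fun (Φ.lie_D i h) u
          rw [LinearMap.sub_apply, Module.End.mul_apply, Module.End.mul_apply,
            Module.End.mem_eigenspace_iff.mp hu, sub_eq_iff_eq_add, map_smul,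
            LinearMap.smul_apply, ← add_smul] at this
          rw [this, h2, sub_eq_add_neg]
        have h4 : -((n + (-i).toNat : ℕ) : ℂ) ≠ 0 := by
          rw [neg_ne_zero, Nat.cast_ne_zero]; omega
        rw [h1, map_smul, hg _ _ (Module.End.mem_eigenspace_iff.mpr h1), LinearMap.smul_apply,
          LinearMap.id_apply, smul_inv_smul₀ h4]
      | zero => simp
      | add u v _ _ hu hv => simp only [map_add, hu, hv]
  exact ⟨g, key, fun u => (hcomm u).trans (key u)⟩

end VermaLike

variable {W : Type*} [AddCommGroup W] [Module ℂ W]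

/-- The Heisenberg operators on `M(k) ⊗ W`: the `h_i ⊗ t^i` with `i ≠ 0` act on `M(k)` and `h_0`
acts on `W`. -/
def tA (a₀ : S.𝔥 →ₗ[ℂ] Module.End ℂ W) (i : ℤ) : S.𝔥 →ₗ[ℂ] Module.End ℂ (M ⊗[ℂ] W) :=
  if i = 0 then LinearMap.lTensorHom (M) ∘ₗ a₀ else LinearMap.rTensorHom W ∘ₗ Φ.A i

variable {a₀ : S.𝔥 →ₗ[ℂ] Module.End ℂ W}

lemma tA_of_ne {i : ℤ} (hi : i ≠ 0) (h : S.𝔥) :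
    tA Φ a₀ i h = LinearMap.rTensor W (Φ.A i h) := by
  rw [tA, if_neg hi]; rfl

lemma tA_zero (h : S.𝔥) : tA Φ a₀ 0 h = LinearMap.lTensor (M) (a₀ h) := by
  rw [tA, if_pos rfl]; rfl

lemma tA_projH {i : ℤ} (hi : i ≠ 0) (h : S.𝔥) :
    tA Φ a₀ i (S.projH i h) = tA Φ a₀ i h := by
  rw [tA_of_ne Φ hi, tA_of_ne Φ hi, Φ.A_projH]

lemma tA_rel (h₀ : ∀ h h', a₀ h * a₀ h' = a₀ h' * a₀ h) :
    HeisRel S k (R := Module.End ℂ (M ⊗[ℂ] W)) (tA Φ a₀) := by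
  intro i j h h'
  by_cases hi : i = 0
  · subst hi
    by_cases hj : j = 0
    · subst hj
      rw [tA_zero, tA_zero, ← LinearMap.lTensor_mul, ← LinearMap.lTensor_mul, h₀, sub_self]
      simp
    · rw [tA_zero, tA_of_ne Φ hj, if_neg (by omega)]
      refine TensorProduct.ext' fun u w => ?_
      simp
  · by_cases hj : j = 0
    · subst hj
      rw [tA_zero, tA_of_ne Φ hi, if_neg (by omega)]
      refine TensorProduct.ext' fun u w => ?_
      simp
    · rw [tA_of_ne Φ hi, tA_of_ne Φ hj, ← LinearMap.rTensor_mul, ← LinearMap.rTensor_mul,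
        ← LinearMap.rTensor_sub, Φ.rel]
      split_ifs
      · rw [LinearMap.rTensor_smul]; congr 1; exact LinearMap.rTensor_id _ _
      · exact LinearMap.rTensor_zero _

/-- The inclusion `w ↦ 1 ⊗ w`. -/
def tι : W →ₗ[ℂ] M ⊗[ℂ] W := TensorProduct.mk ℂ _ _ (Φ.one)

lemma tι_apply (w : W) : tι Φ w = Φ.one ⊗ₜ w := rfl

/-- The projection to the vacuum. -/
def tε : M ⊗[ℂ] W →ₗ[ℂ] W :=
  (TensorProduct.lid ℂ W).toLinearMap ∘ₗ LinearMap.rTensor W (Φ.ε)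

lemma tε_tmul (u : M) (w : W) : tε Φ (u ⊗ₜ w) = Φ.ε u • w := by
  simp [tε]

lemma t_gen (Q : Submodule ℂ (M ⊗[ℂ] W)) (hι : ∀ w, tι Φ w ∈ Q)
    (hQ : ∀ i, i < 0 → ∀ h, ∀ v ∈ Q, tA Φ a₀ i h v ∈ Q) (v) : v ∈ Q := by
  induction v using TensorProduct.induction_on with
  | zero => exact zero_mem _
  | add x y hx hy => exact add_mem hx hy
  | tmul u w =>
    refine Φ.induction (Q.comap ((TensorProduct.mk ℂ _ _).flip w)) (hι w) ?_ u
    intro i hi h u hu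
    have := hQ i hi h _ hu
    rw [tA_of_ne Φ hi.ne] at this
    simpa using this

lemma t_annFin (h₀ : ∀ h h', a₀ h * a₀ h' = a₀ h' * a₀ h) : AnnFin (tA Φ a₀) := by
  let Q : Submodule ℂ (M ⊗[ℂ] W) :=
    { carrier := {v | ∃ J : ℕ, ∀ j : ℕ, J ≤ j → ∀ h, tA Φ a₀ j h v = 0}
      zero_mem' := ⟨0, fun j _ h => map_zero _⟩
      add_mem' := by
        rintro v w ⟨J, hJ⟩ ⟨J', hJ'⟩
        exact ⟨max J J', fun j hj h => by rw [map_add, hJ j (by omega), hJ' j (by omega), add_zero]⟩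
      smul_mem' := by
        rintro c v ⟨J, hJ⟩
        exact ⟨J, fun j hj h => by rw [map_smul, hJ j hj, smul_zero]⟩ }
  refine fun v => t_gen Φ (a₀ := a₀) Q ?_ ?_ v
  · intro w
    refine ⟨1, fun j hj h => ?_⟩
    rw [tA_of_ne Φ (by omega), tι_apply, LinearMap.rTensor_tmul, Φ.A_one _ h (by omega), TensorProduct.zero_tmul]
  · rintro i hi h v ⟨J, hJ⟩
    refine ⟨max J ((-i).toNat + 1), fun j hj h' => ?_⟩
    have := LinearMap.congr_fun (tA_rel Φ h₀ j i h' h) v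
    rw [if_neg (by omega), LinearMap.sub_apply, Module.End.mul_apply, Module.End.mul_apply,
      hJ j (by omega), map_zero, sub_zero] at this
    exact this

/-- Both sides vanish on `1 ⊗ W` and have the same commutators with the creation operators, which
generate everything from there. -/
lemma t_sugawara [FiniteDimensional ℂ 𝔤] [LieAlgebra.IsSemisimple ℂ 𝔤] (hk : k ≠ 0) (h₀ : ∀ h h', a₀ h * a₀ h' = a₀ h' * a₀ h) (v : M ⊗[ℂ] W) :
    sugawara k (tA Φ a₀) (t_annFin Φ h₀) v = - LinearMap.rTensor W (Φ.D) v := by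
  refine t_gen Φ (a₀ := a₀) (LinearMap.eqLocus (sugawara k (tA Φ a₀) (t_annFin Φ h₀))
    (- LinearMap.rTensor W (Φ.D))) ?_ ?_ v
  · intro w
    rw [LinearMap.mem_eqLocus, sugawara_eq_zero, LinearMap.neg_apply, tι_apply,
      LinearMap.rTensor_tmul, Φ.D_one, TensorProduct.zero_tmul, neg_zero]
    intro i hi h
    rw [tA_of_ne Φ (by omega), tι_apply, LinearMap.rTensor_tmul, Φ.A_one _ h (by omega), TensorProduct.zero_tmul]
  · intro i hi h v hv
    rw [LinearMap.mem_eqLocus] at hv ⊢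
    rw [lie_sugawara (tA_rel Φ h₀) (fun i hi => tA_projH Φ hi) _ hk hi.ne, hv,
      tA_of_ne Φ hi.ne]
    have h1 : LinearMap.rTensor W (Φ.D) * LinearMap.rTensor W (Φ.A i h) -
        LinearMap.rTensor W (Φ.A i h) * LinearMap.rTensor W (Φ.D) =
          (i : ℂ) • LinearMap.rTensor W (Φ.A i h) := by
      rw [← LinearMap.rTensor_mul, ← LinearMap.rTensor_mul, ← LinearMap.rTensor_sub,
        Φ.lie_D, LinearMap.rTensor_smul]
    have h2 := LinearMap.congr_fun h1 v
    rw [LinearMap.sub_apply, Module.End.mul_apply, Module.End.mul_apply,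
      sub_eq_iff_eq_add, LinearMap.smul_apply] at h2
    rw [LinearMap.neg_apply, LinearMap.neg_apply, h2, map_neg]
    abel

/-- `M(k) ⊗ W` is generated by its vacuum space `1 ⊗ W`. -/
def tHeisVac [FiniteDimensional ℂ 𝔤] [LieAlgebra.IsSemisimple ℂ 𝔤] (hk : k ≠ 0) (h₀ : ∀ h h', a₀ h * a₀ h' = a₀ h' * a₀ h) :
    HeisVac S k (M ⊗[ℂ] W) W where
  a := tA Φ a₀
  rel := tA_rel Φ h₀
  ι := tι Φ
  ε := tε Φ
  ε_ι w := by rw [tι_apply, tε_tmul, Φ.ε_one, one_smul]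
  a_ι i hi h w := by
    rw [tA_of_ne Φ (by omega), tι_apply, LinearMap.rTensor_tmul, Φ.A_one _ h (by omega), TensorProduct.zero_tmul]
  ε_a i hi h v := by
    rw [tA_of_ne Φ hi.ne]
    induction v using TensorProduct.induction_on with
    | zero => simp
    | add x y hx hy => rw [map_add, map_add, hx, hy, add_zero]
    | tmul u w => rw [LinearMap.rTensor_tmul, tε_tmul, Φ.ε_A _ hi, zero_smul]
  vac v hv := by
    -- A vacuum vector is killed by the Sugawara operator, hence by `D ⊗ 1`. Applying the partial
    -- inverse `g ⊗ 1` leaves `v - ι (ε v) = 0`.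
    obtain ⟨g, hg, -⟩ := Φ.exists_D_inverse
    have h1 := t_sugawara Φ hk h₀ v
    rw [sugawara_eq_zero _ hv, eq_comm, neg_eq_zero] at h1
    have h2 : ∀ v : M ⊗[ℂ] W, LinearMap.rTensor W g (LinearMap.rTensor W (Φ.D) v) =
        v - tι Φ (tε Φ v) := by
      intro v
      induction v using TensorProduct.induction_on with
      | zero => simp
      | add x y hx hy => rw [map_add, map_add, hx, hy, map_add, map_add]; abel
      | tmul u w =>
        rw [LinearMap.rTensor_tmul, LinearMap.rTensor_tmul, hg, tε_tmul, tι_apply,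
          TensorProduct.sub_tmul, TensorProduct.tmul_smul, TensorProduct.smul_tmul']
    have h3 := h2 v
    rw [h1, map_zero, eq_comm, sub_eq_zero] at h3
    exact h3.symm
  gen Q hι hQ v := t_gen Φ Q hι hQ v

lemma t_exists_preimage {v : M ⊗[ℂ] W} (hv : tε Φ v = 0) :
    ∃ v', LinearMap.rTensor W (Φ.D) v' = v := by
  obtain ⟨g, -, hg⟩ := Φ.exists_D_inverse
  refine ⟨LinearMap.rTensor W g v, ?_⟩
  have h2 : ∀ v : M ⊗[ℂ] W, LinearMap.rTensor W (Φ.D) (LinearMap.rTensor W g v) =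
      v - tι Φ (tε Φ v) := by
    intro v
    induction v using TensorProduct.induction_on with
    | zero => simp
    | add x y hx hy => rw [map_add, map_add, hx, hy, map_add, map_add]; abel
    | tmul u w =>
      rw [LinearMap.rTensor_tmul, LinearMap.rTensor_tmul, hg, tε_tmul, tι_apply,
        TensorProduct.sub_tmul, TensorProduct.tmul_smul, TensorProduct.smul_tmul']
  rw [h2, hv, map_zero, sub_zero]

/-! ### The grading of the tensor product -/

/-- The operator `d_0 ⊗ 1 + 1 ⊗ d`. -/
def tD (d : Module.End ℂ W) : Module.End ℂ (M ⊗[ℂ] W) :=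
  LinearMap.rTensor W (Φ.D) + LinearMap.lTensor (M) d

lemma lie_tD_tA {d : Module.End ℂ W} (hd : ∀ h, d * a₀ h = a₀ h * d) (i : ℤ) (h : S.𝔥) :
    tD Φ d * tA Φ a₀ i h - tA Φ a₀ i h * tD Φ d = (i : ℂ) • tA Φ a₀ i h := by
  by_cases hi : i = 0
  · subst hi
    rw [tA_zero, tD, add_mul, mul_add, ← LinearMap.lTensor_mul, ← LinearMap.lTensor_mul, hd]
    have : LinearMap.rTensor W (Φ.D) * LinearMap.lTensor (M) (a₀ h) =
        LinearMap.lTensor (M) (a₀ h) * LinearMap.rTensor W (Φ.D) := by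
      refine TensorProduct.ext' fun u w => ?_; simp
    rw [this]
    simp
  · rw [tA_of_ne Φ hi, tD, add_mul, mul_add, ← LinearMap.rTensor_mul, ← LinearMap.rTensor_mul]
    have : LinearMap.rTensor W (Φ.A i h) * LinearMap.lTensor (M) d =
        LinearMap.lTensor (M) d * LinearMap.rTensor W (Φ.A i h) := by
      refine TensorProduct.ext' fun u w => ?_; simp
    rw [this, add_sub_add_right_eq_sub, ← LinearMap.rTensor_sub, Φ.lie_D,
      LinearMap.rTensor_smul]

lemma tD_graded {d : Module.End ℂ W} (hd : GradedBddAbove d) : GradedBddAbove (tD Φ d) := by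
  rw [gradedBddAbove_iff] at hd ⊢
  -- `F z` is spanned by tensors of degrees `-n` and `z + n`. These subspaces lie in the eigenspaces
  -- and exhaust the tensor product, so they are the eigenspaces; as `n ≥ 0`, the bound for `d`
  -- passes to `tD`.
  let F : ℂ → Submodule ℂ (M ⊗[ℂ] W) := fun z => Submodule.span ℂ
    {v | ∃ (n : ℕ) (u : M) (w : W), u ∈ Module.End.eigenspace (Φ.D) (-(n : ℂ)) ∧
      w ∈ Module.End.eigenspace d (z + n) ∧ v = u ⊗ₜ w}
  have hF : ∀ z, F z ≤ Module.End.eigenspace (tD Φ d) z := by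
    intro z
    refine Submodule.span_le.mpr ?_
    rintro _ ⟨n, u, w, hu, hw, rfl⟩
    rw [SetLike.mem_coe, Module.End.mem_eigenspace_iff, tD, LinearMap.add_apply,
      LinearMap.rTensor_tmul, LinearMap.lTensor_tmul, Module.End.mem_eigenspace_iff.mp hu,
      Module.End.mem_eigenspace_iff.mp hw, TensorProduct.tmul_smul, ← TensorProduct.smul_tmul',
      ← add_smul]
    congr 1; ring
  have htop : ⨆ z, F z = ⊤ := by
    refine Submodule.eq_top_iff'.mpr fun v => ?_
    induction v using TensorProduct.induction_on with
    | zero => exact zero_mem _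
    | add x y hx hy => exact add_mem hx hy
    | tmul u w =>
      have hu : u ∈ ⨆ n : ℕ, Module.End.eigenspace (Φ.D) (-(n : ℂ)) :=
        Φ.iSup_eigenspace ▸ Submodule.mem_top
      have hw : w ∈ ⨆ z, Module.End.eigenspace d z := hd.1 ▸ Submodule.mem_top
      induction hu using Submodule.iSup_induction' with
      | zero => rw [TensorProduct.zero_tmul]; exact zero_mem _
      | add x y _ _ hx hy => rw [TensorProduct.add_tmul]; exact add_mem hx hy
      | mem n u hu =>
        induction hw using Submodule.iSup_induction' with
        | zero => rw [TensorProduct.tmul_zero]; exact zero_mem _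
        | add x y _ _ hx hy => rw [TensorProduct.tmul_add]; exact add_mem hx hy
        | mem z w hw =>
          refine Submodule.mem_iSup_of_mem (z - n) (Submodule.subset_span ⟨n, u, w, hu, ?_, rfl⟩)
          rwa [sub_add_cancel]
  have hEq := eq_of_iSupIndep (tD Φ d).eigenspaces_iSupIndep hF htop
  refine ⟨by rw [← htop]; exact iSup_congr fun z => (hEq z).symm, fun z => ?_⟩
  obtain ⟨ℓ₀, h⟩ := hd.2 z
  refine ⟨ℓ₀, fun ℓ hℓ => ?_⟩
  rw [← hEq, Submodule.span_eq_bot]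
  rintro _ ⟨n, u, w, _, hw, rfl⟩
  have := h (ℓ + n) (by omega)
  rw [Int.cast_add, Int.cast_natCast, ← add_assoc] at this
  rw [this, Submodule.mem_bot] at hw
  rw [hw, TensorProduct.tmul_zero]

end VermaTensor

end

section

/-! ### Graded Heisenberg modules are induced from their vacuum -/

section StoneVonNeumann

variable {𝔤 : Type u} [LieRing 𝔤] [LieAlgebra ℂ 𝔤]

/-- A vector space with an action of the Heisenberg operators at level `k` and a compatible
degree operator whose degrees are bounded above. -/
structure HeisGr (S : Data 𝔤) (k : ℂ) (E : Type*) [AddCommGroup E] [Module ℂ E] where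
  a : ℤ → S.𝔥 →ₗ[ℂ] Module.End ℂ E
  rel : HeisRel S k a
  a_projH : ∀ i h, a i (S.projH i h) = a i h
  D : Module.End ℂ E
  lie_D : ∀ i h, D * a i h - a i h * D = (i : ℂ) • a i h
  graded : GradedBddAbove D

/-- The universal property of the Verma module for representations on `F`. -/
def VermaLike.HasLift {S : Data 𝔤} {k : ℂ} {M : Type*} [AddCommGroup M] [Module ℂ M]
    (Φ : VermaLike S k M) (F : Type*) [AddCommGroup F] [Module ℂ F] : Prop :=
  ∀ (a : ℤ → S.𝔥 →ₗ[ℂ] Module.End ℂ F) (D : Module.End ℂ F),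
    (∀ i h, a i (S.projH i h) = a i h) → HeisRel S k a →
    (∀ i h, D * a i h - a i h * D = (i : ℂ) • a i h) → ∀ e : F, (∀ i h, 0 ≤ i → a i h e = 0) →
    D e = 0 → ∃ φ : M →ₗ[ℂ] F, φ Φ.one = e ∧ (∀ h i u, φ (Φ.A i h u) = a i h (φ u)) ∧
      ∀ u, φ (Φ.D u) = D (φ u)

lemma Data.vermaLike_hasLift (S : Data 𝔤) [FiniteDimensional ℂ 𝔤] [LieAlgebra.IsSemisimple ℂ 𝔤]
    (k : ℂ) (F : Type*) [AddCommGroup F] [Module ℂ F] : (S.vermaLike k).HasLift F :=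
  fun _ _ ha H hD e he hDe => S.exists_vermaLift ha H hD e he hDe

namespace HeisGr

variable {S : Data 𝔤} {k : ℂ} {E : Type*} [AddCommGroup E] [Module ℂ E] (V : HeisGr S k E)

/-- The vacuum space. -/
def vac : Submodule ℂ E := ⨅ (h : S.𝔥) (i : ℤ) (_ : 0 < i), LinearMap.ker (V.a i h)

lemma mem_vac {v : E} : v ∈ V.vac ↔ ∀ i, 0 < i → ∀ h, V.a i h v = 0 := by
  simp only [vac, Submodule.mem_iInf, LinearMap.mem_ker]
  tauto

lemma D_apply_a (i : ℤ) (h : S.𝔥) (v : E) :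
    V.D (V.a i h v) = V.a i h (V.D v) + (i : ℂ) • V.a i h v := by
  have := LinearMap.congr_fun (V.lie_D i h) v
  rw [LinearMap.sub_apply, Module.End.mul_apply, Module.End.mul_apply, sub_eq_iff_eq_add] at this
  rw [this, add_comm]; rfl

lemma D_mem_vac {v : E} (hv : v ∈ V.vac) : V.D v ∈ V.vac := by
  rw [mem_vac] at hv ⊢
  intro i hi h
  have := V.D_apply_a i h v
  rw [hv i hi h, map_zero, smul_zero, add_zero] at this
  exact this.symm

/-- The degree operator on the vacuum space. -/
def Dvac : Module.End ℂ V.vac := V.D.restrict fun _ hv => V.D_mem_vac hv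

lemma Dvac_graded : GradedBddAbove V.Dvac := V.graded.restrict _ _

lemma annFin : AnnFin V.a := by
  intro v
  obtain ⟨N, hN⟩ := V.graded.exists_degBdd v
  exact ⟨N + 1, fun j hj h => hN _ _ (V.lie_D j h) (by omega)⟩

/-- Post-composition of linear maps on the vacuum space. -/
def postComp : Module.End ℂ E →ₗ[ℂ] Module.End ℂ (V.vac →ₗ[ℂ] E) :=
  LinearMap.llcomp ℂ V.vac E E

variable {M : Type*} [AddCommGroup M] [Module ℂ M] (Φ : VermaLike S k M)

/-- The Heisenberg operators on `M ⊗ Ω`, with `h_0` acting as zero. -/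
abbrev tA₀ : ℤ → S.𝔥 →ₗ[ℂ] Module.End ℂ (M ⊗[ℂ] V.vac) := tA Φ (0 : S.𝔥 →ₗ[ℂ] Module.End ℂ V.vac)

/-- The universal property of the Verma module is applied to `Hom(Ω, E)` with the inclusion `Ω → E`
as highest weight vector, and the lift is uncurried. There `h_0` is made to act by zero and the
degree operator is `f ↦ D f - f D`, because the highest weight vector has to be killed by both. -/
lemma exists_linear (hΦ : Φ.HasLift (V.vac →ₗ[ℂ] E)) : ∃ Ψ : M ⊗[ℂ] V.vac →ₗ[ℂ] E,
    (∀ w, Ψ (tι Φ w) = w) ∧ (∀ i, i ≠ 0 → ∀ h v, Ψ (V.tA₀ Φ i h v) = V.a i h (Ψ v)) ∧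
      ∀ v, Ψ (tD Φ V.Dvac v) = V.D (Ψ v) := by
  obtain ⟨φ, h1, h2, h3⟩ := hΦ (fun i => if i = 0 then 0 else V.postComp ∘ₗ V.a i)
    (V.postComp V.D - LinearMap.lcomp ℂ E V.Dvac) (fun i h => by
      split_ifs
      · rfl
      · simp [V.a_projH]) (fun i j h h' => by
      by_cases hi : i = 0
      · simp [hi]
      · by_cases hj : j = 0
        · simp [hj, hi]
        · simp only [if_neg hi, if_neg hj]
          refine LinearMap.ext fun f => LinearMap.ext fun w => ?_
          have := LinearMap.congr_fun (V.rel i j h h') (f w)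
          split_ifs with h0
          · rw [if_pos h0] at this; exact this
          · rw [if_neg h0] at this; exact this) (fun i h => by
      by_cases hi : i = 0
      · simp [hi]
      · simp only [if_neg hi]
        refine LinearMap.ext fun f => LinearMap.ext fun w => ?_
        have := V.D_apply_a i h (f w)
        change V.D (V.a i h (f w)) - V.a i h (f (V.Dvac w)) -
          V.a i h (V.D (f w) - f (V.Dvac w)) = (i : ℂ) • V.a i h (f w)
        rw [this, map_sub]; abel) V.vac.subtype (fun i h hi => by
      by_cases hi0 : i = 0
      · simp [hi0]
      · simp only [if_neg hi0]
        refine LinearMap.ext fun w => ?_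
        exact V.mem_vac.mp w.2 i (by omega) h) (by
      refine LinearMap.ext fun w => ?_
      exact sub_self _)
  refine ⟨TensorProduct.lift φ, fun w => ?_, fun i hi h v => ?_, fun v => ?_⟩
  · rw [tι_apply, TensorProduct.lift.tmul, h1]; rfl
  · rw [tA₀, tA_of_ne Φ hi]
    induction v using TensorProduct.induction_on with
    | zero => simp
    | add x y hx hy => simp only [map_add, hx, hy]
    | tmul u w =>
      rw [LinearMap.rTensor_tmul, TensorProduct.lift.tmul, TensorProduct.lift.tmul, h2, if_neg hi]
      rfl
  · rw [tD]
    induction v using TensorProduct.induction_on with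
    | zero => simp
    | add x y hx hy => rw [map_add, map_add, map_add, hx, hy, map_add]
    | tmul u w =>
      rw [LinearMap.add_apply, LinearMap.rTensor_tmul, LinearMap.lTensor_tmul, map_add,
        TensorProduct.lift.tmul, TensorProduct.lift.tmul, TensorProduct.lift.tmul, h3]
      change V.D (φ u w) - φ u (V.Dvac w) + φ u (V.Dvac w) = _
      rw [sub_add_cancel]

variable [FiniteDimensional ℂ 𝔤] [LieAlgebra.IsSemisimple ℂ 𝔤]

/-- The Sugawara operator. -/
abbrev sug : Module.End ℂ E := sugawara k V.a V.annFin

lemma sug_a (hk : k ≠ 0) {i : ℤ} (hi : i ≠ 0) (h : S.𝔥) (v : E) :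
    V.sug (V.a i h v) = V.a i h (V.sug v) - (i : ℂ) • V.a i h v :=
  lie_sugawara V.rel (fun i _ => V.a_projH i) V.annFin hk hi h v

/-- The Sugawara operator has no negative eigenvalues. -/
lemma eq_zero_of_sug_eq (hk : k ≠ 0) (t : ℕ) : ∀ (i : ℤ) (v : E), 0 < i → DegBdd V.D (t - 1) v →
    V.sug v = (-(i : ℂ)) • v → v = 0 := by
  induction t with
  | zero => intro i v _ hv _; exact hv.eq_zero (by omega)
  | succ t ih =>
    intro i v hi hv hs
    -- An annihilation operator of degree `j` sends `v` to an eigenvector for `-(j + i)` with a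
    -- smaller degree bound, which vanishes by induction. So `v` is a vacuum vector, where the
    -- Sugawara operator is zero.
    have h1 : ∀ j, 0 < j → ∀ h, V.a j h v = 0 := by
      intro j hj h
      refine ih (j + i) _ (by omega) ((hv.apply (V.lie_D j h)).mono (by push_cast; omega)) ?_
      rw [V.sug_a hk hj.ne', hs, map_smul, ← sub_smul]
      congr 1; push_cast; ring
    rw [sug, sugawara_eq_zero _ h1, eq_comm] at hs
    exact (smul_eq_zero_iff_right (neg_ne_zero.mpr (by exact_mod_cast hi.ne'))).mp hs

/-- Injectivity: by induction the annihilation operators kill a vector of the kernel, which then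
lies in `1 ⊗ Ω`, where the map is the inclusion. Surjectivity: by induction the image contains all
`a_i v`, `i > 0`, and a correction by an element of the image turns `v` into a vacuum vector. -/
theorem exists_equiv (hk : k ≠ 0) (hΦ : Φ.HasLift (V.vac →ₗ[ℂ] E)) :
    ∃ Ψ : M ⊗[ℂ] V.vac ≃ₗ[ℂ] E, (∀ w, Ψ (tι Φ w) = w) ∧
      (∀ i, i ≠ 0 → ∀ h v, Ψ (V.tA₀ Φ i h v) = V.a i h (Ψ v)) ∧
      ∀ v, Ψ (tD Φ V.Dvac v) = V.D (Ψ v) := by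
  obtain ⟨Ψ, h1, h2, h3⟩ := V.exists_linear Φ hΦ
  let H₀ : HeisVac S k (M ⊗[ℂ] V.vac) V.vac :=
    tHeisVac Φ (a₀ := (0 : S.𝔥 →ₗ[ℂ] Module.End ℂ V.vac)) hk fun _ _ => rfl
  -- With the bound `t - 1` the case `t = 0` has a negative bound and concerns only the zero vector;
  -- every annihilation operator lowers the bound by at least one.
  have hinj : ∀ t : ℕ, ∀ v, DegBdd (tD Φ V.Dvac) (t - 1) v → Ψ v = 0 → v = 0 := by
    intro t
    induction t with
    | zero => intro v hv _; exact hv.eq_zero (by omega)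
    | succ t ih =>
      intro v hv h0
      have hv0 : tι Φ (tε Φ v) = v := by
        refine H₀.vac v fun i hi h => ih _ ?_ ?_
        · refine (hv.apply (lie_tD_tA Φ (fun _ => ?_) i h)).mono (by push_cast; omega)
          simp
        · have := h2 i hi.ne' h v
          rw [h0, map_zero] at this
          exact this
      rw [← hv0, h1] at h0
      rw [← hv0, show tε Φ v = 0 from Subtype.ext h0, map_zero]
  have hsurj : ∀ t : ℕ, ∀ v, DegBdd V.D (t - 1) v → v ∈ LinearMap.range Ψ := by
    intro t
    induction t with
    | zero => intro v hv; rw [hv.eq_zero (by omega)]; exact zero_mem _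
    | succ t ih =>
      intro v hv
      have ha : ∀ i, 0 < i → ∀ h, V.a i h v ∈ LinearMap.range Ψ := fun i hi h =>
        ih _ ((hv.apply (V.lie_D i h)).mono (by push_cast; omega))
      have hs : V.sug v ∈ (LinearMap.ker (tε Φ)).map Ψ := by
        rw [sug, sugawara, LinearMap.smul_apply, locSum_apply]
        refine Submodule.smul_mem _ _ ?_
        rw [finsum_eq_sum _ (V.annFin.locFin v)]
        refine sum_mem fun j _ => ?_
        rw [sugTerm_apply]
        refine sum_mem fun l _ => ?_
        obtain ⟨u, hu⟩ := ha ((j + 1 : ℕ) : ℤ) (by omega) (S.bH' l)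
        refine ⟨V.tA₀ Φ (-((j + 1 : ℕ) : ℤ)) (S.bH l) u, H₀.ε_a _ (by omega) _ _, ?_⟩
        rw [h2 _ (by omega), hu]
      obtain ⟨u, hu, hus⟩ := hs
      obtain ⟨u', rfl⟩ := t_exists_preimage Φ (LinearMap.mem_ker.mp hu)
      have hΨs : ∀ u, V.sug (Ψ u) = - Ψ (LinearMap.rTensor V.vac Φ.D u) := by
        intro u
        have h4 := congrArg Ψ (t_sugawara Φ (a₀ := (0 : S.𝔥 →ₗ[ℂ] Module.End ℂ V.vac)) hk
          (fun _ _ => rfl) u)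
        rw [map_neg] at h4
        rw [← h4, sug, sugawara, sugawara, LinearMap.smul_apply, LinearMap.smul_apply, map_smul,
          locSum_apply, locSum_apply,
          linear_finsum _ ((t_annFin Φ (a₀ := (0 : S.𝔥 →ₗ[ℂ] Module.End ℂ V.vac))
            fun _ _ => rfl).locFin u)]
        congr 1
        refine finsum_congr fun j => ?_
        rw [sugTerm_apply, sugTerm_apply, map_sum]
        refine Finset.sum_congr rfl fun l _ => ?_
        rw [h2 _ (by omega), h2 _ (by omega)]
      -- `sug v` is the image of some `D u'`, and `sug` corresponds to `-D`, so `sug v₀ = 0`. Then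
      -- `a_i v₀` has Sugawara eigenvalue `-i < 0` and must vanish: `v₀` is a vacuum vector.
      set v₀ := v + Ψ u' with hv₀
      have hv₀s : V.sug v₀ = 0 := by
        rw [hv₀, map_add, hΨs, hus, add_neg_cancel]
      have hv₀mem : v₀ ∈ V.vac := by
        rw [mem_vac]
        intro i hi h
        obtain ⟨y, hy⟩ : V.a i h v₀ ∈ LinearMap.range Ψ := by
          rw [hv₀, map_add]
          exact add_mem (ha i hi h) ⟨_, h2 i hi.ne' h u'⟩
        obtain ⟨N, hN⟩ := V.graded.exists_degBdd (V.a i h v₀)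
        refine V.eq_zero_of_sug_eq hk (N + 1) i _ hi (hN.mono (by push_cast; omega)) ?_
        rw [V.sug_a hk hi.ne', hv₀s, map_zero, zero_sub, neg_smul]
      have : v = Ψ (tι Φ ⟨v₀, hv₀mem⟩) - Ψ u' := by
        rw [h1]
        exact (add_sub_cancel_right v (Ψ u')).symm
      rw [this]
      exact sub_mem ⟨_, rfl⟩ ⟨_, rfl⟩
  refine ⟨LinearEquiv.ofBijective Ψ ⟨?_, fun v => ?_⟩, h1, h2, h3⟩
  · rw [injective_iff_map_eq_zero]
    intro v hv
    obtain ⟨N, hN⟩ := (tD_graded Φ V.Dvac_graded).exists_degBdd v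
    exact hinj (N + 1) v (hN.mono (by push_cast; omega)) hv
  · obtain ⟨N, hN⟩ := V.graded.exists_degBdd v
    exact hsurj (N + 1) v (hN.mono (by push_cast; omega))

end HeisGr

end StoneVonNeumann

end

/-! ### Graded Heisenberg modules as modules generated by their vacuum. -/

section

variable {𝔤 : Type u} [LieRing 𝔤] [LieAlgebra ℂ 𝔤]

namespace HeisGr

variable {S : Data 𝔤} {k : ℂ} {E : Type*} [AddCommGroup E] [Module ℂ E] (V : HeisGr S k E)
  {M : Type*} [AddCommGroup M] [Module ℂ M] (Φ : VermaLike S k M)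
  [FiniteDimensional ℂ 𝔤] [LieAlgebra.IsSemisimple ℂ 𝔤]
  (hk : k ≠ 0) (hΦ : Φ.HasLift (V.vac →ₗ[ℂ] E))

/-- The isomorphism of `V` with the module induced from its vacuum space. -/
def Ψ : M ⊗[ℂ] V.vac ≃ₗ[ℂ] E := (V.exists_equiv Φ hk hΦ).choose

lemma Ψ_tι (w : V.vac) : V.Ψ Φ hk hΦ (tι Φ w) = w := (V.exists_equiv Φ hk hΦ).choose_spec.1 w

lemma Ψ_tA {i : ℤ} (hi : i ≠ 0) (a₀ : S.𝔥 →ₗ[ℂ] Module.End ℂ V.vac) (h : S.𝔥)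
    (v : M ⊗[ℂ] V.vac) : V.Ψ Φ hk hΦ (tA Φ a₀ i h v) = V.a i h (V.Ψ Φ hk hΦ v) := by
  rw [tA_of_ne Φ hi, ← tA_of_ne Φ (a₀ := (0 : S.𝔥 →ₗ[ℂ] Module.End ℂ V.vac)) hi]
  exact (V.exists_equiv Φ hk hΦ).choose_spec.2.1 i hi h v

lemma Ψ_tD (v : M ⊗[ℂ] V.vac) : V.Ψ Φ hk hΦ (tD Φ V.Dvac v) = V.D (V.Ψ Φ hk hΦ v) :=
  (V.exists_equiv Φ hk hΦ).choose_spec.2.2 v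

/-- A graded Heisenberg module is generated by its vacuum space. -/
def heisVac : HeisVac S k E V.vac where
  a := V.a
  rel := V.rel
  ι := V.vac.subtype
  ε := tε Φ ∘ₗ (V.Ψ Φ hk hΦ).symm.toLinearMap
  ε_ι w := by
    have : (V.Ψ Φ hk hΦ).symm w = tι Φ w := by
      rw [LinearEquiv.symm_apply_eq, Ψ_tι]
    rw [LinearMap.comp_apply, Submodule.subtype_apply, LinearEquiv.coe_coe, this]
    exact (tHeisVac Φ (a₀ := (0 : S.𝔥 →ₗ[ℂ] Module.End ℂ V.vac)) hk fun _ _ => rfl).ε_ι w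
  a_ι i hi h w := V.mem_vac.mp w.2 i hi h
  ε_a i hi h v := by
    have : (V.Ψ Φ hk hΦ).symm (V.a i h v) = V.tA₀ Φ i h ((V.Ψ Φ hk hΦ).symm v) := by
      rw [LinearEquiv.symm_apply_eq, Ψ_tA _ _ _ _ hi.ne, LinearEquiv.apply_symm_apply]
    rw [LinearMap.comp_apply, LinearEquiv.coe_coe, this]
    exact (tHeisVac Φ (a₀ := (0 : S.𝔥 →ₗ[ℂ] Module.End ℂ V.vac)) hk fun _ _ => rfl).ε_a i hi h _
  vac v hv := by
    have : (V.Ψ Φ hk hΦ).symm v = tι Φ ⟨v, V.mem_vac.mpr hv⟩ := by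
      rw [LinearEquiv.symm_apply_eq, Ψ_tι]
    rw [LinearMap.comp_apply, LinearEquiv.coe_coe, this]
    exact congrArg V.vac.subtype
      ((tHeisVac Φ (a₀ := (0 : S.𝔥 →ₗ[ℂ] Module.End ℂ V.vac)) hk fun _ _ => rfl).ε_ι _)
  gen Q hι hQ v := by
    have := t_gen Φ (a₀ := (0 : S.𝔥 →ₗ[ℂ] Module.End ℂ V.vac))
      (Q.comap (V.Ψ Φ hk hΦ).toLinearMap) (fun w => ?_) (fun i hi h v hv => ?_)
      ((V.Ψ Φ hk hΦ).symm v)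
    · simpa using this
    · rw [Submodule.mem_comap, LinearEquiv.coe_coe, Ψ_tι]; exact hι w
    · rw [Submodule.mem_comap, LinearEquiv.coe_coe, Ψ_tA _ _ _ _ hi.ne]
      exact hQ i hi h _ hv

end HeisGr

/-! ### The algebra of vacuum expectation values. -/

namespace HeisVac

variable {S : Data 𝔤} {k : ℂ} {E W : Type*} [AddCommGroup E] [Module ℂ E]
  [AddCommGroup W] [Module ℂ W] (H : HeisVac S k E W)

/-- The vacuum expectation value of an operator. -/
def vev : Module.End ℂ E →ₗ[ℂ] Module.End ℂ W where
  toFun Y := H.ε ∘ₗ Y ∘ₗ H.ι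
  map_add' Y Y' := by ext; simp
  map_smul' c Y := by ext; simp

lemma vev_apply (Y : Module.End ℂ E) (w : W) : H.vev Y w = H.ε (Y (H.ι w)) := rfl

lemma vev_one : H.vev 1 = 1 := by
  ext w; exact H.ε_ι w

/-- Operators whose commutators with each `a i h`, `i ≠ 0`, are multiples of `a i h`. -/
def Compat (Y : Module.End ℂ E) : Prop :=
  ∀ i, i ≠ 0 → ∀ h, ∃ c : ℂ, Y * H.a i h - H.a i h * Y = c • H.a i h

variable {H}

lemma compat_of_commute {Y : Module.End ℂ E}
    (hY : ∀ i, i ≠ 0 → ∀ h, Y * H.a i h - H.a i h * Y = 0) : H.Compat Y :=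
  fun i hi h => ⟨0, by rw [hY i hi h, zero_smul]⟩

namespace Compat

variable {Y : Module.End ℂ E} (hY : H.Compat Y)

include hY

/-- The commutator of `Y` with an annihilation operator is a multiple of that operator and kills the
vacuum, so `Y` preserves the vacuum space. -/
lemma ι_vev (w : W) : H.ι (H.vev Y w) = Y (H.ι w) := by
  rw [vev_apply]
  refine H.vac _ fun i hi h => ?_
  obtain ⟨c, hc⟩ := hY i hi.ne' h
  have := LinearMap.congr_fun hc (H.ι w)
  simpa [H.a_ι i hi] using this

lemma ε_apply (v : E) : H.ε (Y v) = H.vev Y (H.ε v) := by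
  refine H.gen (LinearMap.eqLocus (H.ε ∘ₗ Y) (H.vev Y ∘ₗ H.ε)) (fun w => ?_)
    (fun i hi h v _ => ?_) v
  · rw [LinearMap.mem_eqLocus, LinearMap.comp_apply, LinearMap.comp_apply, H.ε_ι]; rfl
  · obtain ⟨c, hc⟩ := hY i hi.ne h
    have := LinearMap.congr_fun hc v
    rw [LinearMap.sub_apply, Module.End.mul_apply, Module.End.mul_apply, sub_eq_iff_eq_add] at this
    rw [LinearMap.mem_eqLocus, LinearMap.comp_apply, LinearMap.comp_apply, this, H.ε_a i hi,
      map_zero, map_add, LinearMap.smul_apply, map_smul, H.ε_a i hi, H.ε_a i hi, smul_zero,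
      add_zero]

/-- Expectation values are not multiplicative in general; they are when one factor preserves both
the vacuum and the kernel of `ε`, as compatible operators do. -/
lemma vev_mul (X : Module.End ℂ E) : H.vev (Y * X) = H.vev Y * H.vev X := by
  ext w; exact hY.ε_apply _

lemma vev_mul' (X : Module.End ℂ E) : H.vev (X * Y) = H.vev X * H.vev Y := by
  ext w
  rw [Module.End.mul_apply, vev_apply, Module.End.mul_apply, ← hY.ι_vev]; rfl

lemma vev_lie (X : Module.End ℂ E) :
    H.vev (Y * X - X * Y) = H.vev Y * H.vev X - H.vev X * H.vev Y := by
  rw [map_sub, hY.vev_mul, hY.vev_mul']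

end Compat

/-! ### Expectation values of brackets of root vectors. -/

section Bracket

variable [FiniteDimensional ℂ 𝔤] [LieAlgebra.IsSemisimple ℂ 𝔤]

/-- Only the component of degree `a` of `x_{β₁}` enters, and writing it as an average over the
powers of `θ` yields the factors `ω^{-pa}`, the coefficients of `δ(ω^{-p} ζ₁/ζ₂)`. -/
lemma _root_.ToroidalZ.Data.gEl_x_lie_gEl_x (S : Data 𝔤) (β₁ β₂ : S.Root) (r s : Fin S.N → ℤ)
    (a b : ℤ) : ⁅S.gEl (S.x β₁) a r, S.gEl (S.x β₂) b s⁆ =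
      (S.m : ℂ)⁻¹ • ∑ p ∈ Finset.range S.m, S.ω ^ (-(p * a)) • S.η p β₁ •
        (S.gEl ⁅S.x (S.θRoot p β₁), S.x β₂⁆ (a + b) (r + s) +
          S.form (S.x (S.θRoot p β₁)) (S.x β₂) • S.cEl a b r s) := by
  rw [S.gEl_lie_gEl, S.proj_eq_sum, smul_lie, Data.gEl_smul, map_smul, LinearMap.smul_apply,
    smul_assoc, ← smul_add]
  congr 1
  let Λ : 𝔤 →ₗ[ℂ] S.L := -(S.gElₗ (a + b) (r + s) ∘ₗ LieAlgebra.ad ℂ 𝔤 (S.x β₂)) +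
    (S.form.flip (S.x β₂)).smulRight (S.cEl a b r s)
  have hΛ : ∀ z, S.gEl ⁅z, S.x β₂⁆ (a + b) (r + s) + S.form z (S.x β₂) • S.cEl a b r s = Λ z := by
    intro z
    rw [← lie_skew, ← neg_one_smul ℂ, Data.gEl_smul, neg_one_smul]
    rfl
  simp only [hΛ]
  rw [map_sum]
  refine Finset.sum_congr rfl fun p _ => ?_
  rw [map_smul, S.θ_iterate_x, map_smul, mul_comm a]

/-- The vacuum expectation values of brackets of root vectors. -/
lemma vev_lie_x (ρ : S.L →ₗ[ℂ] Module.End ℂ E)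
    (Z : S.Root → (Fin S.N → ℤ) → ℤ → Module.End ℂ W)
    (K : Fin (S.N + 1) → (Fin S.N → ℤ) → ℤ → Module.End ℂ W) (Hh : S.𝔥₀ →ₗ[ℂ] Module.End ℂ W)
    (hZ : ∀ (β : S.Root) r n, H.vev (ρ (S.gEl (S.x β) n r)) = Z β r n)
    (hK : ∀ i r p, H.vev (ρ (S.kEl i r p)) = K i r p)
    (hH : ∀ (h : S.𝔥) r n, H.vev (ρ (S.gEl h n r)) =
      if (S.m : ℤ) ∣ n then k⁻¹ • (Hh (S.proj₀ h) * K 0 r (n / S.m)) else 0)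
    (β₁ β₂ : S.Root) (r s : Fin S.N → ℤ) (a b : ℤ) (v : W) :
    let κ : Fin (S.N + 1) → Module.End ℂ W := fun i =>
      if (S.m : ℤ) ∣ a + b then K i (r + s) ((a + b) / S.m) else 0
    H.vev (ρ ⁅S.gEl (S.x β₁) a r, S.gEl (S.x β₂) b s⁆) v =
    (S.m : ℂ)⁻¹ • ∑ p ∈ Finset.range S.m, S.ω ^ (-(p * a)) • S.η p β₁ •
      open scoped Classical in
      if h : IsRoot S.form S.𝔥 (S.θ^[p] β₁ + β₂) then
        S.ε (S.θ^[p] β₁) β₂ • Z ⟨S.θ^[p] β₁ + β₂, h⟩ (r + s) (a + b) v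
      else if S.θ^[p] β₁ + (β₂ : 𝔤) = 0 then
        S.form (S.x β₂) (S.x (-β₂)) •
          (-(k⁻¹ • Hh (S.proj₀ ⟨β₂, β₂.2.1⟩) (κ 0 v)) + ∑ i : Fin S.N, (r i : ℂ) • κ i.succ v +
            ((S.m : ℂ)⁻¹ * a) • κ 0 v)
      else 0 := by
  intro κ
  have hc : H.vev (ρ (S.cEl a b r s)) v =
      ∑ i : Fin S.N, (r i : ℂ) • κ i.succ v + ((S.m : ℂ)⁻¹ * a) • κ 0 v := by
    simp only [κ, Data.cEl]
    split_ifs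
    · simp only [map_add, map_smul, map_sum, hK, LinearMap.add_apply, LinearMap.sum_apply,
        LinearMap.smul_apply]
      rw [add_comm, div_eq_inv_mul]
    · simp
  rw [S.gEl_x_lie_gEl_x, map_smul, map_smul, map_sum, map_sum, LinearMap.smul_apply,
    LinearMap.sum_apply]
  congr 1
  refine Finset.sum_congr rfl fun p _ => ?_
  rw [map_smul, map_smul, map_smul, map_smul, LinearMap.smul_apply, LinearMap.smul_apply]
  congr 2
  rw [map_add, map_add, LinearMap.add_apply, map_smul, map_smul, LinearMap.smul_apply, hc]
  have hp : (S.θRoot p β₁ : 𝔤) = S.θ^[p] β₁ := rfl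
  -- If `θ^p β₁ + β₂` is a root, the form vanishes on the two root vectors and the central term
  -- drops out. If it is zero, the bracket is a multiple of `θ^p β₁ = -β₂ ∈ 𝔥`, evaluated by `hH`.
  -- Otherwise both bracket and form vanish.
  split_ifs with h1 h2
  · have h3 := S.ε_spec _ _ (S.θRoot p β₁).2 β₂.2 h1
    rw [h3, S.form_x_x h1.2.1, zero_smul, add_zero, Data.gEl_smul, map_smul, map_smul,
      LinearMap.smul_apply]
    congr 2
    exact hZ ⟨_, h1⟩ (r + s) (a + b)
  · have h3 : (S.θRoot p β₁ : 𝔤) = -β₂ := eq_neg_of_add_eq_zero_left h2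
    rw [S.lie_x_x_of_add_eq_zero h2, Data.gEl_smul, map_smul, map_smul, LinearMap.smul_apply,
      ← smul_add, S.form_comm, h3]
    congr 1
    rw [← neg_one_smul ℂ (β₂ : 𝔤), Data.gEl_smul, map_smul, map_smul, LinearMap.smul_apply,
      hH ⟨β₂, β₂.2.1⟩, neg_one_smul, add_assoc]
    congr 2
    simp only [κ]
    split_ifs
    · rfl
    · simp
  · rw [S.lie_x_x_of_not_isRoot h2 h1, S.form_x_x h2, zero_smul, add_zero]
    have : S.gEl (0 : 𝔤) (a + b) (r + s) = 0 := (S.gElₗ _ _).map_zero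
    rw [this, map_zero, map_zero, LinearMap.zero_apply]

end Bracket

end HeisVac

end

section

/-! ### The vacuum functor -/

variable {𝔤 : Type u} [LieRing 𝔤] [LieAlgebra ℂ 𝔤] {S : Data 𝔤} {k : ℂ}

namespace ModC

section Basic

variable (V : ModC.{u, w} S k)

/-- The action of `L̃(𝔤, θ)` as a linear map. -/
def actₗ : S.L →ₗ[ℂ] Module.End ℂ V.carrier := LieModule.toEnd ℂ S.L V.carrier

lemma actₗ_apply (y : S.L) : V.actₗ y = V.act y := rfl

lemma act_apply (y : S.L) (v : V.carrier) : V.act y v = ⁅y, v⁆ := rfl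

lemma act_smul (c : ℂ) (y : S.L) : V.act (c • y) = c • V.act y := V.actₗ.map_smul c y

lemma act_zero : V.act 0 = 0 := V.actₗ.map_zero

lemma act_lie (y z : S.L) : V.act ⁅y, z⁆ = V.act y * V.act z - V.act z * V.act y :=
  LinearMap.ext fun v => lie_lie y z v

lemma act_mul_comm {y z : S.L} (h : ⁅y, z⁆ = 0) : V.act y * V.act z = V.act z * V.act y := by
  rw [← sub_eq_zero, ← act_lie, h, act_zero]

lemma act_level : V.act (S.kEl 0 0 0) = k • (1 : Module.End ℂ V.carrier) :=
  LinearMap.ext V.level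

lemma lie_act_d_gEl (i : Fin (S.N + 1)) (x : 𝔤) (n : ℤ) (r : Fin S.N → ℤ) :
    V.act (S.dEl i) * V.act (S.gEl x n r) - V.act (S.gEl x n r) * V.act (S.dEl i) =
      (S.deg (n, r) i : ℂ) • V.act (S.gEl x n r) := by
  rw [← act_lie, S.dEl_lie_gEl, act_smul]

lemma lie_act_d_kEl (i j : Fin (S.N + 1)) (r : Fin S.N → ℤ) (p : ℤ) :
    V.act (S.dEl i) * V.act (S.kEl j r p) - V.act (S.kEl j r p) * V.act (S.dEl i) =
      (S.deg (S.m * p, r) i : ℂ) • V.act (S.kEl j r p) := by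
  rw [← act_lie, S.dEl_lie_kEl, act_smul]

/-- The two operators commute and have degrees `n - mp` and `mp`. For large `|p|` one of these
exceeds the bound for `v`, and that operator is applied first. -/
lemma finite_gEl_kEl (x : 𝔤) (r s : Fin S.N → ℤ) (n : ℤ) (v : V.carrier) :
    (fun p : ℤ => V.act (S.gEl x (n - S.m * p) r) (V.act (S.kEl 0 s p) v)).HasFiniteSupport := by
  obtain ⟨N, hN⟩ := V.graded.exists_degBdd v
  have hm : (1 : ℤ) ≤ S.m := by exact_mod_cast S.m_pos
  refine hasFiniteSupport_int (-(N + |n|)) N (fun p hp => ?_) fun p hp => ?_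
  · rw [← Module.End.mul_apply, V.act_mul_comm (S.gEl_lie_kEl _ _ _ _ _ _), Module.End.mul_apply,
      hN _ _ (V.lie_act_d_gEl 0 x (n - S.m * p) r), map_zero]
    change (N : ℤ) < n - S.m * p
    have h1 := neg_abs_le n
    have h2 := abs_nonneg n
    nlinarith
  · rw [hN _ _ (V.lie_act_d_kEl 0 0 s p), map_zero]
    change (N : ℤ) < S.m * p
    nlinarith

lemma finite_kEl_kEl (i : Fin (S.N + 1)) (r s : Fin S.N → ℤ) (n : ℤ) (v : V.carrier) :
    (fun p : ℤ => V.act (S.kEl i r (n - p)) (V.act (S.kEl 0 s p) v)).HasFiniteSupport := by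
  obtain ⟨N, hN⟩ := V.graded.exists_degBdd v
  have hm : (1 : ℤ) ≤ S.m := by exact_mod_cast S.m_pos
  refine hasFiniteSupport_int (n - N) N (fun p hp => ?_) fun p hp => ?_
  · rw [← Module.End.mul_apply, V.act_mul_comm (S.kEl_lie_kEl _ _ _ _ _ _), Module.End.mul_apply,
      hN _ _ (V.lie_act_d_kEl 0 i r (n - p)), map_zero]
    change (N : ℤ) < S.m * (n - p)
    nlinarith
  · rw [hN _ _ (V.lie_act_d_kEl 0 0 s p), map_zero]
    change (N : ℤ) < S.m * p
    nlinarith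

lemma lie_hom {V V' : ModC.{u, w} S k} (f : V ⟶ V') (y : S.L) (v : V.carrier) :
    lin f (V.act y v) = V'.act y (lin f v) :=
  LieModuleHom.map_lie (R := ℂ) (L := S.L) (f : V.carrier →ₗ⁅ℂ, S.L⁆ V'.carrier) y v

end Basic

variable [FiniteDimensional ℂ 𝔤] [LieAlgebra.IsSemisimple ℂ 𝔤] (V : ModC.{u, w} S k)

/-- The underlying graded Heisenberg module. -/
def heisGr : HeisGr S k V.carrier where
  a i := V.actₗ ∘ₗ S.gElₗ i 0 ∘ₗ S.𝔥.toSubmodule.subtype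
  rel i j h h' := by
    change V.act (S.gEl h i 0) * V.act (S.gEl h' j 0) - V.act (S.gEl h' j 0) * V.act (S.gEl h i 0) =
      _
    rw [← act_lie, S.gEl_lie_gEl_cartan]
    split_ifs
    · rw [act_smul, act_level, smul_smul]
      congr 1
      ring
    · exact V.act_zero
  a_projH i h := congrArg V.act (S.gEl_proj h i 0)
  D := V.act (S.dEl 0)
  lie_D i h := V.lie_act_d_gEl 0 h i 0
  graded := V.graded

lemma heisGr_a (i : ℤ) (h : S.𝔥) : V.heisGr.a i h = V.act (S.gEl h i 0) := rfl

/-- A module in `C_k` as a Heisenberg module generated by its vacuum space. -/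
def heisVac (hk : k ≠ 0) : HeisVac S k V.carrier V.vacuum :=
  V.heisGr.heisVac (S.vermaLike k) hk (S.vermaLike_hasLift k _)

variable (hk : k ≠ 0)

lemma heisVac_a (i : ℤ) (h : S.𝔥) : (V.heisVac hk).a i h = V.act (S.gEl h i 0) := rfl

lemma heisVac_ι (v : V.vacuum) : (V.heisVac hk).ι v = (v : V.carrier) := rfl

lemma compat_kEl (i : Fin (S.N + 1)) (r : Fin S.N → ℤ) (p : ℤ) :
    (V.heisVac hk).Compat (V.act (S.kEl i r p)) :=
  HeisVac.compat_of_commute fun j _ h => by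
    rw [heisVac_a, ← act_lie, S.kEl_lie_gEl, act_zero]

lemma compat_gEl (h : S.𝔥) : (V.heisVac hk).Compat (V.act (S.gEl h 0 0)) :=
  HeisVac.compat_of_commute fun j hj h' => by
    rw [heisVac_a, ← act_lie, S.gEl_lie_gEl_cartan, if_neg (by omega), act_zero]

lemma compat_dEl (i : Fin (S.N + 1)) : (V.heisVac hk).Compat (V.act (S.dEl i)) :=
  fun j _ h => ⟨_, V.lie_act_d_gEl i h j 0⟩

lemma isVertex (β : S.Root) (r : Fin S.N → ℤ) :
    (V.heisVac hk).IsVertex ⟨β, β.2.1⟩ fun n => V.act (S.gEl (S.x β) n r) where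
  lie i _ h n := by
    rw [heisVac_a, ← act_lie, S.gEl_lie_gEl, S.form_cartan_x (S.proj_mem i h.2), zero_smul,
      add_zero, S.lie_x _ (S.proj_mem i h.2), Data.gEl_smul, act_smul, zero_add, add_comm n]
  bdd w := by
    obtain ⟨N, hN⟩ := V.graded.exists_degBdd (w : V.carrier)
    exact ⟨N, fun n hn => hN _ _ (V.lie_act_d_gEl 0 (S.x β) n r) hn⟩

/-- The operators on the vacuum space induced by elements of `L̃(𝔤, θ)`. -/
def vop (y : S.L) : Module.End ℂ V.vacuum := (V.heisVac hk).vev (V.act y)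

/-- `vop` as a linear map. -/
def vopₗ : S.L →ₗ[ℂ] Module.End ℂ V.vacuum := (V.heisVac hk).vev ∘ₗ V.actₗ

lemma vopₗ_apply (y : S.L) : V.vopₗ hk y = V.vop hk y := rfl

lemma vop_smul (c : ℂ) (y : S.L) : V.vop hk (c • y) = c • V.vop hk y := (V.vopₗ hk).map_smul c y

lemma vop_zero : V.vop hk 0 = 0 := (V.vopₗ hk).map_zero

lemma vop_apply (y : S.L) (w : V.vacuum) :
    V.vop hk y w = (V.heisVac hk).ε (V.act y (w : V.carrier)) := rfl

variable {V hk} in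
lemma coe_vop {y : S.L} (hy : (V.heisVac hk).Compat (V.act y)) (w : V.vacuum) :
    (V.vop hk y w : V.carrier) = V.act y w := hy.ι_vev w

variable {V hk} in
lemma vop_lie {y : S.L} (hy : (V.heisVac hk).Compat (V.act y)) (z : S.L) :
    V.vop hk y * V.vop hk z - V.vop hk z * V.vop hk y = V.vop hk ⁅y, z⁆ := by
  rw [vop, vop, vop, act_lie, hy.vev_lie]

lemma vop_gEl_kEl (x : 𝔤) (r s : Fin S.N → ℤ) (n : ℤ) (v : V.vacuum) :
    k⁻¹ • ∑ᶠ p : ℤ, V.vop hk (S.gEl x (n - S.m * p) r) (V.vop hk (S.kEl 0 s p) v) =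
      V.vop hk (S.gEl x n (r + s)) v := by
  rw [vop_apply, act_apply, ← V.factor_x, map_smul]
  simp only [← act_apply]
  rw [linear_finsum _ (V.finite_gEl_kEl x r s n v)]
  congr 1
  refine finsum_congr fun p => ?_
  rw [vop_apply, coe_vop (V.compat_kEl hk 0 s p)]

lemma vop_kEl_kEl (i : Fin (S.N + 1)) (r s : Fin S.N → ℤ) (n : ℤ) (v : V.vacuum) :
    k⁻¹ • ∑ᶠ p : ℤ, V.vop hk (S.kEl i r (n - p)) (V.vop hk (S.kEl 0 s p) v) =
      V.vop hk (S.kEl i (r + s) n) v := by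
  rw [vop_apply, act_apply, ← V.factor_k, map_smul]
  simp only [← act_apply]
  rw [linear_finsum _ (V.finite_kEl_kEl i r s n v)]
  congr 1
  refine finsum_congr fun p => ?_
  rw [vop_apply, coe_vop (V.compat_kEl hk 0 s p)]

/-- The action of `𝔥_0` on the vacuum space. -/
def vH : S.𝔥₀ →ₗ[ℂ] Module.End ℂ V.vacuum := V.vopₗ hk ∘ₗ S.gElₗ 0 0 ∘ₗ S.𝔥₀.subtype

lemma vH_apply (α : S.𝔥₀) : V.vH hk α = V.vop hk (S.gEl α 0 0) := rfl

/-- The factorisation expresses `h(r, ζ)` through the oscillators and `k_0(r, ζ^m)`. Oscillators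
`h_j` with `j ≠ 0` have expectation value zero, so only the term with `mp = n` remains. -/
lemma vop_gEl_cartan (h : S.𝔥) (r : Fin S.N → ℤ) (n : ℤ) : V.vop hk (S.gEl h n r) =
    if (S.m : ℤ) ∣ n then k⁻¹ • (V.vH hk (S.proj₀ h) * V.vop hk (S.kEl 0 r (n / S.m))) else 0 := by
  have hm : (S.m : ℤ) ≠ 0 := by exact_mod_cast S.m_pos.ne'
  refine LinearMap.ext fun v => ?_
  have h0 : ∀ j, j ≠ 0 → ∀ w, V.vop hk (S.gEl h j 0) w = 0 := by
    intro j hj w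
    rcases lt_or_gt_of_ne hj with hj | hj
    · exact (V.heisVac hk).ε_a j hj h _
    · rw [vop_apply]
      have := (V.heisVac hk).a_ι j hj h w
      rw [heisVac_a, heisVac_ι] at this
      rw [this, map_zero]
  have h1 := V.vop_gEl_kEl hk h 0 r n v
  rw [zero_add] at h1
  rw [← h1]
  split_ifs with hd
  · rw [finsum_eq_single _ (n / S.m) fun p hp => h0 _ (fun hc => hp ?_) _]
    · rw [Int.mul_ediv_cancel' hd, sub_self, vH_apply]
      have : S.gEl (S.proj₀ h : 𝔤) 0 0 = S.gEl h 0 0 := S.gEl_proj h 0 0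
      rw [this]; rfl
    · rw [sub_eq_zero.mp hc, Int.mul_ediv_cancel_left _ hm]
  · rw [finsum_eq_zero_of_forall_eq_zero fun p => h0 _ (fun hc => hd ⟨p, sub_eq_zero.mp hc⟩) _,
      smul_zero, LinearMap.zero_apply]

/-- The vacuum space as an object of `D_k`. -/
def vacObj : ModD.{u, w} S k where
  carrier := V.vacuum
  Z β r n := V.vop hk (S.gEl (S.x β) n r)
  K i r p := V.vop hk (S.kEl i r p)
  H := V.vH hk
  d i := V.vop hk (S.dEl i)
  level := by rw [vop, act_level, map_smul, HeisVac.vev_one]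
  graded := by
    have : V.vop hk (S.dEl 0) = V.heisGr.Dvac :=
      LinearMap.ext fun w => Subtype.ext (coe_vop (V.compat_dEl hk 0) w)
    rw [this]
    exact V.heisGr.Dvac_graded
  factor_Z β r s n v := V.vop_gEl_kEl hk _ r s n v
  factor_K i r s n v := by
    -- The factorisation in `ModC` has the two central factors in the opposite order; they commute.
    have h := V.vop_kEl_kEl hk i s r n v
    rw [add_comm s r] at h
    rw [← h]
    congr 1
    refine finsum_congr fun p => ?_
    have h1 := vop_lie (V.compat_kEl hk 0 r p) (S.kEl i s (n - p))
    rw [S.kEl_lie_kEl, vop_zero, sub_eq_zero] at h1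
    exact LinearMap.congr_fun h1 v
  rel_K r p := by
    have h := congrArg (V.vopₗ hk) (S.sum_kEl r p)
    simp only [map_add, map_sum, map_smul, vopₗ_apply, map_zero] at h
    rw [← h, smul_smul]
    congr 2
    push_cast
    rw [inv_mul_cancel_left₀ S.m_ne_zero]
  d_zero_Z β r n := by
    rw [vop_lie (V.compat_dEl hk 0), S.dEl_lie_gEl, vop_smul]; rfl
  d_succ_Z i β r n := by
    rw [vop_lie (V.compat_dEl hk i.succ), S.dEl_lie_gEl, vop_smul]; rfl
  d_zero_K j r p := by
    rw [vop_lie (V.compat_dEl hk 0), S.dEl_lie_kEl, vop_smul]; rfl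
  d_succ_K i j r p := by
    rw [vop_lie (V.compat_dEl hk i.succ), S.dEl_lie_kEl, vop_smul]; rfl
  d_H i α := by
    rw [← sub_eq_zero, vH_apply, vop_lie (V.compat_dEl hk i), S.dEl_lie_gEl, vop_smul]
    refine Fin.cases ?_ (fun j => ?_) i <;> simp [Data.deg]
  d_d i j := by
    rw [← sub_eq_zero, vop_lie (V.compat_dEl hk i), S.dEl_lie_dEl, vop_zero]
  H_H α α' := by
    rw [← sub_eq_zero, vH_apply, vH_apply, vop_lie (V.compat_gEl hk ⟨α, α.2.1⟩)]
    have := S.gEl_lie_gEl_cartan ⟨α, α.2.1⟩ ⟨α', α'.2.1⟩ 0 0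
    rw [this]
    simp [vop_zero]
  H_Z α β r n := by
    have h1 : S.proj 0 (α : 𝔤) = α := S.proj_of_θ_eq (by simpa using α.2.2)
    rw [vH_apply, vop_lie (V.compat_gEl hk ⟨α, α.2.1⟩), S.gEl_lie_gEl]
    simp only [h1]
    rw [S.form_cartan_x α.2.1, zero_smul, add_zero, S.lie_x _ α.2.1, Data.gEl_smul, vop_smul,
      zero_add, zero_add]
  twist_Z p β β' hβ r n := by
    obtain rfl : β' = S.θRoot p β := Subtype.ext hβ
    rw [← vop_smul, ← S.gEl_θ_iterate, S.θ_iterate_x, Data.gEl_smul, vop_smul]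
  K_K i r p j s q := by
    rw [← sub_eq_zero, vop_lie (V.compat_kEl hk i r p), S.kEl_lie_kEl, vop_zero]
  K_Z i r p β s n := by
    rw [← sub_eq_zero, vop_lie (V.compat_kEl hk i r p), S.kEl_lie_gEl, vop_zero]
  K_H i r p α := by
    rw [← sub_eq_zero, vH_apply, vop_lie (V.compat_kEl hk i r p), S.kEl_lie_gEl, vop_zero]
  comm β₁ β₂ r s a b v := by
    have h := HeisVac.vev_lie_x V.actₗ (H := V.heisVac hk)
      (fun β r n => V.vop hk (S.gEl (S.x β) n r)) (fun i r p => V.vop hk (S.kEl i r p)) (V.vH hk)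
      (fun _ _ _ => rfl) (fun _ _ _ => rfl) (fun h r n => V.vop_gEl_cartan hk h r n)
      β₁ β₂ r s a b v
    -- The expectation value of the commutator is computed twice: from the bracket in `L̃(𝔤, θ)`,
    -- which is `h`, and from the two products of vertex operators by `ε_X_X`.
    refine Eq.trans ?_ h
    rw [actₗ_apply, act_lie, map_sub, LinearMap.sub_apply]
    congr 1
    · exact (HeisVac.ε_X_X (V.isVertex hk β₁ r) (V.isVertex hk β₂ s) hk a b v).symm
    · exact (HeisVac.ε_X_X (V.isVertex hk β₂ s) (V.isVertex hk β₁ r) hk b a v).symm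

variable {V} {V' : ModC.{u, w} S k} (f : V ⟶ V')

lemma lin_mem_vacuum {v : V.carrier} (hv : v ∈ V.vacuum) : lin f v ∈ V'.vacuum :=
  V'.heisGr.mem_vac.mpr fun i hi h => by
    rw [heisGr_a, ← lie_hom, ← heisGr_a, V.heisGr.mem_vac.mp hv i hi h, map_zero]

/-- The restriction of a morphism to the vacuum spaces. -/
def vacLin : V.vacuum →ₗ[ℂ] V'.vacuum := (lin f).restrict fun _ hv => lin_mem_vacuum f hv

lemma ε_lin (v : V.carrier) : (V'.heisVac hk).ε (lin f v) = vacLin f ((V.heisVac hk).ε v) := by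
  refine (V.heisVac hk).gen
    (LinearMap.eqLocus ((V'.heisVac hk).ε ∘ₗ lin f) (vacLin f ∘ₗ (V.heisVac hk).ε))
    (fun w => ?_) (fun i hi h v _ => ?_) v
  · rw [LinearMap.mem_eqLocus, LinearMap.comp_apply, LinearMap.comp_apply, HeisVac.ε_ι]
    exact (V'.heisVac hk).ε_ι (vacLin f w)
  · rw [LinearMap.mem_eqLocus, LinearMap.comp_apply, LinearMap.comp_apply, HeisVac.ε_a _ i hi,
      map_zero, heisVac_a, lie_hom, ← heisVac_a _ hk, HeisVac.ε_a _ i hi]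

lemma vacLin_vop (y : S.L) (v : V.vacuum) :
    vacLin f (V.vop hk y v) = V'.vop hk y (vacLin f v) := by
  rw [vop_apply, ← ε_lin, lie_hom]; rfl

/-- The functor `V ↦ Ω_V`. -/
def vacFunctor : ModC.{u, w} S k ⥤ ModD.{u, w} S k where
  obj V := V.vacObj hk
  map {V V'} f :=
    ({ lin := vacLin f
       map_Z := fun _ _ _ v => vacLin_vop hk f _ v
       map_K := fun _ _ _ v => vacLin_vop hk f _ v
       map_H := fun _ v => vacLin_vop hk f _ v
       map_d := fun _ v => vacLin_vop hk f _ v } : ModD.Hom (V.vacObj hk) (V'.vacObj hk))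
  map_id _ := rfl
  map_comp _ _ := rfl

/-- `vacObj` defines `Z` as the expectation value of `x_β(r, ζ)`; `finsum_Em_X_Ep` identifies it
with `E⁻ x_β E⁺` on the vacuum. -/
lemma isVacuumFunctor : IsVacuumFunctor (vacFunctor (S := S) hk : ModC.{u, w} S k ⥤ _) :=
  ⟨fun V => LinearEquiv.refl ℂ V.vacuum,
    fun V β r n u => ((V.isVertex hk β r).finsum_Em_X_Ep hk n u).symm,
    fun V i r p u => coe_vop (V.compat_kEl hk i r p) u,
    fun V α u => coe_vop (V.compat_gEl hk ⟨α, α.2.1⟩) u,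
    fun V i u => coe_vop (V.compat_dEl hk i) u,
    fun _ _ _ _ => rfl⟩

end ModC

end

section

/-! ### Vertex operators on the induced module -/

variable {𝔤 : Type u} [LieRing 𝔤] [LieAlgebra ℂ 𝔤] {S : Data 𝔤} {k : ℂ}

section LocSum

variable {ι E : Type*} [AddCommGroup E] [Module ℂ E]

lemma locSum_congr {f g : ι → Module.End ℂ E} (hf : LocFin f) (hg : LocFin g) (h : ∀ i, f i = g i) :
    locSum f hf = locSum g hg := by
  obtain rfl : f = g := funext h
  rfl

lemma locFin_smul (c : ℂ) {f : ι → Module.End ℂ E} (hf : LocFin f) :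
    LocFin fun j => c • f j :=
  fun v => hasFiniteSupport_linear (c • LinearMap.id) (hf v)

lemma smul_locSum (c : ℂ) {f : ι → Module.End ℂ E} (hf : LocFin f) :
    c • locSum f hf = locSum (fun i => c • f i) (locFin_smul c hf) :=
  LinearMap.ext fun v => smul_finsum' c (hf v)

lemma locFin_lie (T : Module.End ℂ E) {f : ι → Module.End ℂ E} (hf : LocFin f) :
    LocFin fun i => T * f i - f i * T := by
  intro v
  have h1 := hasFiniteSupport_add (hasFiniteSupport_linear T (hf v))
    (hasFiniteSupport_linear (-LinearMap.id) (hf (T v)))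
  have h2 : (fun i => (T * f i - f i * T) v) =
      fun i => T (f i v) + (-LinearMap.id : Module.End ℂ E) (f i (T v)) := by
    funext i
    simp [sub_eq_add_neg]
  rw [h2]; exact h1

lemma lie_locSum (T : Module.End ℂ E) {f : ι → Module.End ℂ E} (hf : LocFin f) :
    T * locSum f hf - locSum f hf * T = locSum (fun i => T * f i - f i * T) (locFin_lie T hf) := by
  refine LinearMap.ext fun v => ?_
  simp only [LinearMap.sub_apply, Module.End.mul_apply, locSum_apply]
  rw [linear_finsum _ (hf v), finsum_sub_distrib (hasFiniteSupport_linear T (hf v)) (hf (T v))]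

lemma lie_locSum_smul {T : Module.End ℂ E} {f : ι → Module.End ℂ E} (hf : LocFin f) {c : ℂ}
    (h : ∀ i, T * f i - f i * T = c • f i) :
    T * locSum f hf - locSum f hf * T = c • locSum f hf := by
  rw [lie_locSum, smul_locSum]
  exact locSum_congr _ _ h

lemma lie_smul_sub_smul (T A B : Module.End ℂ E) (c d : ℂ) :
    T * (c • A - d • B) - (c • A - d • B) * T = c • (T * A - A * T) - d • (T * B - B * T) := by
  simp only [mul_sub, sub_mul, mul_smul_comm, smul_mul_assoc, smul_sub]
  abel

lemma lie_mul_left_right {D A B : Module.End ℂ E} {a b : ℂ} (hA : D * A - A * D = a • A)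
    (hB : D * B - B * D = b • B) : D * (A * B) - A * B * D = (a + b) • (A * B) := by
  have : D * (A * B) - A * B * D = (D * A - A * D) * B + A * (D * B - B * D) := by noncomm_ring
  rw [this, hA, hB, smul_mul_assoc, mul_smul_comm, add_smul]

lemma locFin_mul_of_degree {m : ℕ} (hm : 0 < m) {D : Module.End ℂ E} (hD : GradedBddAbove D) (n : ℤ)
    {A B : ℤ → Module.End ℂ E}
    (hA : ∀ p, D * A p - A p * D = ((n - m * p : ℤ) : ℂ) • A p)
    (hB : ∀ p, D * B p - B p * D = ((m * p : ℤ) : ℂ) • B p) (hAB : ∀ p, A p * B p = B p * A p) :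
    LocFin fun p => A p * B p := by
  intro v
  obtain ⟨N, hN⟩ := hD.exists_degBdd v
  have hm : (1 : ℤ) ≤ m := by exact_mod_cast hm
  refine hasFiniteSupport_int (-(N + |n|)) N (fun p hp => ?_) fun p hp => ?_
  · change (A p * B p) v = 0
    rw [hAB, Module.End.mul_apply, hN _ _ (hA p), map_zero]
    have h1 := neg_abs_le n
    have h2 := abs_nonneg n
    nlinarith
  · change (A p * B p) v = 0
    rw [Module.End.mul_apply, hN _ _ (hB p), map_zero]
    nlinarith

end LocSum

/-- `proj₀` as a linear map. -/
def Data.proj₀ₗ (S : Data 𝔤) : S.𝔥 →ₗ[ℂ] S.𝔥₀ where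
  toFun := S.proj₀
  map_add' h h' := Subtype.ext ((S.proj 0).map_add h h')
  map_smul' c h := Subtype.ext ((S.proj 0).map_smul c h)

namespace ModD

variable (W : ModD.{u, w} S k) {M : Type*} [AddCommGroup M] [Module ℂ M] (Φ : VermaLike S k M)

/-- The action of `h_0`, `h ∈ 𝔥`. -/
def a₀ : S.𝔥 →ₗ[ℂ] Module.End ℂ W.carrier := W.H ∘ₗ S.proj₀ₗ

lemma a₀_apply (h : S.𝔥) : W.a₀ h = W.H (S.proj₀ h) := rfl

lemma a₀_comm (h h' : S.𝔥) : W.a₀ h * W.a₀ h' = W.a₀ h' * W.a₀ h := W.H_H _ _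

lemma a₀_projH (h : S.𝔥) : W.a₀ (S.projH 0 h) = W.a₀ h := by
  rw [a₀_apply, a₀_apply]
  congr 1
  exact Subtype.ext (S.proj_proj 0 (h : 𝔤))

/-- The Heisenberg operators on `M ⊗ W`. -/
abbrev ta (i : ℤ) : S.𝔥 →ₗ[ℂ] Module.End ℂ (M ⊗[ℂ] W.carrier) := tA Φ W.a₀ i

/-- An operator on `W` acting on `M ⊗ W`. -/
abbrev tL (M : Type*) [AddCommGroup M] [Module ℂ M] (Y : Module.End ℂ W.carrier) :
    Module.End ℂ (M ⊗[ℂ] W.carrier) := LinearMap.lTensor M Y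

/-- The degree operator on `M ⊗ W`. -/
abbrev td : Module.End ℂ (M ⊗[ℂ] W.carrier) := tD Φ (W.d 0)

lemma ta_rel : HeisRel S k (R := Module.End ℂ (M ⊗[ℂ] W.carrier)) (W.ta Φ) := tA_rel Φ W.a₀_comm

lemma ta_projH (i : ℤ) (h : S.𝔥) : W.ta Φ i (S.projH i h) = W.ta Φ i h := by
  by_cases hi : i = 0
  · subst hi
    rw [ta, tA_zero, tA_zero, a₀_projH]
  · exact tA_projH Φ hi h

lemma lie_tL_tL (Y Y' : Module.End ℂ W.carrier) :
    W.tL M Y * W.tL M Y' - W.tL M Y' * W.tL M Y = W.tL M (Y * Y' - Y' * Y) := by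
  rw [tL, tL, tL, ← LinearMap.lTensor_mul, ← LinearMap.lTensor_mul, ← LinearMap.lTensor_sub]

lemma tL_smul (c : ℂ) (Y : Module.End ℂ W.carrier) : W.tL M (c • Y) = c • W.tL M Y :=
  LinearMap.lTensor_smul _ _ _

lemma tL_ta {i : ℤ} (hi : i ≠ 0) (Y : Module.End ℂ W.carrier) (h : S.𝔥) :
    W.tL M Y * W.ta Φ i h = W.ta Φ i h * W.tL M Y := by
  rw [ta, tA_of_ne Φ hi]
  exact TensorProduct.ext' fun u w => by simp

lemma tL_ta_of_commute {Y : Module.End ℂ W.carrier} (hY : ∀ α, Y * W.H α = W.H α * Y) (i : ℤ)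
    (h : S.𝔥) : W.tL M Y * W.ta Φ i h = W.ta Φ i h * W.tL M Y := by
  by_cases hi : i = 0
  · subst hi
    rw [ta, tA_zero, ← sub_eq_zero, lie_tL_tL, a₀_apply, hY, sub_self]
    exact LinearMap.lTensor_zero _
  · exact W.tL_ta Φ hi Y h

lemma lie_td_tL (Y : Module.End ℂ W.carrier) :
    W.td Φ * W.tL M Y - W.tL M Y * W.td Φ = W.tL M (W.d 0 * Y - Y * W.d 0) := by
  rw [← lie_tL_tL, td, tD, add_mul, mul_add]
  have : LinearMap.rTensor W.carrier Φ.D * W.tL M Y = W.tL M Y * LinearMap.rTensor W.carrier Φ.D :=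
    TensorProduct.ext' fun u w => by simp
  rw [this]
  abel

lemma lie_td_ta (i : ℤ) (h : S.𝔥) :
    W.td Φ * W.ta Φ i h - W.ta Φ i h * W.td Φ = (i : ℂ) • W.ta Φ i h :=
  lie_tD_tA Φ (fun _ => W.d_H 0 _) i h

lemma td_graded : GradedBddAbove (W.td Φ) := tD_graded Φ W.graded

/-- The operators `k_i(r)_p` on `M ⊗ W`. -/
def tK (M : Type*) [AddCommGroup M] [Module ℂ M] (i : Fin (S.N + 1)) (r : Fin S.N → ℤ) (p : ℤ) :
    Module.End ℂ (M ⊗[ℂ] W.carrier) := W.tL M (W.K i r p)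

lemma lie_td_tK (i : Fin (S.N + 1)) (r : Fin S.N → ℤ) (p : ℤ) :
    W.td Φ * W.tK M i r p - W.tK M i r p * W.td Φ = ((S.m * p : ℤ) : ℂ) • W.tK M i r p := by
  rw [tK, lie_td_tL, W.d_zero_K, tL_smul]

lemma tK_ta (i : Fin (S.N + 1)) (r : Fin S.N → ℤ) (p j : ℤ) (h : S.𝔥) :
    W.tK M i r p * W.ta Φ j h = W.ta Φ j h * W.tK M i r p :=
  W.tL_ta_of_commute Φ (W.K_H i r p) j h

lemma tK_tK (i : Fin (S.N + 1)) (r : Fin S.N → ℤ) (p : ℤ) (j : Fin (S.N + 1)) (s : Fin S.N → ℤ)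
    (q : ℤ) : W.tK M i r p * W.tK M j s q = W.tK M j s q * W.tK M i r p := by
  rw [tK, tK, ← sub_eq_zero, lie_tL_tL, W.K_K, sub_self]
  exact LinearMap.lTensor_zero _

/-- The coefficients of `E⁻(β, ζ)` on `M ⊗ W`. -/
abbrev tEm (β : S.𝔥) (n : ℕ) : Module.End ℂ (M ⊗[ℂ] W.carrier) :=
  S.expMinus k (fun j => W.ta Φ j β) n

/-- The coefficients of `E⁺(β, ζ)` on `M ⊗ W`. -/
abbrev tEp (β : S.𝔥) (n : ℕ) : Module.End ℂ (M ⊗[ℂ] W.carrier) :=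
  S.expPlus k (fun j => W.ta Φ j β) n

lemma tL_tEm (Y : Module.End ℂ W.carrier) (β : S.𝔥) (n : ℕ) :
    W.tL M Y * W.tEm Φ β n = W.tEm Φ β n * W.tL M Y := by
  rw [← sub_eq_zero]
  have := derivation_expCoeff_of_weight ((W.ta_rel Φ).commute_minus β) (adOp_mul (W.tL M Y))
    (s := 0) (fun j => ?_) n
  · rw [zero_mul, zero_smul] at this; exact this
  · rw [zero_mul, zero_smul, adOp_apply]
    by_cases hj : j = 0
    · simp [hj]
    rw [mul_smul_comm, smul_mul_assoc, W.tL_ta Φ (by omega), sub_self]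

lemma tL_tEp (Y : Module.End ℂ W.carrier) (β : S.𝔥) (n : ℕ) :
    W.tL M Y * W.tEp Φ β n = W.tEp Φ β n * W.tL M Y := by
  rw [← sub_eq_zero]
  have := derivation_expCoeff_of_weight ((W.ta_rel Φ).commute_plus β) (adOp_mul (W.tL M Y))
    (s := 0) (fun j => ?_) n
  · rw [zero_mul, zero_smul] at this; exact this
  · rw [zero_mul, zero_smul, adOp_apply]
    by_cases hj : j = 0
    · simp [hj]
    rw [mul_smul_comm, smul_mul_assoc, W.tL_ta Φ (by omega), sub_self]

/-- The terms of the coefficient of `ζ^n` in `E⁻(-β, ζ) E⁺(-β, ζ) ⊗ Z(β, r, ζ)`. -/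
def xTerm (β : S.Root) (r : Fin S.N → ℤ) (n : ℤ) (ab : ℕ × ℕ) : Module.End ℂ (M ⊗[ℂ] W.carrier) :=
  W.tEm Φ (-⟨β, β.2.1⟩) ab.1 * (W.tL M (W.Z β r (n + ab.1 - ab.2)) * W.tEp Φ (-⟨β, β.2.1⟩) ab.2)

lemma lie_td_Z (β : S.Root) (r : Fin S.N → ℤ) (n : ℤ) :
    W.td Φ * W.tL M (W.Z β r n) - W.tL M (W.Z β r n) * W.td Φ = (n : ℂ) • W.tL M (W.Z β r n) := by
  rw [lie_td_tL, W.d_zero_Z, tL_smul]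

lemma lie_td_xTerm (β : S.Root) (r : Fin S.N → ℤ) (n : ℤ) (ab : ℕ × ℕ) :
    W.td Φ * W.xTerm Φ β r n ab - W.xTerm Φ β r n ab * W.td Φ = (n : ℂ) • W.xTerm Φ β r n ab := by
  rw [xTerm, lie_mul_left_right ((W.ta_rel Φ).lie_degree_expMinus (W.lie_td_ta Φ) _ _)
    (lie_mul_left_right (W.lie_td_Z Φ β r _)
      ((W.ta_rel Φ).lie_degree_expPlus (W.lie_td_ta Φ) _ _))]
  congr 1
  push_cast
  ring

lemma xTerm_locFin (β : S.Root) (r : Fin S.N → ℤ) (n : ℤ) : LocFin (W.xTerm Φ β r n) := by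
  intro v
  obtain ⟨N, hN⟩ := (W.td_graded Φ).exists_degBdd v
  -- The factor `E⁺` of degree `b` forces `b ≤ N`. After it the degree bound is `N - b`, while `Z`
  -- has degree `n + a - b`, so `a` is bounded too; the bound used is not sharp.
  refine ((Set.finite_Iic (2 * N + n.natAbs)).prod (Set.finite_Iic N)).subset fun ab hab => ?_
  have h1 : ab.2 ≤ N := by
    by_contra hc
    apply hab
    change W.xTerm Φ β r n ab v = 0
    have := hN _ (ab.2 : ℤ) ((W.ta_rel Φ).lie_degree_expPlus (W.lie_td_ta Φ) (-⟨β, β.2.1⟩) ab.2)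
      (by omega)
    rw [xTerm, Module.End.mul_apply, Module.End.mul_apply, this, map_zero, map_zero]
  refine ⟨?_, h1⟩
  by_contra hc
  rw [Set.mem_Iic, not_le] at hc
  apply hab
  change W.xTerm Φ β r n ab v = 0
  have := hN.apply (i := ab.2)
    ((W.ta_rel Φ).lie_degree_expPlus (W.lie_td_ta Φ) (-⟨β, β.2.1⟩) ab.2) _ _
      (W.lie_td_Z Φ β r (n + ab.1 - ab.2)) (by omega)
  rw [xTerm, Module.End.mul_apply, Module.End.mul_apply, this, map_zero]

/-- The coefficient of `ζ^n` in `E⁻(-β, ζ) E⁺(-β, ζ) ⊗ Z(β, r, ζ)`. -/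
def X (β : S.Root) (r : Fin S.N → ℤ) (n : ℤ) : Module.End ℂ (M ⊗[ℂ] W.carrier) :=
  locSum (W.xTerm Φ β r n) (W.xTerm_locFin Φ β r n)

lemma lie_td_X (β : S.Root) (r : Fin S.N → ℤ) (n : ℤ) :
    W.td Φ * W.X Φ β r n - W.X Φ β r n * W.td Φ = (n : ℂ) • W.X Φ β r n :=
  lie_locSum_smul _ fun _ => W.lie_td_xTerm Φ β r n _

lemma lie_tL_X {Y : Module.End ℂ W.carrier} {β : S.Root} {r : Fin S.N → ℤ} {c : ℂ}
    (hY : ∀ n, Y * W.Z β r n - W.Z β r n * Y = c • W.Z β r n) (n : ℤ) :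
    W.tL M Y * W.X Φ β r n - W.X Φ β r n * W.tL M Y = c • W.X Φ β r n := by
  refine lie_locSum_smul _ fun ab => ?_
  have h1 : ∀ n, W.tL M Y * W.tL M (W.Z β r n) - W.tL M (W.Z β r n) * W.tL M Y =
      c • W.tL M (W.Z β r n) := fun n => by rw [lie_tL_tL, hY, tL_smul]
  rw [xTerm, lie_mul_left_right (a := 0) (b := c + 0) (by rw [W.tL_tEm Φ, sub_self, zero_smul])
    (lie_mul_left_right (h1 _) (by rw [W.tL_tEp Φ, sub_self, zero_smul]))]
  simp

lemma tK_X (i : Fin (S.N + 1)) (s : Fin S.N → ℤ) (p : ℤ) (β : S.Root) (r : Fin S.N → ℤ) (n : ℤ) :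
    W.tK M i s p * W.X Φ β r n = W.X Φ β r n * W.tK M i s p := by
  rw [← sub_eq_zero, tK, W.lie_tL_X Φ (c := 0) fun n => by rw [W.K_Z, sub_self, zero_smul],
    zero_smul]

/-- A creation operator fails to commute only with `E⁺`, an annihilation operator only with `E⁻`,
and `h_0` only with `Z`. In the first two cases the commutator shifts one summation index by `|i|`;
the sign of the scalar is corrected by `-β` in the exponentials. -/
lemma lie_ta_X (hk : k ≠ 0) (i : ℤ) (h : S.𝔥) (β : S.Root) (r : Fin S.N → ℤ) (n : ℤ) :
    W.ta Φ i h * W.X Φ β r n - W.X Φ β r n * W.ta Φ i h =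
      S.form (S.proj i h) β • W.X Φ β r (n + i) := by
  set b : S.𝔥 := -⟨β, β.2.1⟩ with hb
  have hform : ∀ j : ℤ, -S.form (S.proj j h) b = S.form (S.proj j h) β := by
    intro j; rw [hb, NegMemClass.coe_neg, map_neg, neg_neg]
  have split : ∀ (a : ℕ) (c : ℕ) (Y : Module.End ℂ W.carrier), i ≠ 0 →
      W.ta Φ i h * (W.tEm Φ b a * (W.tL M Y * W.tEp Φ b c)) -
        W.tEm Φ b a * (W.tL M Y * W.tEp Φ b c) * W.ta Φ i h =
      (W.ta Φ i h * W.tEm Φ b a - W.tEm Φ b a * W.ta Φ i h) * (W.tL M Y * W.tEp Φ b c) +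
        W.tEm Φ b a * (W.tL M Y * (W.ta Φ i h * W.tEp Φ b c - W.tEp Φ b c * W.ta Φ i h)) := by
    intro a c Y hi
    have := W.tL_ta Φ hi Y h
    have h2 : W.tL M Y * (W.ta Φ i h * W.tEp Φ b c) = W.ta Φ i h * (W.tL M Y * W.tEp Φ b c) := by
      rw [← mul_assoc, this, mul_assoc]
    simp only [mul_sub, sub_mul, mul_assoc, h2]
    abel
  rcases lt_trichotomy i 0 with hi | hi | hi
  · obtain ⟨j, rfl⟩ : ∃ j : ℕ, i = -(j : ℤ) := ⟨i.natAbs, by omega⟩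
    have hj : j ≠ 0 := by omega
    rw [X, X, lie_locSum, smul_locSum]
    refine LinearMap.ext fun v => ?_
    rw [locSum_apply, locSum_apply,
      ← finsum_comp_injective (e := fun ab : ℕ × ℕ => (ab.1, ab.2 + j))]
    · refine finsum_congr fun ab => ?_
      rw [xTerm, ← hb, split _ _ _ hi.ne, (W.ta_rel Φ).lie_expMinus_of_neg b h hi,
        (W.ta_rel Φ).lie_expPlus hk b h hj, if_pos (Nat.le_add_left j ab.2), zero_mul, zero_add,
        Nat.add_sub_cancel, hform, mul_smul_comm, mul_smul_comm, xTerm, ← hb]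
      congr 5
      push_cast; ring_nf
    · rintro ⟨a, c⟩ ⟨a', c'⟩ hac
      simpa using hac
    · rintro ⟨a, c⟩ hac
      have hc : ¬ j ≤ c := fun hc => hac ⟨(a, c - j), by simp [Nat.sub_add_cancel hc]⟩
      rw [xTerm, ← hb, split _ _ _ hi.ne, (W.ta_rel Φ).lie_expMinus_of_neg b h hi,
        (W.ta_rel Φ).lie_expPlus hk b h hj, if_neg hc, zero_mul, zero_add, mul_zero, mul_zero,
        LinearMap.zero_apply]
  · subst hi
    rw [ta, tA_zero, add_zero]
    exact W.lie_tL_X Φ (fun n => W.H_Z _ _ _ _) n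
  · lift i to ℕ using hi.le
    have hj : i ≠ 0 := by omega
    rw [X, X, lie_locSum, smul_locSum]
    refine LinearMap.ext fun v => ?_
    rw [locSum_apply, locSum_apply,
      ← finsum_comp_injective (e := fun ab : ℕ × ℕ => (ab.1 + i, ab.2))]
    · refine finsum_congr fun ab => ?_
      rw [xTerm, ← hb, split _ _ _ hi.ne', (W.ta_rel Φ).lie_expPlus_of_pos b h hi,
        (W.ta_rel Φ).lie_expMinus hk b h hj, if_pos (Nat.le_add_left i ab.1), mul_zero, mul_zero,
        add_zero, Nat.add_sub_cancel, hform, smul_mul_assoc, xTerm, ← hb]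
      congr 5
      push_cast; ring_nf
    · rintro ⟨a, c⟩ ⟨a', c'⟩ hac
      simpa using hac
    · rintro ⟨a, c⟩ hac
      have hc : ¬ i ≤ a := fun hc => hac ⟨(a - i, c), by simp [Nat.sub_add_cancel hc]⟩
      rw [xTerm, ← hb, split _ _ _ hi.ne', (W.ta_rel Φ).lie_expPlus_of_pos b h hi,
        (W.ta_rel Φ).lie_expMinus hk b h hj, if_neg hc, zero_mul, mul_zero, mul_zero, add_zero,
        LinearMap.zero_apply]

/-! ### Operator identities on `M ⊗ W` from their expectation values. -/

section Vacuum

variable [FiniteDimensional ℂ 𝔤] [LieAlgebra.IsSemisimple ℂ 𝔤] (hk : k ≠ 0)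

/-- `M ⊗ W` is generated by its vacuum space `W`. -/
def tH : HeisVac S k (M ⊗[ℂ] W.carrier) W.carrier := tHeisVac Φ hk W.a₀_comm

lemma vev_tL (Y : Module.End ℂ W.carrier) : (W.tH Φ hk).vev (W.tL M Y) = Y :=
  LinearMap.ext fun w => (W.tH Φ hk).ε_ι (Y w)

lemma vev_X (β : S.Root) (r : Fin S.N → ℤ) (n : ℤ) :
    (W.tH Φ hk).vev (W.X Φ β r n) = W.Z β r n := by
  refine LinearMap.ext fun w => ?_
  rw [HeisVac.vev_apply, X, locSum_apply, linear_finsum _ (W.xTerm_locFin Φ β r n _),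
    finsum_eq_single _ (0, 0)]
  · have h1 : ∀ b, W.tEm Φ b 0 = 1 := fun b => expMinus_zero _ _ _
    have h2 : ∀ b, W.tEp Φ b 0 = 1 := fun b => expPlus_zero _ _ _
    rw [xTerm]
    simp only [h1, h2, one_mul, mul_one, Nat.cast_zero, add_zero, sub_zero]
    exact LinearMap.congr_fun (W.vev_tL Φ hk (W.Z β r n)) w
  · rintro ⟨a, b⟩ hab
    rw [xTerm, Module.End.mul_apply, Module.End.mul_apply]
    by_cases hb : b = 0
    · have ha : a ≠ 0 := fun ha => hab (by rw [ha, hb])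
      exact (W.tH Φ hk).ε_Em _ ha _
    · have := (W.tH Φ hk).Ep_ι (-⟨β, β.2.1⟩) hb w
      change W.tEp Φ (-⟨β, β.2.1⟩) b ((W.tH Φ hk).ι w) = 0 at this
      rw [this, map_zero, map_zero, map_zero]

lemma X_isVertex (β : S.Root) (r : Fin S.N → ℤ) :
    (W.tH Φ hk).IsVertex ⟨β, β.2.1⟩ (W.X Φ β r) where
  lie i _ h n := W.lie_ta_X Φ hk i h β r n
  bdd w := by
    obtain ⟨N, hN⟩ := (W.td_graded Φ).exists_degBdd ((W.tH Φ hk).ι w)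
    exact ⟨N, fun n hn => hN _ _ (W.lie_td_X Φ β r n) hn⟩

/-- A homogeneous family of operators which is stable under commutators with the Heisenberg
operators and has zero vacuum expectation values is zero. -/
lemma operators_eq_zero (P : ℤ → Set (Module.End ℂ (M ⊗[ℂ] W.carrier)))
    (hP : ∀ n, ∀ Y ∈ P n, ∀ i, i ≠ 0 → ∀ h,
      W.ta Φ i h * Y - Y * W.ta Φ i h ∈ Submodule.span ℂ (P (n + i)))
    (hd : ∀ n, ∀ Y ∈ P n, W.td Φ * Y - Y * W.td Φ = (n : ℂ) • Y)
    (hε : ∀ n, ∀ Y ∈ P n, (W.tH Φ hk).vev Y = 0) (n : ℤ) (Y) (hY : Y ∈ P n) : Y = 0 := by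
  refine (W.tH Φ hk).operator_eq_zero P hP (fun w => ?_)
    (fun n Y hY w => LinearMap.congr_fun (hε n Y hY) w) n Y hY
  obtain ⟨N, hN⟩ := (W.td_graded Φ).exists_degBdd ((W.tH Φ hk).ι w)
  exact ⟨N, fun n hn Y hY => hN _ _ (hd n Y hY) hn⟩

lemma family_eq_zero (Y : ℤ → Module.End ℂ (M ⊗[ℂ] W.carrier))
    (hY : ∀ i, i ≠ 0 → ∀ h, ∃ c : ℂ, ∀ n,
      W.ta Φ i h * Y n - Y n * W.ta Φ i h = c • Y (n + i))
    (hd : ∀ n, W.td Φ * Y n - Y n * W.td Φ = (n : ℂ) • Y n)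
    (hε : ∀ n, (W.tH Φ hk).vev (Y n) = 0) (n : ℤ) : Y n = 0 := by
  refine W.operators_eq_zero Φ hk (fun n => {Y n}) ?_ ?_ ?_ n _ rfl
  · rintro n _ rfl i hi h
    obtain ⟨c, hc⟩ := hY i hi h
    exact Submodule.mem_span_singleton.mpr ⟨c, (hc n).symm⟩
  · rintro n _ rfl; exact hd n
  · rintro n _ rfl; exact hε n

include hk in
-- Both sides have the same commutators with the oscillators up to one common scalar, and their
-- expectation values agree by `twist_Z`.
lemma twist_X (p : ℕ) (β : S.Root) (r : Fin S.N → ℤ) (n : ℤ) :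
    S.ω ^ (p * n) • W.X Φ β r n = S.η p β • W.X Φ (S.θRoot p β) r n := by
  rw [← sub_eq_zero]
  refine W.family_eq_zero Φ hk
    (fun n => S.ω ^ (p * n) • W.X Φ β r n - S.η p β • W.X Φ (S.θRoot p β) r n) ?_ ?_ ?_ n
  · intro i _ h
    refine ⟨S.ω ^ (-(p * i)) * S.form (S.proj i h) β, fun n => ?_⟩
    have h1 : S.form (S.proj i h) (S.θRoot p β) =
        S.ω ^ (-(p * i)) * S.form (S.proj i h) β := by
      change S.form (S.proj i h) (S.θ^[p] β) = _
      rw [S.form_proj_left, S.proj_θ_iterate, map_smul, ← S.form_proj_left, smul_eq_mul, mul_neg]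
    have h2 : S.ω ^ (p * n) = S.ω ^ (-(p * i)) * S.ω ^ (p * (n + i)) := by
      rw [← zpow_add₀ S.ω_ne_zero]; congr 1; ring
    have h3 := W.lie_ta_X Φ hk i h β r n
    have h4 := W.lie_ta_X Φ hk i h (S.θRoot p β) r n
    rw [lie_smul_sub_smul, h3, h4, h1, h2]
    module
  · intro n
    rw [lie_smul_sub_smul, lie_td_X, lie_td_X, smul_sub]
    congr 1 <;> exact smul_comm _ _ _
  · intro n
    rw [map_sub, map_smul, map_smul, vev_X, vev_X, W.twist_Z p β (S.θRoot p β) rfl, sub_self]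

lemma X_tK_locFin (β : S.Root) (r s : Fin S.N → ℤ) (n : ℤ) :
    LocFin fun p : ℤ => W.X Φ β r (n - S.m * p) * W.tK M 0 s p :=
  locFin_mul_of_degree S.m_pos (W.td_graded Φ) n (fun _ => W.lie_td_X Φ β r _)
    (fun _ => W.lie_td_tK Φ 0 s _) fun p => (W.tK_X Φ 0 s p β r _).symm

include hk in
-- The operators `k_0(s, ζ^m)` commute with the oscillators, so the product behaves like a single
-- vertex operator; its expectation value is given by `factor_Z`.
lemma factor_X (β : S.Root) (r s : Fin S.N → ℤ) (n : ℤ) :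
    k⁻¹ • locSum _ (W.X_tK_locFin Φ β r s n) = W.X Φ β (r + s) n := by
  rw [← sub_eq_zero, ← one_smul ℂ (W.X Φ β (r + s) n)]
  refine W.family_eq_zero Φ hk
    (fun n => k⁻¹ • locSum _ (W.X_tK_locFin Φ β r s n) - (1 : ℂ) • W.X Φ β (r + s) n) ?_ ?_ ?_ n
  · intro i _ h
    refine ⟨S.form (S.proj i h) β, fun n => ?_⟩
    rw [lie_smul_sub_smul, W.lie_ta_X Φ hk, lie_locSum, smul_sub, smul_comm _ k⁻¹,
      smul_comm _ (1 : ℂ), smul_locSum (S.form (S.proj i h) β)]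
    congr 2
    refine locSum_congr _ _ fun p => ?_
    rw [← mul_assoc, mul_assoc _ (W.tK M 0 s p), W.tK_ta Φ, ← mul_assoc, ← sub_mul,
      W.lie_ta_X Φ hk, smul_mul_assoc]
    rw [sub_add_eq_add_sub]
  · intro n
    rw [lie_smul_sub_smul, lie_td_X, smul_sub (n : ℂ), smul_comm _ k⁻¹, smul_comm _ (1 : ℂ)]
    congr 2
    refine lie_locSum_smul _ fun p => ?_
    rw [lie_mul_left_right (W.lie_td_X Φ β r _) (W.lie_td_tK Φ 0 s p)]
    congr 1
    push_cast; ring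
  · intro n
    refine LinearMap.ext fun w => ?_
    rw [map_sub, map_smul, one_smul, vev_X, LinearMap.sub_apply, LinearMap.smul_apply, LinearMap.zero_apply,
      ← W.factor_Z, HeisVac.vev_apply, locSum_apply,
      linear_finsum _ (W.X_tK_locFin Φ β r s n _), sub_eq_zero]
    congr 1
    refine finsum_congr fun p => ?_
    rw [← W.vev_X Φ hk β r]
    rfl

end Vacuum

end ModD

end

section

/-! ### The representation of the toroidal algebra on the induced module -/

variable {𝔤 : Type u} [LieRing 𝔤] [LieAlgebra ℂ 𝔤] {S : Data 𝔤} {k : ℂ}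

lemma lie_smul_right {E : Type*} [AddCommGroup E] [Module ℂ E] (T A : Module.End ℂ E) (c : ℂ) :
    T * (c • A) - (c • A) * T = c • (T * A - A * T) := by
  rw [mul_smul_comm, smul_mul_assoc, smul_sub]

section TensorLocSum

variable {ι M F : Type*} [AddCommGroup M] [Module ℂ M] [AddCommGroup F] [Module ℂ F]

lemma LocFin.lTensor {f : ι → Module.End ℂ F} (hf : LocFin f) :
    LocFin fun i => LinearMap.lTensor M (f i) := by
  intro v
  induction v using TensorProduct.induction_on with
  | zero => simp [Function.HasFiniteSupport]
  | add x y hx hy => simp only [map_add]; exact hasFiniteSupport_add hx hy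
  | tmul u w => exact hasFiniteSupport_linear (TensorProduct.mk ℂ M F u) (hf w)

lemma lTensor_locSum {f : ι → Module.End ℂ F} (hf : LocFin f) :
    LinearMap.lTensor M (locSum f hf) = locSum _ (hf.lTensor (M := M)) :=
  TensorProduct.ext' fun u w => linear_finsum (TensorProduct.mk ℂ M F u) (hf w)

end TensorLocSum

namespace ModD

variable (W : ModD.{u, w} S k) {M : Type*} [AddCommGroup M] [Module ℂ M] (Φ : VermaLike S k M)

lemma K_K_locFin (i : Fin (S.N + 1)) (r s : Fin S.N → ℤ) (n : ℤ) :
    LocFin fun p : ℤ => W.K i s (n - p) * W.K 0 r p :=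
  locFin_mul_of_degree S.m_pos W.graded (S.m * n)
    (fun p => by rw [W.d_zero_K, mul_sub]) (fun p => W.d_zero_K 0 r p) fun p => W.K_K _ _ _ _ _ _

lemma factor_K' (i : Fin (S.N + 1)) (r s : Fin S.N → ℤ) (n : ℤ) :
    k⁻¹ • locSum _ (W.K_K_locFin i r s n) = W.K i (r + s) n := by
  refine LinearMap.ext fun v => ?_
  rw [← W.factor_K, LinearMap.smul_apply, locSum_apply]
  congr 1
  exact finsum_congr fun p => by rw [W.K_K]; rfl

lemma tK_tK_locFin (i : Fin (S.N + 1)) (r s : Fin S.N → ℤ) (n : ℤ) :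
    LocFin fun p : ℤ => W.tK M i s (n - p) * W.tK M 0 r p := by
  have := (W.K_K_locFin i r s n).lTensor (M := M)
  simp only [LinearMap.lTensor_mul] at this
  exact this

lemma factor_tK (i : Fin (S.N + 1)) (r s : Fin S.N → ℤ) (n : ℤ) :
    k⁻¹ • locSum _ (W.tK_tK_locFin (M := M) i r s n) = W.tK M i (r + s) n := by
  rw [tK, ← factor_K', tL_smul, tL, lTensor_locSum]
  congr 1
  exact locSum_congr _ _ fun p => (LinearMap.lTensor_mul _ _ _).symm

lemma K_zero_zero_of_ne {p : ℤ} (hp : p ≠ 0) : W.K 0 0 p = 0 := by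
  have := W.rel_K 0 p
  simp only [Pi.zero_apply, Int.cast_zero, zero_smul, Finset.sum_const_zero, zero_add] at this
  rw [smul_smul] at this
  refine (smul_eq_zero_iff_right ?_).mp this
  have h1 : ((S.m * p : ℤ) : ℂ) = S.m * p := by push_cast; rfl
  rw [h1, inv_mul_cancel_left₀ S.m_ne_zero]
  exact_mod_cast hp

lemma tK_zero_zero (M : Type*) [AddCommGroup M] [Module ℂ M] (p : ℤ) :
    W.tK M 0 0 p = if p = 0 then k • (1 : Module.End ℂ (M ⊗[ℂ] W.carrier)) else 0 := by
  split_ifs with hp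
  · subst hp
    rw [tK, W.level, tL_smul]
    congr 1
    exact LinearMap.lTensor_id _ _
  · rw [tK, W.K_zero_zero_of_ne hp]
    exact LinearMap.lTensor_zero _

lemma ta_tK_locFin (h : S.𝔥) (r : Fin S.N → ℤ) (n : ℤ) :
    LocFin fun p : ℤ => W.ta Φ (n - S.m * p) h * W.tK M 0 r p :=
  locFin_mul_of_degree S.m_pos (W.td_graded Φ) n (fun _ => W.lie_td_ta Φ _ h)
    (fun _ => W.lie_td_tK Φ 0 r _) fun p => (W.tK_ta Φ 0 r p _ h).symm

/-- The coefficient of `ζ^n` in `h(r, ζ) = k⁻¹ h(ζ) k_0(r, ζ^m)`. -/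
def Y (r : Fin S.N → ℤ) (n : ℤ) : S.𝔥 →ₗ[ℂ] Module.End ℂ (M ⊗[ℂ] W.carrier) where
  toFun h := k⁻¹ • locSum _ (W.ta_tK_locFin Φ h r n)
  map_add' h h' := by
    rw [← smul_add]
    congr 1
    refine LinearMap.ext fun v => ?_
    rw [LinearMap.add_apply, locSum_apply, locSum_apply, locSum_apply,
      ← finsum_add_distrib (W.ta_tK_locFin Φ h r n v) (W.ta_tK_locFin Φ h' r n v)]
    exact finsum_congr fun p => by rw [map_add, add_mul]; rfl
  map_smul' c h := by
    rw [smul_comm, RingHom.id_apply, smul_locSum c]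
    congr 1
    exact locSum_congr _ _ fun p => by rw [map_smul, smul_mul_assoc]

lemma Y_apply (r : Fin S.N → ℤ) (n : ℤ) (h : S.𝔥) :
    W.Y Φ r n h = k⁻¹ • locSum _ (W.ta_tK_locFin Φ h r n) := rfl

lemma lie_Y_smul {T : Module.End ℂ (M ⊗[ℂ] W.carrier)} {c : ℂ} {h : S.𝔥} {r : Fin S.N → ℤ} {n : ℤ}
    (hT : ∀ p : ℤ, T * (W.ta Φ (n - S.m * p) h * W.tK M 0 r p) -
      W.ta Φ (n - S.m * p) h * W.tK M 0 r p * T = c • (W.ta Φ (n - S.m * p) h * W.tK M 0 r p)) :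
    T * W.Y Φ r n h - W.Y Φ r n h * T = c • W.Y Φ r n h := by
  rw [Y_apply, lie_smul_right, lie_locSum_smul _ hT, smul_comm]

lemma lie_td_Y (h : S.𝔥) (r : Fin S.N → ℤ) (n : ℤ) :
    W.td Φ * W.Y Φ r n h - W.Y Φ r n h * W.td Φ = (n : ℂ) • W.Y Φ r n h :=
  W.lie_Y_smul Φ fun p => by
    rw [lie_mul_left_right (W.lie_td_ta Φ _ h) (W.lie_td_tK Φ 0 r p)]
    congr 1
    push_cast; ring

lemma lie_tL_Y {T : Module.End ℂ W.carrier} (hT : ∀ α, T * W.H α = W.H α * T) {c : ℂ}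
    {r : Fin S.N → ℤ} (hK : ∀ p, T * W.K 0 r p - W.K 0 r p * T = c • W.K 0 r p) (h : S.𝔥) (n : ℤ) :
    W.tL M T * W.Y Φ r n h - W.Y Φ r n h * W.tL M T = c • W.Y Φ r n h :=
  W.lie_Y_smul Φ fun p => by
    rw [lie_mul_left_right (a := 0) (b := c) (by rw [W.tL_ta_of_commute Φ hT, sub_self, zero_smul])
      (by rw [tK, lie_tL_tL, hK, tL_smul]), zero_add]

lemma tK_Y (i : Fin (S.N + 1)) (s : Fin S.N → ℤ) (p : ℤ) (h : S.𝔥) (r : Fin S.N → ℤ) (n : ℤ) :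
    W.tK M i s p * W.Y Φ r n h = W.Y Φ r n h * W.tK M i s p := by
  rw [← sub_eq_zero, tK, W.lie_tL_Y Φ (c := 0) (W.K_H i s p)
    (fun q => by rw [W.K_K, sub_self, zero_smul]), zero_smul]

/-- `[h'_i, h_{n-mp}]` is a scalar, non-zero at most for the single `p` with `mp = i + n`; the level
in it cancels the factor `k⁻¹`. -/
lemma lie_ta_Y (hk : k ≠ 0) (i : ℤ) (h' h : S.𝔥) (r : Fin S.N → ℤ) (n : ℤ) :
    W.ta Φ i h' * W.Y Φ r n h - W.Y Φ r n h * W.ta Φ i h' =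
      if (S.m : ℤ) ∣ i + n then
        ((i : ℂ) / S.m * S.form (S.proj i h') h) • W.tK M 0 r ((i + n) / S.m) else 0 := by
  have hm : (S.m : ℤ) ≠ 0 := by exact_mod_cast S.m_pos.ne'
  rw [Y_apply, lie_smul_right, lie_locSum]
  have h1 : ∀ p : ℤ, W.ta Φ i h' * (W.ta Φ (n - S.m * p) h * W.tK M 0 r p) -
      W.ta Φ (n - S.m * p) h * W.tK M 0 r p * W.ta Φ i h' =
      if i + n = S.m * p then
        (k * ((i : ℂ) / S.m * S.form (S.proj i h') h)) • W.tK M 0 r p else 0 := by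
    intro p
    rw [mul_assoc _ _ (W.ta Φ i h'), W.tK_ta Φ, ← mul_assoc, ← mul_assoc, ← sub_mul, W.ta_rel Φ]
    by_cases hp : i + n = S.m * p
    · rw [if_pos (by omega), if_pos hp, smul_mul_assoc, one_mul]
      congr 1; ring
    · rw [if_neg (by omega), if_neg hp, zero_mul]
  refine LinearMap.ext fun v => ?_
  rw [LinearMap.smul_apply, locSum_apply]
  simp only [h1]
  split_ifs with hd
  · rw [finsum_eq_single _ ((i + n) / S.m) fun p hp => ?_]
    · rw [if_pos (Int.mul_ediv_cancel' hd).symm, LinearMap.smul_apply, smul_smul,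
        inv_mul_cancel_left₀ hk, LinearMap.smul_apply]
    · rw [if_neg, LinearMap.zero_apply]
      intro hc
      exact hp (by rw [hc, Int.mul_ediv_cancel_left _ hm])
  · rw [finsum_eq_zero_of_forall_eq_zero, smul_zero, LinearMap.zero_apply]
    intro p
    rw [if_neg fun hc => hd ⟨p, hc⟩, LinearMap.zero_apply]

lemma Y_projH (h : S.𝔥) (r : Fin S.N → ℤ) (n : ℤ) : W.Y Φ r n (S.projH n h) = W.Y Φ r n h := by
  rw [Y_apply, Y_apply]
  congr 1
  refine locSum_congr _ _ fun p => ?_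
  have : S.projH n h = S.projH (n - S.m * p) h :=
    Subtype.ext (by rw [S.coe_projH, S.coe_projH, S.proj_sub_m_mul])
  rw [this, ta_projH]

lemma Y_zero (hk : k ≠ 0) (n : ℤ) (h : S.𝔥) : W.Y Φ 0 n h = W.ta Φ n h := by
  refine LinearMap.ext fun v => ?_
  rw [Y_apply, LinearMap.smul_apply, locSum_apply, finsum_eq_single _ 0 fun p hp => ?_]
  · rw [tK_zero_zero, if_pos rfl, mul_smul_comm, mul_one, LinearMap.smul_apply,
      inv_smul_smul₀ hk, mul_zero, sub_zero]
  · rw [tK_zero_zero, if_neg hp, mul_zero, LinearMap.zero_apply]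

/-- `[h_n(r), T]` in terms of the commutators of the Heisenberg operators with `T`. -/
lemma lie_Y (h : S.𝔥) (r : Fin S.N → ℤ) (n : ℤ) {T : Module.End ℂ (M ⊗[ℂ] W.carrier)}
    (hT : ∀ p, W.tK M 0 r p * T = T * W.tK M 0 r p) (v : M ⊗[ℂ] W.carrier) :
    (W.Y Φ r n h * T - T * W.Y Φ r n h) v = k⁻¹ • ∑ᶠ p : ℤ,
      ((W.ta Φ (n - S.m * p) h * T - T * W.ta Φ (n - S.m * p) h) * W.tK M 0 r p) v := by
  have h1 : W.Y Φ r n h * T - T * W.Y Φ r n h = - (k⁻¹ • (T * locSum _ (W.ta_tK_locFin Φ h r n) -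
      locSum _ (W.ta_tK_locFin Φ h r n) * T)) := by
    rw [Y_apply, ← lie_smul_right, neg_sub]
  rw [h1, lie_locSum, LinearMap.neg_apply, LinearMap.smul_apply, locSum_apply,
    ← smul_neg k⁻¹ (finsum _), ← finsum_neg_distrib]
  congr 1
  refine finsum_congr fun p => ?_
  rw [← LinearMap.neg_apply, neg_sub, sub_mul, mul_assoc _ _ T, hT, mul_assoc, mul_assoc]

variable [FiniteDimensional ℂ 𝔤] [LieAlgebra.IsSemisimple ℂ 𝔤] (hk : k ≠ 0)

lemma vev_Y (h : S.𝔥) (r : Fin S.N → ℤ) (n : ℤ) : (W.tH Φ hk).vev (W.Y Φ r n h) =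
    if (S.m : ℤ) ∣ n then k⁻¹ • (W.H (S.proj₀ h) * W.K 0 r (n / S.m)) else 0 := by
  have hm : (S.m : ℤ) ≠ 0 := by exact_mod_cast S.m_pos.ne'
  have h0 : ∀ j, j ≠ 0 → ∀ w, (W.tH Φ hk).ε (W.ta Φ j h ((W.tH Φ hk).ι w)) = 0 := by
    intro j hj w
    rcases lt_or_gt_of_ne hj with hj | hj
    · exact (W.tH Φ hk).ε_a j hj h _
    · have := (W.tH Φ hk).a_ι j hj h w
      change W.ta Φ j h _ = 0 at this
      rw [this, map_zero]
  have h1 : ∀ p w, W.tK M 0 r p ((W.tH Φ hk).ι w) = (W.tH Φ hk).ι (W.K 0 r p w) := fun _ _ => rfl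
  refine LinearMap.ext fun w => ?_
  rw [HeisVac.vev_apply, Y_apply, LinearMap.smul_apply, map_smul, locSum_apply,
    linear_finsum _ (W.ta_tK_locFin Φ h r n _)]
  simp only [Module.End.mul_apply, h1]
  split_ifs with hd
  · rw [LinearMap.smul_apply, finsum_eq_single _ (n / S.m) fun p hp => h0 _ (fun hc => hp ?_) _]
    · rw [Int.mul_ediv_cancel' hd, sub_self, ta, tA_zero]
      congr 1
      exact LinearMap.congr_fun (W.vev_tL Φ hk (W.a₀ h)) _
    · rw [sub_eq_zero.mp hc, Int.mul_ediv_cancel_left _ hm]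
  · rw [finsum_eq_zero_of_forall_eq_zero fun p => h0 _ (fun hc => hd ⟨p, sub_eq_zero.mp hc⟩) _,
      smul_zero, LinearMap.zero_apply]

lemma Y_tK_locFin (h : S.𝔥) (r s : Fin S.N → ℤ) (n : ℤ) :
    LocFin fun p : ℤ => W.Y Φ r (n - S.m * p) h * W.tK M 0 s p :=
  locFin_mul_of_degree S.m_pos (W.td_graded Φ) n (fun _ => W.lie_td_Y Φ h r _)
    (fun _ => W.lie_td_tK Φ 0 s _) fun p => (W.tK_Y Φ 0 s p h r _).symm

include hk in
-- Both sides are linear in the oscillators, and their commutators with them agree by the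
-- factorisation of the `k_0`'s. The difference thus commutes with all of them, and its expectation
-- value vanishes by `factor_K'`.
lemma factor_Y (h : S.𝔥) (r s : Fin S.N → ℤ) (n : ℤ) :
    k⁻¹ • locSum _ (W.Y_tK_locFin Φ h r s n) = W.Y Φ (r + s) n h := by
  have hm : (S.m : ℤ) ≠ 0 := by exact_mod_cast S.m_pos.ne'
  have hdvd : ∀ {n p : ℤ}, (S.m : ℤ) ∣ n - S.m * p ↔ (S.m : ℤ) ∣ n :=
    fun {n p} => dvd_sub_left (Dvd.intro p rfl)
  have hdiv : ∀ {n p : ℤ}, (S.m : ℤ) ∣ n → (n - S.m * p) / S.m = n / S.m - p := by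
    rintro _ p ⟨q, rfl⟩
    rw [← mul_sub, Int.mul_ediv_cancel_left _ hm, Int.mul_ediv_cancel_left _ hm]
  rw [← sub_eq_zero, ← one_smul ℂ (W.Y Φ (r + s) n h)]
  refine W.family_eq_zero Φ hk
    (fun n => k⁻¹ • locSum _ (W.Y_tK_locFin Φ h r s n) - (1 : ℂ) • W.Y Φ (r + s) n h) ?_ ?_ ?_ n
  · intro i _ h'
    refine ⟨0, fun n => ?_⟩
    rw [zero_smul, lie_smul_sub_smul, W.lie_ta_Y Φ hk, lie_locSum, one_smul, sub_eq_zero]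
    have h1 : ∀ p : ℤ, W.ta Φ i h' * (W.Y Φ r (n - S.m * p) h * W.tK M 0 s p) -
        W.Y Φ r (n - S.m * p) h * W.tK M 0 s p * W.ta Φ i h' =
        if (S.m : ℤ) ∣ i + n then ((i : ℂ) / S.m * S.form (S.proj i h') h) •
          (W.tK M 0 r ((i + n) / S.m - p) * W.tK M 0 s p) else 0 := by
      intro p
      rw [mul_assoc _ _ (W.ta Φ i h'), W.tK_ta Φ, ← mul_assoc, ← mul_assoc, ← sub_mul,
        W.lie_ta_Y Φ hk, ← add_sub_assoc]
      by_cases hd : (S.m : ℤ) ∣ i + n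
      · rw [if_pos (hdvd.mpr hd), if_pos hd, hdiv hd, smul_mul_assoc]
      · rw [if_neg (mt hdvd.mp hd), if_neg hd, zero_mul]
    split_ifs with hd
    · rw [add_comm r s, ← factor_tK, smul_comm _ k⁻¹, smul_locSum (_ / _ * _)]
      congr 1
      exact locSum_congr _ _ fun p => by rw [h1, if_pos hd]
    · refine LinearMap.ext fun v => ?_
      rw [LinearMap.smul_apply, locSum_apply, finsum_eq_zero_of_forall_eq_zero, smul_zero,
        LinearMap.zero_apply]
      intro p
      rw [h1, if_neg hd, LinearMap.zero_apply]
  · intro n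
    rw [lie_smul_sub_smul, lie_td_Y, smul_sub (n : ℂ), smul_comm _ k⁻¹, smul_comm _ (1 : ℂ)]
    congr 2
    refine lie_locSum_smul _ fun p => ?_
    rw [lie_mul_left_right (W.lie_td_Y Φ h r _) (W.lie_td_tK Φ 0 s p)]
    congr 1
    push_cast; ring
  · intro n
    refine LinearMap.ext fun w => ?_
    rw [map_sub, map_smul, one_smul, LinearMap.sub_apply, LinearMap.smul_apply,
      LinearMap.zero_apply, HeisVac.vev_apply, locSum_apply,
      linear_finsum _ (W.Y_tK_locFin Φ h r s n _), sub_eq_zero]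
    have h1 : ∀ p : ℤ, (W.tH Φ hk).ε ((W.Y Φ r (n - S.m * p) h * W.tK M 0 s p)
        ((W.tH Φ hk).ι w)) = (W.tH Φ hk).vev (W.Y Φ r (n - S.m * p) h) (W.K 0 s p w) :=
      fun _ => rfl
    simp only [h1, vev_Y, hdvd]
    split_ifs with hd
    · simp only [hdiv hd]
      rw [add_comm r s, ← W.factor_K', LinearMap.smul_apply, Module.End.mul_apply,
        LinearMap.smul_apply, map_smul, locSum_apply,
        linear_finsum _ (W.K_K_locFin 0 s r (n / S.m) w)]
      congr 1
      rw [smul_finsum' k⁻¹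
        (hasFiniteSupport_linear (W.H (S.proj₀ h)) (W.K_K_locFin 0 s r (n / S.m) w))]
      rfl
    · simp

end ModD

end

section

/-! ### The module induced from an object of `D_k` -/

variable {𝔤 : Type u} [LieRing 𝔤] [LieAlgebra ℂ 𝔤] {S : Data 𝔤} {k : ℂ}

namespace Data

variable (S) [FiniteDimensional ℂ 𝔤] [LieAlgebra.IsSemisimple ℂ 𝔤]

/-- `𝔤` is spanned by the Cartan subalgebra and the root vectors. -/
lemma root_induction {P : 𝔤 → Prop} (hadd : ∀ x y, P x → P y → P (x + y))
    (hsmul : ∀ (c : ℂ) x, P x → P (c • x)) (hh : ∀ h : S.𝔥, P h) (hx : ∀ β : S.Root, P (S.x β))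
    (x : 𝔤) : P x := by
  rw [← S.cartanProj_add_sum x]
  refine hadd _ _ (hh _) (Finset.sum_induction _ P hadd ?_ fun β _ => hsmul _ _ (hx β))
  simpa using hh 0

lemma L_root_induction {P : S.L → Prop} (hadd : ∀ X Y, P X → P Y → P (X + Y))
    (hsmul : ∀ (c : ℂ) X, P X → P (c • X)) (hh : ∀ (h : S.𝔥) n r, P (S.gEl h n r))
    (hx : ∀ (β : S.Root) n r, P (S.gEl (S.x β) n r))
    (hk : ∀ i r p, P (S.kEl i r p)) (hd : ∀ i, P (S.dEl i)) (Y : S.L) : P Y := by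
  refine S.L_induction hadd hsmul (fun x n r => ?_) hk hd Y
  refine S.root_induction (P := fun x => P (S.gEl x n r)) (fun x y h1 h2 => ?_) (fun c x h => ?_)
    (fun h => hh h n r) (fun β => hx β n r) x
  · rw [S.gEl_add]; exact hadd _ _ h1 h2
  · rw [S.gEl_smul]; exact hsmul _ _ h

end Data

namespace ModD

variable (W : ModD.{u, w} S k) {M : Type*} [AddCommGroup M] [Module ℂ M] (Φ : VermaLike S k M)

lemma rel_tK (M : Type*) [AddCommGroup M] [Module ℂ M] (r : Fin S.N → ℤ) (p : ℤ) :
    ∑ i : Fin S.N, (r i : ℂ) • W.tK M i.succ r p + (p : ℂ) • W.tK M 0 r p = 0 := by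
  have h := congrArg (LinearMap.lTensorHom (R := ℂ) (N := W.carrier) (P := W.carrier) M)
    (W.rel_K r p)
  simp only [map_add, map_sum, map_smul, map_zero] at h
  rw [smul_smul, show (S.m : ℂ)⁻¹ * ((S.m * p : ℤ) : ℂ) = p by
    push_cast; rw [inv_mul_cancel_left₀ S.m_ne_zero]] at h
  exact h

/-- The action of `t^γ k_i`, extended by zero. -/
def repCtr (M : Type*) [AddCommGroup M] [Module ℂ M] (i : Fin (S.N + 1)) (γ : S.Exp) :
    Module.End ℂ (M ⊗[ℂ] W.carrier) :=
  if (S.m : ℤ) ∣ γ.1 then W.tK M i γ.2 (γ.1 / S.m) else 0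

lemma sum_smul_repCtr (M : Type*) [AddCommGroup M] [Module ℂ M] (γ : S.Exp) :
    ∑ i, ((if i = 0 then (S.m : ℂ)⁻¹ else 1) * S.deg γ i) • W.repCtr M i γ = 0 := by
  simp only [repCtr]
  obtain ⟨n, r⟩ := γ
  dsimp only
  split_ifs with hn
  · obtain ⟨p, rfl⟩ := hn
    rw [← W.rel_tK M r p, Fin.sum_univ_succ, add_comm,
      Int.mul_ediv_cancel_left _ (by exact_mod_cast S.m_pos.ne' : (S.m : ℤ) ≠ 0)]
    congr 1
    · refine Finset.sum_congr rfl fun i _ => ?_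
      rw [if_neg (Fin.succ_ne_zero i), one_mul]
      rfl
    · rw [if_pos rfl]
      congr 1
      change (S.m : ℂ)⁻¹ * ((S.m * p : ℤ) : ℂ) = p
      push_cast
      rw [inv_mul_cancel_left₀ S.m_ne_zero]
  · simp

lemma finite_tK_tK (i : Fin (S.N + 1)) (r s : Fin S.N → ℤ) (n : ℤ) (v : M ⊗[ℂ] W.carrier) :
    (fun p : ℤ => W.tK M 0 s (n - p) (W.tK M i r p v)).HasFiniteSupport := by
  have h := W.tK_tK_locFin (M := M) i s r n v
  refine (h.image fun p => n - p).subset fun p hp => ⟨n - p, ?_, sub_sub_cancel n p⟩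
  rw [Function.mem_support] at hp ⊢
  change (W.tK M i r (n - (n - p)) * W.tK M 0 s (n - p)) v ≠ 0
  rwa [sub_sub_cancel, tK_tK]

lemma factor_tK_apply (i : Fin (S.N + 1)) (r s : Fin S.N → ℤ) (n : ℤ) (v : M ⊗[ℂ] W.carrier) :
    k⁻¹ • ∑ᶠ p : ℤ, W.tK M 0 s (n - p) (W.tK M i r p v) = W.tK M i (r + s) n v := by
  rw [add_comm r s, ← factor_tK, LinearMap.smul_apply, locSum_apply]
  congr 1
  rw [← finsum_comp_injective (e := fun p : ℤ => n - p) sub_right_injective fun p hp =>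
    absurd ⟨n - p, sub_sub_cancel n p⟩ hp]
  refine finsum_congr fun p => ?_
  rw [tK_tK, sub_sub_cancel]; rfl

/-- The commutator is a sum over `p` of products of two `k_0`'s with coefficient `a/m - p`. The
relation `rel_tK` trades the part `-p k_0(r)_p` for `∑ r_i k_i(r)_p`, and factorisation collapses
each sum to a single central operator. -/
lemma lie_Y_Y (hk : k ≠ 0) (h h' : S.𝔥) (r s : Fin S.N → ℤ) (a b : ℤ) :
    W.Y Φ r a h * W.Y Φ s b h' - W.Y Φ s b h' * W.Y Φ r a h = S.form (S.proj a h) h' •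
      if (S.m : ℤ) ∣ a + b then (a / S.m : ℂ) • W.tK M 0 (r + s) ((a + b) / S.m) +
        ∑ i : Fin S.N, (r i : ℂ) • W.tK M i.succ (r + s) ((a + b) / S.m) else 0 := by
  have hm : (S.m : ℤ) ≠ 0 := by exact_mod_cast S.m_pos.ne'
  refine LinearMap.ext fun v => ?_
  rw [W.lie_Y Φ h r a fun p => W.tK_Y Φ 0 r p h' s b]
  simp only [W.lie_ta_Y Φ hk, S.proj_sub_m_mul]
  by_cases hd : (S.m : ℤ) ∣ a + b
  · obtain ⟨t, ht⟩ := hd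
    have h1 : ∀ p : ℤ, a - S.m * p + b = S.m * (t - p) := fun p => by rw [mul_sub, ← ht]; ring
    have h2 : ∀ p : ℤ, (((a - S.m * p : ℤ) : ℂ) / S.m) = a / S.m - p := fun p => by
      push_cast
      rw [sub_div, mul_div_cancel_left₀ _ S.m_ne_zero]
    have h3 : ∀ p : ℤ, ((((a - S.m * p : ℤ) : ℂ) / S.m * S.form (S.proj a h) h') •
        W.tK M 0 s (t - p) * W.tK M 0 r p) v = S.form (S.proj a h) h' •
          ((a / S.m : ℂ) • W.tK M 0 s (t - p) (W.tK M 0 r p v) +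
            ∑ i : Fin S.N, (r i : ℂ) • W.tK M 0 s (t - p) (W.tK M i.succ r p v)) := by
      intro p
      have h4 := congrArg (W.tK M 0 s (t - p)) (LinearMap.congr_fun (W.rel_tK M r p) v)
      simp only [LinearMap.add_apply, LinearMap.sum_apply, LinearMap.smul_apply, map_add, map_sum,
        map_smul, LinearMap.zero_apply, map_zero] at h4
      rw [eq_neg_of_add_eq_zero_left h4, h2, smul_mul_assoc, LinearMap.smul_apply,
        Module.End.mul_apply]
      module
    simp only [h1, ht, dvd_mul_right, if_true, Int.mul_ediv_cancel_left _ hm, h3]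
    have hf := W.finite_tK_tK (M := M) 0 r s t v
    have hf' := fun i : Fin S.N => W.finite_tK_tK (M := M) i.succ r s t v
    have hf1 : (fun p : ℤ => (a / S.m : ℂ) •
        W.tK M 0 s (t - p) (W.tK M 0 r p v)).HasFiniteSupport :=
      hasFiniteSupport_linear ((a / S.m : ℂ) • LinearMap.id) hf
    have hf2 : ∀ i : Fin S.N, (fun p : ℤ => (r i : ℂ) •
        W.tK M 0 s (t - p) (W.tK M i.succ r p v)).HasFiniteSupport := fun i =>
      hasFiniteSupport_linear ((r i : ℂ) • LinearMap.id) (hf' i)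
    have hf3 : (fun p : ℤ => ∑ i : Fin S.N, (r i : ℂ) •
        W.tK M 0 s (t - p) (W.tK M i.succ r p v)).HasFiniteSupport :=
      (Set.finite_iUnion hf2).subset fun p hp => by
        by_contra hc
        refine hp (Finset.sum_eq_zero fun i _ => ?_)
        rw [Set.mem_iUnion, not_exists] at hc
        exact Function.notMem_support.mp (hc i)
    rw [← smul_finsum' _ (hasFiniteSupport_add hf1 hf3), LinearMap.smul_apply, smul_comm k⁻¹]
    congr 1
    rw [finsum_add_distrib hf1 hf3, finsum_sum_comm _ _ fun i _ => hf2 i,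
      ← smul_finsum' _ hf, smul_add, smul_comm k⁻¹, W.factor_tK_apply, LinearMap.add_apply,
      LinearMap.smul_apply, LinearMap.sum_apply, Finset.smul_sum]
    congr 1
    refine Finset.sum_congr rfl fun i _ => ?_
    rw [← smul_finsum' _ (hf' i), smul_comm k⁻¹, W.factor_tK_apply, LinearMap.smul_apply]
  · have h1 : ∀ p : ℤ, ¬ (S.m : ℤ) ∣ a - S.m * p + b := fun p hp => hd <| by
      have := dvd_add hp (Dvd.intro p rfl : (S.m : ℤ) ∣ S.m * p)
      rwa [show a - S.m * p + b + S.m * p = a + b by ring] at this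
    simp [h1, hd]

section

variable [FiniteDimensional ℂ 𝔤] [LieAlgebra.IsSemisimple ℂ 𝔤] (hk : k ≠ 0)

include hk in
lemma lie_Y_X (h : S.𝔥) (β : S.Root) (r s : Fin S.N → ℤ) (a b : ℤ) :
    W.Y Φ r a h * W.X Φ β s b - W.X Φ β s b * W.Y Φ r a h =
      S.form (S.proj a h) β • W.X Φ β (r + s) (a + b) := by
  refine LinearMap.ext fun v => ?_
  rw [W.lie_Y Φ h r a fun p => W.tK_X Φ 0 r p β s b, add_comm r s, ← W.factor_X Φ hk,
    smul_comm _ k⁻¹, LinearMap.smul_apply, LinearMap.smul_apply, locSum_apply,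
    smul_finsum' _ (W.X_tK_locFin Φ β s r (a + b) v)]
  congr 1
  refine finsum_congr fun p => ?_
  rw [W.lie_ta_X Φ hk, S.proj_sub_m_mul, smul_mul_assoc, LinearMap.smul_apply]
  congr 4
  ring

/-- The action of `x ↦ x t^γ`. -/
def repLoop (γ : S.Exp) : 𝔤 →ₗ[ℂ] Module.End ℂ (M ⊗[ℂ] W.carrier) :=
  W.Y Φ γ.2 γ.1 ∘ₗ S.cartanProj + ∑ β, (S.coord β).smulRight (W.X Φ β γ.2 γ.1)

lemma repLoop_apply (γ : S.Exp) (x : 𝔤) : W.repLoop Φ γ x =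
    W.Y Φ γ.2 γ.1 (S.cartanProj x) + ∑ β, S.coord β x • W.X Φ β γ.2 γ.1 := by
  simp [repLoop, LinearMap.sum_apply]

/-- The action of the derivations. -/
def repDer : Fin (S.N + 1) → Module.End ℂ (M ⊗[ℂ] W.carrier) :=
  Fin.cases (W.td Φ) fun i => W.tL M (W.d i.succ)

/-- The action of `L̃(𝔤, θ)` on `M ⊗ W`. -/
def rep : S.L →ₗ[ℂ] Module.End ℂ (M ⊗[ℂ] W.carrier) :=
  S.torLift (W.repLoop Φ) (W.repCtr M) (W.sum_smul_repCtr M) (W.repDer Φ) ∘ₗ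
    S.L.toSubmodule.subtype

lemma rep_kEl (i : Fin (S.N + 1)) (r : Fin S.N → ℤ) (p : ℤ) :
    W.rep Φ (S.kEl i r p) = W.tK M i r p := by
  refine (S.torLift_kEl (W.repLoop Φ) (W.repCtr M) (W.sum_smul_repCtr M) (W.repDer Φ) i r p).trans ?_
  rw [repCtr, if_pos (dvd_mul_right _ _),
    Int.mul_ediv_cancel_left _ (by exact_mod_cast S.m_pos.ne' : (S.m : ℤ) ≠ 0)]

lemma rep_dEl (i : Fin (S.N + 1)) : W.rep Φ (S.dEl i) = W.repDer Φ i :=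
  S.torLift_dEl (W.repLoop Φ) (W.repCtr M) (W.sum_smul_repCtr M) (W.repDer Φ) i

lemma rep_gEl (x : 𝔤) (n : ℤ) (r : Fin S.N → ℤ) :
    W.rep Φ (S.gEl x n r) = W.repLoop Φ (n, r) (S.proj n x) :=
  S.torLift_gEl (W.repLoop Φ) (W.repCtr M) (W.sum_smul_repCtr M) (W.repDer Φ) x n r

lemma rep_gEl_cartan (h : S.𝔥) (n : ℤ) (r : Fin S.N → ℤ) :
    W.rep Φ (S.gEl h n r) = W.Y Φ r n h := by
  have h1 : S.proj n (h : 𝔤) = (S.projH n h : 𝔤) := (S.coe_projH n h).symm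
  rw [rep_gEl, repLoop_apply, h1, S.cartanProj_cartan, Finset.sum_eq_zero, add_zero, W.Y_projH Φ]
  intro β _
  rw [S.coord_cartan β (S.projH n h).2, zero_smul]

lemma repLoop_x (γ : S.Exp) (β : S.Root) : W.repLoop Φ γ (S.x β) = W.X Φ β γ.2 γ.1 := by
  rw [repLoop_apply, S.cartanProj_x, map_zero, zero_add, Finset.sum_eq_single β]
  · rw [S.coord_x_self, one_smul]
  · intro δ _ hδ
    rw [S.coord_x_of_ne, zero_smul]
    exact hδ
  · simp

include hk in
-- `rep` is evaluated on the `n`-th component of `x_β`, an average over `m` twisted root vectors;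
-- `twist_X` makes all summands equal.
lemma rep_gEl_x (β : S.Root) (n : ℤ) (r : Fin S.N → ℤ) :
    W.rep Φ (S.gEl (S.x β) n r) = W.X Φ β r n := by
  rw [rep_gEl, S.proj_eq_sum, map_smul, map_sum]
  have h2 : ∀ p ∈ Finset.range S.m, W.repLoop Φ (n, r)
      (S.ω ^ (-(n * (p : ℤ))) • S.θ^[p] (S.x β)) = W.X Φ β r n := by
    intro p _
    rw [S.θ_iterate_x, map_smul, map_smul, repLoop_x, ← W.twist_X Φ hk, smul_smul,
      ← zpow_add₀ S.ω_ne_zero, mul_comm n, neg_add_cancel, zpow_zero, one_smul]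
  rw [Finset.sum_congr rfl h2, Finset.sum_const, Finset.card_range, ← Nat.cast_smul_eq_nsmul ℂ,
    smul_smul, inv_mul_cancel₀ S.m_ne_zero, one_smul]

lemma rep_cEl (a b : ℤ) (r s : Fin S.N → ℤ) : W.rep Φ (S.cEl a b r s) =
    if (S.m : ℤ) ∣ a + b then (a / S.m : ℂ) • W.tK M 0 (r + s) ((a + b) / S.m) +
        ∑ i : Fin S.N, (r i : ℂ) • W.tK M i.succ (r + s) ((a + b) / S.m) else 0 := by
  rw [Data.cEl]
  split_ifs
  · simp only [map_add, map_smul, map_sum, rep_kEl]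
  · exact map_zero _

/-- The representation property for a pair of elements. -/
def IsRep (y z : S.L) : Prop :=
  W.rep Φ ⁅y, z⁆ = W.rep Φ y * W.rep Φ z - W.rep Φ z * W.rep Φ y

variable {W Φ} in
lemma IsRep.symm {y z : S.L} (h : W.IsRep Φ y z) : W.IsRep Φ z y := by
  unfold IsRep at h ⊢
  rw [← lie_skew, map_neg, h, neg_sub]

lemma isRep_of_gen {y : S.L} (hh : ∀ (h : S.𝔥) n r, W.IsRep Φ y (S.gEl h n r))
    (hx : ∀ (β : S.Root) n r, W.IsRep Φ y (S.gEl (S.x β) n r))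
    (hK : ∀ i r p, W.IsRep Φ y (S.kEl i r p)) (hd : ∀ i, W.IsRep Φ y (S.dEl i)) (z : S.L) :
    W.IsRep Φ y z := by
  refine S.L_root_induction (P := W.IsRep Φ y) (fun z z' h h' => ?_) (fun c z h => ?_) hh hx hK hd z
  · unfold IsRep at h h' ⊢
    rw [lie_add, map_add, h, h', map_add, mul_add, add_mul]
    abel
  · unfold IsRep at h ⊢
    rw [lie_smul, map_smul, h, map_smul, lie_smul_right]

end

end ModD

end

section

/-! ### The induction functor -/

variable {𝔤 : Type u} [LieRing 𝔤] [LieAlgebra ℂ 𝔤] {S : Data 𝔤} {k : ℂ}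

namespace Data

lemma map_expCoeff {R R' : Type*} [Ring R] [Algebra ℂ R] [Ring R'] [Algebra ℂ R'] (φ : R →ₐ[ℂ] R')
    (a : ℕ → R) (n : ℕ) : φ (expCoeff a n) = expCoeff (fun j => φ (a j)) n := by
  rw [expCoeff, expCoeff, map_sum]
  refine Finset.sum_congr rfl fun l _ => ?_
  have h1 : PowerSeries.map (φ : R →+* R') (PowerSeries.mk fun j => if j = 0 then 0 else a j) =
      PowerSeries.mk fun j => if j = 0 then 0 else φ (a j) := by
    ext j
    rw [PowerSeries.coeff_map, PowerSeries.coeff_mk, PowerSeries.coeff_mk]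
    split_ifs
    · exact map_zero _
    · rfl
  rw [map_smul, ← h1, ← map_pow, PowerSeries.coeff_map]
  rfl

lemma expCoeff_congr {R : Type*} [Ring R] [Algebra ℂ R] {a b : ℕ → R} (h : ∀ j, j ≠ 0 → a j = b j)
    (n : ℕ) : expCoeff a n = expCoeff b n := by
  have : (fun j => if j = 0 then 0 else a j) = fun j => if j = 0 then 0 else b j := by
    funext j
    split_ifs with hj
    · rfl
    · exact h j hj
  rw [expCoeff, expCoeff, this]

lemma gEl_cartan_lie_x (S : Data 𝔤) [FiniteDimensional ℂ 𝔤] [LieAlgebra.IsSemisimple ℂ 𝔤] (h : S.𝔥)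
    (β : S.Root) (i n : ℤ) (r s : Fin S.N → ℤ) : ⁅S.gEl h i r, S.gEl (S.x β) n s⁆ =
      S.form (S.proj i h) β • S.gEl (S.x β) (i + n) (r + s) := by
  rw [S.gEl_lie_gEl, S.form_cartan_x (S.proj_mem i h.2), zero_smul, add_zero,
    S.lie_x _ (S.proj_mem i h.2), gEl_smul]

end Data

namespace ModD

/-! ### The representation property on `M ⊗ W`. -/

section Rep

variable (W : ModD.{u, w} S k) {M : Type*} [AddCommGroup M] [Module ℂ M] (Φ : VermaLike S k M)

/-- The tensor product with the identity of `W`, as a homomorphism of algebras. -/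
def rAlgHom (M : Type*) [AddCommGroup M] [Module ℂ M] :
    Module.End ℂ M →ₐ[ℂ] Module.End ℂ (M ⊗[ℂ] W.carrier) :=
  AlgHom.ofLinearMap (LinearMap.rTensorHom W.carrier) (LinearMap.rTensor_id _ _)
    fun _ _ => LinearMap.rTensor_mul _ _ _

/-- The oscillators on `M ⊗ W` differ from `A ⊗ 1` only at index `0`, which does not enter the
exponential; so the exponential is the image of the one on `M` under an algebra homomorphism. -/
lemma tEm_tmul (β : S.𝔥) (n : ℕ) (u : M) (w : W.carrier) :
    W.tEm Φ β n (u ⊗ₜ w) = (S.expMinus k (fun j => Φ.A j β) n u) ⊗ₜ w := by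
  have : W.tEm Φ β n = W.rAlgHom M (S.expMinus k (fun j => Φ.A j β) n) := by
    rw [Data.expMinus, Data.map_expCoeff]
    refine Data.expCoeff_congr (fun j hj => ?_) n
    rw [map_smul]
    exact congrArg (_ • ·) (tA_of_ne Φ (a₀ := W.a₀) (i := -(j : ℤ)) (by omega) β)
  rw [this]; rfl

lemma tEp_tmul (β : S.𝔥) (n : ℕ) (u : M) (w : W.carrier) :
    W.tEp Φ β n (u ⊗ₜ w) = (S.expPlus k (fun j => Φ.A j β) n u) ⊗ₜ w := by
  have : W.tEp Φ β n = W.rAlgHom M (S.expPlus k (fun j => Φ.A j β) n) := by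
    rw [Data.expPlus, Data.map_expCoeff]
    refine Data.expCoeff_congr (fun j hj => ?_) n
    rw [map_smul]
    exact congrArg (_ • ·) (tA_of_ne Φ (a₀ := W.a₀) (i := (j : ℤ)) (by omega) β)
  rw [this]; rfl

lemma xTerm_tmul (β : S.Root) (r : Fin S.N → ℤ) (n : ℤ) (ab : ℕ × ℕ) (u : M) (w : W.carrier) :
    W.xTerm Φ β r n ab (u ⊗ₜ w) = (S.expMinus k (fun j => Φ.A j (-⟨β, β.2.1⟩)) ab.1
      (S.expPlus k (fun j => Φ.A j (-⟨β, β.2.1⟩)) ab.2 u)) ⊗ₜ W.Z β r (n + ab.1 - ab.2) w := by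
  rw [xTerm, Module.End.mul_apply, Module.End.mul_apply, tEp_tmul, LinearMap.lTensor_tmul,
    tEm_tmul]

variable [FiniteDimensional ℂ 𝔤] [LieAlgebra.IsSemisimple ℂ 𝔤]

lemma rep_dEl_zero : W.rep Φ (S.dEl 0) = W.td Φ := W.rep_dEl Φ 0

lemma rep_dEl_succ (i : Fin S.N) : W.rep Φ (S.dEl i.succ) = W.tL M (W.d i.succ) :=
  W.rep_dEl Φ i.succ

lemma isRep_dEl_kEl (i j : Fin (S.N + 1)) (r : Fin S.N → ℤ) (p : ℤ) :
    W.IsRep Φ (S.dEl i) (S.kEl j r p) := by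
  rw [IsRep, S.dEl_lie_kEl, map_smul, rep_kEl]
  refine Fin.cases ?_ (fun i => ?_) i
  · rw [rep_dEl_zero, lie_td_tK]; rfl
  · rw [rep_dEl_succ, tK, lie_tL_tL, W.d_succ_K, tL_smul]; rfl

variable (hk : k ≠ 0)

include hk

lemma isRep_kEl (i : Fin (S.N + 1)) (r : Fin S.N → ℤ) (p : ℤ) (z : S.L) :
    W.IsRep Φ (S.kEl i r p) z := by
  refine W.isRep_of_gen Φ (fun h n s => ?_) (fun β n s => ?_) (fun j s q => ?_)
    (fun j => (W.isRep_dEl_kEl Φ j i r p).symm) z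
  · rw [IsRep, S.kEl_lie_gEl, map_zero, rep_kEl, rep_gEl_cartan, tK_Y, sub_self]
  · rw [IsRep, S.kEl_lie_gEl, map_zero, rep_kEl, W.rep_gEl_x Φ hk, tK_X, sub_self]
  · rw [IsRep, S.kEl_lie_kEl, map_zero, rep_kEl, rep_kEl, tK_tK, sub_self]

lemma isRep_dEl (i : Fin (S.N + 1)) (z : S.L) : W.IsRep Φ (S.dEl i) z := by
  refine W.isRep_of_gen Φ (fun h n s => ?_) (fun β n s => ?_)
    (fun j s q => W.isRep_dEl_kEl Φ i j s q) (fun j => ?_) z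
  · rw [IsRep, S.dEl_lie_gEl, map_smul, rep_gEl_cartan]
    refine Fin.cases ?_ (fun i => ?_) i
    · rw [rep_dEl_zero, lie_td_Y]; rfl
    · rw [rep_dEl_succ, W.lie_tL_Y Φ (W.d_H _) fun p => W.d_succ_K i 0 s p]; rfl
  · rw [IsRep, S.dEl_lie_gEl, map_smul, W.rep_gEl_x Φ hk]
    refine Fin.cases ?_ (fun i => ?_) i
    · rw [rep_dEl_zero, lie_td_X]; rfl
    · rw [rep_dEl_succ, W.lie_tL_X Φ fun n => W.d_succ_Z i β s n]; rfl
  · rw [IsRep, S.dEl_lie_dEl, map_zero]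
    have h0 : W.tL M (0 : Module.End ℂ W.carrier) = 0 := LinearMap.lTensor_zero _
    have h1 : ∀ i, W.td Φ * W.tL M (W.d i) - W.tL M (W.d i) * W.td Φ = 0 := fun i => by
      rw [lie_td_tL, W.d_d, sub_self, h0]
    refine Fin.cases ?_ (fun i => ?_) i
    · refine Fin.cases (sub_self _).symm (fun j => ?_) j
      rw [rep_dEl_zero, rep_dEl_succ, h1]
    · refine Fin.cases ?_ (fun j => ?_) j
      · rw [rep_dEl_zero, rep_dEl_succ, ← neg_sub, h1, neg_zero]
      · rw [rep_dEl_succ, rep_dEl_succ, lie_tL_tL, W.d_d, sub_self, h0]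

lemma isRep_cartan (h : S.𝔥) (n : ℤ) (r : Fin S.N → ℤ) (z : S.L) :
    W.IsRep Φ (S.gEl h n r) z := by
  refine W.isRep_of_gen Φ (fun h' n' s => ?_) (fun β n' s => ?_)
    (fun j s q => (W.isRep_kEl Φ hk j s q _).symm) (fun j => (W.isRep_dEl Φ hk j _).symm) z
  · rw [IsRep, S.gEl_lie_gEl, S.lie_cartan (S.proj_mem n h.2) h'.2, rep_gEl_cartan, rep_gEl_cartan,
      W.lie_Y_Y Φ hk, map_add, map_smul, rep_cEl]
    have : S.gEl (0 : 𝔤) (n + n') (r + s) = 0 := (S.gElₗ _ _).map_zero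
    rw [this, map_zero, zero_add]
  · rw [IsRep, S.gEl_cartan_lie_x, map_smul, W.rep_gEl_x Φ hk, W.rep_gEl_x Φ hk, rep_gEl_cartan,
      W.lie_Y_X Φ hk]

omit hk in
/-- The defect of the representation property. -/
lemma lie_rep_defect {g : S.L} (hg : ∀ z, W.IsRep Φ g z) (y z : S.L) :
    let Δ : S.L → S.L → Module.End ℂ (M ⊗[ℂ] W.carrier) := fun y z =>
      W.rep Φ ⁅y, z⁆ - (W.rep Φ y * W.rep Φ z - W.rep Φ z * W.rep Φ y)
    W.rep Φ g * Δ y z - Δ y z * W.rep Φ g = Δ ⁅g, y⁆ z + Δ y ⁅g, z⁆ := by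
  intro Δ
  -- The Jacobi identity in `L̃(𝔤, θ)`, together with the derivation property of commutators of
  -- operators, shows that bracketing with `g` acts on the defect by derivations in both arguments.
  have h1 := hg ⁅y, z⁆
  rw [IsRep, leibniz_lie, map_add] at h1
  have h2 : W.rep Φ ⁅g, y⁆ = _ := hg y
  have h3 : W.rep Φ ⁅g, z⁆ = _ := hg z
  have h4 : W.rep Φ ⁅⁅g, y⁆, z⁆ = W.rep Φ g * W.rep Φ ⁅y, z⁆ - W.rep Φ ⁅y, z⁆ * W.rep Φ g -
      W.rep Φ ⁅y, ⁅g, z⁆⁆ := eq_sub_of_add_eq h1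
  simp only [Δ, h4, h2, h3, mul_sub, sub_mul, mul_assoc]
  abel

/-- The defects of all pairs of root vectors form a family stable under commutators with the
oscillators. Their expectation values vanish exactly by the generalised commutation relation of `W`,
so the defects vanish. -/
lemma isRep_x_x (β γ : S.Root) (a b : ℤ) (r s : Fin S.N → ℤ) :
    W.IsRep Φ (S.gEl (S.x β) a r) (S.gEl (S.x γ) b s) := by
  let Δ : S.L → S.L → Module.End ℂ (M ⊗[ℂ] W.carrier) := fun y z =>
    W.rep Φ ⁅y, z⁆ - (W.rep Φ y * W.rep Φ z - W.rep Φ z * W.rep Φ y)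
  have hΔl : ∀ (c : ℂ) y z, Δ (c • y) z = c • Δ y z := fun c y z => by
    simp only [Δ, smul_lie, map_smul, smul_mul_assoc, mul_smul_comm, smul_sub]
  have hΔr : ∀ (c : ℂ) y z, Δ y (c • z) = c • Δ y z := fun c y z => by
    simp only [Δ, lie_smul, map_smul, smul_mul_assoc, mul_smul_comm, smul_sub]
  -- A commutator with an oscillator shifts `a` in one summand and `b` in the other, so stability
  -- requires the set of all defects of total degree `n` rather than one operator per degree.
  let P : ℤ → Set (Module.End ℂ (M ⊗[ℂ] W.carrier)) := fun n =>
    {Y | ∃ (β γ : S.Root) (a b : ℤ) (r s : Fin S.N → ℤ), a + b = n ∧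
      Y = Δ (S.gEl (S.x β) a r) (S.gEl (S.x γ) b s)}
  refine sub_eq_zero.mp (W.operators_eq_zero Φ hk P ?_ ?_ ?_ (a + b) _ ⟨β, γ, a, b, r, s, rfl, rfl⟩)
  · rintro n _ ⟨β, γ, a, b, r, s, rfl, rfl⟩ i _ h
    rw [← W.Y_zero Φ hk, ← rep_gEl_cartan, W.lie_rep_defect Φ (W.isRep_cartan Φ hk h i 0),
      S.gEl_cartan_lie_x, S.gEl_cartan_lie_x]
    refine add_mem ?_ ?_
    · exact (congrArg (· ∈ Submodule.span ℂ (P _)) (hΔl _ _ _)).mpr (Submodule.smul_mem _ _ (Submodule.subset_span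
        ⟨β, γ, i + a, b, 0 + r, s, by ring, rfl⟩))
    · exact (congrArg (· ∈ Submodule.span ℂ (P _)) (hΔr _ _ _)).mpr (Submodule.smul_mem _ _ (Submodule.subset_span
        ⟨β, γ, a, i + b, r, 0 + s, by ring, rfl⟩))
  · rintro n _ ⟨β, γ, a, b, r, s, rfl, rfl⟩
    rw [← rep_dEl_zero, W.lie_rep_defect Φ (W.isRep_dEl Φ hk 0), S.dEl_lie_gEl, S.dEl_lie_gEl]
    refine (congrArg₂ (· + ·) (hΔl _ _ _) (hΔr _ _ _)).trans ?_
    rw [← add_smul]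
    congr 1
    push_cast; rfl
  · rintro n _ ⟨β, γ, a, b, r, s, rfl, rfl⟩
    refine LinearMap.ext fun v => ?_
    have h1 := HeisVac.vev_lie_x (H := W.tH Φ hk) (W.rep Φ) W.Z W.K W.H
      (fun β r n => by rw [W.rep_gEl_x Φ hk, vev_X])
      (fun i r p => by rw [rep_kEl, tK, vev_tL])
      (fun h r n => by rw [rep_gEl_cartan, vev_Y]) β γ r s a b v
    have h2 := W.comm β γ r s a b v
    have h3 : ∀ (β γ : S.Root) (r s : Fin S.N → ℤ) (a b : ℤ),
        (W.tH Φ hk).vev (W.X Φ β r a * W.X Φ γ s b) v =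
          ∑ᶠ n : ℕ, S.prodCoeff k β γ n • W.Z β r (a - n) (W.Z γ s (b + n) v) := by
      intro β γ r s a b
      refine (HeisVac.ε_X_X (W.X_isVertex Φ hk β r) (W.X_isVertex Φ hk γ s) hk a b v).trans ?_
      refine finsum_congr fun n => ?_
      rw [← W.vev_X Φ hk β, ← W.vev_X Φ hk γ]
      rfl
    -- `h1` evaluates the bracket, `h3` the two products; that they agree is `h2`, the relation
    -- `comm` of `W`.
    rw [map_sub, map_sub, LinearMap.sub_apply, h1, LinearMap.sub_apply, W.rep_gEl_x Φ hk,
      W.rep_gEl_x Φ hk, h3, h3, h2, sub_self]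
    rfl

lemma isRep (y z : S.L) : W.IsRep Φ y z := by
  have hx : ∀ (β : S.Root) n r, W.IsRep Φ y (S.gEl (S.x β) n r) := fun β n r =>
    (W.isRep_of_gen Φ (y := S.gEl (S.x β) n r) (fun h n' s => (W.isRep_cartan Φ hk h n' s _).symm)
      (fun γ n' s => W.isRep_x_x Φ hk β γ n n' r s)
      (fun j s q => (W.isRep_kEl Φ hk j s q _).symm) (fun j => (W.isRep_dEl Φ hk j _).symm) y).symm
  exact W.isRep_of_gen Φ (fun h n s => (W.isRep_cartan Φ hk h n s _).symm) hx
    (fun j s q => (W.isRep_kEl Φ hk j s q _).symm) (fun j => (W.isRep_dEl Φ hk j _).symm) z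

lemma rep_gEl_kEl_locFin (x : 𝔤) (r s : Fin S.N → ℤ) (n : ℤ) :
    LocFin fun p : ℤ => W.rep Φ (S.gEl x (n - S.m * p) r) * W.tK M 0 s p := by
  refine locFin_mul_of_degree S.m_pos (W.td_graded Φ) n (fun p => ?_)
    (fun _ => W.lie_td_tK Φ 0 s _) fun p => ?_
  · have h := W.isRep Φ hk (S.dEl 0) (S.gEl x (n - S.m * p) r)
    rw [IsRep, S.dEl_lie_gEl, map_smul, rep_dEl_zero] at h
    exact h.symm
  · have h := W.isRep Φ hk (S.gEl x (n - S.m * p) r) (S.kEl 0 s p)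
    rw [IsRep, S.gEl_lie_kEl, map_zero, rep_kEl] at h
    exact (sub_eq_zero.mp h.symm)

lemma factor_rep (x : 𝔤) (r s : Fin S.N → ℤ) (n : ℤ) (v : M ⊗[ℂ] W.carrier) :
    k⁻¹ • ∑ᶠ p : ℤ, W.rep Φ (S.gEl x (n - S.m * p) r) (W.rep Φ (S.kEl 0 s p) v) =
      W.rep Φ (S.gEl x n (r + s)) v := by
  simp only [rep_kEl]
  have hfin : ∀ x, (fun p : ℤ => W.rep Φ (S.gEl x (n - S.m * p) r)
      (W.tK M 0 s p v)).HasFiniteSupport := fun x => W.rep_gEl_kEl_locFin Φ hk x r s n v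
  refine S.root_induction (P := fun x => k⁻¹ • ∑ᶠ p : ℤ, W.rep Φ (S.gEl x (n - S.m * p) r)
    (W.tK M 0 s p v) = W.rep Φ (S.gEl x n (r + s)) v) (fun x y hx hy => ?_) (fun c x hx => ?_)
    (fun h => ?_) (fun β => ?_) x
  · simp only [Data.gEl_add, map_add, LinearMap.add_apply]
    rw [finsum_add_distrib (hfin x) (hfin y), smul_add, hx, hy]
  · simp only [Data.gEl_smul, map_smul, LinearMap.smul_apply]
    rw [← smul_finsum' c (hfin x), smul_comm, hx]
  · simp only [rep_gEl_cartan]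
    rw [← W.factor_Y Φ hk]; rfl
  · simp only [W.rep_gEl_x Φ hk]
    rw [← W.factor_X Φ hk]; rfl

end Rep

/-! ### The induced module as a functor. -/

section Functor

variable [FiniteDimensional ℂ 𝔤] [LieAlgebra.IsSemisimple ℂ 𝔤] {M : Type u} [AddCommGroup M]
  [Module ℂ M] (Φ : VermaLike S k M) (hk : k ≠ 0)

/-- The module `M ⊗ W` of the twisted toroidal algebra. -/
def indObj (W : ModD.{u, max u w} S k) : ModC.{u, max u w} S k :=
  let i₁ : LieRingModule S.L (M ⊗[ℂ] W.carrier) :=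
    { bracket := fun y v => W.rep Φ y v
      add_lie := fun y z v => by
        change W.rep Φ (y + z) v = _
        rw [map_add]; rfl
      lie_add := fun y v v' => (W.rep Φ y).map_add v v'
      leibniz_lie := fun y z v => by
        have h := LinearMap.congr_fun (W.isRep Φ hk y z) v
        change W.rep Φ y (W.rep Φ z v) = W.rep Φ ⁅y, z⁆ v + W.rep Φ z (W.rep Φ y v)
        rw [h]
        exact (sub_add_cancel _ _).symm }
  let i₂ : LieModule ℂ S.L (M ⊗[ℂ] W.carrier) :=
    { smul_lie := fun c y v => by
        change W.rep Φ (c • y) v = _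
        rw [map_smul]; rfl
      lie_smul := fun c y v => (W.rep Φ y).map_smul c v }
  { carrier := M ⊗[ℂ] W.carrier
    lieRingModule := i₁
    lieModule := i₂
    level := fun v => by
      change W.rep Φ (S.kEl 0 0 0) v = _
      rw [rep_kEl, tK_zero_zero, if_pos rfl]; rfl
    graded := by
      have : LieModule.toEnd ℂ S.L (M ⊗[ℂ] W.carrier) (S.dEl 0) = W.td Φ := W.rep_dEl_zero Φ
      rw [this]
      exact W.td_graded Φ
    factor_x := W.factor_rep Φ hk
    factor_k := fun i r s n v => by
      change k⁻¹ • ∑ᶠ p : ℤ, W.rep Φ (S.kEl i r (n - p)) (W.rep Φ (S.kEl 0 s p) v) =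
        W.rep Φ (S.kEl i (r + s) n) v
      simp only [rep_kEl]
      rw [add_comm r s, ← W.factor_tK]; rfl }

variable {W W' : ModD.{u, max u w} S k} (g : W ⟶ W')

/-- The linear map `id ⊗ g`. -/
def indLin (M : Type u) [AddCommGroup M] [Module ℂ M] :
    M ⊗[ℂ] W.carrier →ₗ[ℂ] M ⊗[ℂ] W'.carrier := LinearMap.lTensor M (lin g)

lemma indLin_tL {Y : Module.End ℂ W.carrier} {Y' : Module.End ℂ W'.carrier}
    (h : ∀ v, lin g (Y v) = Y' (lin g v)) (v : M ⊗[ℂ] W.carrier) :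
    indLin g M (W.tL M Y v) = W'.tL M Y' (indLin g M v) := by
  refine LinearMap.congr_fun (f := indLin g M ∘ₗ W.tL M Y) (g := W'.tL M Y' ∘ₗ indLin g M) ?_ v
  exact TensorProduct.ext' fun u w => congrArg (u ⊗ₜ[ℂ] ·) (h w)

lemma indLin_ta (i : ℤ) (h : S.𝔥) (v : M ⊗[ℂ] W.carrier) :
    indLin g M (W.ta Φ i h v) = W'.ta Φ i h (indLin g M v) := by
  by_cases hi : i = 0
  · subst hi
    rw [ta, ta, tA_zero, tA_zero]
    exact indLin_tL g (Hom.map_H g _) v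
  · rw [ta, ta, tA_of_ne Φ hi, tA_of_ne Φ hi]
    refine LinearMap.congr_fun (f := indLin g M ∘ₗ LinearMap.rTensor _ (Φ.A i h))
      (g := LinearMap.rTensor _ (Φ.A i h) ∘ₗ indLin g M) ?_ v
    exact TensorProduct.ext' fun u w => rfl

lemma indLin_X (β : S.Root) (r : Fin S.N → ℤ) (n : ℤ) (v : M ⊗[ℂ] W.carrier) :
    indLin g M (W.X Φ β r n v) = W'.X Φ β r n (indLin g M v) := by
  rw [X, X, locSum_apply, locSum_apply, linear_finsum _ (W.xTerm_locFin Φ β r n v)]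
  refine finsum_congr fun ab => ?_
  refine LinearMap.congr_fun (f := indLin g M ∘ₗ W.xTerm Φ β r n ab)
    (g := W'.xTerm Φ β r n ab ∘ₗ indLin g M) ?_ v
  refine TensorProduct.ext' fun u w => ?_
  rw [LinearMap.comp_apply, LinearMap.comp_apply, xTerm_tmul]
  refine Eq.trans ?_ (W'.xTerm_tmul Φ β r n ab u (lin g w)).symm
  exact congrArg (_ ⊗ₜ[ℂ] ·) (Hom.map_Z g β r _ w)

include hk in
lemma indLin_rep (y : S.L) (v : M ⊗[ℂ] W.carrier) :
    indLin g M (W.rep Φ y v) = W'.rep Φ y (indLin g M v) := by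
  refine S.L_root_induction (P := fun y => ∀ v, indLin g M (W.rep Φ y v) =
    W'.rep Φ y (indLin g M v)) (fun y z hy hz v => ?_) (fun c y hy v => ?_) (fun h n r v => ?_)
    (fun β n r v => ?_) (fun i r p v => ?_) (fun i v => ?_) y v
  · simp only [map_add, LinearMap.add_apply, hy, hz]
  · simp only [map_smul, LinearMap.smul_apply, hy]
  · rw [rep_gEl_cartan, rep_gEl_cartan, Y_apply, Y_apply, LinearMap.smul_apply,
      LinearMap.smul_apply, map_smul, locSum_apply, locSum_apply,
      linear_finsum _ (W.ta_tK_locFin Φ h r n v)]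
    congr 1
    refine finsum_congr fun p => ?_
    rw [Module.End.mul_apply, indLin_ta, Module.End.mul_apply, tK, tK,
      indLin_tL g (Hom.map_K g 0 r p)]
  · rw [W.rep_gEl_x Φ hk, W'.rep_gEl_x Φ hk, indLin_X]
  · rw [rep_kEl, rep_kEl, tK, tK, indLin_tL g (Hom.map_K g i r p)]
  · refine Fin.cases ?_ (fun i => ?_) i
    · rw [rep_dEl_zero, rep_dEl_zero, td, td, tD, tD, LinearMap.add_apply, LinearMap.add_apply,
        map_add]
      congr 1
      · refine LinearMap.congr_fun (f := indLin g M ∘ₗ LinearMap.rTensor _ Φ.D)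
          (g := LinearMap.rTensor _ Φ.D ∘ₗ indLin g M) ?_ v
        exact TensorProduct.ext' fun u w => rfl
      · exact indLin_tL g (Hom.map_d g 0) v
    · rw [rep_dEl_succ, rep_dEl_succ, indLin_tL g (Hom.map_d g i.succ)]

/-- The functor `W ↦ M ⊗ W`. -/
def indFunctor : ModD.{u, max u w} S k ⥤ ModC.{u, max u w} S k where
  obj W := W.indObj Φ hk
  map {W W'} g :=
    ({ indLin g M with map_lie' := fun {y v} => indLin_rep Φ hk g y v } :
      (W.indObj Φ hk).carrier →ₗ⁅ℂ, S.L⁆ (W'.indObj Φ hk).carrier)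
  map_id W := LieModuleHom.ext fun v =>
    LinearMap.congr_fun (LinearMap.lTensor_id M W.carrier) v
  map_comp {W W' W''} g g' := LieModuleHom.ext fun v =>
    LinearMap.congr_fun (LinearMap.lTensor_comp M (lin g') (lin g)) v

end Functor

lemma isInductionFunctor [FiniteDimensional ℂ 𝔤] [LieAlgebra.IsSemisimple ℂ 𝔤] (hk : k ≠ 0) :
    IsInductionFunctor (indFunctor (S.vermaLike k) hk :
      ModD.{u, max u w} S k ⥤ ModC.{u, max u w} S k) := by
  refine ⟨fun W => LinearEquiv.refl ℂ _, ?_, ?_, ?_, ?_, ?_, ?_⟩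
  · intro W β r n u v
    change W.rep (S.vermaLike k) (S.gEl (S.x β) n r) (u ⊗ₜ v) = _
    rw [W.rep_gEl_x _ hk, X, locSum_apply]
    exact finsum_congr fun ab => W.xTerm_tmul (S.vermaLike k) β r n ab u v
  · intro W h r n u v
    change W.rep (S.vermaLike k) (S.gEl h n r) (u ⊗ₜ v) = _
    rw [rep_gEl_cartan, Y_apply, LinearMap.smul_apply, locSum_apply]
    refine congrArg (k⁻¹ • ·) (finsum_congr fun p => ?_)
    by_cases hp : n - S.m * p = 0
    · rw [if_pos hp, hp, ta, tA_zero]; rfl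
    · rw [if_neg hp, ta, tA_of_ne _ hp]; rfl
  · intro W i r p u v
    change W.rep (S.vermaLike k) (S.kEl i r p) (u ⊗ₜ v) = _
    rw [rep_kEl]; rfl
  · intro W u v
    change W.rep (S.vermaLike k) (S.dEl 0) (u ⊗ₜ v) = _
    rw [rep_dEl_zero]; rfl
  · intro W i u v
    change W.rep (S.vermaLike k) (S.dEl i.succ) (u ⊗ₜ v) = _
    rw [rep_dEl_succ]; rfl
  · intro W W' g u v
    rfl

end ModD

end

section

/-! ### The equivalence -/

variable {𝔤 : Type u} [LieRing 𝔤] [LieAlgebra ℂ 𝔤] {S : Data 𝔤} {k : ℂ}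
  [FiniteDimensional ℂ 𝔤] [LieAlgebra.IsSemisimple ℂ 𝔤] (hk : k ≠ 0)

namespace ModD

variable (W : ModD.{u, w} S k) {M : Type*} [AddCommGroup M] [Module ℂ M] (Φ : VermaLike S k M)

include hk in
lemma rep_gEl_zero (i : ℤ) (h : S.𝔥) : W.rep Φ (S.gEl h i 0) = W.ta Φ i h := by
  rw [rep_gEl_cartan, W.Y_zero Φ hk]

omit hk in
lemma td_tι (w : W.carrier) : W.td Φ (tι Φ w) = tι Φ (W.d 0 w) := by
  rw [td, tD, tι_apply, LinearMap.add_apply, LinearMap.rTensor_tmul, Φ.D_one,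
    TensorProduct.zero_tmul, zero_add]
  rfl

lemma vev_td : (W.tH Φ hk).vev (W.td Φ) = W.d 0 := by
  refine LinearMap.ext fun w => ?_
  rw [HeisVac.vev_apply]
  exact (congrArg (tε Φ) (W.td_tι Φ w)).trans ((W.tH Φ hk).ε_ι _)

/-- The vacuum expectation values of `rep` on the generators determine those of any other
representation. -/
lemma vev_rep_eq (ρ : S.L →ₗ[ℂ] Module.End ℂ W.carrier)
    (hZ : ∀ (β : S.Root) n r, ρ (S.gEl (S.x β) n r) = W.Z β r n)
    (hH : ∀ (h : S.𝔥) n r, ρ (S.gEl h n r) =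
      if (S.m : ℤ) ∣ n then k⁻¹ • (W.H (S.proj₀ h) * W.K 0 r (n / S.m)) else 0)
    (hK : ∀ i r p, ρ (S.kEl i r p) = W.K i r p) (hd : ∀ i, ρ (S.dEl i) = W.d i) (y : S.L) :
    (W.tH Φ hk).vev (W.rep Φ y) = ρ y := by
  refine S.L_root_induction (P := fun y => (W.tH Φ hk).vev (W.rep Φ y) = ρ y)
    (fun y z hy hz => ?_) (fun c y hy => ?_) (fun h n r => ?_)
    (fun β n r => ?_) (fun i r p => ?_) (fun i => ?_) y
  · rw [map_add, map_add, hy, hz, map_add]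
  · rw [map_smul, map_smul, hy, map_smul]
  · rw [rep_gEl_cartan, vev_Y, hH]
  · rw [W.rep_gEl_x Φ hk, vev_X, hZ]
  · rw [rep_kEl, tK, vev_tL, hK]
  · rw [hd]
    refine Fin.cases ?_ (fun i => ?_) i
    · rw [rep_dEl_zero, vev_td]
    · rw [rep_dEl_succ, vev_tL]

end ModD

namespace ModC

variable (V : ModC.{u, w} S k) {M : Type*} [AddCommGroup M] [Module ℂ M] (Φ : VermaLike S k M)

lemma vev_rep (y : S.L) :
    ((V.vacObj hk).tH Φ hk).vev ((V.vacObj hk).rep Φ y) = V.vop hk y :=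
  (V.vacObj hk).vev_rep_eq hk Φ (V.vopₗ hk) (fun _ _ _ => rfl)
    (fun h n r => V.vop_gEl_cartan hk h r n) (fun _ _ _ => rfl) (fun _ => rfl) y

variable (Ψ : M ⊗[ℂ] V.vacuum ≃ₗ[ℂ] V.carrier) (hι : ∀ w : V.vacuum, Ψ (tι Φ w) = w)
  (ha : ∀ i, i ≠ 0 → ∀ h v, Ψ ((V.vacObj hk).ta Φ i h v) = V.act (S.gEl h i 0) (Ψ v))
  (hD : ∀ v, Ψ ((V.vacObj hk).td Φ v) = V.act (S.dEl 0) (Ψ v))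

include hι ha

lemma ε_equiv (u : M ⊗[ℂ] V.vacuum) : (V.heisVac hk).ε (Ψ u) = tε Φ u := by
  refine ((V.vacObj hk).tH Φ hk).gen
    (LinearMap.eqLocus ((V.heisVac hk).ε ∘ₗ Ψ.toLinearMap) (tε Φ)) (fun w => ?_)
    (fun i hi h v _ => ?_) u
  · exact (congrArg (V.heisVac hk).ε (hι w)).trans (((V.heisVac hk).ε_ι w).trans
      (((V.vacObj hk).tH Φ hk).ε_ι w).symm)
  · exact (congrArg (V.heisVac hk).ε (ha i hi.ne h v)).trans (((V.heisVac hk).ε_a i hi h _).trans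
      (((V.vacObj hk).tH Φ hk).ε_a i hi h v).symm)

include hD

/-- An isomorphism of graded Heisenberg modules extending the inclusion of the vacuum space is
an isomorphism of `L̃(𝔤, θ)`-modules. -/
lemma equiv_rep (y : S.L) (v : M ⊗[ℂ] V.vacuum) :
    Ψ ((V.vacObj hk).rep Φ y v) = V.act y (Ψ v) := by
  set W := V.vacObj hk
  let c : Module.End ℂ V.carrier ≃ₐ[ℂ] Module.End ℂ (M ⊗[ℂ] W.carrier) := Ψ.symm.conjAlgEquiv ℂ
  have hc : ∀ Y u, c Y u = Ψ.symm (Y (Ψ u)) := fun Y u => rfl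
  -- `Δ` compares the action of `V`, transported along `Ψ`, with the induced action on `M ⊗ Ω_V`. It
  -- vanishes on the oscillators and on `d_0` by hypothesis.
  let Δ : S.L →ₗ[ℂ] Module.End ℂ (M ⊗[ℂ] W.carrier) := c.toLinearMap ∘ₗ V.actₗ - W.rep Φ
  have hΔ : ∀ y, Δ y = c (V.act y) - W.rep Φ y := fun y => rfl
  have hg : ∀ g, Δ g = 0 → ∀ y, W.rep Φ g * Δ y - Δ y * W.rep Φ g = Δ ⁅g, y⁆ := by
    intro g h0 y
    have h1 : c (V.act g) = W.rep Φ g := sub_eq_zero.mp h0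
    have h2 : W.rep Φ ⁅g, y⁆ = _ := W.isRep Φ hk g y
    rw [hΔ, hΔ, h2, act_lie, map_sub, map_mul, map_mul, h1, mul_sub, sub_mul]
    abel
  have ha' : ∀ i, i ≠ 0 → ∀ h : S.𝔥, Δ (S.gEl h i 0) = 0 := by
    intro i hi h
    rw [hΔ, W.rep_gEl_zero hk]
    refine sub_eq_zero.mpr (LinearMap.ext fun u => ?_)
    rw [hc, ← ha i hi h u]
    exact Ψ.symm_apply_apply _
  have hd' : Δ (S.dEl 0) = 0 := by
    rw [hΔ, ModD.rep_dEl_zero]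
    refine sub_eq_zero.mpr (LinearMap.ext fun u => ?_)
    rw [hc, ← hD u]
    exact Ψ.symm_apply_apply _
  -- Since `[g, Δ y] = Δ [g, y]` whenever `Δ g = 0`, the values of `Δ` on elements of degree `n`
  -- form a family stable under the oscillators. Their expectation values vanish because both
  -- actions induce the same operators on the vacuum.
  let P : ℤ → Set (Module.End ℂ (M ⊗[ℂ] W.carrier)) := fun n =>
    {Y | ∃ y : S.L, ⁅S.dEl 0, y⁆ = (n : ℂ) • y ∧ Y = Δ y}
  have key : ∀ n y, ⁅S.dEl 0, y⁆ = ((n : ℤ) : ℂ) • y → Δ y = 0 := by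
    intro n y hy
    refine W.operators_eq_zero Φ hk P ?_ ?_ ?_ n _ ⟨y, hy, rfl⟩
    · rintro n _ ⟨y, hy, rfl⟩ i hi h
      refine Submodule.subset_span ⟨⁅S.gEl h i 0, y⁆, ?_, ?_⟩
      · rw [leibniz_lie, S.dEl_lie_gEl, hy, smul_lie, lie_smul, ← add_smul]
        congr 1
        change ((i : ℤ) : ℂ) + n = _
        push_cast; ring
      · rw [← W.rep_gEl_zero hk, hg _ (ha' i hi h)]
    · rintro n _ ⟨y, hy, rfl⟩
      rw [← W.rep_dEl_zero, hg _ hd', hy, map_smul]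
    · rintro n _ ⟨y, hy, rfl⟩
      have hvr : (W.tH Φ hk).vev (W.rep Φ y) = V.vop hk y := V.vev_rep hk Φ y
      rw [hΔ, map_sub, hvr]
      refine sub_eq_zero.mpr (LinearMap.ext fun u => ?_)
      have h1 : Ψ (tι Φ u) = (u : V.vacuum).1 := hι u
      have h2 := V.ε_equiv hk Φ Ψ hι ha (Ψ.symm (V.act y (u : V.vacuum).1))
      rw [LinearEquiv.apply_symm_apply] at h2
      exact (congrArg (fun x => tε Φ (Ψ.symm (V.act y x))) h1).trans h2.symm
  have h0 : Δ y = 0 := S.L_root_induction (P := fun y => Δ y = 0)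
    (fun y z hy hz => by rw [map_add, hy, hz, add_zero])
    (fun c y hy => by rw [map_smul, hy, smul_zero])
    (fun h n r => key _ _ (S.dEl_lie_gEl 0 _ n r)) (fun β n r => key _ _ (S.dEl_lie_gEl 0 _ n r))
    (fun i r p => key _ _ (S.dEl_lie_kEl 0 i r p))
    (fun i => key 0 _ (by rw [S.dEl_lie_dEl, Int.cast_zero, zero_smul])) y
  have h1 := LinearMap.congr_fun (sub_eq_zero.mp h0) v
  rw [← h1]
  exact Ψ.apply_symm_apply _

end ModC

end

/-! ### The natural isomorphisms of the equivalence. -/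

section

variable {𝔤 : Type u} [LieRing 𝔤] [LieAlgebra ℂ 𝔤] {S : Data 𝔤} {k : ℂ}

/-- A linear equivalence commuting with all the operators is an isomorphism in `D_k`. -/
def ModD.isoOfEquiv {W W' : ModD.{u, w} S k} (e : W.carrier ≃ₗ[ℂ] W'.carrier)
    (hZ : ∀ β r n v, e (W.Z β r n v) = W'.Z β r n (e v))
    (hK : ∀ i r p v, e (W.K i r p v) = W'.K i r p (e v))
    (hH : ∀ α v, e (W.H α v) = W'.H α (e v)) (hd : ∀ i v, e (W.d i v) = W'.d i (e v)) : W ≅ W' where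
  hom := ({ lin := e, map_Z := hZ, map_K := hK, map_H := hH, map_d := hd } : ModD.Hom W W')
  inv := ({ lin := e.symm
            map_Z := fun β r n v => by
              rw [LinearEquiv.coe_coe, LinearEquiv.symm_apply_eq, hZ, LinearEquiv.apply_symm_apply]
            map_K := fun i r p v => by
              rw [LinearEquiv.coe_coe, LinearEquiv.symm_apply_eq, hK, LinearEquiv.apply_symm_apply]
            map_H := fun α v => by
              rw [LinearEquiv.coe_coe, LinearEquiv.symm_apply_eq, hH, LinearEquiv.apply_symm_apply]
            map_d := fun i v => by
              rw [LinearEquiv.coe_coe, LinearEquiv.symm_apply_eq, hd,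
                LinearEquiv.apply_symm_apply] } : ModD.Hom W' W)
  hom_inv_id := ModD.Hom.ext (LinearMap.ext fun v => e.symm_apply_apply v)
  inv_hom_id := ModD.Hom.ext (LinearMap.ext fun v => e.apply_symm_apply v)

/-- A linear equivalence commuting with the action is an isomorphism in `C_k`. -/
def ModC.isoOfEquiv {V V' : ModC.{u, w} S k} (e : V.carrier ≃ₗ[ℂ] V'.carrier)
    (he : ∀ y v, e (V.act y v) = V'.act y (e v)) : V ≅ V' where
  hom := ({ (e : V.carrier →ₗ[ℂ] V'.carrier) with map_lie' := fun {y v} => he y v } :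
    V.carrier →ₗ⁅ℂ, S.L⁆ V'.carrier)
  inv := ({ (e.symm : V'.carrier →ₗ[ℂ] V.carrier) with
      map_lie' := fun {y v} => by
        have h := he y (e.symm v)
        rw [LinearEquiv.apply_symm_apply] at h
        exact (LinearEquiv.symm_apply_eq e).mpr h.symm } :
    V'.carrier →ₗ⁅ℂ, S.L⁆ V.carrier)
  hom_inv_id := LieModuleHom.ext fun v => e.symm_apply_apply v
  inv_hom_id := LieModuleHom.ext fun v => e.apply_symm_apply v

variable [FiniteDimensional ℂ 𝔤] [LieAlgebra.IsSemisimple ℂ 𝔤] (hk : k ≠ 0)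

namespace ModC

section

variable (V : ModC.{u, w} S k) {M : Type*} [AddCommGroup M] [Module ℂ M] (Φ : VermaLike S k M)
  (hΦ : Φ.HasLift (V.vacuum →ₗ[ℂ] V.carrier))

/-- The isomorphism `M ⊗ Ω_V ≃ V`. -/
def vacEquiv : M ⊗[ℂ] V.vacuum ≃ₗ[ℂ] V.carrier := V.heisGr.Ψ Φ hk hΦ

lemma vacEquiv_tι (w : V.vacuum) : V.vacEquiv hk Φ hΦ (tι Φ w) = w := V.heisGr.Ψ_tι Φ hk hΦ w

lemma vacEquiv_ta (i : ℤ) (hi : i ≠ 0) (h : S.𝔥) (v : M ⊗[ℂ] V.vacuum) :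
    V.vacEquiv hk Φ hΦ ((V.vacObj hk).ta Φ i h v) =
      V.act (S.gEl h i 0) (V.vacEquiv hk Φ hΦ v) := V.heisGr.Ψ_tA Φ hk hΦ hi _ h v

lemma vop_dEl_zero : V.vop hk (S.dEl 0) = V.heisGr.Dvac :=
  LinearMap.ext fun w => Subtype.ext (coe_vop (V.compat_dEl hk 0) w)

lemma vacEquiv_td (v : M ⊗[ℂ] V.vacuum) : V.vacEquiv hk Φ hΦ ((V.vacObj hk).td Φ v) =
    V.act (S.dEl 0) (V.vacEquiv hk Φ hΦ v) := by
  have h : (V.vacObj hk).td Φ = tD Φ V.heisGr.Dvac := congrArg (tD Φ) (V.vop_dEl_zero hk)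
  rw [h]
  exact V.heisGr.Ψ_tD Φ hk hΦ v

end

section Unit

variable {M : Type u} [AddCommGroup M] [Module ℂ M] (Φ : VermaLike S k M)

/-- The isomorphism `M ⊗ Ω_V ≅ V` in `C_k`. -/
def vacIso (V : ModC.{u, max u w} S k) (hΦ : Φ.HasLift (V.vacuum →ₗ[ℂ] V.carrier)) :
    (V.vacObj hk).indObj Φ hk ≅ V :=
  isoOfEquiv (V := (V.vacObj hk).indObj Φ hk) (V.vacEquiv hk Φ hΦ)
    (V.equiv_rep hk Φ _ (V.vacEquiv_tι hk Φ hΦ) (V.vacEquiv_ta hk Φ hΦ) (V.vacEquiv_td hk Φ hΦ))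

lemma vacEquiv_natural {V V' : ModC.{u, max u w} S k} (f : V ⟶ V')
    (hΦ : Φ.HasLift (V.vacuum →ₗ[ℂ] V.carrier)) (hΦ' : Φ.HasLift (V'.vacuum →ₗ[ℂ] V'.carrier))
    (v : M ⊗[ℂ] V.vacuum) :
    V'.vacEquiv hk Φ hΦ' (ModD.indLin ((vacFunctor hk).map f) M v) =
      lin f (V.vacEquiv hk Φ hΦ v) := by
  refine ((V.vacObj hk).tH Φ hk).gen
    (LinearMap.eqLocus ((V'.vacEquiv hk Φ hΦ').toLinearMap ∘ₗ
      ModD.indLin ((vacFunctor hk).map f) M)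
      (lin f ∘ₗ (V.vacEquiv hk Φ hΦ).toLinearMap)) (fun w => ?_)
    (fun i hi h v hv => ?_) v
  · refine Eq.trans (V'.vacEquiv_tι hk Φ hΦ' (vacLin f w)) ?_
    exact (congrArg (lin f) (V.vacEquiv_tι hk Φ hΦ w)).symm
  · have h1 : V'.vacEquiv hk Φ hΦ' (ModD.indLin ((vacFunctor hk).map f) M v) =
      lin f (V.vacEquiv hk Φ hΦ v) := hv
    have h2 := ModD.indLin_ta Φ ((vacFunctor hk).map f) i h v
    refine (congrArg (V'.vacEquiv hk Φ hΦ') h2).trans ?_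
    refine (V'.vacEquiv_ta hk Φ hΦ' i hi.ne h _).trans ?_
    rw [h1, ← lie_hom]
    exact (congrArg (lin f) (V.vacEquiv_ta hk Φ hΦ i hi.ne h v)).symm

/-- The natural isomorphism `M ⊗ Ω_V ≅ V`. -/
def vacNatIso (hΦ : ∀ V : ModC.{u, max u w} S k, Φ.HasLift (V.vacuum →ₗ[ℂ] V.carrier)) :
    vacFunctor hk ⋙ ModD.indFunctor Φ hk ≅ 𝟭 (ModC.{u, max u w} S k) :=
  NatIso.ofComponents (fun V => V.vacIso hk Φ (hΦ V)) fun {V V'} f =>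
    LieModuleHom.ext fun v => vacEquiv_natural hk Φ f (hΦ V) (hΦ V') v

end Unit

end ModC

namespace ModD

variable {M : Type u} [AddCommGroup M] [Module ℂ M] (Φ : VermaLike S k M)

section

variable (W : ModD.{u, max u w} S k)

lemma act_indObj_gEl (i : ℤ) (h : S.𝔥) :
    (W.indObj Φ hk).act (S.gEl h i 0) = W.ta Φ i h := W.rep_gEl_zero hk Φ i h

lemma tι_mem_vacuum (w : W.carrier) : (tι Φ w : M ⊗[ℂ] W.carrier) ∈ (W.indObj Φ hk).vacuum := by
  refine (W.indObj Φ hk).heisGr.mem_vac.mpr fun i hi h => ?_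
  rw [ModC.heisGr_a, act_indObj_gEl]
  exact (W.tH Φ hk).a_ι i hi h w

lemma tι_tε {v : M ⊗[ℂ] W.carrier} (hv : v ∈ (W.indObj Φ hk).vacuum) : tι Φ (tε Φ v) = v := by
  refine (W.tH Φ hk).vac v fun i hi h => ?_
  have := (W.indObj Φ hk).heisGr.mem_vac.mp hv i hi h
  rw [ModC.heisGr_a, act_indObj_gEl] at this
  exact this

/-- The isomorphism of the vacuum space of `M ⊗ W` with `W`. -/
def vacuumEquiv : (W.indObj Φ hk).vacuum ≃ₗ[ℂ] W.carrier where
  toLinearMap := tε Φ ∘ₗ (W.indObj Φ hk).vacuum.subtype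
  invFun w := ⟨tι Φ w, W.tι_mem_vacuum hk Φ w⟩
  left_inv v := Subtype.ext (W.tι_tε hk Φ v.2)
  right_inv w := (W.tH Φ hk).ε_ι w

/-- The vacuum projection of `M ⊗ W` as an object of `C_k` comes from a chosen isomorphism, `tε`
from the vacuum functional. Both vanish on images of creation operators and agree on `1 ⊗ W`, which
determines them. -/
lemma vacuumEquiv_ε (u : M ⊗[ℂ] W.carrier) :
    W.vacuumEquiv hk Φ (((W.indObj Φ hk).heisVac hk).ε u) = tε Φ u := by
  refine (W.tH Φ hk).gen (LinearMap.eqLocus ((W.vacuumEquiv hk Φ).toLinearMap ∘ₗ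
    ((W.indObj Φ hk).heisVac hk).ε) (tε Φ)) (fun w => ?_) (fun i hi h v _ => ?_) u
  · exact (congrArg (W.vacuumEquiv hk Φ) (((W.indObj Φ hk).heisVac hk).ε_ι
      ⟨tι Φ w, W.tι_mem_vacuum hk Φ w⟩))
  · have h1 := ((W.indObj Φ hk).heisVac hk).ε_a i hi h v
    rw [ModC.heisVac_a, act_indObj_gEl] at h1
    refine (congrArg (W.vacuumEquiv hk Φ) h1).trans ?_
    rw [map_zero]
    exact ((W.tH Φ hk).ε_a i hi h v).symm

lemma vacuumEquiv_vop (y : S.L) (v : (W.indObj Φ hk).vacuum) :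
    W.vacuumEquiv hk Φ ((W.indObj Φ hk).vop hk y v) =
      (W.tH Φ hk).vev (W.rep Φ y) (W.vacuumEquiv hk Φ v) := by
  refine (W.vacuumEquiv_ε hk Φ _).trans ?_
  exact congrArg (fun u => tε Φ (W.rep Φ y u)) (W.tι_tε hk Φ v.2).symm

lemma proj₀_coe (α : S.𝔥₀) : S.proj₀ ⟨α, α.2.1⟩ = α :=
  Subtype.ext (S.proj_of_θ_eq (by simpa using α.2.2))

/-- The isomorphism of the vacuum space of `M ⊗ W` with `W` in `D_k`. -/
def vacuumIso : (W.indObj Φ hk).vacObj hk ≅ W :=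
  isoOfEquiv (W := (W.indObj Φ hk).vacObj hk) (W.vacuumEquiv hk Φ)
    (fun β r n v => (W.vacuumEquiv_vop hk Φ _ v).trans (by
      rw [W.rep_gEl_x Φ hk, vev_X]; rfl))
    (fun i r p v => (W.vacuumEquiv_vop hk Φ _ v).trans (by
      rw [rep_kEl, tK, vev_tL]; rfl))
    (fun α v => (W.vacuumEquiv_vop hk Φ _ v).trans (by
      have h := W.rep_gEl_zero hk Φ 0 ⟨α, α.2.1⟩
      rw [ta, tA_zero] at h
      have h1 : (W.tH Φ hk).vev (W.rep Φ (S.gEl α 0 0)) = W.H (S.proj₀ ⟨α, α.2.1⟩) :=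
        (congrArg (W.tH Φ hk).vev h).trans (W.vev_tL Φ hk _)
      exact LinearMap.congr_fun (h1.trans (congrArg W.H (proj₀_coe α))) _))
    (Fin.cases (fun v => (W.vacuumEquiv_vop hk Φ _ v).trans (by
        rw [rep_dEl_zero, vev_td]; rfl))
      fun i v => (W.vacuumEquiv_vop hk Φ _ v).trans (by
        rw [rep_dEl_succ, vev_tL]; rfl))

end

lemma tε_indLin {W W' : ModD.{u, max u w} S k} (g : W ⟶ W') (v : M ⊗[ℂ] W.carrier) :
    tε Φ (indLin g M v) = lin g (tε Φ v) := by
  refine LinearMap.congr_fun (f := tε Φ ∘ₗ indLin g M) (g := lin g ∘ₗ tε Φ) ?_ v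
  refine TensorProduct.ext' fun u w => ?_
  refine (tε_tmul Φ u (lin g w)).trans ?_
  rw [LinearMap.comp_apply, tε_tmul, map_smul]

/-- The natural isomorphism `Ω_{M ⊗ W} ≅ W`. -/
def vacuumNatIso : indFunctor Φ hk ⋙ ModC.vacFunctor hk ≅ 𝟭 (ModD.{u, max u w} S k) :=
  NatIso.ofComponents (fun W => W.vacuumIso hk Φ) fun {W W'} g =>
    Hom.ext (LinearMap.ext fun v => tε_indLin Φ g (show (W.indObj Φ hk).vacuum from v).1)

end ModD

end

end ToroidalZ

end

theorem proposition2p6 {𝔤 : Type u} [LieRing 𝔤] [LieAlgebra ℂ 𝔤]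
    [FiniteDimensional ℂ 𝔤] [LieAlgebra.IsSemisimple ℂ 𝔤]
    (S : ToroidalZ.Data 𝔤) (k : ℂ) (hk : k ≠ 0) :
    ∃ e : ToroidalZ.ModC.{u, max u w} S k ≌ ToroidalZ.ModD.{u, max u w} S k,
      ToroidalZ.IsVacuumFunctor e.functor ∧ ToroidalZ.IsInductionFunctor e.inverse :=
  -- `Equivalence.mk` may change the unit to obtain the triangle identity but keeps the two
  -- functors, so their descriptions apply to it directly.
  ⟨CategoryTheory.Equivalence.mk (ToroidalZ.ModC.vacFunctor hk)
      (ToroidalZ.ModD.indFunctor (S.vermaLike k) hk)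
      (ToroidalZ.ModC.vacNatIso hk (S.vermaLike k) fun _ => S.vermaLike_hasLift k _).symm
      (ToroidalZ.ModD.vacuumNatIso hk (S.vermaLike k)),
    ToroidalZ.ModC.isVacuumFunctor hk, ToroidalZ.ModD.isInductionFunctor hk⟩
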